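/- Let $k$ be a field. A variety over $k$ is an integral separated scheme of finite type over $k$. For a proper variety $X$ over $k$ let $\delta_X$ be the zero-cycle on $X_{k(X)} = X\times_k k(X)$ induced by the diagonal of $X$, i.e. the $k(X)$-rational point of $X_{k(X)}$ given by the generic point of $X$. The torsion order $\operatorname{Tor}(X)\in\mathbb N\cup\{\infty\}$ is the smallest positive integer $m$ such that $$ m\cdot\delta_X = z_{k(X)} \in \operatorname{CH}_0(X_{k(X)}) $$ for some zero-cycle $z$ on $X$, where $z_{k(X)}$ is the pullback of $z$; it is $\infty$ if no such integer exists. Let $X$ be a smooth projective variety over $k$ with $\operatorname{Tor}(X)<\infty$, and let $n$ be a positive integer. Let $S^nX = X^n/\operatorname{Sym}(n)$ be the symmetric product: the quotient of the $n$-fold fibre product $X^n$ over $k$ by the permutation action of $\operatorname{Sym}(n)$, i.e. the $k$-scheme with an affine $\operatorname{Sym}(n)$-invariant morphism $q\colon X^n\to S^nX$ such that $\mathcal O_{S^nX} = (q_*\mathcal O_{X^n})^{\operatorname{Sym}(n)}$. Then $S^nX$ is a proper variety over $k$, its torsion order is finite, and $$ \operatorname{Tor}(S^nX) \mid n!\cdot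 \operatorname{Tor}(X)^n . $$ -/

import Mathlib

open AlgebraicGeometry CategoryTheory CategoryTheory.Limits

universe u

namespace TorsionOrder

/-! ### Zero-cycles and the Chow group of zero-cycles -/

/-- The group `Z₀(X)` of zero-cycles: the free abelian group on the closed points of `X`. -/
abbrev ZeroCycle (X : Scheme.{u}) : Type u :=
  {x : X // IsClosed ({x} : Set X)} →₀ ℤ

/-- `z` is the zero-cycle `∑_c ord_c(φ) [c]` of a nonzero rational function `φ` on an integral
closed curve `ι : C ⟶ X`; the sum is over the closed points `c` of `C`, and `Scheme.ord φ c` is the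
order of vanishing (defined by lengths over the one-dimensional local ring of `C` at `c`). -/
def IsDivisorOnCurve {X : Scheme.{u}} (z : ZeroCycle X) : Prop :=
  ∃ (C : Scheme.{u}) (ι : C ⟶ X) (_ : IsIntegral C) (_ : IsLocallyNoetherian C)
    (φ : C.functionField),
    IsClosedImmersion ι ∧ topologicalKrullDim C = 1 ∧ φ ≠ 0 ∧
    (∀ (c : C) (hc : IsClosed ({ι c} : Set X)), z ⟨ι c, hc⟩ = Scheme.ord φ c) ∧
    (∀ x : {x : X // IsClosed ({x} : Set X)}, x.1 ∉ Set.range ι → z x = 0)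

/-- The subgroup of zero-cycles that are rationally equivalent to zero. -/
noncomputable def ratEquivZero (X : Scheme.{u}) : AddSubgroup (ZeroCycle X) :=
  AddSubgroup.closure {z | IsDivisorOnCurve z}

/-- The Chow group `CH₀(X)` of zero-cycles modulo rational equivalence. -/
noncomputable abbrev CH0 (X : Scheme.{u}) : Type u := ZeroCycle X ⧸ ratEquivZero X

/-- The class of a zero-cycle in `CH₀(X)`. -/
noncomputable abbrev cycleClass {X : Scheme.{u}} (z : ZeroCycle X) : CH0 X := QuotientAddGroup.mk z

/-- The multiplicity at `y` of the scheme-theoretic fibre of `p` through `y`: the length of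
`𝒪_{Y,y} / 𝔪_{p(y)} 𝒪_{Y,y}` over `𝒪_{Y,y}`. -/
noncomputable def fibreMultiplicity {Y X : Scheme.{u}} (p : Y ⟶ X) (y : Y) : ℕ :=
  (Module.length (Y.presheaf.stalk y)
    (Y.presheaf.stalk y ⧸
      (IsLocalRing.maximalIdeal (X.presheaf.stalk (p y))).map (p.stalkMap y).hom)).toNat

open Classical in
/-- `w` is the (flat) pullback `p^* z` of the zero-cycle `z`: the coefficient of `p^*[x]` at a
point `y` above `x` is the multiplicity of the fibre `p⁻¹(x)` at `y`. It is used for the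
projections `X_K ⟶ X` of a base change along a field extension; then `p^* z` is written `z_K`. -/
def IsPullbackCycle {Y X : Scheme.{u}} (p : Y ⟶ X) (z : ZeroCycle X) (w : ZeroCycle Y) : Prop :=
  ∀ y : {y : Y // IsClosed ({y} : Set Y)},
    w y = if h : IsClosed ({p y.1} : Set X) then z ⟨p y.1, h⟩ * fibreMultiplicity p y.1 else 0

/-! ### The torsion order -/

section Tor

variable {k : Type u} [Field k] {X : Scheme.{u}} (f : X ⟶ Spec (.of k)) [IsIntegral X]

/-- The inclusion `Spec k(X) ⟶ X` of the generic point. -/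
noncomputable abbrev genericInclusion (X : Scheme.{u}) [IsIntegral X] :
    Spec X.functionField ⟶ X :=
  X.fromSpecStalk (genericPoint X)

/-- The base change `X_{k(X)} = X ×_k Spec k(X)` of a `k`-variety to its function field. -/
noncomputable abbrev overFunctionField : Scheme.{u} :=
  pullback f (genericInclusion X ≫ f)

/-- The projection `X_{k(X)} ⟶ X`. -/
noncomputable abbrev overFunctionFieldProj : overFunctionField f ⟶ X :=
  pullback.fst f (genericInclusion X ≫ f)

/-- The `k(X)`-rational point of `X_{k(X)}` given by the generic point of `X`: it is the generic
fibre of the diagonal `X ⟶ X ×_k X`. -/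
noncomputable def diagonalSection : Spec X.functionField ⟶ overFunctionField f :=
  pullback.lift (genericInclusion X) (𝟙 _) (by simp)

/-- The underlying point of `diagonalSection`. -/
noncomputable def diagonalPoint : overFunctionField f :=
  diagonalSection f (IsLocalRing.closedPoint X.functionField)

lemma isClosed_diagonalPoint [IsSeparated f] :
    IsClosed ({diagonalPoint f} : Set (overFunctionField f)) := by
  have h1 : IsClosedImmersion (diagonalSection f ≫ pullback.snd f (genericInclusion X ≫ f)) := by
    have : diagonalSection f ≫ pullback.snd f (genericInclusion X ≫ f) = 𝟙 _ :=
      pullback.lift_snd _ _ _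
    rw [this]; infer_instance
  have h2 : IsClosedImmersion (diagonalSection f) :=
    IsClosedImmersion.of_comp _ (pullback.snd f (genericInclusion X ≫ f))
  have h3 := h2.isClosedEmbedding.isClosedMap _
    ((PrimeSpectrum.isClosed_singleton_iff_isMaximal
      (IsLocalRing.closedPoint X.functionField)).2 (by
        simpa [IsLocalRing.closedPoint] using IsLocalRing.maximalIdeal.isMaximal _))
  have h4 : diagonalSection f '' {IsLocalRing.closedPoint X.functionField} =
      {diagonalPoint f} := Set.image_singleton
  exact h4 ▸ h3

/-- The zero-cycle `δ_X` on `X_{k(X)}` induced by the diagonal. -/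
noncomputable def diagonalCycle [IsSeparated f] : ZeroCycle (overFunctionField f) :=
  Finsupp.single ⟨diagonalPoint f, isClosed_diagonalPoint f⟩ 1

/-- `m · δ_X = z_{k(X)}` in `CH₀(X_{k(X)})` for some zero-cycle `z` on `X`. -/
def DiagonalMultipleDescends [IsSeparated f] (m : ℕ) : Prop :=
  ∃ (z : ZeroCycle X) (w : ZeroCycle (overFunctionField f)),
    IsPullbackCycle (overFunctionFieldProj f) z w ∧
    m • cycleClass (diagonalCycle f) = cycleClass w

/-- The torsion order `Tor(X) ∈ ℕ ∪ {∞}`: the smallest positive integer `m` such that `m · δ_X`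
is of the form `z_{k(X)}` in `CH₀(X_{k(X)})`, and `∞` if there is none. -/
noncomputable def torsionOrder [IsSeparated f] : ℕ∞ :=
  sInf {e : ℕ∞ | ∃ m : ℕ, 0 < m ∧ DiagonalMultipleDescends f m ∧ e = m}

end Tor

/-! ### Projective schemes over a field -/

section Proj

attribute [local instance] MvPolynomial.gradedAlgebra

/-- Projective space `ℙ^N` over `k`. -/
noncomputable abbrev projectiveSpace (k : Type u) [Field k] (N : ℕ) : Scheme.{u} :=
  Proj (MvPolynomial.homogeneousSubmodule (Fin (N + 1)) k)

/-- The structure morphism of `ℙ^N` over `k`. -/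
noncomputable abbrev projectiveSpaceStructure (k : Type u) [Field k] (N : ℕ) :
    projectiveSpace k N ⟶ Spec (.of k) :=
  Proj.toSpecZero (MvPolynomial.homogeneousSubmodule (Fin (N + 1)) k) ≫
    Spec.map (CommRingCat.ofHom
      (algebraMap k (MvPolynomial.homogeneousSubmodule (Fin (N + 1)) k 0)))

/-- `X` is projective over `k`: it has a closed immersion into some `ℙ^N` over `k`. -/
def IsProjectiveOver {k : Type u} [Field k] {X : Scheme.{u}} (f : X ⟶ Spec (.of k)) : Prop :=
  ∃ (N : ℕ) (i : X ⟶ projectiveSpace k N),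
    IsClosedImmersion i ∧ i ≫ projectiveSpaceStructure k N = f

end Proj

/-! ### Symmetric products -/

section Sym

variable {k : Type u} [Field k] {X : Scheme.{u}} (f : X ⟶ Spec (.of k)) (n : ℕ)

/-- The `n`-fold fibre product `X^n` over `k`. -/
noncomputable abbrev power : Scheme.{u} :=
  widePullback (Spec (.of k)) (fun _ : Fin n => X) (fun _ => f)

/-- The structure morphism `X^n ⟶ Spec k`. -/
noncomputable abbrev powerStructure : power f n ⟶ Spec (.of k) :=
  WidePullback.base (fun _ : Fin n => f)

/-- The automorphism of `X^n` that permutes the factors by `σ`: its `i`-th component is the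
projection to the factor `σ i`. -/
noncomputable def permute (σ : Equiv.Perm (Fin n)) : power f n ⟶ power f n :=
  WidePullback.lift (powerStructure f n)
    (fun i => WidePullback.π (fun _ : Fin n => f) (σ i)) (fun i => WidePullback.π_arrow _ (σ i))

/-- `q : X^n ⟶ S` is the quotient of `X^n` by the permutation action of `Sym(n)`, that is,
`S = S^n X`: the morphism `q` is affine and invariant, and over every open `U` of `S` it identifies
`Γ(S, U)` with the ring of `Sym(n)`-invariant functions on `q⁻¹(U)`, so that
`𝒪_S = (q_* 𝒪_{X^n})^{Sym(n)}`. (Over an affine open `U` with `q⁻¹(U) = Spec A` this says that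
`q` is `Spec A ⟶ Spec A^{Sym(n)}`; so `q` is unique up to a unique isomorphism.) -/
structure IsSymmetricProduct {S : Scheme.{u}} (q : power f n ⟶ S) : Prop where
  isAffineHom : IsAffineHom q
  invariant : ∀ σ : Equiv.Perm (Fin n), permute f n σ ≫ q = q
  injective : ∀ U : S.Opens, Function.Injective (q.app U).hom
  /-- A function `s` on `q⁻¹(U)` with `σ^* s = s` for all `σ` comes from `U`. The condition `h`
  (that `σ` maps `q⁻¹(U)` to itself) always holds, by `invariant`. -/
  exists_of_invariant : ∀ (U : S.Opens) (s : Γ(power f n, q ⁻¹ᵁ U)),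
    (∀ (σ : Equiv.Perm (Fin n)) (h : q ⁻¹ᵁ U ≤ permute f n σ ⁻¹ᵁ q ⁻¹ᵁ U),
      ((permute f n σ).appLE (q ⁻¹ᵁ U) (q ⁻¹ᵁ U) h).hom s = s) →
    ∃ t : Γ(S, U), (q.app U).hom t = s

end Sym

end TorsionOrder

/-! Write `m = Tor(X)` and say that a multiple of a diagonal descends if it is rationally equivalent
to the pullback of a zero-cycle. The multiples that descend are closed under remainders, so the
torsion order divides each positive one (`DiagonalMultipleDescends.torsionOrder_dvd`). It is
therefore enough to show that `d * m ^ n` descends for `S^n X`, where `d` is the degree of `k(X^n)`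
over `k(S^n X)`. The smaller field is the fixed field of `Sym(n)`, so `d` divides `n!` by Galois
theory (`finrank_dvd_card_of_isInvariant`).

Integrality of `X^n`. The variety `X` is geometrically integral. Suppose that a base change of `X`
splits into two clopen parts. Each part has a point over the generic point of `X`, and over a common
algebraically closed field `Ω` these become rational points of `X_Ω`. The relation for the diagonal
specializes to both: `m` times either point is equivalent to the same pulled back cycle. But a cycle
equivalent to zero on a projective scheme has degree zero on each clopen part
(`sum_filter_eq_zero`), a contradiction. So the base changes are connected, and their local rings
are domains by smoothness (`isDomain_stalk_of_smooth`).

Products (`DiagonalMultipleDescends.prod`). Over `K = k(X × Y)` the diagonal point is a pair `(x,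
y)`. On the slice `{x} × Y_K` a multiple `m₂ (x, y)` becomes `x × z₂`. For each finite scheme `V`
that occurs in `z₂`, the cycle `x × V_K` is a section of `X` over an Artinian base, so `m₁` times it
becomes the pullback of a product cycle. Induction gives `m ^ n` for `X^n`.

Descent (`DiagonalMultipleDescends.of_isFinite`). Pushing forward along the finite morphism from
`(X^n)_{k(X^n)}` to `(S^n X)_{k(S^n X)}` sends the diagonal to `d` times the diagonal.

The intersection theory behind this consists of four results. Pushforward along finite morphisms
respects rational equivalence, because the divisor of a function pushes forward to that of its norm
(`pushCycle_mem_ratEquivZero`). So does base change from a field to an Artinian scheme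
(`exists_isPullbackCycle`). A principal divisor on a projective curve over an algebraically closed
field has degree zero, by a count with the Hilbert function (`IsCurveAtlas.sum_eq_zero`). Cycles of
Artinian schemes commute with flat pullback (`isPullbackCycle_finiteCycle`).

Two devices keep this manageable. A curve is replaced by its generic point `η`, and an order of
vanishing by the length of `𝒪_{Y,y}` modulo the prime of `η` and the function (`IsDivisorAt`).
Zero-cycles are combinations of cycles of finite morphisms from Artinian schemes
(`zeroCycle_induction`), so every compatibility of cycles becomes a pasting of cartesian squares. -/

namespace TorsionOrder

/-! ### Lengths: kernels, cokernels and multiplicities of components -/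

section Length

open Module

lemma length_eq_ker_add_range {R M N : Type*} [Ring R] [AddCommGroup M] [Module R M]
    [AddCommGroup N] [Module R N] (f : M →ₗ[R] N) :
    length R M = length R (LinearMap.ker f) + length R (LinearMap.range f) :=
  length_eq_add_of_exact (LinearMap.ker f).subtype f.rangeRestrict
    (Submodule.injective_subtype _) f.surjective_rangeRestrict
    (by rw [LinearMap.exact_iff, LinearMap.ker_rangeRestrict, Submodule.range_subtype])

/-- Each length splits into those of the kernel and the range of the outgoing map, and exactness
matches them. The additive form avoids subtraction, so infinite lengths are allowed. -/
lemma length_six_term {R M₁ M₂ M₃ M₄ M₅ M₆ : Type*} [Ring R] [AddCommGroup M₁] [Module R M₁]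
    [AddCommGroup M₂] [Module R M₂] [AddCommGroup M₃] [Module R M₃] [AddCommGroup M₄] [Module R M₄]
    [AddCommGroup M₅] [Module R M₅] [AddCommGroup M₆] [Module R M₆]
    (f₁ : M₁ →ₗ[R] M₂) (f₂ : M₂ →ₗ[R] M₃) (f₃ : M₃ →ₗ[R] M₄) (f₄ : M₄ →ₗ[R] M₅) (f₅ : M₅ →ₗ[R] M₆)
    (h₁ : Function.Injective f₁) (h₂ : Function.Exact f₁ f₂) (h₃ : Function.Exact f₂ f₃)
    (h₄ : Function.Exact f₃ f₄) (h₅ : Function.Exact f₄ f₅) (h₆ : Function.Surjective f₅) :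
    length R M₁ + length R M₃ + length R M₅ = length R M₂ + length R M₄ + length R M₆ := by
  rw [length_eq_ker_add_range f₂, length_eq_ker_add_range f₃, length_eq_ker_add_range f₄,
    length_eq_ker_add_range f₅, h₂.linearMap_ker_eq, h₃.linearMap_ker_eq, h₄.linearMap_ker_eq,
    h₅.linearMap_ker_eq, (LinearEquiv.ofInjective f₁ h₁).length_eq, LinearMap.range_eq_top.2 h₆,
    length_top]
  abel

/-- The lengths of the kernel and of the cokernel of endomorphisms of an exact sequence. -/
lemma length_ker_coker {R M N P : Type*} [CommRing R] [AddCommGroup M] [Module R M]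
    [AddCommGroup N] [Module R N] [AddCommGroup P] [Module R P] (f : N →ₗ[R] M) (g : M →ₗ[R] P)
    (hf : Function.Injective f) (hg : Function.Surjective g) (H : Function.Exact f g)
    (i₁ : N →ₗ[R] N) (i₂ : M →ₗ[R] M) (i₃ : P →ₗ[R] P)
    (h₁ : f.comp i₁ = i₂.comp f) (h₂ : g.comp i₂ = i₃.comp g) :
    length R (LinearMap.ker i₁) + length R (LinearMap.ker i₃) +
      length R (M ⧸ LinearMap.range i₂) =
    length R (LinearMap.ker i₂) + length R (N ⧸ LinearMap.range i₁) +
      length R (P ⧸ LinearMap.range i₃) ∧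
    length R (LinearMap.ker i₂) ≤ length R (LinearMap.ker i₁) + length R (LinearMap.ker i₃) := by
  let F₁ : LinearMap.ker i₁ →ₗ[R] LinearMap.ker i₂ :=
    f.restrict fun x hx => by
      rw [LinearMap.mem_ker] at hx ⊢
      rw [← LinearMap.comp_apply, ← h₁, LinearMap.comp_apply, hx, map_zero]
  let F₂ : LinearMap.ker i₂ →ₗ[R] LinearMap.ker i₃ :=
    g.restrict fun x hx => by
      rw [LinearMap.mem_ker] at hx ⊢
      rw [← LinearMap.comp_apply, ← h₂, LinearMap.comp_apply, hx, map_zero]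
  let G₁ : (N ⧸ LinearMap.range i₁) →ₗ[R] (M ⧸ LinearMap.range i₂) :=
    Submodule.mapQ _ _ f (by
      rintro _ ⟨x, rfl⟩
      exact ⟨f x, (LinearMap.congr_fun h₁ x).symm⟩)
  let G₂ : (M ⧸ LinearMap.range i₂) →ₗ[R] (P ⧸ LinearMap.range i₃) :=
    Submodule.mapQ _ _ g (by
      rintro _ ⟨x, rfl⟩
      exact ⟨g x, (LinearMap.congr_fun h₂ x).symm⟩)
  have hF₁ : Function.Injective F₁ := fun x y hxy => Subtype.ext (hf (congrArg Subtype.val hxy))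
  have hF : Function.Exact F₁ F₂ := by
    intro x
    constructor
    · intro hx
      obtain ⟨y, hy⟩ := (H x.1).1 (congrArg Subtype.val hx)
      refine ⟨⟨y, hf ?_⟩, Subtype.ext hy⟩
      rw [← LinearMap.comp_apply, h₁, LinearMap.comp_apply, hy, map_zero]
      exact x.2
    · rintro ⟨y, rfl⟩
      exact Subtype.ext ((H _).2 ⟨y.1, rfl⟩)
  refine ⟨?_, ?_⟩
  swap
  · rw [length_eq_ker_add_range F₂, hF.linearMap_ker_eq, ← (LinearEquiv.ofInjective F₁ hF₁).length_eq]
    exact add_le_add_right (length_le_of_injective (LinearMap.range F₂).subtype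
      (Submodule.injective_subtype _)) _
  -- The six terms are the kernels and then the cokernels of the snake sequence.
  refine length_six_term F₁ F₂
    (SnakeLemma.δ' i₁ i₂ i₃ f g H f g H h₁ h₂ (LinearMap.ker i₃).subtype
      ((LinearMap.exact_iff.2 (by rw [Submodule.range_subtype]))) (LinearMap.range i₁).mkQ
      (LinearMap.exact_iff.2 (by rw [Submodule.ker_mkQ])) hg hf) G₁ G₂ ?_ ?_ ?_ ?_ ?_ ?_
  · exact hF₁
  · exact hF
  · exact SnakeLemma.exact_δ'_right i₁ i₂ i₃ f g H f g H h₁ h₂ (LinearMap.ker i₂).subtype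
      (LinearMap.exact_iff.2 (by rw [Submodule.range_subtype])) _ _ _ _ hg hf F₂ rfl
      (Submodule.injective_subtype _)
  · exact SnakeLemma.exact_δ'_left i₁ i₂ i₃ f g H f g H h₁ h₂ _ _ _ _ (LinearMap.range i₂).mkQ
      (LinearMap.exact_iff.2 (by rw [Submodule.ker_mkQ])) hg hf G₁ rfl
      (Submodule.mkQ_surjective _)
  · intro x
    obtain ⟨x, rfl⟩ := Submodule.mkQ_surjective _ x
    constructor
    · intro hx
      obtain ⟨y, hy⟩ := (Submodule.Quotient.mk_eq_zero _).1 hx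
      obtain ⟨w, rfl⟩ := hg y
      have : g (x - i₂ w) = 0 := by
        rw [map_sub, ← LinearMap.comp_apply g i₂, h₂, LinearMap.comp_apply, hy, sub_self]
      obtain ⟨v, hv⟩ := (H _).1 this
      refine ⟨Submodule.Quotient.mk v, ?_⟩
      refine (Submodule.Quotient.eq _).2 ⟨-w, ?_⟩
      rw [hv, map_neg]
      abel
    · rintro ⟨y, hy⟩
      obtain ⟨y, rfl⟩ := Submodule.mkQ_surjective _ y
      rw [← hy]
      refine (Submodule.Quotient.mk_eq_zero _).2 ?_
      rw [(H _).2 ⟨y, rfl⟩]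
      exact zero_mem _
  · intro x
    obtain ⟨x, rfl⟩ := Submodule.mkQ_surjective _ x
    obtain ⟨y, rfl⟩ := hg x
    exact ⟨Submodule.Quotient.mk y, rfl⟩

/-- An Artinian ring is the product of its localizations, so its length over any base is the
sum of the lengths of the localizations. -/
lemma length_eq_sum_localization (A R : Type*) [CommRing A] [CommRing R] [Algebra A R]
    [IsArtinianRing R] [Fintype (MaximalSpectrum R)] :
    length A R = ∑ m : MaximalSpectrum R, length A (Localization.AtPrime m.asIdeal) := by
  rw [(((MaximalSpectrum.toPiLocalizationEquiv R).restrictScalars A).toLinearEquiv).length_eq]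
  exact length_pi_of_fintype (R := A)
    (M := fun m : MaximalSpectrum R => Localization.AtPrime m.asIdeal)

open TensorProduct in
/-- The order of vanishing of `a` on a one-dimensional ring `R ⧸ I` is the sum over the
irreducible components of their multiplicities times the orders of vanishing on them. -/
theorem length_quotient_sup_span {R : Type u} [CommRing R] [IsNoetherianRing R] (I : Ideal R) (a : R)
    {ι : Type*} [Fintype ι] (q : ι → Ideal R) [∀ j, (q j).IsPrime] (hqinj : Function.Injective q)
    (hq : Set.range q = I.minimalPrimes)
    (S : ι → Type*) [∀ j, CommRing (S j)] [∀ j, Algebra R (S j)]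
    [∀ j, IsLocalization.AtPrime (S j) (q j)]
    (dim : ∀ p : Ideal R, p.IsPrime → I ≤ p → p ∈ I.minimalPrimes ∨ p.IsMaximal)
    (ha : ∀ j, a ∉ q j) (nzd : ∀ x, a * x ∈ I → x ∈ I) :
    length R (R ⧸ (I ⊔ Ideal.span {a})) =
      ∑ j, length (S j) (S j ⧸ I.map (algebraMap R (S j))) *
        length R (R ⧸ (q j ⊔ Ideal.span {a})) := by
  have hqI : ∀ j, q j ∈ I.minimalPrimes := fun j => hq ▸ Set.mem_range_self j
  have coker : ∀ {N : Type u} [AddCommGroup N] [Module R N] (p : Ideal R) (e : N ≃ₗ[R] R ⧸ p),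
      length R (N ⧸ LinearMap.range (LinearMap.lsmul R N a)) =
        length R (R ⧸ (p ⊔ Ideal.span {a})) := by
    intro N _ _ p e
    let π : R →ₗ[R] N ⧸ LinearMap.range (LinearMap.lsmul R N a) :=
      (LinearMap.range (LinearMap.lsmul R N a)).mkQ ∘ₗ e.symm.toLinearMap ∘ₗ p.mkQ
    have hπ : Function.Surjective π :=
      (Submodule.mkQ_surjective _).comp (e.symm.surjective.comp (Submodule.mkQ_surjective _))
    have hk : LinearMap.ker π = p ⊔ Ideal.span {a} := by
      ext x
      rw [LinearMap.mem_ker]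
      simp only [π, LinearMap.comp_apply, Submodule.mkQ_apply, Submodule.Quotient.mk_eq_zero,
        LinearMap.mem_range, LinearMap.lsmul_apply]
      constructor
      · rintro ⟨n, hn⟩
        obtain ⟨r, hr⟩ := Submodule.mkQ_surjective p (e n)
        have h2 : p.mkQ (x - a * r) = 0 := by
          have := congrArg e hn
          rw [map_smul, ← hr] at this
          rw [map_sub, ← smul_eq_mul, map_smul, this]
          simp
        have h3 := (Submodule.Quotient.mk_eq_zero p).1 h2
        rw [← sub_add_cancel x (a * r)]
        exact Submodule.add_mem_sup h3 (Ideal.mul_mem_right _ _ (Ideal.mem_span_singleton_self a))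
      · intro hx
        obtain ⟨y, hy, z, hz, rfl⟩ := Submodule.mem_sup.1 hx
        obtain ⟨r, rfl⟩ := Ideal.mem_span_singleton'.1 hz
        refine ⟨e.symm (p.mkQ r), ?_⟩
        rw [← map_smul, ← map_smul, smul_eq_mul, mul_comm a r]
        refine congrArg e.symm ?_
        rw [← Submodule.mkQ_apply, map_add, Submodule.mkQ_apply, Submodule.mkQ_apply,
          (Submodule.Quotient.mk_eq_zero p).2 hy, zero_add]
    rw [← (LinearMap.quotKerEquivOfSurjective π hπ).length_eq, hk]
  -- A prime over `p` contains `a`, so it is not minimal over `I` and must be maximal; hence `R ⧸ p`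
  -- is Artinian.
  have artin : ∀ p : Ideal R, I ≤ p → a ∈ p → length R (R ⧸ p) ≠ ⊤ := by
    intro p hIp hap
    have : IsArtinianRing (R ⧸ p) := by
      rw [isArtinianRing_iff_isNoetherianRing_krullDimLE_zero]
      refine ⟨inferInstance, Ring.krullDimLE_zero_iff.2 fun P hP => ?_⟩
      have hc : I ≤ P.comap (Ideal.Quotient.mk p) := fun x hx => by
        rw [Ideal.mem_comap, Ideal.Quotient.eq_zero_iff_mem.2 (hIp hx)]
        exact zero_mem _
      rcases dim _ (hP.comap _) hc with h | h
      · exfalso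
        obtain ⟨j, hj⟩ := hq ▸ h
        refine ha j (hj ▸ ?_)
        rw [Ideal.mem_comap, Ideal.Quotient.eq_zero_iff_mem.2 hap]
        exact zero_mem _
      · have h3 := Ideal.map_comap_of_surjective _ (Ideal.Quotient.mk_surjective (I := p)) P
        exact h3 ▸ (Ideal.map_eq_top_or_isMaximal_of_surjective (Ideal.Quotient.mk p)
          Ideal.Quotient.mk_surjective h).resolve_left (h3.symm ▸ hP.ne_top)
    have h2 : length (R ⧸ p) (R ⧸ p) ≠ ⊤ := length_ne_top
    rwa [← length_eq_of_surjective (S := R) (R := R ⧸ p) Ideal.Quotient.mk_surjective] at h2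
  -- The multiplicity of `N` along the component `q j`; it is additive because localization is
  -- exact.
  let μ : ∀ (j : ι) (N : Type u) [AddCommGroup N] [Module R N], ℕ∞ :=
    fun j N _ _ => length (S j) (S j ⊗[R] N)
  have μq : ∀ (j : ι) {N : Type u} [AddCommGroup N] [Module R N] (p : Ideal R) (e : N ≃ₗ[R] R ⧸ p),
      μ j N = length (S j) (S j ⧸ p.map (algebraMap R (S j))) := by
    intro j N _ _ p e
    exact (AlgebraTensorModule.congr (LinearEquiv.refl (S j) (S j)) e).length_eq.trans
      (Algebra.TensorProduct.quotIdealMapEquivTensorQuot (S j) p).toLinearEquiv.length_eq.symm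
  -- Dévissage: length of cokernel minus length of kernel of multiplication by `a`, and the sum over
  -- components, are additive in `N`, so it suffices to treat `R ⧸ p` with `p` prime. The finiteness
  -- of the kernel is carried along because kernels are cancelled at the end.
  have key : ∀ (N : Type u) [AddCommGroup N] [Module R N] [Module.Finite R N],
      (∀ i ∈ I, ∀ x : N, i • x = 0) →
      length R (N ⧸ LinearMap.range (LinearMap.lsmul R N a)) =
        length R (LinearMap.ker (LinearMap.lsmul R N a)) +
        ∑ j, μ j N * length R (R ⧸ (q j ⊔ Ideal.span {a})) ∧
      length R (LinearMap.ker (LinearMap.lsmul R N a)) ≠ ⊤ := by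
    intro N _ _ _
    refine IsNoetherianRing.induction_on_isQuotientEquivQuotientPrime R (M := N) inferInstance
      (motive := fun N _ _ _ => (∀ i ∈ I, ∀ x : N, i • x = 0) →
      length R (N ⧸ LinearMap.range (LinearMap.lsmul R N a)) =
        length R (LinearMap.ker (LinearMap.lsmul R N a)) +
        ∑ j, μ j N * length R (R ⧸ (q j ⊔ Ideal.span {a})) ∧
      length R (LinearMap.ker (LinearMap.lsmul R N a)) ≠ ⊤) ?_ ?_ ?_
    · intro N _ _ _ _ _
      simp [μ, length_eq_zero]
    · intro N _ _ _ p e hN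
      have hIp : I ≤ p.1 := by
        intro i hi
        have := hN i hi (e.symm (p.1.mkQ 1))
        rw [← map_smul, ← map_smul, LinearEquiv.map_eq_zero_iff, smul_eq_mul, mul_one] at this
        exact (Submodule.Quotient.mk_eq_zero p.1).1 this
      rw [coker p.1 e]
      simp only [μq _ p.1 e]
      have h0 : ∀ j, q j ≠ p.1 → length (S j) (S j ⧸ p.1.map (algebraMap R (S j))) = 0 := by
        intro j hj
        have : ¬ p.1 ≤ q j := fun h => hj ((hqI j).2 ⟨p.2, hIp⟩ h |>.antisymm h)
        obtain ⟨x, hx, hxj⟩ := Set.not_subset.1 this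
        rw [length_eq_zero_iff, Submodule.Quotient.subsingleton_iff]
        exact Ideal.eq_top_of_isUnit_mem _ (Ideal.mem_map_of_mem _ hx)
          (IsLocalization.map_units (S j) (⟨x, hxj⟩ : (q j).primeCompl))
      -- If `a ∈ p`, multiplication is zero, kernel and cokernel are both `N`, and no component is
      -- `p`. Otherwise it is injective: either `p` is a component, with multiplicity one, or `p` is
      -- maximal and both sides vanish.
      by_cases hap : a ∈ p.1
      · have hz : LinearMap.lsmul R N a = 0 := by
          ext x
          apply e.injective
          obtain ⟨r, hr⟩ := Submodule.mkQ_surjective p.1 (e x)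
          simp only [LinearMap.lsmul_apply, LinearMap.zero_apply, map_zero, map_smul]
          rw [← hr, ← map_smul]
          exact (Submodule.Quotient.mk_eq_zero p.1).2 (Ideal.mul_mem_right _ _ hap)
        have hj : ∀ j, q j ≠ p.1 := fun j h => ha j (h ▸ hap)
        rw [hz, LinearMap.ker_zero, length_top, e.length_eq,
          sup_eq_left.2 ((Ideal.span_singleton_le_iff_mem _).2 hap)]
        exact ⟨by simp [h0 _ (hj _)], artin p.1 hIp hap⟩
      · have hz : LinearMap.ker (LinearMap.lsmul R N a) = ⊥ := by
          rw [LinearMap.ker_eq_bot']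
          intro x hx
          apply e.injective
          obtain ⟨r, hr⟩ := Submodule.mkQ_surjective p.1 (e x)
          have h1 := congrArg e hx
          rw [LinearMap.lsmul_apply, map_smul, ← hr, ← map_smul, map_zero] at h1
          have h2 := (p.2.mem_or_mem ((Submodule.Quotient.mk_eq_zero p.1).1 h1)).resolve_left hap
          rw [← hr, map_zero]
          exact (Submodule.Quotient.mk_eq_zero p.1).2 h2
        rw [hz, length_bot, zero_add]
        refine ⟨?_, by simp⟩
        by_cases h : p.1 ∈ I.minimalPrimes
        · obtain ⟨j₀, hj₀⟩ := hq ▸ h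
          rw [Finset.sum_eq_single j₀ (fun j _ hj => by
            rw [h0 j (fun h => hj (hqinj (h.trans hj₀.symm))), zero_mul]) (by simp), ← hj₀]
          have := IsLocalization.AtPrime.isLocalRing (S j₀) (q j₀)
          have h1 : IsSimpleModule (S j₀) (S j₀ ⧸ (q j₀).map (algebraMap R (S j₀))) := by
            rw [IsLocalization.AtPrime.map_eq_maximalIdeal (q j₀) (S j₀),
              isSimpleModule_iff_isCoatom]
            exact Ideal.isMaximal_def.1 inferInstance
          rw [length_eq_one (S j₀), one_mul]
        · have hmax := (dim p.1 p.2 hIp).resolve_left h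
          rw [hmax.1.2 (p.1 ⊔ Ideal.span {a}) (left_lt_sup.2 fun h =>
            hap ((Ideal.span_singleton_le_iff_mem _).1 h)),
            length_eq_zero_iff.2 (Submodule.Quotient.subsingleton_iff.2 rfl)]
          exact (Finset.sum_eq_zero fun j _ => by
            rw [h0 j fun h' => h (h' ▸ hqI j), zero_mul]).symm
    · intro N₁ _ _ _ N₂ _ _ _ N₃ _ _ _ f g hf hg H ih₁ ih₃ hN
      obtain ⟨h₁, h₁'⟩ := ih₁ fun i hi x => hf (by rw [map_smul, hN i hi, map_zero])
      obtain ⟨h₃, h₃'⟩ := ih₃ fun i hi x => by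
        obtain ⟨y, rfl⟩ := hg x
        rw [← map_smul, hN i hi, map_zero]
      have hsum : ∑ j, μ j N₂ * length R (R ⧸ (q j ⊔ Ideal.span {a})) =
          ∑ j, μ j N₁ * length R (R ⧸ (q j ⊔ Ideal.span {a})) +
          ∑ j, μ j N₃ * length R (R ⧸ (q j ⊔ Ideal.span {a})) := by
        rw [← Finset.sum_add_distrib]
        refine Finset.sum_congr rfl fun j _ => ?_
        rw [← add_mul]
        congr 1
        have : Module.Flat R (S j) := IsLocalization.flat _ (q j).primeCompl
        exact length_eq_add_of_exact (AlgebraTensorModule.lTensor (S j) (S j) f)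
          (AlgebraTensorModule.lTensor (S j) (S j) g)
          (Module.Flat.lTensor_preserves_injective_linearMap f hf)
          (LinearMap.lTensor_surjective (S j) hg) (lTensor_exact (S j) H hg)
      obtain ⟨hk, hk'⟩ := length_ker_coker f g hf hg H (LinearMap.lsmul R N₁ a)
        (LinearMap.lsmul R N₂ a) (LinearMap.lsmul R N₃ a) (by ext; simp) (by ext; simp)
      have h2 : length R (LinearMap.ker (LinearMap.lsmul R N₂ a)) ≠ ⊤ :=
        ne_top_of_le_ne_top (WithTop.add_ne_top.2 ⟨h₁', h₃'⟩) hk'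
      refine ⟨?_, h2⟩
      rw [h₁, h₃] at hk
      rw [hsum]
      generalize length R (LinearMap.ker (LinearMap.lsmul R N₁ a)) = k₁ at *
      generalize length R (LinearMap.ker (LinearMap.lsmul R N₂ a)) = k₂ at *
      generalize length R (LinearMap.ker (LinearMap.lsmul R N₃ a)) = k₃ at *
      have : k₁ + k₃ ≠ ⊤ := by simp [h₁', h₃']
      refine ENat.add_right_injective_of_ne_top this ?_
      beta_reduce
      rw [hk]
      abel
  have h1 := (key (R ⧸ I) fun i hi x => by
    obtain ⟨r, rfl⟩ := Submodule.mkQ_surjective I x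
    rw [← map_smul]
    exact (Submodule.Quotient.mk_eq_zero I).2 (Ideal.mul_mem_right _ _ hi)).1
  rw [coker I (LinearEquiv.refl R _)] at h1
  have hz : LinearMap.ker (LinearMap.lsmul R (R ⧸ I) a) = ⊥ := by
    rw [LinearMap.ker_eq_bot']
    intro x hx
    obtain ⟨r, rfl⟩ := Submodule.mkQ_surjective I x
    rw [LinearMap.lsmul_apply, ← map_smul] at hx
    exact (Submodule.Quotient.mk_eq_zero I).2 (nzd r ((Submodule.Quotient.mk_eq_zero I).1 hx))
  rw [hz, length_bot, zero_add] at h1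
  rw [h1]
  refine Finset.sum_congr rfl fun j _ => ?_
  rw [μq j I (LinearEquiv.refl R _)]

end Length

/-! ### Orders of norms over one-dimensional domains -/

section LengthNorm

open Module Polynomial Pointwise

/-- A finitely generated torsion module over a one-dimensional Noetherian domain has finite
length. -/
lemma length_ne_top_of_torsion {A Q : Type*} [CommRing A] [IsDomain A] [IsNoetherianRing A]
    [Ring.KrullDimLE 1 A] [AddCommGroup Q] [Module A Q] [Module.Finite A Q]
    (h : ∀ x : Q, ∃ a : A, a ≠ 0 ∧ a • x = 0) : length A Q ≠ ⊤ := by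
  obtain ⟨a, ha, haQ⟩ : ∃ a : A, a ≠ 0 ∧ ∀ x : Q, a • x = 0 := by
    obtain ⟨s, hs⟩ := Module.Finite.fg_top (R := A) (M := Q)
    choose c hc hcx using h
    refine ⟨∏ x ∈ s, c x, Finset.prod_ne_zero_iff.2 fun x _ => hc x, fun x => ?_⟩
    have : (⊤ : Submodule A Q) ≤ LinearMap.ker (LinearMap.lsmul A Q (∏ x ∈ s, c x)) := by
      rw [← hs, Submodule.span_le]
      intro y hy
      obtain ⟨r, hr⟩ := Finset.dvd_prod_of_mem c hy
      simp only [SetLike.mem_coe, LinearMap.mem_ker, LinearMap.lsmul_apply]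
      rw [hr, mul_comm, mul_smul, hcx, smul_zero]
    exact this trivial
  -- One element `a` kills `Q`, so `Q` is a quotient of a power of `A ⧸ a`, whose length is finite.
  obtain ⟨n, g, hg⟩ := Module.Finite.exists_fin' A Q
  let g' : (Fin n → A ⧸ Ideal.span {a}) →ₗ[A] Q :=
    LinearMap.lsum A _ A fun i => (Ideal.span {a}).liftQ (LinearMap.toSpanSingleton A Q (g (Pi.single i 1)))
      (by
        rw [Ideal.span, Submodule.span_le, Set.singleton_subset_iff]
        simpa using haQ _)
  have hg' : Function.Surjective g' := by
    intro x
    obtain ⟨v, rfl⟩ := hg x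
    refine ⟨fun i => Submodule.Quotient.mk (v i), ?_⟩
    simp only [g', LinearMap.lsum_apply, LinearMap.sum_apply, LinearMap.comp_apply,
      LinearMap.proj_apply, Submodule.liftQ_apply, LinearMap.toSpanSingleton_apply, ← map_smul]
    rw [← map_sum]
    congr 1
    ext j
    simp [Finset.sum_apply, Pi.single_apply]
  refine ne_top_of_le_ne_top ?_ (length_le_of_surjective g' hg')
  rw [length_pi_of_fintype]
  exact WithTop.sum_ne_top.2 fun i _ => Ring.ord_ne_top (by simpa using ha)

/-- The quotient of `M` by `N` is finitely generated and torsion, so of finite length, and an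
endomorphism of such a module has kernel and cokernel of the same length. The snake lemma then
carries the cokernel from `M` to `N`. -/
lemma length_coker_eq_of_lattice {A M N : Type*} [CommRing A] [IsDomain A] [IsNoetherianRing A]
    [Ring.KrullDimLE 1 A] [AddCommGroup M] [Module A M] [Module.Finite A M]
    [AddCommGroup N] [Module A N] (f : N →ₗ[A] M) (hf : Function.Injective f)
    (h : ∀ x : M, ∃ a : A, a ≠ 0 ∧ a • x ∈ LinearMap.range f)
    (i₁ : N →ₗ[A] N) (i₂ : M →ₗ[A] M) (h₁ : f.comp i₁ = i₂.comp f)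
    (hi₂ : Function.Injective i₂) :
    length A (M ⧸ LinearMap.range i₂) = length A (N ⧸ LinearMap.range i₁) := by
  have hi₁ : Function.Injective i₁ := by
    have : Function.Injective (f.comp i₁) := by
      rw [h₁]; exact hi₂.comp hf
    exact Function.Injective.of_comp (f := f) this
  let i₃ : (M ⧸ LinearMap.range f) →ₗ[A] (M ⧸ LinearMap.range f) :=
    Submodule.mapQ _ _ i₂ (by
      rintro _ ⟨x, rfl⟩
      exact ⟨i₁ x, LinearMap.congr_fun h₁ x⟩)
  have hk := (length_ker_coker f (LinearMap.range f).mkQ hf (Submodule.mkQ_surjective _)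
    (LinearMap.exact_iff.2 (Submodule.ker_mkQ _)) i₁ i₂ i₃ h₁ rfl).1
  have hQ : length A (M ⧸ LinearMap.range f) ≠ ⊤ := length_ne_top_of_torsion fun x => by
    obtain ⟨x, rfl⟩ := Submodule.mkQ_surjective _ x
    obtain ⟨a, ha, hx⟩ := h x
    refine ⟨a, ha, ?_⟩
    rw [← map_smul]
    exact (Submodule.Quotient.mk_eq_zero _).2 hx
  have h3 : length A (LinearMap.ker i₃) = length A ((M ⧸ LinearMap.range f) ⧸ LinearMap.range i₃) := by
    have h4 := length_eq_ker_add_range i₃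
    have h5 := length_eq_add_of_exact (LinearMap.range i₃).subtype (LinearMap.range i₃).mkQ
      (Submodule.injective_subtype _) (Submodule.mkQ_surjective _)
      (LinearMap.exact_iff.2 (by rw [Submodule.ker_mkQ, Submodule.range_subtype]))
    have h6 : length A (LinearMap.range i₃) ≠ ⊤ :=
      ne_top_of_le_ne_top hQ (length_le_of_injective _ (Submodule.injective_subtype _))
    rw [h5, add_comm] at h4
    exact ENat.add_left_injective_of_ne_top h6 h4.symm
  have h7 : length A (LinearMap.ker i₃) ≠ ⊤ :=
    ne_top_of_le_ne_top hQ (length_le_of_injective _ (Submodule.injective_subtype _))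
  rw [LinearMap.ker_eq_bot.2 hi₁, LinearMap.ker_eq_bot.2 hi₂, length_bot, length_bot, ← h3, zero_add,
    zero_add, add_comm] at hk
  exact ENat.add_left_injective_of_ne_top h7 hk

/-- Lengths are over the base `A`, not over `B`, so this is not the additivity of `Ring.ord` on `B`.
-/
lemma length_quotient_mul {A B : Type*} [CommRing A] [CommRing B] [IsDomain B] [Algebra A B]
    (x y : B) (hx : x ≠ 0) :
    length A (B ⧸ Ideal.span {x * y}) =
      length A (B ⧸ Ideal.span {x}) + length A (B ⧸ Ideal.span {y}) := by
  rw [mul_comm x y]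
  have hx' := mem_nonZeroDivisors_of_ne_zero hx
  have lem : x • Ideal.span {y} = Ideal.span {y * x} := by
    rw [← Submodule.singleton_set_smul, ← Ideal.submodule_span_eq, Submodule.set_smul_span]
    simp [mul_comm]
  have := length_eq_add_of_exact ((Ideal.mulQuot x (Ideal.span {y})).restrictScalars A)
    ((Ideal.quotOfMul x (Ideal.span {y})).restrictScalars A)
    (Ideal.mulQuot_injective (Ideal.span {y}) hx')
    (Ideal.quotOfMul_surjective (Ideal.span {y})) (Ideal.exact_mulQuot_quotOfMul (Ideal.span {y}))
  rw [lem] at this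
  rw [this, add_comm]

/-- Killing the root of `A[X] ⧸ p` leaves `A` modulo `p(0)`. This is how the constant coefficient of
a minimal polynomial enters. -/
lemma length_adjoinRoot_quotient_root {A : Type*} [CommRing A] (p : A[X]) :
    length A (AdjoinRoot p ⧸ LinearMap.range (LinearMap.mulLeft A (AdjoinRoot.root p))) =
      Ring.ord A (p.coeff 0) := by
  let π : A →ₗ[A] (AdjoinRoot p ⧸ LinearMap.range (LinearMap.mulLeft A (AdjoinRoot.root p))) :=
    (LinearMap.range (LinearMap.mulLeft A (AdjoinRoot.root p))).mkQ ∘ₗ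
      Algebra.linearMap A (AdjoinRoot p)
  have hπ : Function.Surjective π := by
    intro x
    obtain ⟨x, rfl⟩ := Submodule.mkQ_surjective _ x
    obtain ⟨q, rfl⟩ := AdjoinRoot.mk_surjective x
    refine ⟨q.coeff 0, ?_⟩
    refine (Submodule.Quotient.eq _).2 ⟨AdjoinRoot.mk p (-q.divX), ?_⟩
    nth_rw 3 [← Polynomial.X_mul_divX_add q]
    rw [map_add, map_mul, AdjoinRoot.mk_X, AdjoinRoot.mk_C, map_neg]
    simp [AdjoinRoot.algebraMap_eq]
  have hk : LinearMap.ker π = Ideal.span {p.coeff 0} := by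
    ext a
    rw [LinearMap.mem_ker, Ideal.mem_span_singleton']
    refine (Submodule.Quotient.mk_eq_zero _).trans ?_
    constructor
    · rintro ⟨y, hy⟩
      obtain ⟨q, rfl⟩ := AdjoinRoot.mk_surjective y
      have h1 : AdjoinRoot.mk p (X * q) = AdjoinRoot.mk p (C a) := by
        rw [map_mul, AdjoinRoot.mk_X, AdjoinRoot.mk_C]; exact hy
      obtain ⟨r, hr⟩ := AdjoinRoot.mk_eq_mk.1 h1
      refine ⟨-r.coeff 0, ?_⟩
      have := congrArg (fun f => f.coeff 0) hr
      simp only [coeff_sub, mul_coeff_zero, coeff_X_zero, zero_mul, coeff_C_zero, zero_sub] at this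
      linear_combination this
    · rintro ⟨r, rfl⟩
      refine ⟨AdjoinRoot.mk p (-(C r * p.divX)), ?_⟩
      have h1 : AdjoinRoot.mk p (C (r * p.coeff 0)) = AdjoinRoot.mk p (X * -(C r * p.divX)) := by
        rw [AdjoinRoot.mk_eq_mk]
        refine ⟨C r, ?_⟩
        nth_rw 3 [← Polynomial.X_mul_divX_add p]
        rw [C_mul]
        ring
      rw [map_mul (AdjoinRoot.mk p) X, AdjoinRoot.mk_X, AdjoinRoot.mk_C] at h1
      exact h1.symm
  rw [← (LinearMap.quotKerEquivOfSurjective π hπ).length_eq, hk]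
  rfl

section

variable {A B K L : Type*} [CommRing A] [IsDomain A] [IsNoetherianRing A]
  [Ring.KrullDimLE 1 A] [CommRing B] [IsDomain B] [Algebra A B] [Module.Finite A B]
  [Field K] [Algebra A K] [IsFractionRing A K] [Field L] [Algebra B L]
  [Algebra K L] [Algebra A L] [IsScalarTower A K L] [IsScalarTower A B L]
  [FiniteDimensional K L]

open IntermediateField in
-- Up to torsion, `B` is a free module over `A[φ] = A[X] ⧸ p` whose rank is the degree of `L` over
-- `K(φ)`. Multiplication by `φ` is diagonal on this lattice, and each summand contributes the order
-- of `p(0)`. That the minimal polynomial has coefficients in `A` must be assumed, as `A` need not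
-- be normal.
lemma length_quotient_of_minpoly (hinj : Function.Injective (algebraMap B L))
    (hBL : ∀ x : L, ∃ a : A, a ≠ 0 ∧ ∃ b : B, algebraMap B L b = a • x)
    (φ : B) (hφ : φ ≠ 0) (p : A[X])
    (hp : p.map (algebraMap A K) = minpoly K (algebraMap B L φ)) :
    length A (B ⧸ Ideal.span {φ}) =
      finrank K⟮algebraMap B L φ⟯ L * Ring.ord A (p.coeff 0) := by
  set φ' := algebraMap B L φ with hφ'
  have hint : IsIntegral K φ' := Algebra.IsIntegral.isIntegral φ'
  have hAK : Function.Injective (algebraMap A K) := IsFractionRing.injective A K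
  have hpm : p.Monic := Polynomial.monic_of_injective hAK (hp ▸ minpoly.monic hint)
  have hp0 : aeval φ p = 0 := by
    apply hinj
    rw [← aeval_algebraMap_apply, map_zero, ← aeval_map_algebraMap K, hp, minpoly.aeval]
  let θ : AdjoinRoot p →ₐ[A] B := AdjoinRoot.liftAlgHom p (Algebra.ofId A B) φ hp0
  have hθr : θ (AdjoinRoot.root p) = φ := AdjoinRoot.liftAlgHom_root _ _ _ _
  have hθ : Function.Injective θ := by
    rw [injective_iff_map_eq_zero]
    intro x hx
    obtain ⟨q, rfl⟩ := AdjoinRoot.mk_surjective x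
    rw [AdjoinRoot.mk_eq_zero]
    have h1 : aeval φ q = 0 := by rw [← hx]; exact (AdjoinRoot.liftAlgHom_mk _ _ _ _ _).symm
    have h2 : aeval φ' (q.map (algebraMap A K)) = 0 := by
      rw [aeval_map_algebraMap, hφ', aeval_algebraMap_apply, h1, map_zero]
    have h3 := minpoly.dvd K φ' h2
    rw [← hp] at h3
    exact (Polynomial.map_dvd_map _ hAK hpm).1 h3
  -- A basis of `L` over `K(φ)`, moved into `B` by scaling with elements of `A`.
  obtain ⟨v, b, hvb⟩ : ∃ (v : Basis (Fin (finrank K⟮φ'⟯ L)) K⟮φ'⟯ L)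
      (b : Fin (finrank K⟮φ'⟯ L) → B), ∀ j, v j = algebraMap B L (b j) := by
    let v₀ := finBasis K⟮φ'⟯ L
    choose a ha b hb using fun j => hBL (v₀ j)
    have hu : ∀ j, IsUnit (algebraMap K K⟮φ'⟯ (algebraMap A K (a j))) := fun j =>
      (isUnit_iff_ne_zero.2 ((map_ne_zero_iff _ hAK).2 (ha j))).map (algebraMap K K⟮φ'⟯)
    refine ⟨v₀.isUnitSMul hu, b, fun j => ?_⟩
    rw [Basis.isUnitSMul_apply, hb, Algebra.smul_def, Algebra.smul_def,
      IsScalarTower.algebraMap_apply A K L, ← IsScalarTower.algebraMap_apply K K⟮φ'⟯ L]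
  let f : (Fin (finrank K⟮φ'⟯ L) → AdjoinRoot p) →ₗ[A] B :=
    LinearMap.lsum A _ A fun j => (LinearMap.mulRight A (b j)).comp θ.toLinearMap
  have hf : ∀ x, f x = ∑ j, θ (x j) * b j := fun x => by simp [f]
  have hθK : ∀ x, algebraMap B L (θ x) ∈ K⟮φ'⟯ := by
    intro x
    obtain ⟨q, rfl⟩ := AdjoinRoot.mk_surjective x
    have : θ (AdjoinRoot.mk p q) = aeval φ q := AdjoinRoot.liftAlgHom_mk _ _ _ _ _
    rw [this, ← aeval_algebraMap_apply, ← aeval_map_algebraMap K, ← hφ']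
    exact IntermediateField.algebra_adjoin_le_adjoin K _ (Polynomial.aeval_mem_adjoin_singleton K φ')
  have hfinj : Function.Injective f := by
    rw [injective_iff_map_eq_zero]
    intro x hx
    have h1 : ∑ j, (⟨algebraMap B L (θ (x j)), hθK _⟩ : K⟮φ'⟯) • v j = 0 := by
      have := congrArg (algebraMap B L) hx
      rw [hf, map_sum, map_zero] at this
      rw [← this]
      refine Finset.sum_congr rfl fun j _ => ?_
      rw [map_mul, hvb]
      rfl
    have h2 := Fintype.linearIndependent_iff.1 v.linearIndependent _ h1
    ext j
    apply hθ
    apply hinj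
    rw [Pi.zero_apply, map_zero, map_zero]
    exact congrArg Subtype.val (h2 j)
  -- Expand `x` in the basis of products of a power of `φ` with some `v j` over `K`, and clear the
  -- denominators of the coefficients.
  have htors : ∀ x : B, ∃ a : A, a ≠ 0 ∧ a • x ∈ LinearMap.range f := by
    intro x
    let pb := adjoin.powerBasis hint
    let w := pb.basis.smulTower v
    obtain ⟨⟨a, ha⟩, hd⟩ := IsLocalization.exist_integer_multiples (nonZeroDivisors A)
      Finset.univ (fun i => w.repr (algebraMap B L x) i)
    choose! d hd using fun i => hd i (Finset.mem_univ i)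
    refine ⟨a, nonZeroDivisors.ne_zero ha,
      fun j => ∑ i, d (i, j) • AdjoinRoot.root p ^ (i : ℕ), hinj ?_⟩
    rw [hf, map_sum, Algebra.smul_def, map_mul, ← IsScalarTower.algebraMap_apply A B L,
      ← Algebra.smul_def, ← w.sum_repr (algebraMap B L x), Finset.smul_sum,
      Fintype.sum_prod_type_right]
    refine Finset.sum_congr rfl fun j _ => ?_
    rw [map_sum, Finset.sum_mul, map_sum]
    refine Finset.sum_congr rfl fun i _ => ?_
    have h1 : w (i, j) = φ' ^ (i : ℕ) * algebraMap B L (b j) := by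
      rw [← hvb, Basis.smulTower_apply, pb.basis_eq_pow]
      change ((pb.gen ^ (i : ℕ) : K⟮φ'⟯) : L) * v j = _
      rw [SubmonoidClass.coe_pow]
      rfl
    rw [← smul_assoc, ← hd (i, j), h1, map_smul, map_pow, hθr, Algebra.smul_def, map_mul, map_mul,
      map_pow, ← hφ', Algebra.smul_def (algebraMap A K _), ← IsScalarTower.algebraMap_apply A K L,
      ← IsScalarTower.algebraMap_apply A B L, mul_assoc]
  let i₁ : (Fin (finrank K⟮φ'⟯ L) → AdjoinRoot p) →ₗ[A] (Fin (finrank K⟮φ'⟯ L) → AdjoinRoot p) :=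
    LinearMap.pi fun j => (LinearMap.mulLeft A (AdjoinRoot.root p)).comp (LinearMap.proj j)
  have hr₁ : LinearMap.range i₁ = Submodule.pi Set.univ
      fun _ => LinearMap.range (LinearMap.mulLeft A (AdjoinRoot.root p)) := by
    ext x
    constructor
    · rintro ⟨y, rfl⟩ j _
      exact ⟨y j, rfl⟩
    · intro hx
      choose y hy using fun j => hx j trivial
      exact ⟨y, funext hy⟩
  have key := length_coker_eq_of_lattice f hfinj htors i₁ (LinearMap.mulLeft A φ) (by
    ext j x
    simp only [LinearMap.comp_apply, hf, LinearMap.mulLeft_apply, Finset.mul_sum]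
    refine Finset.sum_congr rfl fun l _ => ?_
    simp only [i₁, LinearMap.pi_apply, LinearMap.comp_apply, LinearMap.proj_apply,
      LinearMap.mulLeft_apply, map_mul, hθr, mul_assoc]) (fun x y hxy => mul_left_cancel₀ hφ hxy)
  rw [hr₁, (Submodule.quotientPi fun _ : Fin (finrank K⟮φ'⟯ L) =>
    LinearMap.range (LinearMap.mulLeft A (AdjoinRoot.root p))).length_eq, length_pi_of_fintype,
    Finset.sum_const, length_adjoinRoot_quotient_root, Finset.card_univ, Fintype.card_fin,
    nsmul_eq_mul] at key
  rw [← key]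
  have h1 : (Ideal.span {φ}).restrictScalars A = LinearMap.range (LinearMap.mulLeft A φ) := by
    ext x
    rw [Submodule.restrictScalars_mem, Ideal.mem_span_singleton']
    exact ⟨fun ⟨y, hy⟩ => ⟨y, (mul_comm _ _).trans hy⟩, fun ⟨y, hy⟩ => ⟨y, (mul_comm _ _).trans hy⟩⟩
  rw [← (Submodule.Quotient.restrictScalarsEquiv A (Ideal.span {φ})).length_eq, h1]

open IntermediateField in
/-- The order of the norm: if `φ = b / s` in `L`, then the length of `B ⧸ b` minus that of `B ⧸ s`
is the order of the norm of `φ`, which up to sign is a power of the constant coefficient of the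
minimal polynomial. -/
theorem length_quotient_norm (hinj : Function.Injective (algebraMap B L))
    (hBL : ∀ x : L, ∃ a : A, a ≠ 0 ∧ ∃ b : B, algebraMap B L b = a • x)
    (φ : L) (hφ : φ ≠ 0) (b : B) (s : A) (hb : algebraMap B L b = s • φ)
    (α β : A) (hβ : β ≠ 0)
    (h : (minpoly K φ).coeff 0 ^ finrank K⟮φ⟯ L * algebraMap A K β = algebraMap A K α) :
    length A (B ⧸ Ideal.span {b}) + Ring.ord A β =
      length A (B ⧸ Ideal.span {algebraMap A B s}) + Ring.ord A α := by
  have hAK : Function.Injective (algebraMap A K) := IsFractionRing.injective A K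
  have hAL : Function.Injective (algebraMap A L) := by
    rw [IsScalarTower.algebraMap_eq A K L]
    exact (algebraMap K L).injective.comp hAK
  have hAB : Function.Injective (algebraMap A B) := by
    rw [IsScalarTower.algebraMap_eq A B L] at hAL
    exact Function.Injective.of_comp hAL
  have hint : IsIntegral K φ := Algebra.IsIntegral.isIntegral φ
  obtain ⟨a, ha, d₁, hd₁⟩ := hBL φ
  obtain ⟨⟨c, hc⟩, hcc⟩ := IsLocalization.exist_integer_multiples (nonZeroDivisors A)
    (minpoly K φ).support (fun i => (minpoly K φ).coeff i)
  -- The factor `a` moves `φ` into `B`. The factor `c` clears the denominators of the minimal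
  -- polynomial: the coefficients of that of `d φ` below the top one are multiplied by a positive
  -- power of `d`.
  set d := c * a with hd
  have hc0 : c ≠ 0 := nonZeroDivisors.ne_zero hc
  have hd0 : d ≠ 0 := mul_ne_zero hc0 ha
  set ψ : B := c • d₁ with hψ
  have hψL : algebraMap B L ψ = algebraMap A K d • φ := by
    rw [hψ, Algebra.smul_def, map_mul, ← IsScalarTower.algebraMap_apply, hd₁, ← Algebra.smul_def,
      ← mul_smul, algebraMap_smul]
  have hdK : algebraMap A K d ≠ 0 := (map_ne_zero_iff _ hAK).2 hd0
  have hmin : minpoly K (algebraMap B L ψ) = (minpoly K φ).scaleRoots (algebraMap A K d) := by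
    rw [hψL]; exact IsIntegrallyClosed.minpoly_smul hdK hint
  have hadj : K⟮algebraMap B L ψ⟯ = K⟮φ⟯ := by
    apply le_antisymm
    · rw [adjoin_simple_le_iff, hψL]
      exact IntermediateField.smul_mem _ (mem_adjoin_simple_self K φ)
    · rw [adjoin_simple_le_iff]
      have : φ = (algebraMap A K d)⁻¹ • algebraMap B L ψ := by rw [hψL, inv_smul_smul₀ hdK]
      rw [this]
      exact IntermediateField.smul_mem _ (mem_adjoin_simple_self K _)
  have hmem : ∀ i, ((minpoly K φ).scaleRoots (algebraMap A K d)).coeff i ∈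
      Set.range (algebraMap A K) := by
    intro i
    rw [coeff_scaleRoots]
    rcases lt_trichotomy i (minpoly K φ).natDegree with hi | hi | hi
    · obtain ⟨m, hm⟩ := Nat.exists_eq_add_of_lt hi
      by_cases hci : (minpoly K φ).coeff i = 0
      · exact ⟨0, by simp [hci]⟩
      obtain ⟨y, hy⟩ := hcc i (mem_support_iff.2 hci)
      refine ⟨y * a * d ^ m, ?_⟩
      rw [hm, show i + m + 1 - i = m + 1 by omega, map_mul, map_mul, hy, hd]
      simp only [Algebra.smul_def, map_mul, map_pow]
      ring
    · rw [hi, coeff_natDegree, (minpoly.monic hint).leadingCoeff]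
      exact ⟨1, by simp⟩
    · rw [coeff_eq_zero_of_natDegree_lt hi]
      exact ⟨0, by simp⟩
  obtain ⟨p, hp⟩ : ∃ p : A[X], p.map (algebraMap A K) =
      (minpoly K φ).scaleRoots (algebraMap A K d) := by
    rw [← Polynomial.mem_lifts, Polynomial.lifts_iff_coeff_lifts]
    exact hmem
  have hψ0 : ψ ≠ 0 := by
    intro h0
    rw [h0, map_zero] at hψL
    exact smul_ne_zero hdK hφ hψL.symm
  have h1 := length_quotient_of_minpoly (K := K) hinj hBL ψ hψ0 p (hp.trans hmin.symm)
  have h2 := length_quotient_of_minpoly (K := K) hinj hBL (algebraMap A B d)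
    ((map_ne_zero_iff _ hAB).2 hd0) (X - C d) (by
      rw [← IsScalarTower.algebraMap_apply A B L, IsScalarTower.algebraMap_apply A K L,
        minpoly.eq_X_sub_C_of_algebraMap_inj _ (algebraMap K L).injective]
      simp)
  have hbot : K⟮algebraMap B L (algebraMap A B d)⟯ = ⊥ := by
    rw [adjoin_simple_eq_bot_iff, ← IsScalarTower.algebraMap_apply A B L,
      IsScalarTower.algebraMap_apply A K L]
    exact IntermediateField.algebraMap_mem _ _
  rw [hbot, IntermediateField.finrank_bot'] at h2
  rw [hadj] at h1
  rw [coeff_sub, coeff_X_zero, coeff_C_zero, zero_sub, Ring.ord_neg] at h2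
  have hp0 : algebraMap A K (p.coeff 0) =
      (minpoly K φ).coeff 0 * algebraMap A K d ^ (minpoly K φ).natDegree := by
    rw [← Polynomial.coeff_map, hp, coeff_scaleRoots, Nat.sub_zero]
  have hc00 : (minpoly K φ).coeff 0 ≠ 0 := minpoly.coeff_zero_ne_zero hint hφ
  have hp00 : p.coeff 0 ≠ 0 := by
    rw [← map_ne_zero_iff _ hAK, hp0]
    exact mul_ne_zero hc00 (pow_ne_zero _ hdK)
  have hdeg : (minpoly K φ).natDegree * finrank K⟮φ⟯ L = finrank K L := by
    rw [← IntermediateField.adjoin.finrank hint, finrank_mul_finrank]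
  have e1 : p.coeff 0 ^ finrank K⟮φ⟯ L * β = α * d ^ finrank K L := by
    apply hAK
    rw [map_mul (algebraMap A K) (p.coeff 0 ^ _), map_pow, hp0, map_mul (algebraMap A K) α, ← h,
      ← hdeg, map_pow, pow_mul]
    ring
  have n := fun {x : A} (hx : x ≠ 0) => mem_nonZeroDivisors_of_ne_zero hx
  have e2 := congrArg (Ring.ord A) e1
  rw [Ring.ord_mul A (n hβ), Ring.ord_mul A (n (pow_ne_zero _ hd0)), Ring.ord_pow (n hp00),
    Ring.ord_pow (n hd0), nsmul_eq_mul, nsmul_eq_mul, ← h1, ← h2] at e2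
  -- Both sides are `d s φ` in `L`, so the known lengths for `d φ` and `d` give the difference of
  -- those for `b` and `s`.
  have e3 : ψ * algebraMap A B s = algebraMap A B d * b := by
    apply hinj
    rw [map_mul, map_mul, hψL, hb, ← IsScalarTower.algebraMap_apply A B L,
      ← IsScalarTower.algebraMap_apply A B L, Algebra.smul_def, Algebra.smul_def,
      ← IsScalarTower.algebraMap_apply A K L]
    ring
  have e4 : length A (B ⧸ Ideal.span {ψ * algebraMap A B s}) =
      length A (B ⧸ Ideal.span {algebraMap A B d * b}) := by rw [e3]
  rw [length_quotient_mul _ _ hψ0, length_quotient_mul _ _ ((map_ne_zero_iff _ hAB).2 hd0)] at e4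
  have f1 : length A (B ⧸ Ideal.span {ψ}) ≠ ⊤ := by
    rw [h1]
    exact WithTop.mul_ne_top (ENat.natCast_ne_top _) (Ring.ord_ne_top (n hp00))
  have f2 : length A (B ⧸ Ideal.span {algebraMap A B d}) ≠ ⊤ := by
    rw [h2]
    exact WithTop.mul_ne_top (ENat.natCast_ne_top _) (Ring.ord_ne_top (n hd0))
  refine ENat.add_right_injective_of_ne_top (WithTop.add_ne_top.2 ⟨f1, f2⟩) ?_
  beta_reduce
  calc _ = (length A (B ⧸ Ideal.span {ψ}) + Ring.ord A β) +
      (length A (B ⧸ Ideal.span {algebraMap A B d}) + length A (B ⧸ Ideal.span {b})) := by abel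
    _ = _ := by rw [e2, ← e4]; abel

end

end LengthNorm

/-! ### Orders of vanishing along the closure of a point -/

section Local

variable {Y : Scheme.{u}} {η y : Y}

/-- The evaluation `𝒪_{Y,y} → κ(η)` at a generization `η` of `y`. -/
noncomputable def evalAt (h : η ⤳ y) : Y.presheaf.stalk y →+* Y.residueField η :=
  (Y.presheaf.stalkSpecializes h ≫ Y.residue η).hom

/-- The prime ideal of `𝒪_{Y,y}` that corresponds to a generization `η` of `y`. -/
noncomputable def primeAt (h : η ⤳ y) : Ideal (Y.presheaf.stalk y) := RingHom.ker (evalAt h)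

instance (h : η ⤳ y) : (primeAt h).IsPrime := RingHom.ker_isPrime _

/-- The length of `𝒪_{Z,y} / a`, with `Z` the closure of `η`. -/
noncomputable def ordLen (h : η ⤳ y) (a : Y.presheaf.stalk y) : ℕ∞ :=
  Module.length (Y.presheaf.stalk y) (Y.presheaf.stalk y ⧸ (primeAt h ⊔ Ideal.span {a}))

lemma primeAt_eq_comap (h : η ⤳ y) : primeAt h =
    (IsLocalRing.maximalIdeal (Y.presheaf.stalk η)).comap (Y.presheaf.stalkSpecializes h).hom := by
  ext x
  rw [primeAt, RingHom.mem_ker, Ideal.mem_comap, ← IsLocalRing.residue_eq_zero_iff]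
  rfl

lemma fromSpecStalk_primeAt (h : η ⤳ y) : Y.fromSpecStalk y ⟨primeAt h, inferInstance⟩ = η := by
  have h1 := Scheme.fromSpecStalk_closedPoint (x := η)
  rw [← Scheme.SpecMap_stalkSpecializes_fromSpecStalk h] at h1
  refine Eq.trans ?_ h1
  refine Eq.trans (congrArg (Y.fromSpecStalk y) ?_) (Scheme.Hom.comp_apply _ _ _).symm
  exact PrimeSpectrum.ext (primeAt_eq_comap h)

lemma fromSpecStalk_specializes (Q : PrimeSpectrum (Y.presheaf.stalk y)) :
    Y.fromSpecStalk y Q ⤳ y := by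
  have : Y.fromSpecStalk y Q ∈ Set.range (Y.fromSpecStalk y) := ⟨Q, rfl⟩
  rwa [Scheme.range_fromSpecStalk] at this

lemma primeAt_le_iff (h : η ⤳ y) (Q : PrimeSpectrum (Y.presheaf.stalk y)) :
    primeAt h ≤ Q.asIdeal ↔ η ⤳ Y.fromSpecStalk y Q := by
  have h1 := (Y.fromSpecStalk y).isEmbedding.specializes_iff
    (x := (⟨primeAt h, inferInstance⟩ : PrimeSpectrum _)) (y := Q)
  rw [fromSpecStalk_primeAt h] at h1
  exact (PrimeSpectrum.le_iff_specializes ⟨primeAt h, inferInstance⟩ Q).trans h1.symm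

/-- An affine neighbourhood of `y` also contains `η`, and both stalks are localizations of its ring
of functions. -/
lemma isLocalization_stalkSpecializes (h : η ⤳ y) :
    letI := (Y.presheaf.stalkSpecializes h).hom.toAlgebra
    IsLocalization.AtPrime (Y.presheaf.stalk η) (primeAt h) := by
  let := (Y.presheaf.stalkSpecializes h).hom.toAlgebra
  obtain ⟨U, hU, hyU, -⟩ := exists_isAffineOpen_mem_and_subset (x := y) (U := ⊤) trivial
  have hηU : η ∈ U := h.mem_open U.2 hyU
  let : Algebra Γ(Y, U) (Y.presheaf.stalk y) := (Y.presheaf.germ U y hyU).hom.toAlgebra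
  let : Algebra Γ(Y, U) (Y.presheaf.stalk η) := (Y.presheaf.germ U η hηU).hom.toAlgebra
  have : IsScalarTower Γ(Y, U) (Y.presheaf.stalk y) (Y.presheaf.stalk η) := by
    refine IsScalarTower.of_algebraMap_eq' ?_
    exact (congrArg CommRingCat.Hom.hom (Y.presheaf.germ_stalkSpecializes hyU h)).symm
  have l1 : IsLocalization.AtPrime (Y.presheaf.stalk y) (hU.primeIdealOf ⟨y, hyU⟩).asIdeal :=
    hU.isLocalization_stalk ⟨y, hyU⟩
  have l2 : IsLocalization.AtPrime (Y.presheaf.stalk η) (hU.primeIdealOf ⟨η, hηU⟩).asIdeal :=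
    hU.isLocalization_stalk ⟨η, hηU⟩
  have key : ∀ r : Γ(Y, U), r ∈ (hU.primeIdealOf ⟨η, hηU⟩).asIdeal ↔
      algebraMap Γ(Y, U) (Y.presheaf.stalk y) r ∈ primeAt h := by
    intro r
    rw [← IsLocalization.AtPrime.to_map_mem_maximal_iff (Y.presheaf.stalk η)
      (hU.primeIdealOf ⟨η, hηU⟩).asIdeal, primeAt_eq_comap,
      Ideal.mem_comap, IsScalarTower.algebraMap_apply Γ(Y, U) (Y.presheaf.stalk y)]
    rfl
  have hle : (hU.primeIdealOf ⟨y, hyU⟩).asIdeal.primeCompl ≤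
      (hU.primeIdealOf ⟨η, hηU⟩).asIdeal.primeCompl := by
    intro r hr hr'
    rw [SetLike.mem_coe, key] at hr'
    refine (inferInstance : (primeAt h).IsPrime).ne_top (Ideal.eq_top_of_isUnit_mem _ hr' ?_)
    exact IsLocalization.map_units (Y.presheaf.stalk y) (⟨r, hr⟩ : (hU.primeIdealOf _).asIdeal.primeCompl)
  have l3 := IsLocalization.isLocalization_of_submonoid_le (Y.presheaf.stalk y)
    (Y.presheaf.stalk η) _ _ hle
  refine IsLocalization.of_le_of_exists_dvd (Submonoid.map (algebraMap Γ(Y, U) (Y.presheaf.stalk y))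
    (hU.primeIdealOf ⟨η, hηU⟩).asIdeal.primeCompl) _ ?_ ?_
  · rintro _ ⟨r, hr, rfl⟩ hr'
    exact hr ((key r).2 hr')
  · intro x hx
    obtain ⟨⟨r, m⟩, hrm⟩ := IsLocalization.surj
      (hU.primeIdealOf ⟨y, hyU⟩).asIdeal.primeCompl x
    refine ⟨algebraMap _ _ r, ⟨r, fun hr => ?_, rfl⟩, ⟨_, hrm.symm⟩⟩
    have := (key r).1 hr
    rw [← hrm] at this
    rcases (inferInstance : (primeAt h).IsPrime).mem_or_mem this with h1 | h1
    · exact hx h1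
    · exact hle m.2 ((key _).2 h1)

lemma exists_evalAt_mul_eq (h : η ⤳ y) (f : Y.residueField η) :
    ∃ a b, evalAt h b ≠ 0 ∧ f * evalAt h b = evalAt h a := by
  obtain ⟨g, rfl⟩ := Y.residue_surjective η f
  let := (Y.presheaf.stalkSpecializes h).hom.toAlgebra
  have := isLocalization_stalkSpecializes h
  obtain ⟨⟨a, b⟩, hab⟩ := IsLocalization.surj (primeAt h).primeCompl g
  exact ⟨a, b, b.2, by
    have := congrArg (Y.residue η).hom hab
    rwa [map_mul] at this⟩

end Local

section CurvePoint

variable {Y : Scheme.{u}}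

/-- A point whose closure has dimension one: it is not closed and all its proper specializations
are closed. -/
structure IsCurvePoint (η : Y) : Prop where
  not_isClosed : ¬ IsClosed ({η} : Set Y)
  isClosed_of_specializes : ∀ y, η ⤳ y → y ≠ η → IsClosed ({y} : Set Y)

variable {η y : Y}

/-- Primes above that of `η` are points between `η` and `y`. Such a point is `η` or is closed, and a
closed generization of `y` is `y` itself. -/
lemma IsCurvePoint.eq_of_le (hη : IsCurvePoint η) (h : η ⤳ y)
    (Q : Ideal (Y.presheaf.stalk y)) [hQ : Q.IsPrime] (hle : primeAt h ≤ Q) :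
    Q = primeAt h ∨ Q = IsLocalRing.maximalIdeal _ := by
  have h1 := (primeAt_le_iff h ⟨Q, hQ⟩).1 hle
  have h2 := fromSpecStalk_specializes (⟨Q, hQ⟩ : PrimeSpectrum (Y.presheaf.stalk y))
  by_cases h3 : Y.fromSpecStalk y ⟨Q, hQ⟩ = η
  · left
    conv_rhs at h3 => rw [← fromSpecStalk_primeAt h]
    exact congrArg PrimeSpectrum.asIdeal ((Y.fromSpecStalk y).isEmbedding.injective h3)
  · right
    have h4 := hη.isClosed_of_specializes _ h1 h3
    have h5 : Y.fromSpecStalk y ⟨Q, hQ⟩ = Y.fromSpecStalk y (IsLocalRing.closedPoint _) := by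
      rw [Scheme.fromSpecStalk_closedPoint]
      have := (h4.closure_eq ▸ specializes_iff_mem_closure.1 h2 :
        y ∈ ({Y.fromSpecStalk y ⟨Q, hQ⟩} : Set Y))
      exact (Set.mem_singleton_iff.1 this).symm
    exact congrArg PrimeSpectrum.asIdeal ((Y.fromSpecStalk y).isEmbedding.injective h5)

/-- Only the maximal ideal contains both the prime of `η` and `a`, so the quotient is Artinian. -/
lemma IsCurvePoint.ordLen_ne_top [IsLocallyNoetherian Y] (hη : IsCurvePoint η)
    (h : η ⤳ y) (a : Y.presheaf.stalk y) (ha : evalAt h a ≠ 0) :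
    ordLen h a ≠ ⊤ := by
  rw [ordLen, Module.length_ne_top_iff]
  set J := primeAt h ⊔ Ideal.span {a}
  have : IsArtinianRing (Y.presheaf.stalk y ⧸ J) := by
    rw [isArtinianRing_iff_isNoetherianRing_krullDimLE_zero]
    refine ⟨inferInstance, Ring.krullDimLE_zero_iff.2 fun I hI => ?_⟩
    have h1 : (I.comap (Ideal.Quotient.mk J)).IsPrime := Ideal.comap_isPrime _ _
    have h2 : J ≤ I.comap (Ideal.Quotient.mk J) := fun x hx => by
      rw [Ideal.mem_comap, Ideal.Quotient.eq_zero_iff_mem.2 hx]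
      exact I.zero_mem
    rcases hη.eq_of_le h _ (le_sup_left.trans h2) with h3 | h3
    · exact absurd (h3.le (h2 (Ideal.mem_sup_right (Ideal.mem_span_singleton_self a)))) ha
    · have := Ideal.map_comap_of_surjective _ Ideal.Quotient.mk_surjective I
      rw [← this]
      have hm : (I.comap (Ideal.Quotient.mk J)).IsMaximal := h3 ▸ inferInstance
      refine Ideal.IsMaximal.map_of_surjective_of_ker_le Ideal.Quotient.mk_surjective ?_
      rw [Ideal.mk_ker]; exact h2
  have h1 : IsFiniteLength (Y.presheaf.stalk y ⧸ J) (Y.presheaf.stalk y ⧸ J) :=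
    isFiniteLength_iff_isNoetherian_isArtinian.2 ⟨inferInstance, inferInstance⟩
  rw [← Module.length_ne_top_iff] at h1 ⊢
  rwa [Module.length_eq_of_surjective (S := Y.presheaf.stalk y) (R := Y.presheaf.stalk y ⧸ J)
    (M := Y.presheaf.stalk y ⧸ J) Ideal.Quotient.mk_surjective]

/-- `z` is the divisor of the rational function `f` on the closure of `η`. -/
structure IsDivisorAt (z : ZeroCycle Y) (η : Y) (f : Y.residueField η) : Prop where
  ne_zero : f ≠ 0
  add_eq : ∀ (y : Y) (hy : IsClosed ({y} : Set Y)) (h : η ⤳ y) (a b : Y.presheaf.stalk y),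
    evalAt h b ≠ 0 → f * evalAt h b = evalAt h a →
      z ⟨y, hy⟩ + (ordLen h b).toNat = (ordLen h a).toNat
  eq_zero : ∀ (y : Y) (hy : IsClosed ({y} : Set Y)), ¬ η ⤳ y → z ⟨y, hy⟩ = 0

end CurvePoint

/-! ### Curves as closed subschemes and curves as points -/

section

lemma length_quotient_ker_sup {R S : Type*} [CommRing R] [CommRing S] (φ : R →+* S)
    (hφ : Function.Surjective φ) (a : R) :
    Module.length R (R ⧸ (RingHom.ker φ ⊔ Ideal.span {a})) = Ring.ord S (φ a) := by
  let := φ.toAlgebra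
  have h1 : RingHom.ker φ ⊔ Ideal.span {a} = (Ideal.span {φ a}).comap φ := by
    rw [← Set.image_singleton, ← Ideal.map_span, Ideal.comap_map_of_surjective _ hφ, sup_comm]
    rfl
  let g : R →ₗ[R] (S ⧸ Ideal.span {φ a}) :=
    ((Ideal.Quotient.mkₐ R (Ideal.span {φ a})).comp (Algebra.ofId R S)).toLinearMap
  have hg : Function.Surjective g := Ideal.Quotient.mk_surjective.comp hφ
  have h2 : RingHom.ker φ ⊔ Ideal.span {a} = LinearMap.ker g := by
    rw [h1]
    ext x
    rw [LinearMap.mem_ker]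
    exact (Ideal.Quotient.eq_zero_iff_mem (I := Ideal.span {φ a})).symm
  rw [h2, (g.quotKerEquivOfSurjective hg).length_eq, Ring.ord,
    Module.length_eq_of_surjective (S := R) (R := S) hφ]

end

section Curve

variable {C : Scheme.{u}} [IsIntegral C]

/-- Irreducible closed subsets correspond to points, so the dimension is that of the specialization
order, in which the generic point is the top element. -/
lemma topologicalKrullDim_eq_one_iff :
    topologicalKrullDim C = 1 ↔ IsCurvePoint (genericPoint C) := by
  have hle : ∀ x y : C, x ≤ y ↔ y ⤳ x := fun x y => Iff.rfl
  have hg : ∀ x : C, x ≤ genericPoint C := fun x => genericPoint_specializes x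
  have hanti : ∀ x y : C, x ≤ y → y ≤ x → x = y := fun x y h1 h2 =>
    (Specializes.antisymm h2 h1).eq
  have hmin : ∀ x : C, IsMin x → IsClosed ({x} : Set C) := by
    intro x hx
    rw [← closure_eq_iff_isClosed]
    refine (Set.Subset.antisymm ?_ subset_closure)
    intro y hy
    have h1 : y ≤ x := specializes_iff_mem_closure.2 hy
    exact hanti _ _ h1 (hx h1)
  have e : topologicalKrullDim C = Order.krullDim C :=
    Order.krullDim_eq_of_orderIso irreducibleSetEquivPoints
  rw [e]
  constructor
  · intro h
    have h1 := Order.krullDim_le_one_iff.1 h.le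
    obtain ⟨x, y, hxy⟩ := Order.one_le_krullDim_iff.1 h.ge
    refine ⟨fun hc => ?_, fun y _ hy => ?_⟩
    · have h2 : ∀ z : C, z = genericPoint C := fun z => by
        have := specializes_iff_mem_closure.1 (genericPoint_specializes z)
        rwa [hc.closure_eq] at this
      exact hxy.ne ((h2 x).trans (h2 y).symm)
    · rcases h1 y with h2 | h2
      · exact hmin y h2
      · exact absurd (hanti _ _ (hg y) (h2 (hg y))) hy
  · intro h
    have hle1 : Order.krullDim C ≤ 1 := by
      rw [Order.krullDim_le_one_iff]
      intro x
      by_cases hx : x = genericPoint C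
      · right; subst hx; exact fun y _ => hg y
      · left
        have h1 := h.isClosed_of_specializes x (genericPoint_specializes x) hx
        intro y hy
        have h2 : y ∈ closure {x} := specializes_iff_mem_closure.1 hy
        rw [h1.closure_eq] at h2
        exact h2.symm.le
    have hge1 : 1 ≤ Order.krullDim C := by
      rw [Order.one_le_krullDim_iff]
      by_contra! hcon
      refine h.not_isClosed (hmin _ fun x hx => ?_)
      by_contra hx'
      exact hcon x (genericPoint C) (lt_of_le_not_ge hx hx')
    exact le_antisymm hle1 hge1

lemma IsCurvePoint.coheight_eq_one (h : IsCurvePoint (genericPoint C)) {c : C}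
    (hc : IsClosed ({c} : Set C)) : Order.coheight c = 1 := by
  have hle : ∀ x y : C, x ≤ y ↔ y ⤳ x := fun x y => Iff.rfl
  have hg : ∀ x : C, x ≤ genericPoint C := fun x => genericPoint_specializes x
  apply le_antisymm
  · refine Order.coheight_le_coe_iff (n := 1).2 fun y hy => ?_
    have : IsMax y := by
      by_cases hy' : y = genericPoint C
      · subst hy'; exact fun x _ => hg x
      · have h1 := h.isClosed_of_specializes y (genericPoint_specializes y) hy'
        have h2 : c ∈ closure {y} := specializes_iff_mem_closure.1 hy.le
        rw [h1.closure_eq] at h2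
        exact absurd h2 hy.ne
    rw [Order.coheight_eq_zero.2 this]; simp
  · rw [Order.one_le_iff_pos, Order.coheight_pos]
    intro hmax
    have h1 : c = genericPoint C := by
      have h2 : c ⤳ genericPoint C := hmax (hg c)
      exact (h2.antisymm (genericPoint_specializes c)).eq
    exact h.not_isClosed (h1 ▸ hc)

variable [IsLocallyNoetherian C]

lemma ord_add_toNat_ord {c : C} (hc : Order.coheight c = 1) (φ : C.functionField)
    (a b : C.presheaf.stalk c) (hφ : φ ≠ 0) (hb : b ≠ 0)
    (h : φ * algebraMap _ C.functionField b = algebraMap _ C.functionField a) :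
    Scheme.ord φ c + ((Ring.ord _ b).toNat : ℤ) = (Ring.ord _ a).toNat := by
  have hinj := IsFractionRing.injective (C.presheaf.stalk c) C.functionField
  have : Ring.KrullDimLE 1 (C.presheaf.stalk c) := krullDimLE_of_coheight_le hc.le
  have ha : a ≠ 0 := by
    rintro rfl
    rw [map_zero] at h
    exact (mul_ne_zero hφ ((map_ne_zero_iff _ hinj).2 hb)) h
  have key : ∀ x : C.presheaf.stalk c, x ≠ 0 →
      Scheme.ord (algebraMap _ C.functionField x) c = ((Ring.ord _ x).toNat : ℤ) := by
    intro x hx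
    rw [Scheme.ord_eq_iff hc ((map_ne_zero_iff _ hinj).2 hx)]
    obtain ⟨m, hm⟩ := ENat.ne_top_iff_exists.1
      (Ring.ord_ne_top (mem_nonZeroDivisors_of_ne_zero hx))
    refine (Ring.ordFrac_eq_ord _ hx).trans ?_
    rw [Ring.ordMonoidWithZeroHom_eq_coe _ (mem_nonZeroDivisors_of_ne_zero hx) hm.symm, ← hm]
    rfl
  rw [← key b hb, ← key a ha, ← h, Scheme.ord_mul hφ ((map_ne_zero_iff _ hinj).2 hb)]

end Curve

section ClosedCurve

variable {C Y : Scheme.{u}} [IsIntegral C] (ι : C ⟶ Y) [IsClosedImmersion ι]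

omit [IsIntegral C] in
lemma IsCurvePoint.map_iff {c : C} : IsCurvePoint (ι c) ↔ IsCurvePoint c := by
  have hcl : ∀ x : C, IsClosed ({ι x} : Set Y) ↔ IsClosed ({x} : Set C) := fun x => by
    rw [ι.isClosedEmbedding.isClosed_iff_image_isClosed, Set.image_singleton]
  have hr : ∀ y, ι c ⤳ y → ∃ x, ι x = y := fun y hy =>
    hy.mem_closed ι.isClosedEmbedding.isClosed_range ⟨c, rfl⟩
  constructor
  · rintro ⟨h1, h2⟩
    refine ⟨fun h => h1 ((hcl c).2 h), fun y hy hne => ?_⟩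
    exact (hcl y).1 (h2 _ (hy.map ι.continuous) fun h => hne (ι.isClosedEmbedding.injective h))
  · rintro ⟨h1, h2⟩
    refine ⟨fun h => h1 ((hcl c).1 h), fun y hy hne => ?_⟩
    obtain ⟨x, rfl⟩ := hr y hy
    exact (hcl x).2 (h2 _ (ι.isEmbedding.specializes_iff.1 hy) fun h => hne (h ▸ rfl))

omit [IsClosedImmersion ι] in
-- The stalk map at the generic point of `C` is local with values in a field, so its kernel is the
-- maximal ideal.
lemma residue_eq_zero_iff_stalkMap_genericPoint (u : Y.presheaf.stalk (ι (genericPoint C))) :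
    Y.residue _ u = 0 ↔ (ι.stalkMap (genericPoint C)).hom u = 0 := by
  have h : IsLocalHom (ι.stalkMap (genericPoint C)).hom := inferInstance
  have h1 : Y.residue _ u = 0 ↔ ¬ IsUnit u := by
    rw [← mem_nonunits_iff, ← IsLocalRing.mem_maximalIdeal]
    exact IsLocalRing.residue_eq_zero_iff u
  rw [h1, not_iff_comm, ← isUnit_map_iff (ι.stalkMap (genericPoint C)).hom]
  exact (isUnit_iff_ne_zero (G₀ := C.functionField)).symm

omit [IsClosedImmersion ι] in
lemma stalkMap_stalkSpecializes_genericPoint (c : C) (x : Y.presheaf.stalk (ι c)) :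
    (ι.stalkMap (genericPoint C)).hom (Y.presheaf.stalkSpecializes
      ((genericPoint_specializes c).map ι.continuous) x) =
    algebraMap (C.presheaf.stalk c) C.functionField ((ι.stalkMap c).hom x) :=
  Scheme.Hom.stalkSpecializes_stalkMap_apply ι _ _ (genericPoint_specializes c) x

omit [IsClosedImmersion ι] in
lemma primeAt_eq_ker (c : C) : primeAt ((genericPoint_specializes c).map ι.continuous) =
    RingHom.ker (ι.stalkMap c).hom := by
  ext x
  rw [RingHom.mem_ker,
    ← map_eq_zero_iff _ (IsFractionRing.injective (C.presheaf.stalk c) C.functionField),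
    ← stalkMap_stalkSpecializes_genericPoint, ← residue_eq_zero_iff_stalkMap_genericPoint]
  rfl

/-- The local ring of `C` at `c` is the quotient of that of `Y` by the prime of the generic point,
so the two notions of order are lengths of the same module. -/
lemma ord_add_toNat_ordLen [IsLocallyNoetherian C] {c : C} (hc : Order.coheight c = 1)
    (φ : Y.presheaf.stalk (ι (genericPoint C))) (hφ : (ι.stalkMap (genericPoint C)).hom φ ≠ 0)
    (a b : Y.presheaf.stalk (ι c))
    (hb : evalAt ((genericPoint_specializes c).map ι.continuous) b ≠ 0)
    (h : Y.residue _ φ * evalAt ((genericPoint_specializes c).map ι.continuous) b =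
      evalAt ((genericPoint_specializes c).map ι.continuous) a) :
    Scheme.ord ((ι.stalkMap (genericPoint C)).hom φ) c +
      ((ordLen ((genericPoint_specializes c).map ι.continuous) b).toNat : ℤ) =
      (ordLen ((genericPoint_specializes c).map ι.continuous) a).toNat := by
  have hlen : ∀ x, ordLen ((genericPoint_specializes c).map ι.continuous) x =
      Ring.ord (C.presheaf.stalk c) ((ι.stalkMap c).hom x) := by
    intro x
    rw [← length_quotient_ker_sup _ (ι.stalkMap_surjective c), ← primeAt_eq_ker]
    rfl
  rw [hlen, hlen]
  refine ord_add_toNat_ord hc _ _ _ hφ ?_ ?_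
  · intro h0
    apply hb
    change b ∈ primeAt _
    rwa [primeAt_eq_ker]
  · rw [← stalkMap_stalkSpecializes_genericPoint, ← stalkMap_stalkSpecializes_genericPoint,
      ← map_mul, ← sub_eq_zero, ← map_sub, ← residue_eq_zero_iff_stalkMap_genericPoint]
    rw [map_sub, map_mul, sub_eq_zero]
    exact h

end ClosedCurve

/-- With its converse `IsDivisorAt.isDivisorOnCurve`, this replaces an embedded curve by the image
of its generic point. Points are easier to push forward and to pull back. -/
lemma IsDivisorOnCurve.exists_isDivisorAt {Y : Scheme.{u}} {z : ZeroCycle Y}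
    (h : IsDivisorOnCurve z) : ∃ η f, IsCurvePoint η ∧ IsDivisorAt z η f := by
  obtain ⟨C, ι, _, _, φ, _, hdim, hφ, h1, h2⟩ := h
  rw [topologicalKrullDim_eq_one_iff] at hdim
  obtain ⟨φ, rfl⟩ := ι.stalkMap_surjective (genericPoint C) φ
  refine ⟨ι (genericPoint C), Y.residue _ φ, (IsCurvePoint.map_iff ι).2 hdim, ?_, ?_, ?_⟩
  · exact fun h => hφ ((residue_eq_zero_iff_stalkMap_genericPoint ι φ).1 h)
  · intro y hy h a b hb hab
    obtain ⟨c, rfl⟩ := h.mem_closed ι.isClosedEmbedding.isClosed_range ⟨_, rfl⟩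
    have hc : IsClosed ({c} : Set C) := by
      rwa [ι.isClosedEmbedding.isClosed_iff_image_isClosed, Set.image_singleton]
    rw [h1 c hy]
    exact ord_add_toNat_ordLen ι (hdim.coheight_eq_one hc) φ hφ a b hb hab
  · intro y hy h
    refine h2 ⟨y, hy⟩ ?_
    rintro ⟨c, hc⟩
    exact h ((show ι c = y from hc) ▸ (genericPoint_specializes c).map ι.continuous)

/-- Over affine opens, functions on the scheme-theoretic image inject into functions on the source,
so the image is reduced. -/
lemma isIntegral_image {X Y : Scheme.{u}} [IsIntegral X] (f : X ⟶ Y) [QuasiCompact f] :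
    IsIntegral f.image := by
  have : IrreducibleSpace f.image := by
    rw [irreducibleSpace_def, Set.top_eq_univ, ← f.toImage.denseRange.closure_range,
      ← Set.image_univ]
    exact ((IrreducibleSpace.isIrreducible_univ X).image _
      f.toImage.continuous.continuousOn).closure
  have : ∀ x : f.image, _root_.IsReduced (f.image.presheaf.stalk x) := fun x => by
    obtain ⟨U, hU, hxU, -⟩ := exists_isAffineOpen_mem_and_subset (x := f.imageι x) (U := ⊤) trivial
    have hV : IsAffineOpen (f.imageι ⁻¹ᵁ U) := hU.preimage _
    have : _root_.IsReduced Γ(f.image, f.imageι ⁻¹ᵁ U) :=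
      isReduced_of_injective (f.toImage.app (f.imageι ⁻¹ᵁ U)).hom (f.toImage_app_injective ⟨U, hU⟩)
    let : Algebra Γ(f.image, f.imageι ⁻¹ᵁ U) (f.image.presheaf.stalk x) :=
      (f.image.presheaf.germ _ x hxU).hom.toAlgebra
    have h : IsLocalization.AtPrime (f.image.presheaf.stalk x)
      (hV.primeIdealOf ⟨x, hxU⟩).asIdeal := hV.isLocalization_stalk ⟨x, hxU⟩
    exact isReduced_localizationPreserves (hV.primeIdealOf ⟨x, hxU⟩).asIdeal.primeCompl _ ‹_›
  have : IsReduced f.image := isReduced_of_isReduced_stalk f.image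
  exact isIntegral_of_irreducibleSpace_of_isReduced _

/-- The curve is the scheme-theoretic image of the spectrum of the residue field of `η`, that is,
the reduced closure of `η`. -/
lemma IsDivisorAt.isDivisorOnCurve {Y : Scheme.{u}} [IsLocallyNoetherian Y] {z : ZeroCycle Y}
    {η : Y} {f : Y.residueField η} (hη : IsCurvePoint η) (hz : IsDivisorAt z η f) :
    IsDivisorOnCurve z := by
  obtain ⟨C, ι, _, _, rfl⟩ : ∃ (C : Scheme.{u}) (ι : C ⟶ Y) (_ : IsIntegral C)
      (_ : IsClosedImmersion ι), ι (genericPoint C) = η := by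
    let g := Y.fromSpecResidueField η
    have := isIntegral_image g
    refine ⟨g.image, g.imageι, this, inferInstance, ?_⟩
    let t : Spec (Y.residueField η) := default
    have h1 : genericPoint g.image = g.toImage t := by
      refine (genericPoint_spec _).eq ?_
      rw [isGenericPoint_def, ← g.toImage.denseRange.closure_range]
      congr 1
      ext y
      constructor
      · rintro rfl; exact ⟨_, rfl⟩
      · rintro ⟨t, rfl⟩; exact congrArg _ (Subsingleton.elim _ _)
    rw [h1, ← Scheme.Hom.comp_apply, Scheme.Hom.toImage_imageι]
    exact Scheme.fromSpecResidueField_apply _ _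
  have : IsLocallyNoetherian C := LocallyOfFiniteType.isLocallyNoetherian ι
  obtain ⟨φ, rfl⟩ := Y.residue_surjective _ f
  have hη' := (IsCurvePoint.map_iff ι).1 hη
  have hφ : (ι.stalkMap (genericPoint C)).hom φ ≠ 0 := fun h =>
    hz.ne_zero ((residue_eq_zero_iff_stalkMap_genericPoint ι φ).2 h)
  refine ⟨C, ι, inferInstance, inferInstance, (ι.stalkMap (genericPoint C)).hom φ, inferInstance,
    topologicalKrullDim_eq_one_iff.2 hη', hφ, fun c hc => ?_, fun x hx => ?_⟩
  · have hc' : IsClosed ({c} : Set C) := by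
      rwa [ι.isClosedEmbedding.isClosed_iff_image_isClosed, Set.image_singleton]
    obtain ⟨a, b, hb, hab⟩ := exists_evalAt_mul_eq
      ((genericPoint_specializes c).map ι.continuous) (Y.residue _ φ)
    have h1 := ord_add_toNat_ordLen ι (hη'.coheight_eq_one hc') φ hφ a b hb hab
    have h2 := hz.add_eq (ι c) hc ((genericPoint_specializes c).map ι.continuous) a b hb hab
    linarith
  · exact hz.eq_zero x.1 x.2 fun h =>
      hx (h.mem_closed ι.isClosedEmbedding.isClosed_range ⟨_, rfl⟩)

/-! ### Semilocal rings of finite morphisms -/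

section

open Module IsLocalRing

lemma isLocalization_quotient_atPrime {R S : Type*} [CommRing R] [CommRing S] [Algebra R S]
    (p I : Ideal R) [p.IsPrime] [IsLocalization.AtPrime S p] (q : Ideal (R ⧸ I)) [q.IsPrime]
    (hq : q.comap (Ideal.Quotient.mk I) = p) :
    IsLocalization.AtPrime (S ⧸ I.map (algebraMap R S)) q := by
  have h : Algebra.algebraMapSubmonoid (R ⧸ I) p.primeCompl = q.primeCompl := by
    ext x
    obtain ⟨x, rfl⟩ := Ideal.Quotient.mk_surjective x
    subst hq
    constructor
    · rintro ⟨y, hy, hyx⟩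
      exact hyx ▸ hy
    · intro hx
      exact ⟨x, hx, rfl⟩
  rw [IsLocalization.AtPrime, ← h]
  infer_instance

/-- The length of a quotient of a finite algebra over a local ring as a sum of local
contributions. -/
theorem length_quotient_eq_sum_localization {A R : Type*} [CommRing A] [IsLocalRing A] [CommRing R]
    [Algebra A R] (I : Ideal R) [IsArtinianRing (R ⧸ I)] {ι : Type*} [Fintype ι] (m : ι → Ideal R)
    [∀ i, (m i).IsMaximal] (hm : ∀ p : Ideal R, p.IsMaximal → I ≤ p → ∃ i, p = m i)
    (hinj : Function.Injective m)
    (S : ι → Type*) [∀ i, CommRing (S i)] [∀ i, Algebra R (S i)] [∀ i, Algebra A (S i)]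
    [∀ i, IsScalarTower A R (S i)] [∀ i, IsLocalization.AtPrime (S i) (m i)]
    [∀ i, IsLocalRing (S i)] [∀ i, IsLocalHom (algebraMap A (S i))] :
    length A (R ⧸ I) = ∑ i, length (S i) (S i ⧸ I.map (algebraMap R (S i))) *
      length (ResidueField A) (ResidueField (S i)) := by
  have : Fintype (MaximalSpectrum (R ⧸ I)) := Fintype.ofFinite _
  have hmax : ∀ p : MaximalSpectrum (R ⧸ I), (p.asIdeal.comap (Ideal.Quotient.mk I)).IsMaximal :=
    fun p => Ideal.comap_isMaximal_of_surjective _ Ideal.Quotient.mk_surjective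
  have hle : ∀ p : MaximalSpectrum (R ⧸ I), I ≤ p.asIdeal.comap (Ideal.Quotient.mk I) :=
    fun p x hx => by
      rw [Ideal.mem_comap, Ideal.Quotient.eq_zero_iff_mem.2 hx]
      exact p.asIdeal.zero_mem
  choose e he using fun p => hm _ (hmax p) (hle p)
  have hsum : ∀ i, length (S i) (S i ⧸ I.map (algebraMap R (S i))) *
      length (ResidueField A) (ResidueField (S i)) = length A (S i ⧸ I.map (algebraMap R (S i))) :=
    fun i => (IsLocalRing.length_restrictScalars A (S i) _).symm
  simp_rw [hsum]
  rw [length_eq_sum_localization A (R ⧸ I)]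
  refine Fintype.sum_of_injective e ?_ _ _ ?_ ?_
  · intro p q hpq
    have : p.asIdeal.comap (Ideal.Quotient.mk I) = q.asIdeal.comap (Ideal.Quotient.mk I) := by
      rw [he, he, hpq]
    exact MaximalSpectrum.ext (Ideal.comap_injective_of_surjective _
      Ideal.Quotient.mk_surjective this)
  -- If `m i` does not contain `I`, then `I` generates the unit ideal in `S i` and the term is zero.
  · intro i hi
    have hI : ¬ I ≤ m i := by
      intro hI
      have h1 : ((m i).map (Ideal.Quotient.mk I)).IsMaximal :=
        Ideal.IsMaximal.map_of_surjective_of_ker_le Ideal.Quotient.mk_surjective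
          (by rwa [Ideal.mk_ker])
      refine hi ⟨⟨_, h1⟩, hinj ?_⟩
      rw [← he, Ideal.comap_map_of_surjective _ Ideal.Quotient.mk_surjective, sup_eq_left]
      exact fun x hx => hI (Ideal.Quotient.eq_zero_iff_mem.1 hx)
    obtain ⟨x, hxI, hx⟩ := SetLike.not_le_iff_exists.1 hI
    have h1 : I.map (algebraMap R (S i)) = ⊤ :=
      Ideal.eq_top_of_isUnit_mem _ (Ideal.mem_map_of_mem _ hxI)
        (IsLocalization.map_units (S i) (⟨x, hx⟩ : (m i).primeCompl))
    have : Subsingleton (S i ⧸ I.map (algebraMap R (S i))) := Ideal.Quotient.subsingleton_iff.2 h1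
    exact length_eq_zero
  · intro p
    have h1 := isLocalization_quotient_atPrime (S := S (e p)) (m (e p)) I p.asIdeal (he p)
    have h2 : IsScalarTower A (R ⧸ I) (S (e p) ⧸ I.map (algebraMap R (S (e p)))) :=
      IsScalarTower.of_algebraMap_eq fun x => by
        refine (congrArg (Ideal.Quotient.mk (I.map (algebraMap R (S (e p)))))
          (IsScalarTower.algebraMap_apply A R (S (e p)) x)).trans ?_
        rfl
    exact (((IsLocalization.algEquiv p.asIdeal.primeCompl (Localization.AtPrime p.asIdeal)
      (S (e p) ⧸ I.map (algebraMap R (S (e p))))).restrictScalars A).toLinearEquiv).length_eq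

end

lemma flat_fromSpecStalk (Y : Scheme.{u}) (y : Y) : Flat (Y.fromSpecStalk y) := by
  obtain ⟨U, hU, hyU, -⟩ := exists_isAffineOpen_mem_and_subset (x := y) (U := ⊤) trivial
  rw [← hU.fromSpecStalk_eq_fromSpecStalk hyU, IsAffineOpen.fromSpecStalk]
  have : Flat (Spec.map (Y.presheaf.germ U y hyU)) := by
    rw [Flat.SpecMap_iff]
    let : Algebra Γ(Y, U) (Y.presheaf.stalk y) := (Y.presheaf.germ U y hyU).hom.toAlgebra
    have : IsLocalization.AtPrime (Y.presheaf.stalk y) (hU.primeIdealOf ⟨y, hyU⟩).asIdeal :=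
      hU.isLocalization_stalk ⟨y, hyU⟩
    exact IsLocalization.flat (Y.presheaf.stalk y) (hU.primeIdealOf ⟨y, hyU⟩).asIdeal.primeCompl
  infer_instance

section Localize

variable {Y' Y : Scheme.{u}} {g : Y' ⟶ Y} {y : Y} {R : CommRingCat.{u}}
  {φ : Y.presheaf.stalk y ⟶ R} {j : Spec R ⟶ Y'}

/-- The map `𝒪_{Y,y} → 𝒪_{Y',y'}` for a point `y'` that maps to a generization of `y`. -/
noncomputable abbrev stalkMapOfSpecializes (g : Y' ⟶ Y) {y' : Y'} (h : g y' ⤳ y) :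
    Y.presheaf.stalk y ⟶ Y'.presheaf.stalk y' :=
  Y.presheaf.stalkSpecializes h ≫ g.stalkMap y'

lemma SpecMap_stalkMapOfSpecializes_fromSpecStalk {y' : Y'} (h : g y' ⤳ y) :
    Spec.map (stalkMapOfSpecializes g h) ≫ Y.fromSpecStalk y = Y'.fromSpecStalk y' ≫ g := by
  rw [Spec.map_comp, Category.assoc, Scheme.SpecMap_stalkSpecializes_fromSpecStalk,
    Scheme.SpecMap_stalkMap_fromSpecStalk]

variable (H : IsPullback j (Spec.map φ) g (Y.fromSpecStalk y))

include H

/-- The map `R → 𝒪_{Y',y'}`, where `Spec R` is the pullback of `Spec 𝒪_{Y,y}` to `Y'`. -/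
noncomputable def toStalkOfPullback {y' : Y'} (h : g y' ⤳ y) : R ⟶ Y'.presheaf.stalk y' :=
  Spec.preimage (H.lift (Y'.fromSpecStalk y') (Spec.map (stalkMapOfSpecializes g h))
    (SpecMap_stalkMapOfSpecializes_fromSpecStalk h).symm)

lemma SpecMap_toStalkOfPullback {y' : Y'} (h : g y' ⤳ y) :
    Spec.map (toStalkOfPullback H h) ≫ j = Y'.fromSpecStalk y' := by
  rw [toStalkOfPullback, Spec.map_preimage, H.lift_fst]

lemma comp_toStalkOfPullback {y' : Y'} (h : g y' ⤳ y) :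
    φ ≫ toStalkOfPullback H h = stalkMapOfSpecializes g h := by
  apply Spec.map_injective
  rw [Spec.map_comp, toStalkOfPullback, Spec.map_preimage, H.lift_snd]

lemma isPreimmersion_of_isPullback : IsPreimmersion j :=
  MorphismProperty.of_isPullback H.flip inferInstance

lemma flat_of_isPullback : Flat j :=
  MorphismProperty.of_isPullback H.flip (flat_fromSpecStalk Y y)

lemma mem_range_of_isPullback (y' : Y') : y' ∈ Set.range j ↔ g y' ⤳ y := by
  constructor
  · rintro ⟨Q, rfl⟩
    rw [← Scheme.Hom.comp_apply, H.w, Scheme.Hom.comp_apply]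
    exact fromSpecStalk_specializes _
  · intro h
    refine ⟨Spec.map (toStalkOfPullback H h) (IsLocalRing.closedPoint _), ?_⟩
    have := SpecMap_toStalkOfPullback H h
    exact (Scheme.Hom.comp_apply _ _ _).symm.trans
      ((congrArg (fun f => f (IsLocalRing.closedPoint _)) this).trans
        Scheme.fromSpecStalk_closedPoint)

/-- Surjectivity holds for preimmersions. Injectivity holds because a flat local homomorphism is
faithfully flat. -/
lemma bijective_stalkMap_of_isPullback (Q : Spec R) : Function.Bijective (j.stalkMap Q) := by
  have := isPreimmersion_of_isPullback H
  have := flat_of_isPullback H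
  refine ⟨?_, j.stalkMap_surjective Q⟩
  have h1 := Flat.stalkMap j Q
  let := (j.stalkMap Q).hom.toAlgebra
  have h2 : Module.Flat (Y'.presheaf.stalk (j Q)) ((Spec R).presheaf.stalk Q) := h1
  have h3 : IsLocalHom (algebraMap (Y'.presheaf.stalk (j Q)) ((Spec R).presheaf.stalk Q)) :=
    inferInstanceAs (IsLocalHom (j.stalkMap Q).hom)
  have h4 := Module.FaithfullyFlat.of_flat_of_isLocalHom
    (A := Y'.presheaf.stalk (j Q)) (B := (Spec R).presheaf.stalk Q)
  exact FaithfulSMul.algebraMap_injective (Y'.presheaf.stalk (j Q)) ((Spec R).presheaf.stalk Q)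

/-- The prime ideal of `R` at a point of `Y'`. -/
noncomputable def primeOfPullback {y' : Y'} (h : g y' ⤳ y) : Ideal R :=
  (IsLocalRing.maximalIdeal (Y'.presheaf.stalk y')).comap (toStalkOfPullback H h).hom

instance {y' : Y'} (h : g y' ⤳ y) : (primeOfPullback H h).IsPrime := Ideal.comap_isPrime _ _

lemma apply_primeOfPullback {y' : Y'} (h : g y' ⤳ y) :
    j ⟨primeOfPullback H h, inferInstance⟩ = y' := by
  have := SpecMap_toStalkOfPullback H h
  exact (Scheme.Hom.comp_apply _ _ _).symm.trans
      ((congrArg (fun f => f (IsLocalRing.closedPoint _)) this).trans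
        Scheme.fromSpecStalk_closedPoint)

/-- The map `j` identifies the stalks of `Y'` with those of `Spec R`. For `g` finite, `R` is thus
one ring, finite over `𝒪_{Y,y}`, that sees all points over `y` at once. -/
lemma isLocalization_toStalkOfPullback {y' : Y'} (h : g y' ⤳ y) :
    letI := (toStalkOfPullback H h).hom.toAlgebra
    IsLocalization.AtPrime (Y'.presheaf.stalk y') (primeOfPullback H h) := by
  have hj := isPreimmersion_of_isPullback H
  obtain ⟨Q, rfl⟩ := (mem_range_of_isPullback H y').2 h
  have hQ : (⟨primeOfPullback H h, inferInstance⟩ : PrimeSpectrum R) = Q :=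
    j.isEmbedding.injective (apply_primeOfPullback H h)
  have : Q.asIdeal.IsPrime := Q.isPrime
  have hP : (primeOfPullback H h).primeCompl = Q.asIdeal.primeCompl :=
    congrArg (fun P : PrimeSpectrum R => P.asIdeal.primeCompl) hQ
  let e : Y'.presheaf.stalk (j Q) ≃+* (Spec R).presheaf.stalk Q :=
    RingEquiv.ofBijective (j.stalkMap Q).hom (bijective_stalkMap_of_isPullback H Q)
  have he : toStalkOfPullback H h ≫ j.stalkMap Q = StructureSheaf.toStalk R Q := by
    apply Spec.map_injective
    rw [← cancel_mono j, Spec.map_comp, Category.assoc, SpecMap_toStalkOfPullback,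
      Scheme.SpecMap_stalkMap_fromSpecStalk]
    exact congrArg (· ≫ j) (Spec.fromSpecStalk_eq' (R := R) Q)
  let := (toStalkOfPullback H h).hom.toAlgebra
  let : Algebra R ((Spec R).presheaf.stalk Q) := (StructureSheaf.toStalk R Q).hom.toAlgebra
  let e' : Y'.presheaf.stalk (j Q) ≃ₐ[R] (Spec R).presheaf.stalk Q :=
    { e with commutes' := fun r => congrArg (fun f => f.hom r) he }
  have : IsLocalization.AtPrime ((Spec R).presheaf.stalk Q) Q.asIdeal :=
    StructureSheaf.IsLocalization.to_stalk R Q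
  rw [IsLocalization.AtPrime, hP]
  exact IsLocalization.isLocalization_of_algEquiv Q.asIdeal.primeCompl e'.symm

lemma toStalkOfPullback_stalkSpecializes {y₁ y₂ : Y'} (h₁ : g y₁ ⤳ y) (h₂ : g y₂ ⤳ y)
    (h : y₁ ⤳ y₂) : toStalkOfPullback H h₂ ≫ Y'.presheaf.stalkSpecializes h =
      toStalkOfPullback H h₁ := by
  have := isPreimmersion_of_isPullback H
  apply Spec.map_injective
  rw [← cancel_mono j, Spec.map_comp, Category.assoc, SpecMap_toStalkOfPullback,
    SpecMap_toStalkOfPullback, Scheme.SpecMap_stalkSpecializes_fromSpecStalk]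

omit H in
lemma exists_isPullback_fromSpecStalk (g : Y' ⟶ Y) [IsAffineHom g] (y : Y) :
    ∃ (R : CommRingCat.{u}) (φ : Y.presheaf.stalk y ⟶ R) (j : Spec R ⟶ Y'),
      IsPullback j (Spec.map φ) g (Y.fromSpecStalk y) := by
  have : IsAffine (pullback g (Y.fromSpecStalk y)) :=
    isAffine_of_isAffineHom (pullback.snd g (Y.fromSpecStalk y))
  let e := (pullback g (Y.fromSpecStalk y)).isoSpec
  refine ⟨_, Spec.preimage (e.inv ≫ pullback.snd g (Y.fromSpecStalk y)), e.inv ≫ pullback.fst _ _,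
    ?_⟩
  rw [Spec.map_preimage]
  exact IsPullback.of_iso (IsPullback.of_hasPullback g (Y.fromSpecStalk y)) e (Iso.refl _)
    (Iso.refl _) (Iso.refl _) (by simp) (by simp) (by simp) (by simp)

lemma finite_of_isPullback [IsFinite g] : φ.hom.Finite := by
  rw [← IsFinite.SpecMap_iff]
  exact MorphismProperty.of_isPullback H inferInstance

lemma isMaximal_primeOfPullback [IsFinite g] {y' : Y'} (h : g y' = y) :
    (primeOfPullback H (specializes_of_eq h)).IsMaximal := by
  have hφ : φ.hom.IsIntegral := (finite_of_isPullback H).to_isIntegral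
  refine Ideal.isMaximal_of_isIntegral_of_isMaximal_comap' φ.hom hφ _ ?_
  rw [primeOfPullback, Ideal.comap_comap, ← CommRingCat.hom_comp, comp_toStalkOfPullback]
  subst h
  rw [stalkMapOfSpecializes, TopCat.Presheaf.stalkSpecializes_refl, Category.id_comp,
    IsLocalRing.maximalIdeal_comap]
  infer_instance

lemma surjective_toStalkOfPullback_residue [IsFinite g] {y' : Y'} (h : g y' = y) :
    Function.Surjective
      (toStalkOfPullback H (specializes_of_eq h) ≫ Y'.residue y').hom := by
  let := (toStalkOfPullback H (specializes_of_eq h)).hom.toAlgebra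
  have := isLocalization_toStalkOfPullback H (specializes_of_eq h)
  have := isMaximal_primeOfPullback H h
  intro x
  obtain ⟨r, hr⟩ := (IsLocalization.AtPrime.equivQuotMaximalIdeal
    (primeOfPullback H (specializes_of_eq h)) (Y'.presheaf.stalk y')).surjective x
  obtain ⟨r, rfl⟩ := Ideal.Quotient.mk_surjective r
  exact ⟨r, hr⟩

omit H in
-- The residue field of `y'` is a quotient of `R`, which is finite over `𝒪_{Y,y}`.
lemma finite_residueFieldMap (g : Y' ⟶ Y) [IsFinite g] (y' : Y') :
    (g.residueFieldMap y').hom.Finite := by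
  obtain ⟨R, φ, j, H⟩ := exists_isPullback_fromSpecStalk g (g y')
  have h1 : Y.residue (g y') ≫ g.residueFieldMap y' =
      φ ≫ (toStalkOfPullback H (specializes_of_eq rfl) ≫ Y'.residue y') := by
    rw [Scheme.residue_residueFieldMap, ← Category.assoc, comp_toStalkOfPullback,
      stalkMapOfSpecializes, TopCat.Presheaf.stalkSpecializes_refl, Category.id_comp]
  have h2 : (Y.residue (g y') ≫ g.residueFieldMap y').hom.Finite := by
    rw [h1]
    exact RingHom.Finite.comp (RingHom.Finite.of_surjective _
      (surjective_toStalkOfPullback_residue H rfl)) (finite_of_isPullback H)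
  rw [CommRingCat.hom_comp] at h2
  exact RingHom.Finite.of_comp_finite h2

/-- The residue degree as a length. -/
lemma length_residueField_eq [IsFinite g] {y' : Y'} (h : g y' = y)
    [alg : Algebra (Y.presheaf.stalk y) (Y'.presheaf.stalk y')]
    (halg : algebraMap (Y.presheaf.stalk y) (Y'.presheaf.stalk y') =
      (stalkMapOfSpecializes g (specializes_of_eq h)).hom)
    [IsLocalHom (algebraMap (Y.presheaf.stalk y) (Y'.presheaf.stalk y'))] :
    Module.length (IsLocalRing.ResidueField (Y.presheaf.stalk y))
      (IsLocalRing.ResidueField (Y'.presheaf.stalk y')) = g.residueDegree y' := by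
  let := φ.hom.toAlgebra
  let := (toStalkOfPullback H (specializes_of_eq h)).hom.toAlgebra
  have : IsScalarTower (Y.presheaf.stalk y) R (Y'.presheaf.stalk y') :=
    IsScalarTower.of_algebraMap_eq' (halg.trans
      (congrArg CommRingCat.Hom.hom (comp_toStalkOfPullback H _)).symm)
  have : Module.Finite (Y.presheaf.stalk y) R := finite_of_isPullback H
  have hfin : Module.Finite (IsLocalRing.ResidueField (Y.presheaf.stalk y))
      (IsLocalRing.ResidueField (Y'.presheaf.stalk y')) := by
    let π : R →ₗ[Y.presheaf.stalk y] IsLocalRing.ResidueField (Y'.presheaf.stalk y') :=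
      (IsScalarTower.toAlgHom (Y.presheaf.stalk y) R _).toLinearMap
    have hπ : Function.Surjective π := surjective_toStalkOfPullback_residue H h
    have := Module.Finite.of_surjective π hπ
    exact Module.Finite.of_restrictScalars_finite (Y.presheaf.stalk y) _ _
  rw [Module.length_eq_finrank]
  subst h
  have e : (inferInstance : Algebra (IsLocalRing.ResidueField (Y.presheaf.stalk (g y')))
      (IsLocalRing.ResidueField (Y'.presheaf.stalk y'))) =
      (g.residueFieldMap y').hom.toAlgebra := by
    refine Algebra.algebra_ext _ _ fun r => ?_
    obtain ⟨r, rfl⟩ := IsLocalRing.residue_surjective r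
    rw [IsLocalRing.ResidueField.algebraMap_residue, halg, stalkMapOfSpecializes,
      TopCat.Presheaf.stalkSpecializes_refl, Category.id_comp]
    exact (congrArg (fun f => (CommRingCat.Hom.hom f) r) (Scheme.residue_residueFieldMap g y')).symm
  rw [Scheme.Hom.residueDegree]
  exact congrArg (fun a : Algebra (IsLocalRing.ResidueField (Y.presheaf.stalk (g y')))
    (IsLocalRing.ResidueField (Y'.presheaf.stalk y')) => ((@Module.finrank _ _ _ _ a.toModule : ℕ) : ℕ∞)) e

/-- Lengths over `𝒪_{Y,y}` of quotients of the pullback of a finite morphism to `Spec 𝒪_{Y,y}`. -/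
theorem length_quotient_eq_sum_stalk [IsFinite g] (I : Ideal R) [IsArtinianRing (R ⧸ I)]
    [Fintype {y' // g y' = y}] :
    letI := φ.hom.toAlgebra
    Module.length (Y.presheaf.stalk y) (R ⧸ I) = ∑ y' : {y' // g y' = y},
      Module.length (Y'.presheaf.stalk y'.1) (Y'.presheaf.stalk y'.1 ⧸
        I.map (toStalkOfPullback H (specializes_of_eq y'.2)).hom) * g.residueDegree y'.1 := by
  let := φ.hom.toAlgebra
  let a₁ (y' : {y' // g y' = y}) : Algebra R (Y'.presheaf.stalk y'.1) :=
    (toStalkOfPullback H (specializes_of_eq y'.2)).hom.toAlgebra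
  let a₂ (y' : {y' // g y' = y}) : Algebra (Y.presheaf.stalk y) (Y'.presheaf.stalk y'.1) :=
    (stalkMapOfSpecializes g (specializes_of_eq y'.2)).hom.toAlgebra
  have a₃ (y' : {y' // g y' = y}) :
      IsScalarTower (Y.presheaf.stalk y) R (Y'.presheaf.stalk y'.1) :=
    IsScalarTower.of_algebraMap_eq'
      (congrArg CommRingCat.Hom.hom (comp_toStalkOfPullback H (specializes_of_eq y'.2))).symm
  have : Module.Finite (Y.presheaf.stalk y) R := finite_of_isPullback H
  have hj := isPreimmersion_of_isPullback H
  have a₄ (y' : {y' // g y' = y}) :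
      IsLocalHom (algebraMap (Y.presheaf.stalk y) (Y'.presheaf.stalk y'.1)) := by
    obtain ⟨y', rfl⟩ := y'
    rw [RingHom.algebraMap_toAlgebra, stalkMapOfSpecializes,
      TopCat.Presheaf.stalkSpecializes_refl, Category.id_comp]
    infer_instance
  have a₅ (y' : {y' // g y' = y}) := isMaximal_primeOfPullback H y'.2
  have a₆ (y' : {y' // g y' = y}) := isLocalization_toStalkOfPullback H (specializes_of_eq y'.2)
  rw [length_quotient_eq_sum_localization (A := Y.presheaf.stalk y) I
    (fun y' : {y' // g y' = y} => primeOfPullback H (specializes_of_eq y'.2)) ?_ ?_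
    (fun y' => Y'.presheaf.stalk y'.1)]
  · refine Finset.sum_congr rfl fun y' _ => ?_
    rw [length_residueField_eq H y'.2 rfl]
    rfl
  · intro p hp _
    have h1 : (p.comap φ.hom).IsMaximal := Ideal.isMaximal_comap_of_isIntegral_of_isMaximal p
    let Q : ↥(Spec R) := (⟨p, hp.isPrime⟩ : PrimeSpectrum R)
    have h2 : g (j Q) = y := by
      have h3 : Spec.map φ Q = IsLocalRing.closedPoint _ :=
        PrimeSpectrum.ext (IsLocalRing.eq_maximalIdeal h1)
      rw [← Scheme.Hom.comp_apply, H.w, Scheme.Hom.comp_apply, h3,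
        Scheme.fromSpecStalk_closedPoint]
    refine ⟨⟨j Q, h2⟩, ?_⟩
    exact congrArg PrimeSpectrum.asIdeal (j.isEmbedding.injective
      (apply_primeOfPullback H (specializes_of_eq h2))).symm
  · intro y₁ y₂ h12
    apply Subtype.ext
    rw [← apply_primeOfPullback H (specializes_of_eq y₁.2),
      ← apply_primeOfPullback H (specializes_of_eq y₂.2)]
    exact congrArg j (PrimeSpectrum.ext h12)

end Localize

section

open Module

lemma length_quotient_ker_sup_of_surjective {A₀ A R B : Type*} [CommRing A₀] [CommRing A]
    [CommRing R] [CommRing B] [Algebra A₀ A] [Algebra A₀ R] [Algebra A₀ B] [Algebra R B]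
    [Algebra A B] [IsScalarTower A₀ A B] [IsScalarTower A₀ R B]
    (hA : Function.Surjective (algebraMap A₀ A)) (hB : Function.Surjective (algebraMap R B)) (r : R) :
    length A₀ (R ⧸ (RingHom.ker (algebraMap R B) ⊔ Ideal.span {r})) =
      length A (B ⧸ Ideal.span {algebraMap R B r}) := by
  have h1 : RingHom.ker (algebraMap R B) ⊔ Ideal.span {r} =
      (Ideal.span {algebraMap R B r}).comap (algebraMap R B) := by
    rw [← Set.image_singleton, ← Ideal.map_span, Ideal.comap_map_of_surjective _ hB, sup_comm]
    rfl
  let g : R →ₗ[A₀] (B ⧸ Ideal.span {algebraMap R B r}) :=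
    ((Ideal.Quotient.mkₐ A₀ (Ideal.span {algebraMap R B r})).comp
      (IsScalarTower.toAlgHom A₀ R B)).toLinearMap
  have hg : Function.Surjective g := Ideal.Quotient.mk_surjective.comp hB
  have h2 : (RingHom.ker (algebraMap R B) ⊔ Ideal.span {r}).restrictScalars A₀ =
      LinearMap.ker g := by
    rw [h1]
    ext x
    rw [LinearMap.mem_ker]
    exact (Ideal.Quotient.eq_zero_iff_mem (I := Ideal.span {algebraMap R B r})).symm
  rw [← (Submodule.Quotient.restrictScalarsEquiv A₀ _).length_eq, h2,
    (g.quotKerEquivOfSurjective hg).length_eq,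
    Module.length_eq_of_surjective (S := A₀) (R := A) hA]

open IntermediateField in
-- This is `length_quotient_norm` for the images of `A₀` in `K` and of `R` in `L`, stated with
-- quotients of `A₀` and `R`. For a finite morphism these images are the local ring of a curve and
-- the semilocal ring of a curve above it. The fraction `r / s` for `f` has its denominator in the
-- base ring, so it serves all points over the base point.
theorem exists_length_add_eq_of_norm {A₀ R K L : Type*} [CommRing A₀] [IsNoetherianRing A₀]
    [CommRing R] [Algebra A₀ R] [Module.Finite A₀ R] [Field K] [Field L] [Algebra A₀ K]
    [Algebra R L] [Algebra K L] [Algebra A₀ L] [IsScalarTower A₀ K L] [IsScalarTower A₀ R L]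
    [FiniteDimensional K L]
    (hK : ∀ x : K, ∃ a b : A₀, algebraMap A₀ K b ≠ 0 ∧ x * algebraMap A₀ K b = algebraMap A₀ K a)
    (hL : ∀ x : L, ∃ r s : R, algebraMap R L s ≠ 0 ∧ x * algebraMap R L s = algebraMap R L r)
    (dim : ∀ Q : Ideal A₀, Q.IsPrime → RingHom.ker (algebraMap A₀ K) ≤ Q →
      Q = RingHom.ker (algebraMap A₀ K) ∨ Q.IsMaximal)
    (f : L) (hf : f ≠ 0) :
    ∃ (r : R) (s : A₀), algebraMap A₀ K s ≠ 0 ∧ algebraMap R L r = f * algebraMap A₀ L s ∧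
      length A₀ (R ⧸ (RingHom.ker (algebraMap R L) ⊔ Ideal.span {r})) ≠ ⊤ ∧
      length A₀ (R ⧸ (RingHom.ker (algebraMap R L) ⊔ Ideal.span {algebraMap A₀ R s})) ≠ ⊤ ∧
      ∀ a b : A₀, algebraMap A₀ K b ≠ 0 →
        (minpoly K f).coeff 0 ^ finrank K⟮f⟯ L * algebraMap A₀ K b = algebraMap A₀ K a →
      length A₀ (R ⧸ (RingHom.ker (algebraMap R L) ⊔ Ideal.span {r})) +
        length A₀ (A₀ ⧸ (RingHom.ker (algebraMap A₀ K) ⊔ Ideal.span {b})) =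
      length A₀ (R ⧸ (RingHom.ker (algebraMap R L) ⊔ Ideal.span {algebraMap A₀ R s})) +
        length A₀ (A₀ ⧸ (RingHom.ker (algebraMap A₀ K) ⊔ Ideal.span {a})) := by
  let A := A₀ ⧸ RingHom.ker (algebraMap A₀ K)
  let B := R ⧸ RingHom.ker (algebraMap R L)
  have hle : RingHom.ker (algebraMap A₀ K) ≤
      (RingHom.ker (algebraMap R L)).comap (algebraMap A₀ R) := by
    intro x hx
    rw [Ideal.mem_comap, RingHom.mem_ker, ← IsScalarTower.algebraMap_apply A₀ R L,
      IsScalarTower.algebraMap_apply A₀ K L, (RingHom.mem_ker).1 hx, map_zero]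
  let : Algebra A B := (Ideal.quotientMap _ (algebraMap A₀ R) hle).toAlgebra
  let : Algebra A K := (RingHom.kerLift (algebraMap A₀ K)).toAlgebra
  let : Algebra B L := (RingHom.kerLift (algebraMap R L)).toAlgebra
  let : Algebra A L := ((algebraMap K L).comp (algebraMap A K)).toAlgebra
  have : IsScalarTower A K L := IsScalarTower.of_algebraMap_eq' rfl
  have : IsScalarTower A B L := IsScalarTower.of_algebraMap_eq fun x => by
    obtain ⟨x, rfl⟩ := Ideal.Quotient.mk_surjective x
    change algebraMap K L (algebraMap A₀ K x) = algebraMap R L (algebraMap A₀ R x)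
    rw [← IsScalarTower.algebraMap_apply, ← IsScalarTower.algebraMap_apply]
  have : IsScalarTower A₀ A B := IsScalarTower.of_algebraMap_eq fun x => rfl
  have : IsScalarTower A₀ A K := IsScalarTower.of_algebraMap_eq fun x => rfl
  have : IsScalarTower R B L := IsScalarTower.of_algebraMap_eq fun x => rfl
  have : Module.Finite A₀ B := Module.Finite.of_surjective
    (Ideal.Quotient.mkₐ A₀ (RingHom.ker (algebraMap R L))).toLinearMap Ideal.Quotient.mk_surjective
  have : Module.Finite A B := Module.Finite.of_restrictScalars_finite A₀ A B
  have : (RingHom.ker (algebraMap A₀ K)).IsPrime := RingHom.ker_isPrime _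
  have : (RingHom.ker (algebraMap R L)).IsPrime := RingHom.ker_isPrime _
  have hAK : Function.Injective (algebraMap A K) := RingHom.kerLift_injective _
  have hBL : Function.Injective (algebraMap B L) := RingHom.kerLift_injective _
  have : FaithfulSMul A K := (faithfulSMul_iff_algebraMap_injective A K).2 hAK
  have : IsFractionRing A K := IsFractionRing.of_field A K fun x => by
    obtain ⟨a, b, hb, hab⟩ := hK x
    exact ⟨Ideal.Quotient.mk _ a, Ideal.Quotient.mk _ b, (eq_div_iff hb).2 hab⟩
  have : Ring.KrullDimLE 1 A := by
    rw [Ring.krullDimLE_one_iff_of_noZeroDivisors]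
    intro Q hQ hQp
    have h1 : (Q.comap (algebraMap A₀ A)).IsPrime := Ideal.comap_isPrime _ _
    have h2 : RingHom.ker (algebraMap A₀ K) ≤ Q.comap (algebraMap A₀ A) := fun x hx => by
      rw [Ideal.mem_comap, show algebraMap A₀ A x = 0 from Ideal.Quotient.eq_zero_iff_mem.2 hx]
      exact Q.zero_mem
    have h3 := Ideal.map_comap_of_surjective (algebraMap A₀ A) Ideal.Quotient.mk_surjective Q
    rcases dim _ h1 h2 with h | h
    · exfalso
      apply hQ
      rw [← h3, h, Ideal.map_eq_bot_iff_le_ker]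
      exact Ideal.mk_ker.ge
    · rw [← h3]
      refine Ideal.IsMaximal.map_of_surjective_of_ker_le Ideal.Quotient.mk_surjective ?_
      exact Ideal.mk_ker.le.trans h2
  have hAB : Function.Injective (algebraMap A B) := by
    have h1 : Function.Injective (algebraMap A L) := (algebraMap K L).injective.comp hAK
    rw [IsScalarTower.algebraMap_eq A B L] at h1
    exact Function.Injective.of_comp h1
  -- `B` is integral over `A`, so every nonzero element divides a nonzero element of `A`. Fractions
  -- over `B` therefore get denominators in `A`, and quotients of `B` by nonzero elements are
  -- torsion.
  have hdvd : ∀ b : B, b ≠ 0 → ∃ a : A, a ≠ 0 ∧ b ∣ algebraMap A B a := fun b hb =>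
    (Algebra.IsIntegral.isIntegral (R := A) b).isAlgebraic.exists_nonzero_dvd
      (mem_nonZeroDivisors_of_ne_zero hb)
  have hBL' : ∀ x : L, ∃ a : A, a ≠ 0 ∧ ∃ b : B, algebraMap B L b = a • x := by
    intro x
    obtain ⟨r, s, hs, hrs⟩ := hL x
    have hs' : Ideal.Quotient.mk (RingHom.ker (algebraMap R L)) s ≠ 0 := fun h =>
      hs (Ideal.Quotient.eq_zero_iff_mem.1 h)
    obtain ⟨a, ha, c, hc⟩ := hdvd _ hs'
    refine ⟨a, ha, c * Ideal.Quotient.mk _ r, ?_⟩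
    have h1 : algebraMap B L (Ideal.Quotient.mk _ s) = algebraMap R L s := rfl
    have h2 : algebraMap B L (Ideal.Quotient.mk _ r) = algebraMap R L r := rfl
    rw [Algebra.smul_def, IsScalarTower.algebraMap_apply A B L, hc, map_mul, map_mul, h1, h2, ← hrs]
    ring
  have hfinite : ∀ b : B, b ≠ 0 → length A (B ⧸ Ideal.span {b}) ≠ ⊤ := by
    intro b hb
    refine length_ne_top_of_torsion fun x => ?_
    obtain ⟨a, ha, c, hc⟩ := hdvd b hb
    refine ⟨a, ha, ?_⟩
    obtain ⟨x, rfl⟩ := Ideal.Quotient.mk_surjective x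
    change Ideal.Quotient.mk (Ideal.span {b}) (a • x) = 0
    rw [Algebra.smul_def, hc]
    exact Ideal.Quotient.eq_zero_iff_mem.2 (Ideal.mul_mem_right _ _
      (Ideal.mul_mem_right _ _ (Ideal.mem_span_singleton_self b)))
  obtain ⟨s, hs, r, hr⟩ := hBL' f
  obtain ⟨s, rfl⟩ := Ideal.Quotient.mk_surjective s
  obtain ⟨r, rfl⟩ := Ideal.Quotient.mk_surjective r
  have hsK : algebraMap A₀ K s ≠ 0 := fun h => hs (Ideal.Quotient.eq_zero_iff_mem.2 h)
  have hr' : algebraMap R L r = f * algebraMap A₀ L s := by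
    refine hr.trans ?_
    rw [Algebra.smul_def, mul_comm, IsScalarTower.algebraMap_apply A₀ K L]
    rfl
  have e1 : ∀ x : R, length A₀ (R ⧸ (RingHom.ker (algebraMap R L) ⊔ Ideal.span {x})) =
      length A (B ⧸ Ideal.span {algebraMap R B x}) := by
    intro x
    have hk : RingHom.ker (algebraMap R L) = RingHom.ker (algebraMap R B) := Ideal.mk_ker.symm
    rw [← length_quotient_ker_sup_of_surjective (A₀ := A₀) Ideal.Quotient.mk_surjective
      Ideal.Quotient.mk_surjective, ← hk]
  have e2 : ∀ x : A₀, length A₀ (A₀ ⧸ (RingHom.ker (algebraMap A₀ K) ⊔ Ideal.span {x})) =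
      Ring.ord A (algebraMap A₀ A x) := by
    intro x
    have hk : RingHom.ker (algebraMap A₀ K) = RingHom.ker (algebraMap A₀ A) := Ideal.mk_ker.symm
    rw [← length_quotient_ker_sup (algebraMap A₀ A) Ideal.Quotient.mk_surjective, ← hk]
  have hsL : algebraMap A₀ L s ≠ 0 := by
    rw [IsScalarTower.algebraMap_apply A₀ K L]
    exact (map_ne_zero_iff _ (algebraMap K L).injective).2 hsK
  refine ⟨r, s, hsK, hr', ?_, ?_, ?_⟩
  · rw [e1]
    refine hfinite _ fun h => ?_
    have : algebraMap R L r = 0 := Ideal.Quotient.eq_zero_iff_mem.1 h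
    rw [hr'] at this
    exact mul_ne_zero hf hsL this
  · rw [e1]
    refine hfinite _ fun h => ?_
    have : algebraMap R L (algebraMap A₀ R s) = 0 := Ideal.Quotient.eq_zero_iff_mem.1 h
    rw [← IsScalarTower.algebraMap_apply] at this
    exact hsL this
  · intro a b hb hab
    rw [e1, e1, e2, e2]
    refine length_quotient_norm (K := K) hBL hBL' f hf _ (algebraMap A₀ A s) hr _ _ ?_ hab
    exact fun h => hb (Ideal.Quotient.eq_zero_iff_mem.1 h)

end

/-! ### Pushforward of zero-cycles along finite morphisms -/

section Push

variable {Y' Y : Scheme.{u}} (g : Y' ⟶ Y) [IsFinite g]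

/-- Finite morphisms are closed, and their fibres are discrete, so no point specializes to another
point of its fibre. -/
lemma isClosed_singleton_map_iff (y' : Y') :
    IsClosed ({g y'} : Set Y) ↔ IsClosed ({y'} : Set Y') := by
  constructor
  · intro h
    rw [← closure_eq_iff_isClosed]
    refine (Set.Subset.antisymm ?_ subset_closure)
    intro y'' h'
    have h1 : y' ⤳ y'' := specializes_iff_mem_closure.2 h'
    have h2 : g y'' = g y' := by
      have := specializes_iff_mem_closure.1 (h1.map g.continuous)
      rwa [h.closure_eq] at this
    have h3 := g.isDiscrete_preimage_singleton (g y')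
    have := h3.to_subtype
    have h4 : (⟨y', rfl⟩ : g ⁻¹' {g y'}) ⤳ ⟨y'', h2⟩ :=
      Topology.IsInducing.subtypeVal.specializes_iff.1 h1
    exact congrArg Subtype.val h4.eq.symm
  · intro h
    have := g.isClosedMap _ h
    rwa [Set.image_singleton] at this

/-- The morphism is closed, so specializations of `g η'` lift to specializations of `η'`. -/
lemma IsCurvePoint.map {η' : Y'} (h : IsCurvePoint η') : IsCurvePoint (g η') := by
  refine ⟨fun hc => h.not_isClosed ((isClosed_singleton_map_iff g _).1 hc), fun y hy hne => ?_⟩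
  have h1 : y ∈ g '' closure {η'} := by
    have h2 : closure {g η'} ⊆ g '' closure {η'} :=
      closure_minimal (Set.singleton_subset_iff.2 ⟨η', subset_closure rfl, rfl⟩)
        (g.isClosedMap _ isClosed_closure)
    exact h2 (specializes_iff_mem_closure.1 hy)
  obtain ⟨y', hy', rfl⟩ := h1
  exact (isClosed_singleton_map_iff g y').2
    (h.isClosed_of_specializes y' (specializes_iff_mem_closure.2 hy') fun h => hne (h ▸ rfl))

/-- The pushforward of zero-cycles along a finite morphism. -/
noncomputable def pushCycle : ZeroCycle Y' →+ ZeroCycle Y :=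
  Finsupp.liftAddHom fun y' => (Finsupp.singleAddHom
    (⟨g y'.1, (isClosed_singleton_map_iff g _).2 y'.2⟩ : {y : Y // IsClosed ({y} : Set Y)})).comp
      (AddMonoidHom.mulRight (g.residueDegree y'.1 : ℤ))

lemma pushCycle_single (y' : {y : Y' // IsClosed ({y} : Set Y')}) (n : ℤ) :
    pushCycle g (Finsupp.single y' n) =
      Finsupp.single ⟨g y'.1, (isClosed_singleton_map_iff g _).2 y'.2⟩
        (n * g.residueDegree y'.1) := by
  simp [pushCycle]

lemma finite_fibre (y : Y) : Finite {y' // g y' = y} :=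
  g.finite_preimage_singleton y

lemma pushCycle_apply (z : ZeroCycle Y') (y : Y) (hy : IsClosed ({y} : Set Y))
    [Fintype {y' // g y' = y}] :
    pushCycle g z ⟨y, hy⟩ = ∑ y' : {y' // g y' = y},
      z ⟨y'.1, (isClosed_singleton_map_iff g _).1 (by rw [y'.2]; exact hy)⟩ *
        (g.residueDegree y'.1 : ℤ) := by
  classical
  induction z using Finsupp.induction_linear with
  | zero => simp
  | add a b ha hb =>
    rw [map_add, Finsupp.add_apply, ha, hb, ← Finset.sum_add_distrib]
    exact Finset.sum_congr rfl fun y' _ => by rw [Finsupp.add_apply, add_mul]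
  | single y₀ n =>
    rw [pushCycle_single, Finsupp.single_apply]
    split_ifs with h
    · have h' : g y₀.1 = y := congrArg Subtype.val h
      rw [Finset.sum_eq_single ⟨y₀.1, h'⟩]
      · rw [Finsupp.single_eq_same]
      · intro b _ hb
        rw [Finsupp.single_apply, if_neg, zero_mul]
        intro hh
        exact hb (Subtype.ext (congrArg Subtype.val hh).symm)
      · simp
    · symm
      refine Finset.sum_eq_zero fun b _ => ?_
      rw [Finsupp.single_apply, if_neg, zero_mul]
      intro hh
      apply h
      apply Subtype.ext
      change g y₀.1 = y
      rw [← b.2]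
      exact congrArg (fun t => g t.1) hh

omit [IsFinite g] in
-- If `y'` is off the closure of `η'`, the ideal of `η'` contains an element that is invertible at
-- `y'`. Otherwise it localizes to the prime of `η'` at `y'`.
lemma length_quotient_map_primeOfPullback {y : Y} {R : CommRingCat.{u}} {φ : Y.presheaf.stalk y ⟶ R}
    {j : Spec R ⟶ Y'} (H : IsPullback j (Spec.map φ) g (Y.fromSpecStalk y)) {η' y' : Y'}
    (hη : g η' ⤳ y) (hy : g y' = y) (r : R) :
    Module.length (Y'.presheaf.stalk y') (Y'.presheaf.stalk y' ⧸
      (primeOfPullback H hη ⊔ Ideal.span {r}).map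
        (toStalkOfPullback H (specializes_of_eq hy)).hom) =
    open Classical in if h : η' ⤳ y' then
      ordLen h ((toStalkOfPullback H (specializes_of_eq hy)).hom r) else 0 := by
  have hj := isPreimmersion_of_isPullback H
  let := (toStalkOfPullback H (specializes_of_eq hy)).hom.toAlgebra
  have hloc := isLocalization_toStalkOfPullback H (specializes_of_eq hy)
  have hspec : η' ⤳ y' ↔ primeOfPullback H hη ≤ primeOfPullback H (specializes_of_eq hy) := by
    have h1 := j.isEmbedding.specializes_iff
      (x := (⟨primeOfPullback H hη, inferInstance⟩ : PrimeSpectrum R))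
      (y := (⟨primeOfPullback H (specializes_of_eq hy), inferInstance⟩ : PrimeSpectrum R))
    rw [apply_primeOfPullback, apply_primeOfPullback] at h1
    exact h1.trans (PrimeSpectrum.le_iff_specializes _ _).symm
  split_ifs with h
  · have h1 : (primeOfPullback H hη).map (toStalkOfPullback H (specializes_of_eq hy)).hom =
        primeAt h := by
      have h2 : primeOfPullback H hη =
          (primeAt h).comap (algebraMap R (Y'.presheaf.stalk y')) := by
        rw [primeAt_eq_comap, Ideal.comap_comap]
        rw [primeOfPullback, ← toStalkOfPullback_stalkSpecializes H hη (specializes_of_eq hy) h]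
        rfl
      rw [h2]
      exact IsLocalization.map_under (primeOfPullback H (specializes_of_eq hy)).primeCompl _ _
    rw [Ideal.map_sup, h1, Ideal.map_span, Set.image_singleton]
    rfl
  · obtain ⟨x, hx, hx'⟩ := SetLike.not_le_iff_exists.1 (fun hle => h (hspec.2 hle))
    have h1 : (primeOfPullback H hη ⊔ Ideal.span {r}).map
        (toStalkOfPullback H (specializes_of_eq hy)).hom = ⊤ :=
      Ideal.eq_top_of_isUnit_mem _ (Ideal.mem_map_of_mem _ (Ideal.mem_sup_left hx))
        (IsLocalization.map_units (Y'.presheaf.stalk y')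
          (⟨x, hx'⟩ : (primeOfPullback H (specializes_of_eq hy)).primeCompl))
    rw [Module.length_eq_zero_iff, Ideal.Quotient.subsingleton_iff, h1]

end Push

lemma isArtinianRing_of_length_ne_top {A B : Type*} [CommRing A] [CommRing B] [Algebra A B]
    (h : Module.length A B ≠ ⊤) : IsArtinianRing B := by
  rw [Module.length_ne_top_iff, isFiniteLength_iff_isNoetherian_isArtinian] at h
  exact isArtinian_of_tower A h.2

section Push

variable {Y' Y : Scheme.{u}} (g : Y' ⟶ Y) [IsFinite g]

open Classical in
lemma length_quotient_primeOfPullback [IsLocallyNoetherian Y'] {y : Y}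
    {R : CommRingCat.{u}} {φ : Y.presheaf.stalk y ⟶ R}
    {j : Spec R ⟶ Y'} (H : IsPullback j (Spec.map φ) g (Y.fromSpecStalk y)) {η' : Y'}
    (hη' : IsCurvePoint η') (hη : g η' ⤳ y) [Fintype {y' // g y' = y}] (r : R)
    (hr : r ∉ primeOfPullback H hη)
    (hlen : letI := φ.hom.toAlgebra
      Module.length (Y.presheaf.stalk y) (R ⧸ (primeOfPullback H hη ⊔ Ideal.span {r})) ≠ ⊤) :
    letI := φ.hom.toAlgebra
    Module.length (Y.presheaf.stalk y) (R ⧸ (primeOfPullback H hη ⊔ Ideal.span {r})) =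
      ((∑ y' : {y' // g y' = y}, (if h : η' ⤳ y'.1 then (ordLen h
        ((toStalkOfPullback H (specializes_of_eq y'.2)).hom r)).toNat else 0) *
          g.residueDegree y'.1 : ℕ) : ℕ∞) := by
  let := φ.hom.toAlgebra
  have := isArtinianRing_of_length_ne_top hlen
  rw [length_quotient_eq_sum_stalk H]
  push_cast
  refine Finset.sum_congr rfl fun y' _ => ?_
  rw [length_quotient_map_primeOfPullback g H hη y'.2]
  split_ifs with h
  · rw [ENat.natCast_toNat]
    refine hη'.ordLen_ne_top h _ fun h0 => hr ?_
    rw [primeOfPullback, ← toStalkOfPullback_stalkSpecializes H hη (specializes_of_eq y'.2) h]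
    have : (toStalkOfPullback H (specializes_of_eq y'.2)).hom r ∈ primeAt h := h0
    rwa [primeAt_eq_comap] at this
  · simp

open IntermediateField Module in
-- The divisor of `f` pushes forward to the divisor of the norm of `f`. The given power of the
-- constant coefficient of the minimal polynomial is that norm up to sign, and signs do not change
-- orders.
lemma IsDivisorAt.pushCycle [IsLocallyNoetherian Y] {z : ZeroCycle Y'} {η' : Y'}
    {f : Y'.residueField η'} (hη' : IsCurvePoint η') (hz : IsDivisorAt z η' f) :
    letI := (g.residueFieldMap η').hom.toAlgebra
    IsDivisorAt (pushCycle g z) (g η') ((minpoly (Y.residueField (g η')) f).coeff 0 ^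
      finrank (Y.residueField (g η'))⟮f⟯ (Y'.residueField η')) := by
  classical
  have : IsLocallyNoetherian Y' := LocallyOfFiniteType.isLocallyNoetherian g
  let : Algebra (Y.residueField (g η')) (Y'.residueField η') :=
    (g.residueFieldMap η').hom.toAlgebra
  have : FiniteDimensional (Y.residueField (g η')) (Y'.residueField η') :=
    finite_residueFieldMap g η'
  have hη := hη'.map g
  refine ⟨pow_ne_zero _ (minpoly.coeff_zero_ne_zero (Algebra.IsIntegral.isIntegral f) hz.ne_zero),
    ?_, ?_⟩
  · intro y hy h a b hb hab
    have := finite_fibre g y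
    have : Fintype {y' // g y' = y} := Fintype.ofFinite _
    obtain ⟨R, φ, j, H⟩ := exists_isPullback_fromSpecStalk g y
    let := φ.hom.toAlgebra
    let : Algebra (Y.presheaf.stalk y) (Y.residueField (g η')) := (evalAt h).toAlgebra
    let : Algebra R (Y'.residueField η') := (toStalkOfPullback H h ≫ Y'.residue η').hom.toAlgebra
    let : Algebra (Y.presheaf.stalk y) (Y'.residueField η') :=
      ((algebraMap (Y.residueField (g η')) (Y'.residueField η')).comp (evalAt h)).toAlgebra
    have : IsScalarTower (Y.presheaf.stalk y) (Y.residueField (g η')) (Y'.residueField η') :=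
      IsScalarTower.of_algebraMap_eq' rfl
    have : IsScalarTower (Y.presheaf.stalk y) R (Y'.residueField η') := by
      refine IsScalarTower.of_algebraMap_eq' ?_
      have : (Y.presheaf.stalkSpecializes h ≫ Y.residue (g η')) ≫ g.residueFieldMap η' =
          φ ≫ (toStalkOfPullback H h ≫ Y'.residue η') := by
        rw [← Category.assoc, comp_toStalkOfPullback, stalkMapOfSpecializes, Category.assoc,
          Category.assoc, Scheme.residue_residueFieldMap]
      exact congrArg CommRingCat.Hom.hom this
    have : Module.Finite (Y.presheaf.stalk y) R := finite_of_isPullback H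
    have hker : RingHom.ker (algebraMap R (Y'.residueField η')) = primeOfPullback H h := by
      ext x
      rw [RingHom.mem_ker, primeOfPullback, Ideal.mem_comap, ← IsLocalRing.residue_eq_zero_iff]
      rfl
    have hL : ∀ x : Y'.residueField η', ∃ r s : R, algebraMap R (Y'.residueField η') s ≠ 0 ∧
        x * algebraMap R _ s = algebraMap R _ r := by
      intro x
      obtain ⟨u, rfl⟩ := Y'.residue_surjective η' x
      let : Algebra R (Y'.presheaf.stalk η') := (toStalkOfPullback H h).hom.toAlgebra
      have := isLocalization_toStalkOfPullback H h
      obtain ⟨⟨r, s⟩, hrs⟩ := IsLocalization.surj (primeOfPullback H h).primeCompl u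
      refine ⟨r, s, fun h0 => s.2 (hker.le h0), ?_⟩
      have := congrArg (Y'.residue η').hom hrs
      rwa [map_mul] at this
    obtain ⟨r, s, hs, hrs, hrlen, hslen, key⟩ := exists_length_add_eq_of_norm
      (A₀ := Y.presheaf.stalk y) (R := R) (exists_evalAt_mul_eq h) hL
      (fun Q hQ hle => (hη.eq_of_le h Q hle).elim Or.inl
        fun h => Or.inr (h ▸ IsLocalRing.maximalIdeal.isMaximal _)) f hz.ne_zero
    have key := key a b hb hab
    have hsL : algebraMap R (Y'.residueField η') (algebraMap (Y.presheaf.stalk y) R s) ≠ 0 := by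
      rw [← IsScalarTower.algebraMap_apply, IsScalarTower.algebraMap_apply (Y.presheaf.stalk y)
        (Y.residueField (g η'))]
      exact (map_ne_zero_iff _ (algebraMap _ (Y'.residueField η')).injective).2 hs
    have hrL : algebraMap R (Y'.residueField η') r ≠ 0 := by
      rw [hrs]
      refine mul_ne_zero hz.ne_zero ?_
      rwa [← IsScalarTower.algebraMap_apply] at hsL
    rw [hker] at hrlen hslen key
    have hr' : r ∉ primeOfPullback H h := fun h0 => hrL (hker.ge h0)
    have hs' : algebraMap (Y.presheaf.stalk y) R s ∉ primeOfPullback H h :=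
      fun h0 => hsL (hker.ge h0)
    rw [length_quotient_primeOfPullback g H hη' h r hr' hrlen,
      length_quotient_primeOfPullback g H hη' h _ hs' hslen] at key
    have ha : evalAt h a ≠ 0 := by
      rw [← hab]
      exact mul_ne_zero (pow_ne_zero _ (minpoly.coeff_zero_ne_zero
        (Algebra.IsIntegral.isIntegral f) hz.ne_zero)) hb
    have key' : _ + ordLen h b = _ + ordLen h a := key
    rw [← ENat.natCast_toNat (hη.ordLen_ne_top h b hb), ← ENat.natCast_toNat (hη.ordLen_ne_top h a ha),
      ← Nat.cast_add, ← Nat.cast_add, Nat.cast_inj] at key'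
    have key'' := congrArg (Nat.cast : ℕ → ℤ) key'
    push_cast at key''
    -- The same fraction `r / s` computes the order of `f` at every point over `y`; these orders,
    -- weighted by residue degrees, add up to the coefficient of the pushforward.
    have hsum : TorsionOrder.pushCycle g z ⟨y, hy⟩ +
        ∑ y' : {y' // g y' = y}, ((if h' : η' ⤳ y'.1 then (ordLen h'
          ((toStalkOfPullback H (specializes_of_eq y'.2)).hom
            (algebraMap (Y.presheaf.stalk y) R s))).toNat else 0 : ℕ) : ℤ) *
          (g.residueDegree y'.1 : ℤ) =
        ∑ y' : {y' // g y' = y}, ((if h' : η' ⤳ y'.1 then (ordLen h'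
          ((toStalkOfPullback H (specializes_of_eq y'.2)).hom r)).toNat else 0 : ℕ) : ℤ) *
          (g.residueDegree y'.1 : ℤ) := by
      rw [pushCycle_apply, ← Finset.sum_add_distrib]
      refine Finset.sum_congr rfl fun y' _ => ?_
      rw [← add_mul]
      congr 1
      have hy' := (isClosed_singleton_map_iff g y'.1).1 (by rw [y'.2]; exact hy)
      split_ifs with h'
      · have hev : ∀ x : R, evalAt h' ((toStalkOfPullback H (specializes_of_eq y'.2)).hom x) =
            algebraMap R (Y'.residueField η') x := by
          intro x
          rw [RingHom.algebraMap_toAlgebra,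
            ← toStalkOfPullback_stalkSpecializes H h (specializes_of_eq y'.2) h']
          rfl
        refine hz.add_eq y'.1 hy' h' _ _ ?_ ?_
        · rw [hev]; exact hsL
        · rw [hev, hev, hrs, ← IsScalarTower.algebraMap_apply]
      · rw [hz.eq_zero y'.1 hy' h']; simp
    linarith
  · intro y hy h
    have := finite_fibre g y
    have : Fintype {y' // g y' = y} := Fintype.ofFinite _
    rw [pushCycle_apply]
    refine Finset.sum_eq_zero fun y' _ => ?_
    rw [hz.eq_zero, zero_mul]
    intro h'
    have := h'.map g.continuous
    rw [y'.2] at this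
    exact h this

/-- Pushforward along a finite morphism respects rational equivalence. -/
theorem pushCycle_mem_ratEquivZero [IsLocallyNoetherian Y] {z : ZeroCycle Y'}
    (hz : z ∈ ratEquivZero Y') : pushCycle g z ∈ ratEquivZero Y := by
  have h : ratEquivZero Y' ≤ (ratEquivZero Y).comap (pushCycle g) := by
    rw [ratEquivZero, AddSubgroup.closure_le]
    intro z hz
    obtain ⟨η, f, hη, hzf⟩ := hz.exists_isDivisorAt
    exact AddSubgroup.subset_closure ((hzf.pushCycle g hη).isDivisorOnCurve (hη.map g))
  exact h hz

end Push

/-! ### Cycles of Artinian schemes -/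

open Module TensorProduct

section Artinian

/-- The source is Noetherian and has finitely many points, all of them closed, so it is discrete. -/
lemma isArtinianScheme_of_isFinite {T' T : Scheme.{u}} (g : T' ⟶ T) [IsFinite g]
    [IsArtinianScheme T] : IsArtinianScheme T' := by
  have h1 : IsLocallyNoetherian T' := LocallyOfFiniteType.isLocallyNoetherian g
  have h2 : CompactSpace T' := QuasiCompact.compactSpace_of_compactSpace g
  have h3 : IsNoetherian T' := {}
  have (t : T) : Finite {t' // g t' = t} := finite_fibre g t
  have h4 : Finite T' :=
    Finite.of_equiv _ (Equiv.sigmaFiberEquiv g)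
  have h5 : T1Space T' := ⟨fun t => (isClosed_singleton_map_iff g t).1 (isClosed_discrete _)⟩
  exact IsArtinianScheme.iff_isNoetherian_and_discreteTopology.2 ⟨h3, inferInstance⟩

lemma isArtinianRing_stalk {T : Scheme.{u}} [IsLocallyArtinian T] (t : T) :
    IsArtinianRing (T.presheaf.stalk t) := by
  obtain ⟨U, hU, hyU, -⟩ := exists_isAffineOpen_mem_and_subset (x := t) (U := ⊤) trivial
  let : Algebra Γ(T, U) (T.presheaf.stalk t) := (T.presheaf.germ U t hyU).hom.toAlgebra
  have : IsLocalization.AtPrime (T.presheaf.stalk t) (hU.primeIdealOf ⟨t, hyU⟩).asIdeal :=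
    hU.isLocalization_stalk ⟨t, hyU⟩
  have : IsArtinianRing Γ(T, U) := IsLocallyArtinian.isArtinianRing_presheaf_obj ⟨U, hU⟩
  exact (IsArtinianRing.localization_surjective (hU.primeIdealOf ⟨t, hyU⟩).asIdeal.primeCompl
    (T.presheaf.stalk t)).isArtinianRing

lemma length_stalk_ne_top {T : Scheme.{u}} [IsLocallyArtinian T] (t : T) :
    length (T.presheaf.stalk t) (T.presheaf.stalk t) ≠ ⊤ := by
  have := isArtinianRing_stalk t
  rw [length_ne_top_iff, isFiniteLength_iff_isNoetherian_isArtinian]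
  exact ⟨inferInstance, inferInstance⟩

end Artinian

/-- The zero-cycle of an Artinian scheme. -/
noncomputable def fundamentalCycle (T : Scheme.{u}) [IsArtinianScheme T] : ZeroCycle T :=
  Finsupp.equivFunOnFinite.symm fun t =>
    ((length (T.presheaf.stalk t.1) (T.presheaf.stalk t.1)).toNat : ℤ)

lemma fundamentalCycle_apply (T : Scheme.{u}) [IsArtinianScheme T]
    (t : {t : T // IsClosed ({t} : Set T)}) :
    fundamentalCycle T t = ((length (T.presheaf.stalk t.1) (T.presheaf.stalk t.1)).toNat : ℤ) := rfl

/-- The zero-cycle of an Artinian scheme that is finite over `Y`. -/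
noncomputable def finiteCycle {T Y : Scheme.{u}} [IsArtinianScheme T] (h : T ⟶ Y) [IsFinite h] :
    ZeroCycle Y :=
  pushCycle h (fundamentalCycle T)

lemma residueDegree_comp {Z Y X : Scheme.{u}} (f : Z ⟶ Y) (g : Y ⟶ X) (z : Z) :
    (f ≫ g).residueDegree z = g.residueDegree (f z) * f.residueDegree z := by
  let a₁ : Algebra (X.residueField (g (f z))) (Y.residueField (f z)) :=
    (g.residueFieldMap (f z)).hom.toAlgebra
  let a₂ : Algebra (Y.residueField (f z)) (Z.residueField z) := (f.residueFieldMap z).hom.toAlgebra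
  let a₃ : Algebra (X.residueField (g (f z))) (Z.residueField z) :=
    ((f ≫ g).residueFieldMap z).hom.toAlgebra
  have : IsScalarTower (X.residueField (g (f z))) (Y.residueField (f z)) (Z.residueField z) :=
    IsScalarTower.of_algebraMap_eq' (congrArg CommRingCat.Hom.hom
      (Scheme.residueFieldMap_comp f g z))
  exact (finrank_mul_finrank (X.residueField (g (f z))) (Y.residueField (f z))
    (Z.residueField z)).symm

lemma pushCycle_comp {Z Y X : Scheme.{u}} (f : Z ⟶ Y) (g : Y ⟶ X) [IsFinite f] [IsFinite g]
    (z : ZeroCycle Z) : pushCycle (f ≫ g) z = pushCycle g (pushCycle f z) := by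
  induction z using Finsupp.induction_linear with
  | zero => simp
  | add a b ha hb => rw [map_add, map_add, map_add, ha, hb]
  | single y n =>
    rw [pushCycle_single, pushCycle_single, pushCycle_single, residueDegree_comp]
    congr 1
    push_cast
    ring

lemma pushCycle_finiteCycle {T Y X : Scheme.{u}} [IsArtinianScheme T] (f : T ⟶ Y) (g : Y ⟶ X)
    [IsFinite f] [IsFinite g] : pushCycle g (finiteCycle f) = finiteCycle (f ≫ g) :=
  (pushCycle_comp f g _).symm

section Length

variable {T Y : Scheme.{u}} (h : T ⟶ Y) [IsFinite h] [IsArtinianScheme T] {y : Y}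
  {R : CommRingCat.{u}} {φ : Y.presheaf.stalk y ⟶ R} {j : Spec R ⟶ T}
  (H : IsPullback j (Spec.map φ) h (Y.fromSpecStalk y))

include H

/-- `R` is finite over a Noetherian local ring, and its spectrum embeds in the discrete space `T`.
-/
lemma isArtinianRing_of_isPullback [IsLocallyNoetherian Y] : IsArtinianRing R := by
  have := isPreimmersion_of_isPullback H
  have h1 : IsNoetherianRing R := by
    let := φ.hom.toAlgebra
    have : Module.Finite (Y.presheaf.stalk y) R := finite_of_isPullback H
    exact IsNoetherianRing.of_finite (Y.presheaf.stalk y) R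
  have h2 : DiscreteTopology (Spec R) := j.isEmbedding.discreteTopology
  exact Scheme.isArtinianScheme_Spec.1
    (IsArtinianScheme.iff_isNoetherian_and_discreteTopology.2 ⟨inferInstance, h2⟩)

/-- `R` is the stalk at `y` of the pushforward of `𝒪_T`. Its length is the sum, over the points of
`T` above `y`, of the local length times the residue degree. -/
theorem finiteCycle_apply [IsLocallyNoetherian Y] [alg : Algebra (Y.presheaf.stalk y) R]
    (halg : algebraMap (Y.presheaf.stalk y) R = φ.hom) (hy : IsClosed ({y} : Set Y)) :
    finiteCycle h ⟨y, hy⟩ = ((length (Y.presheaf.stalk y) R).toNat : ℤ) := by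
  obtain rfl : alg = φ.hom.toAlgebra := Algebra.algebra_ext _ _ fun r => congr($halg r)
  let := φ.hom.toAlgebra
  have := isArtinianRing_of_isPullback h H
  have : Fintype {y' // h y' = y} := (@Fintype.ofFinite _ (finite_fibre h y))
  have : IsArtinianRing (R ⧸ (⊥ : Ideal R)) := inferInstance
  have h1 := length_quotient_eq_sum_stalk H ⊥
  have h2 : length (Y.presheaf.stalk y) R = length (Y.presheaf.stalk y) (R ⧸ (⊥ : Ideal R)) :=
    ((Submodule.quotEquivOfEqBot (⊥ : Ideal R) rfl).symm.restrictScalars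
      (Y.presheaf.stalk y)).length_eq
  have h3 (t : {y' // h y' = y}) : length (T.presheaf.stalk t.1) (T.presheaf.stalk t.1 ⧸
      (⊥ : Ideal R).map (toStalkOfPullback H (specializes_of_eq t.2)).hom) =
      length (T.presheaf.stalk t.1) (T.presheaf.stalk t.1) :=
    (Submodule.quotEquivOfEqBot _ Ideal.map_bot).length_eq
  rw [finiteCycle, pushCycle_apply, h2, h1, ENat.toNat_sum]
  · push_cast
    refine Finset.sum_congr rfl fun t _ => ?_
    rw [h3, ENat.toNat_mul, ENat.toNat_natCast, fundamentalCycle_apply]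
    push_cast
    rfl
  · intro t _
    rw [h3]
    exact WithTop.mul_ne_top (length_stalk_ne_top _) (ENat.natCast_ne_top _)

end Length

section BaseChange

/-- Pasting of squares: the restriction of `T'` to `Spec A'` is the base change to `A'` of the
restriction of `T` to `Spec A`. -/
lemma exists_isPullback_tensorProduct {T' T Y' Y : Scheme.{u}} {p' : T' ⟶ T} {h' : T' ⟶ Y'}
    {h : T ⟶ Y} {p : Y' ⟶ Y} (H : IsPullback p' h' h p) {A R A' : CommRingCat.{u}} {φ : A ⟶ R}
    {j : Spec R ⟶ T} {i : Spec A ⟶ Y} (H₁ : IsPullback j (Spec.map φ) h i) {ψ : A ⟶ A'}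
    {i' : Spec A' ⟶ Y'} (hi : Spec.map ψ ≫ i = i' ≫ p) [alg₁ : Algebra A R] [alg₂ : Algebra A A']
    (h₁ : algebraMap A R = φ.hom) (h₂ : algebraMap A A' = ψ.hom) :
    ∃ j' : Spec (.of (A' ⊗[A] R)) ⟶ T', IsPullback j'
      (Spec.map (CommRingCat.ofHom (Algebra.TensorProduct.includeLeftRingHom))) h' i' := by
  obtain rfl : φ = CommRingCat.ofHom (algebraMap A R) := CommRingCat.hom_ext h₁.symm
  obtain rfl : ψ = CommRingCat.ofHom (algebraMap A A') := CommRingCat.hom_ext h₂.symm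
  have H₂ := (CommRingCat.isPushout_tensorProduct A A' R).op.map Scheme.Spec
  have H₃ : IsPullback _ _ h (i' ≫ p) := hi ▸ IsPullback.paste_horiz H₂ H₁
  exact ⟨_, IsPullback.of_right' H₃ H⟩

/-- Under a flat local homomorphism, the length of a base change is the old length times the length
of the closed fibre, which is the multiplicity in the definition of the pullback. Over a nonclosed
point of `Y` there is nothing to count, since finite morphisms send the points of `T`, all closed,
to closed points. -/
theorem isPullbackCycle_finiteCycle {T' T Y' Y : Scheme.{u}} {p' : T' ⟶ T} {h' : T' ⟶ Y'}
    {h : T ⟶ Y} {p : Y' ⟶ Y} (H : IsPullback p' h' h p) [Flat p] [IsFinite h] [IsFinite h']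
    [IsArtinianScheme T] [IsArtinianScheme T'] [IsLocallyNoetherian Y] [IsLocallyNoetherian Y'] :
    IsPullbackCycle p (finiteCycle h) (finiteCycle h') := by
  rintro ⟨y', hy'⟩
  split_ifs with hy
  · obtain ⟨R, φ, j, H₁⟩ := exists_isPullback_fromSpecStalk h (p y')
    let := φ.hom.toAlgebra
    let := (p.stalkMap y').hom.toAlgebra
    have : Module.Flat (Y.presheaf.stalk (p y')) (Y'.presheaf.stalk y') := Flat.stalkMap p y'
    have : IsLocalHom (algebraMap (Y.presheaf.stalk (p y')) (Y'.presheaf.stalk y')) :=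
      inferInstanceAs (IsLocalHom (p.stalkMap y').hom)
    obtain ⟨j', H'⟩ := exists_isPullback_tensorProduct H H₁
      (Scheme.SpecMap_stalkMap_fromSpecStalk p (x := y')) rfl rfl
    have h1 := finiteCycle_apply h H₁ rfl hy
    have h2 := finiteCycle_apply (alg := Algebra.TensorProduct.leftAlgebra) h' H' rfl hy'
    have h3 := congrArg ENat.toNat (IsLocalRing.length_baseChange (Y.presheaf.stalk (p y'))
      (Y'.presheaf.stalk y') R)
    rw [ENat.toNat_mul] at h3
    exact h2.trans ((congrArg (fun n : ℕ => (n : ℤ)) h3).trans ((Nat.cast_mul _ _).trans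
      (congrArg (fun n : ℤ => n * (fibreMultiplicity p y' : ℤ)) h1).symm))
  · classical
    have : Fintype {t // h' t = y'} := (@Fintype.ofFinite _ (finite_fibre h' y'))
    have : IsEmpty {t // h' t = y'} := by
      refine ⟨fun t => hy ?_⟩
      have h1 : p y' = h (p' t.1) := by
        rw [← Scheme.Hom.comp_apply, H.w, Scheme.Hom.comp_apply, t.2]
      change IsClosed {p y'}
      rw [h1]
      exact (isClosed_singleton_map_iff h _).2 (isClosed_discrete _)
    rw [finiteCycle, pushCycle_apply]
    simp

/-- The fundamental cycle of a base change of `T` by a finite field extension pushes forward to a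
multiple of the fundamental cycle of `T`. -/
theorem pushCycle_fundamentalCycle {T' T : Scheme.{u}} {K F : Type u} [Field K] [Field F]
    [Algebra K F] [FiniteDimensional K F] {p' : T' ⟶ Spec (.of F)} {π : T' ⟶ T}
    {c : T ⟶ Spec (.of K)}
    (H : IsPullback p' π (Spec.map (CommRingCat.ofHom (algebraMap K F))) c) [IsFinite π]
    [IsArtinianScheme T'] [IsArtinianScheme T] :
    pushCycle π (fundamentalCycle T') = finrank K F • fundamentalCycle T := by
  ext ⟨t, ht⟩
  have H₁ : IsPullback (𝟙 (Spec (.of F))) (Spec.map (CommRingCat.ofHom (algebraMap K F)))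
    (Spec.map (CommRingCat.ofHom (algebraMap K F))) (𝟙 _) := IsPullback.of_id_fst
  -- Over the local ring at `t`, `T'` is its tensor product with `F`, which is free of rank the
  -- degree of `F` over `K`.
  let ψ : CommRingCat.of K ⟶ T.presheaf.stalk t := Spec.preimage (T.fromSpecStalk t ≫ c)
  let := ψ.hom.toAlgebra
  obtain ⟨j', H'⟩ := exists_isPullback_tensorProduct H H₁ (ψ := ψ) (i' := T.fromSpecStalk t)
    ((Category.comp_id _).trans (Spec.map_preimage _)) rfl rfl
  refine (finiteCycle_apply (alg := Algebra.TensorProduct.leftAlgebra) π H' rfl ht).trans ?_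
  rw [Finsupp.smul_apply, fundamentalCycle_apply, nsmul_eq_mul, ← Nat.cast_mul]
  have h1 : length (T.presheaf.stalk t) (T.presheaf.stalk t ⊗[K] F) =
      finrank K F * length (T.presheaf.stalk t) (T.presheaf.stalk t) := by
    have e := Algebra.TensorProduct.basis (T.presheaf.stalk t) (finBasis K F)
    rw [e.equivFun.length_eq, length_pi_of_fintype]
    simp
  have h2 := congrArg ENat.toNat h1
  rw [ENat.toNat_mul, ENat.toNat_natCast] at h2
  exact congrArg (fun n : ℕ => (n : ℤ)) h2

end BaseChange

open TensorProduct

/-! ### Base change of affine curves by Artinian algebras -/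

section Dimension

open Polynomial

/-- Noether normalization. The dimension bound passes down the integral extension, so there is at
most one variable, and there is at least one because `A` is not a field. -/
lemma exists_finite_injective_polynomial (K A : Type*) [Field K] [CommRing A] [IsDomain A]
    [Algebra K A] [Algebra.FiniteType K A] (h1 : ¬ IsField A)
    (h2 : ∀ P : Ideal A, P.IsPrime → P ≠ ⊥ → P.IsMaximal) :
    ∃ φ : K[X] →ₐ[K] A, Function.Injective φ ∧ φ.Finite := by
  obtain ⟨s, g, hg, hfin⟩ := exists_finite_inj_algHom_of_fg K A
  let := g.toRingHom.toAlgebra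
  have : Module.Finite (MvPolynomial (Fin s) K) A := hfin
  have hinj : Function.Injective (algebraMap (MvPolynomial (Fin s) K) A) := hg
  have h3 : Ring.KrullDimLE 1 (MvPolynomial (Fin s) K) := by
    refine Ring.krullDimLE_one_iff_of_noZeroDivisors.2 fun P hP hPp => ?_
    obtain ⟨Q, hQ, rfl⟩ := Ideal.exists_ideal_over_prime_of_isIntegral_of_isDomain (S := A) P
      (by rw [(RingHom.injective_iff_ker_eq_bot _).1 hinj]; exact bot_le)
    have := h2 Q hQ (by
      rintro rfl
      exact hP ((RingHom.injective_iff_ker_eq_bot _).1 hinj))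
    exact Ideal.isMaximal_comap_of_isIntegral_of_isMaximal Q
  have h4 : s ≤ 1 := by
    have := MvPolynomial.ringKrullDim_of_isNoetherianRing (R := K) (ι := Fin s)
    have h5 := (Order.krullDimLE_iff _ _).1 h3
    rw [← ringKrullDim, this, ringKrullDim_eq_zero_of_field] at h5
    simpa using h5
  obtain rfl | rfl : s = 0 ∨ s = 1 := by omega
  · refine (h1 ?_).elim
    have : IsField (MvPolynomial (Fin 0) K) :=
      (MvPolynomial.isEmptyRingEquiv K (Fin 0)).toMulEquiv.isField (Field.toIsField K)
    exact isField_of_isIntegral_of_isField' this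
  · let e := (MvPolynomial.uniqueAlgEquiv K (Fin 1)).symm
    refine ⟨g.comp e.toAlgHom, hg.comp e.injective, ?_⟩
    exact RingHom.Finite.comp (g := g.toRingHom) hfin (RingHom.Finite.of_surjective e.toRingHom e.surjective)

/-- The irreducible components of the base change of an integral affine curve by an Artinian
algebra are curves. -/
theorem minimalPrimes_tensorProduct {K A R : Type*} [Field K] [CommRing A] [IsDomain A]
    [Algebra K A] [Algebra.FiniteType K A] (h1 : ¬ IsField A)
    (h2 : ∀ P : Ideal A, P.IsPrime → P ≠ ⊥ → P.IsMaximal) [CommRing R] [Algebra K R]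
    [IsArtinianRing R] (q : Ideal (A ⊗[K] R)) (hq : q ∈ minimalPrimes (A ⊗[K] R)) :
    ¬ q.IsMaximal ∧ ∀ q' : Ideal (A ⊗[K] R), q'.IsPrime → q < q' → q'.IsMaximal := by
  obtain ⟨φ, hφ, hfin⟩ := exists_finite_injective_polynomial K A h1 h2
  let : Algebra K[X] R[X] := Polynomial.algebra ..
  let a₁ := φ.toRingHom.toAlgebra
  have hfin' : Module.Finite K[X] A := hfin
  -- A torsion-free module over a principal ideal domain is flat.
  have hflat : Module.Flat K[X] A := by
    rw [IsDedekindDomain.flat_iff_torsion_eq_bot, eq_bot_iff]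
    rintro x ⟨a, ha⟩
    have h3 : φ a * x = 0 := ha
    exact (mul_eq_zero.1 h3).resolve_left fun h => nonZeroDivisors.coe_ne_zero a
      (hφ (h.trans (map_zero φ).symm))
  let a₂ : Algebra R[X] (A ⊗[K] R) :=
    (Polynomial.eval₂RingHom (Algebra.TensorProduct.includeRight : R →ₐ[K] A ⊗[K] R).toRingHom
      (φ X ⊗ₜ 1)).toAlgebra
  have t₁ : IsScalarTower K K[X] A := .of_algebraMap_eq' φ.comp_algebraMap.symm
  let a₄ : Algebra R (A ⊗[K] R) := Algebra.TensorProduct.rightAlgebra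
  have t₃ : IsScalarTower K[X] R[X] (A ⊗[K] R) := by
    refine .of_algebraMap_eq' (Polynomial.ringHom_ext (fun c => ?_) ?_)
    · have : algebraMap K A c ⊗ₜ[K] (1 : R) = 1 ⊗ₜ algebraMap K R c := by
        rw [Algebra.algebraMap_eq_smul_one, Algebra.algebraMap_eq_smul_one, smul_tmul]
      have h3 : φ (C c) = algebraMap K A c := φ.commutes c
      simp [RingHom.algebraMap_toAlgebra, Algebra.TensorProduct.algebraMap_apply, h3, this]
    · simp [RingHom.algebraMap_toAlgebra, Algebra.TensorProduct.algebraMap_apply]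
  have t₄ : IsScalarTower R R[X] (A ⊗[K] R) := by
    refine .of_algebraMap_eq' (RingHom.ext fun r => ?_)
    simp [RingHom.algebraMap_toAlgebra]
  have t₅ : IsScalarTower K R[X] (A ⊗[K] R) := by
    refine .of_algebraMap_eq' (RingHom.ext fun c => ?_)
    rw [IsScalarTower.algebraMap_apply K R (A ⊗[K] R), IsScalarTower.algebraMap_eq K R R[X],
      ← RingHom.comp_assoc, ← IsScalarTower.algebraMap_eq R R[X] (A ⊗[K] R)]
    rfl
  have po : Algebra.IsPushout K[X] A R[X] (A ⊗[K] R) := by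
    refine Algebra.IsPushout.comp_iff (R := K) (R' := R) .. |>.1 ?_
    infer_instance
  have po' := po.symm
  have hfin₂ : Module.Finite R[X] (A ⊗[K] R) :=
    Module.Finite.equiv po'.out.equiv
  have hflat₂ : Module.Flat R[X] (A ⊗[K] R) := Module.Flat.isBaseChange _ _ _ _ po'.out
  have hqp := hq.1.1
  -- Going down for the flat extension of `R[X]`: the minimal prime `q` contracts to a minimal
  -- prime.
  have hmin (P : Ideal R[X]) (hP : P.IsPrime) (hle : P ≤ q.under R[X]) : P = q.under R[X] := by
    obtain ⟨q₁, hq₁, hq₁p, ⟨rfl⟩⟩ := Ideal.exists_ideal_le_liesOver_of_le (p := P) q hle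
    rw [le_antisymm hq₁ (hq.2 ⟨hq₁p, bot_le⟩ hq₁)]
  -- A minimal prime of `R[X]` is extended from `R`; here `m` is maximal, as `R` is Artinian.
  have hM : (((q.under R[X]).under R).map C) = q.under R[X] :=
    hmin _ Ideal.isPrime_map_C_of_isPrime (Ideal.map_le_iff_le_comap.2 le_rfl)
  generalize hm : (q.under R[X]).under R = m at hM
  have hmp : m.IsPrime := hm ▸ inferInstance
  have hmax : m.IsMaximal := IsArtinianRing.isMaximal_of_isPrime m
  constructor
  · intro hqm
    have h3 : (q.under R[X]).IsMaximal := Ideal.isMaximal_comap_of_isIntegral_of_isMaximal q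
    -- If `q` were maximal, so would be its contraction `m R[X]`, but that is strictly smaller than
    -- the ideal of polynomials with constant term in `m`.
    have h4 : q.under R[X] = m.comap (constantCoeff (R := R)) := by
      refine h3.eq_of_le (Ideal.comap_ne_top _ hmp.ne_top) ?_
      rw [← hM, Ideal.map_le_iff_le_comap]
      intro r hr
      simpa using hr
    have h5 : (X : R[X]) ∈ q.under R[X] := by rw [h4]; simp
    rw [← hM, Ideal.mem_map_C_iff] at h5
    exact hmp.ne_top ((Ideal.eq_top_iff_one _).2 (by simpa using h5 1))
  · intro q' hq' hlt
    have h3 : q.under R[X] < q'.under R[X] := Ideal.IsIntegral.comap_lt_comap hlt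
    let F := Ideal.Quotient.field m
    let ψ : R[X] →+* (R ⧸ m)[X] := mapRingHom (Ideal.Quotient.mk m)
    have hψ : Function.Surjective ψ := Polynomial.map_surjective _ Ideal.Quotient.mk_surjective
    have hker : RingHom.ker ψ = q.under R[X] := by
      rw [Polynomial.ker_mapRingHom, Ideal.mk_ker, hM]
    have h4 : ((q'.under R[X]).map ψ).IsPrime :=
      Ideal.map_isPrime_of_surjective hψ (hker ▸ h3.le)
    have h5 : ((q'.under R[X]).map ψ) ≠ ⊥ := by
      rw [Ne, Ideal.map_eq_bot_iff_le_ker, hker]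
      exact h3.not_ge
    -- A nonzero prime of the polynomial ring over the field `R ⧸ m` is maximal; maximality then
    -- lifts along the integral extension.
    have h6 : ((q'.under R[X]).map ψ).IsMaximal := IsPrime.to_maximal_ideal h5
    have h7 : (((q'.under R[X]).map ψ).comap ψ).IsMaximal :=
      Ideal.comap_isMaximal_of_surjective ψ hψ
    rw [Ideal.comap_map_of_surjective _ hψ] at h7
    have h8 : (⊥ : Ideal (R ⧸ m)[X]).comap ψ ≤ q'.under R[X] := (hker.trans_le h3.le)
    rw [sup_of_le_left h8] at h7
    exact Ideal.isMaximal_of_isIntegral_of_isMaximal_comap q' h7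

end Dimension

/-! ### Existence of principal divisors -/

section Divisor

variable {Y : Scheme.{u}} {η y : Y}

lemma ordLen_eq_ord (h : η ⤳ y) (a : Y.presheaf.stalk y) :
    ordLen h a = Ring.ord (evalAt h).range ((evalAt h).rangeRestrict a) := by
  rw [← length_quotient_ker_sup _ (evalAt h).rangeRestrict_surjective, RingHom.ker_rangeRestrict]
  rfl

lemma ordLen_mul (h : η ⤳ y) (a b : Y.presheaf.stalk y) (hb : evalAt h b ≠ 0) :
    ordLen h (a * b) = ordLen h a + ordLen h b := by
  rw [ordLen_eq_ord, ordLen_eq_ord, ordLen_eq_ord, map_mul, Ring.ord_mul]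
  exact mem_nonZeroDivisors_of_ne_zero fun h0 => hb congr(($h0 : Y.residueField η))

lemma ordLen_congr (h : η ⤳ y) {a b : Y.presheaf.stalk y} (hab : evalAt h a = evalAt h b) :
    ordLen h a = ordLen h b := by
  rw [ordLen_eq_ord, ordLen_eq_ord]
  exact congrArg _ (Subtype.ext hab)

lemma ordLen_of_isUnit (h : η ⤳ y) {a : Y.presheaf.stalk y} (ha : IsUnit a) :
    ordLen h a = 0 := by
  rw [ordLen, Module.length_eq_zero_iff, Ideal.Quotient.subsingleton_iff]
  exact Ideal.eq_top_of_isUnit_mem _ (Ideal.mem_sup_right (Ideal.mem_span_singleton_self a)) ha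

/-- A closed subset of a Noetherian scheme all of whose points are closed is finite. -/
lemma finite_of_isClosed [IsNoetherian Y] {Z : Set Y} (hZ : IsClosed Z)
    (h : ∀ y ∈ Z, IsClosed ({y} : Set Y)) : Z.Finite := by
  have : TopologicalSpace.NoetherianSpace Y := inferInstance
  obtain ⟨S, hS, hSc, hSi, hSU⟩ :=
    TopologicalSpace.NoetherianSpace.exists_finite_set_isClosed_irreducible hZ
  rw [hSU]
  refine hS.sUnion fun t ht => ?_
  obtain ⟨x, hx⟩ := QuasiSober.sober (hSi t ht) (hSc t ht)
  have hxt : x ∈ t := by rw [← hx.def]; exact subset_closure rfl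
  have hx' : IsClosed ({x} : Set Y) := h x (hSU ▸ Set.mem_sUnion.2 ⟨t, ht, hxt⟩)
  rw [← hx.def, hx'.closure_eq]
  exact Set.finite_singleton x

/-- One representation of `f` as a fraction at each point is enough: two of them give equal cross
products on the curve, and orders are additive. -/
lemma IsDivisorAt.of_choice {z : ZeroCycle Y} {f : Y.residueField η} (hf : f ≠ 0)
    [IsLocallyNoetherian Y] (hη : IsCurvePoint η)
    (h₁ : ∀ (y : Y) (hy : IsClosed ({y} : Set Y)) (h : η ⤳ y), ∃ a b : Y.presheaf.stalk y,
      evalAt h b ≠ 0 ∧ f * evalAt h b = evalAt h a ∧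
        z ⟨y, hy⟩ + (ordLen h b).toNat = (ordLen h a).toNat)
    (h₂ : ∀ (y : Y) (hy : IsClosed ({y} : Set Y)), ¬ η ⤳ y → z ⟨y, hy⟩ = 0) :
    IsDivisorAt z η f := by
  refine ⟨hf, fun y hy h a b hb hab => ?_, h₂⟩
  obtain ⟨a', b', hb', hab', hz⟩ := h₁ y hy h
  have ha : evalAt h a ≠ 0 := hab ▸ mul_ne_zero hf hb
  have ha' : evalAt h a' ≠ 0 := hab' ▸ mul_ne_zero hf hb'
  have h3 : ordLen h (a * b') = ordLen h (a' * b) := ordLen_congr h (by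
    rw [map_mul, map_mul, ← hab, ← hab']; ring)
  rw [ordLen_mul h _ _ hb', ordLen_mul h _ _ hb] at h3
  have h4 := congrArg ENat.toNat h3
  rw [ENat.toNat_add (hη.ordLen_ne_top h _ ha) (hη.ordLen_ne_top h _ hb'),
    ENat.toNat_add (hη.ordLen_ne_top h _ ha') (hη.ordLen_ne_top h _ hb)] at h4
  omega

/-- The issue is finite support. Represent `f` by a function on an open set. Its order is zero
wherever that function is a unit, and the rest of the closure of `η` is a closed set of closed
points, hence finite. -/
theorem exists_isDivisorAt [IsNoetherian Y] (hη : IsCurvePoint η) {f : Y.residueField η}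
    (hf : f ≠ 0) : ∃ z, IsDivisorAt z η f := by
  classical
  obtain ⟨s, rfl⟩ := Y.residue_surjective η f
  obtain ⟨U, hU, s, rfl⟩ := Y.presheaf.exists_germ_eq s
  have hUs : η ∈ Y.basicOpen s := by
    rw [Scheme.mem_basicOpen _ _ _ hU]
    by_contra hn
    exact hf ((IsLocalRing.residue_eq_zero_iff _).2 hn)
  have hle := Y.basicOpen_le s
  choose a b hb hab using fun (y : Y) (h : η ⤳ y) =>
    exists_evalAt_mul_eq h (Y.residue η (Y.presheaf.germ U η hU s))
  let D (y : {y : Y // IsClosed ({y} : Set Y)}) : ℤ :=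
    if h : η ⤳ y.1 then (ordLen h (a _ h)).toNat - (ordLen h (b _ h)).toNat else 0
  have hfin : (closure {η} ∩ (Y.basicOpen s : Set Y)ᶜ).Finite := by
    refine finite_of_isClosed (isClosed_closure.inter (Y.basicOpen s).2.isClosed_compl) ?_
    rintro y ⟨hy1, hy2⟩
    exact hη.isClosed_of_specializes y (specializes_iff_mem_closure.2 hy1)
      (by rintro rfl; exact hy2 hUs)
  have hsupp : D.support.Finite := by
    refine Set.Finite.subset (hfin.preimage Subtype.val_injective.injOn) fun y hy => ?_
    by_cases h : η ⤳ y.1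
    · refine ⟨specializes_iff_mem_closure.1 h, fun hys => hy ?_⟩
      have hs : IsUnit (Y.presheaf.germ U y.1 (hle hys) s) :=
        (Scheme.mem_basicOpen _ _ _ (hle hys)).1 hys
      have h1 : evalAt h (Y.presheaf.germ U y.1 (hle hys) s * b _ h) = evalAt h (a _ h) := by
        rw [map_mul, ← hab]
        congr 1
        exact congrArg (Y.residue η).hom (Y.presheaf.germ_stalkSpecializes_apply (hle hys) h s)
      simp only [D, dif_pos h]
      rw [← ordLen_congr h h1, ordLen_mul h _ _ (hb _ h), ordLen_of_isUnit h hs, zero_add, sub_self]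
    · exact (hy (dif_neg h)).elim
  refine ⟨Finsupp.ofSupportFinite D hsupp, .of_choice hf hη (fun y hy h => ?_) fun y hy h => ?_⟩
  · refine ⟨a _ h, b _ h, hb _ h, hab _ h, ?_⟩
    simp [Finsupp.ofSupportFinite_coe, D, h]
  · simp [Finsupp.ofSupportFinite_coe, D, h]

end Divisor

open TensorProduct

/-! ### Components of the preimage of a curve -/

section Chart

/-- In a Jacobson space a locally closed point is closed. -/
lemma isClosed_singleton_map_iff_of_isImmersion {Z Y : Scheme.{u}} (i : Z ⟶ Y) [IsImmersion i]
    [JacobsonSpace Y] (x : Z) : IsClosed ({i x} : Set Y) ↔ IsClosed ({x} : Set Z) := by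
  constructor
  · intro h
    have := h.preimage i.continuous
    rwa [show i ⁻¹' {i x} = {x} from
      Set.ext fun z => ⟨fun h => i.isEmbedding.injective h, fun h => congrArg i h⟩] at this
  · intro h
    apply isClosed_singleton_of_isLocallyClosed_singleton
    rw [← Set.image_singleton]
    exact h.isLocallyClosed.image i.isEmbedding.isInducing i.isLocallyClosed_range

/-- `Spec A` is the closure of `η` inside an affine neighbourhood of `y`. It contains all points
between `η` and `y`, since they lie in every neighbourhood of `y`. -/
lemma exists_isImmersion_range_eq {Y : Scheme.{u}} {η y : Y} (h : η ⤳ y) :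
    ∃ (A : CommRingCat.{u}) (_ : IsDomain A) (i : Spec A ⟶ Y) (b : Spec A), IsImmersion i ∧
      LocallyOfFiniteType i ∧ y ∈ Set.range i ∧ b.asIdeal = ⊥ ∧ i b = η ∧
        ∀ ζ, η ⤳ ζ → ζ ⤳ y → ζ ∈ Set.range i := by
  obtain ⟨U, hU, hyU, -⟩ := exists_isAffineOpen_mem_and_subset (x := y) (U := ⊤) trivial
  let P : ↥(Spec Γ(Y, U)) := hU.primeIdealOf ⟨η, h.mem_open U.2 hyU⟩
  have hP : hU.fromSpec P = η := hU.fromSpec_primeIdealOf ⟨η, h.mem_open U.2 hyU⟩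
  have hPp : P.asIdeal.IsPrime := P.isPrime
  let A : CommRingCat.{u} := .of (Γ(Y, U) ⧸ P.asIdeal)
  let c : Spec A ⟶ Spec Γ(Y, U) := Spec.map (CommRingCat.ofHom (Ideal.Quotient.mk P.asIdeal))
  have hc : IsClosedImmersion c := IsClosedImmersion.spec_of_surjective _ Ideal.Quotient.mk_surjective
  have hdom : IsDomain A := inferInstanceAs (IsDomain (Γ(Y, U) ⧸ P.asIdeal))
  let b : ↥(Spec A) := (⟨⊥, Ideal.isPrime_bot⟩ : PrimeSpectrum A)
  have hcP : c b = P :=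
    PrimeSpectrum.ext (RingHom.ker_eq_comap_bot _ |>.symm.trans Ideal.mk_ker)
  have key (ζ : Y) (hζ : η ⤳ ζ) (hy : ζ ⤳ y) : ζ ∈ Set.range (c ≫ hU.fromSpec) := by
    let Q : ↥(Spec Γ(Y, U)) := hU.primeIdealOf ⟨ζ, hy.mem_open U.2 hyU⟩
    have h1 : hU.fromSpec Q = ζ := hU.fromSpec_primeIdealOf _
    have h2 : P ⤳ Q := by
      rw [← hU.fromSpec.isEmbedding.specializes_iff, hP, h1]
      exact hζ
    obtain ⟨x, hx⟩ := h2.mem_closed c.isClosedEmbedding.isClosed_range ⟨_, hcP⟩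
    exact ⟨x, by rw [Scheme.Hom.comp_apply, hx, h1]⟩
  refine ⟨A, hdom, c ≫ hU.fromSpec, b, inferInstance, inferInstance, key y h specializes_rfl, rfl,
    ?_, key⟩
  rw [Scheme.Hom.comp_apply, hcP, hP]

variable {Y' Y : Scheme.{u}} {K : Type u} [Field K] {R : CommRingCat.{u}} {φ : CommRingCat.of K ⟶ R}
  {p : Y' ⟶ Y} {π' : Y' ⟶ Spec R} {π : Y ⟶ Spec (.of K)}

lemma exists_isPullback_Spec_tensorProduct (H : IsPullback p π' π (Spec.map φ)) {A : CommRingCat.{u}}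
    (i : Spec A ⟶ Y) : ∃ (_ : Algebra K A) (_ : Algebra K R) (j : Spec (.of (A ⊗[K] R)) ⟶ Y'),
      Spec.map (CommRingCat.ofHom (algebraMap K A)) = i ≫ π ∧
      IsPullback j (Spec.map (CommRingCat.ofHom (Algebra.TensorProduct.includeLeftRingHom))) p i := by
  let ψ : CommRingCat.of K ⟶ A := Spec.preimage (i ≫ π)
  let a₁ : Algebra K A := ψ.hom.toAlgebra
  let a₂ : Algebra K R := φ.hom.toAlgebra
  have H₂ := (CommRingCat.isPushout_tensorProduct K A R).op.map Scheme.Spec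
  have hψ : Spec.map (CommRingCat.ofHom (algebraMap K A)) = i ≫ π := Spec.map_preimage _
  have H₃ : IsPullback (Spec.map _) (Spec.map _) (Spec.map φ)
    (Spec.map (CommRingCat.ofHom (algebraMap K A))) := H₂
  rw [hψ] at H₃
  exact ⟨a₁, a₂, _, hψ, IsPullback.of_right' H₃ H.flip⟩

lemma flat_of_isPullback_Spec (H : IsPullback p π' π (Spec.map φ)) : Flat p := by
  have : Flat (Spec.map φ) := by
    rw [Flat.SpecMap_iff]
    let := φ.hom.toAlgebra
    exact inferInstanceAs (Module.Flat K R)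
  exact MorphismProperty.of_isPullback H.flip this

end Chart

/-- The generic points of the irreducible components of the preimage of the closure of `η`. -/
def maximalPoints {Y' Y : Scheme.{u}} (p : Y' ⟶ Y) (η : Y) : Set Y' :=
  {η' | η ⤳ p η' ∧ ∀ ζ, ζ ⤳ η' → η ⤳ p ζ → ζ = η'}

section MaximalPoints

variable {Y' Y : Scheme.{u}} {p : Y' ⟶ Y} {η : Y}

/-- Generizations lift along flat morphisms, so a component of the preimage dominates the closure of
`η`. -/
lemma map_eq_of_mem_maximalPoints [Flat p] {η' : Y'} (h : η' ∈ maximalPoints p η) : p η' = η := by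
  obtain ⟨ζ, hζ, hpζ⟩ := Flat.generalizingMap p h.1
  rw [← h.2 ζ hζ (specializes_of_eq hpζ.symm), hpζ]

lemma finite_maximalPoints [IsNoetherian Y'] : (maximalPoints p η).Finite := by
  have hZ : IsClosed (p ⁻¹' closure {η}) := isClosed_closure.preimage p.continuous
  obtain ⟨S, hS, hSc, hSi, hSU⟩ :=
    TopologicalSpace.NoetherianSpace.exists_finite_set_isClosed_irreducible hZ
  have key (t : S) : ∃ x : Y', IsGenericPoint x t.1 := QuasiSober.sober (hSi t t.2) (hSc t t.2)
  choose x hx using key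
  have := hS.to_subtype
  refine (Set.finite_range x).subset fun η' hη' => ?_
  have h1 : η' ∈ ⋃₀ S := hSU ▸ specializes_iff_mem_closure.1 hη'.1
  obtain ⟨t, ht, hyt⟩ := Set.mem_sUnion.1 h1
  refine ⟨⟨t, ht⟩, hη'.2 _ ((hx ⟨t, ht⟩).specializes hyt)
    (specializes_iff_mem_closure.2 (show x ⟨t, ht⟩ ∈ p ⁻¹' closure {η} from ?_))⟩
  rw [hSU]
  exact Set.mem_sUnion.2 ⟨t, ht, (hx ⟨t, ht⟩).mem⟩

variable {K : Type u} [Field K] {R : CommRingCat.{u}} [IsArtinianRing R] {φ : CommRingCat.of K ⟶ R}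
  {π' : Y' ⟶ Spec R} {π : Y ⟶ Spec (.of K)} (H : IsPullback p π' π (Spec.map φ))
  [LocallyOfFiniteType π]

include H in
-- On an affine chart `Spec A` of the closure of `η`, the preimage is the spectrum of `A ⊗ R` and
-- `η'` is a minimal prime, so `minimalPrimes_tensorProduct` applies. Finite type over Artinian
-- bases makes both schemes Jacobson, so closedness can be tested on charts.
lemma IsCurvePoint.of_mem_maximalPoints (hη : IsCurvePoint η) {η' : Y'}
    (h : η' ∈ maximalPoints p η) : IsCurvePoint η' := by
  have : JacobsonSpace Y := LocallyOfFiniteType.jacobsonSpace π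
  have : JacobsonSpace Y' := by
    have : LocallyOfFiniteType π' := MorphismProperty.of_isPullback H inferInstance
    exact LocallyOfFiniteType.jacobsonSpace π'
  have := flat_of_isPullback_Spec H
  -- For each specialization `ζ` of `η'`, a chart that contains both points. The properties of `A`
  -- used later say that the closure of `η` is a curve.
  have key (ζ : Y') (hζ : η' ⤳ ζ) : ∃ (A : CommRingCat.{u}) (_ : IsDomain A) (_ : Algebra K A)
      (_ : Algebra K R) (j : Spec (.of (A ⊗[K] R)) ⟶ Y') (Q' Q : Spec (.of (A ⊗[K] R))),
      ¬ IsField A ∧ (∀ P : Ideal A, P.IsPrime → P ≠ ⊥ → P.IsMaximal) ∧ Algebra.FiniteType K A ∧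
      IsImmersion j ∧ j Q = η' ∧ j Q' = ζ ∧ Q.asIdeal ∈ minimalPrimes (A ⊗[K] R) := by
    obtain ⟨A, hA, i, b, hi, hfin, ⟨z, hz⟩, hb, hbot, hr⟩ :=
      exists_isImmersion_range_eq (h.1.trans (hζ.map p.continuous))
    obtain ⟨alg₁, alg₂, j, hj, Hj⟩ := exists_isPullback_Spec_tensorProduct H i
    refine ⟨A, hA, alg₁, alg₂, j, ?_⟩
    have hrange : ∀ ζ' : Y', p ζ' ∈ Set.range i → ∃ Q, j Q = ζ' := by
      rintro ζ' ⟨a, ha⟩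
      obtain ⟨Q, hQ, -⟩ := Scheme.exists_preimage_of_isPullback Hj ζ' a ha.symm
      exact ⟨Q, hQ⟩
    obtain ⟨Q', hQ'⟩ := hrange ζ ⟨z, hz⟩
    obtain ⟨Q, hQ⟩ := hrange η' (hr _ h.1 (hζ.map p.continuous))
    have hjI : IsImmersion j := MorphismProperty.of_isPullback Hj.flip hi
    refine ⟨Q', Q, fun hf => hη.not_isClosed ?_, fun P hP hP0 => ?_, ?_,
      hjI, hQ, hQ', ⟨Q.isPrime, bot_le⟩, ?_⟩
    · rw [← hbot, isClosed_singleton_map_iff_of_isImmersion]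
      refine (PrimeSpectrum.isClosed_singleton_iff_isMaximal _).2 ?_
      let := hf.toField
      exact hb ▸ Ideal.bot_isMaximal
    · let P' : ↥(Spec A) := (⟨P, hP⟩ : PrimeSpectrum A)
      have h1 := hη.isClosed_of_specializes (i P') ?_ ?_
      · rw [isClosed_singleton_map_iff_of_isImmersion] at h1
        exact (PrimeSpectrum.isClosed_singleton_iff_isMaximal _).1 h1
      · rw [← hbot, i.isEmbedding.specializes_iff]
        exact (PrimeSpectrum.le_iff_specializes b _).1 (hb.trans_le bot_le)
      · rw [← hbot]
        exact fun he => hP0 ((congrArg PrimeSpectrum.asIdeal (i.isEmbedding.injective he)).trans hb)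
    · have h1 : LocallyOfFiniteType (Spec.map (CommRingCat.ofHom (algebraMap K A))) :=
        hj ▸ inferInstance
      exact RingHom.finiteType_algebraMap.1 (HasRingHomProperty.Spec_iff.1 h1)
    · rintro Q₁ ⟨hQ₁, -⟩ hle
      let Q₁' : ↥(Spec (.of (A ⊗[K] R))) := (⟨Q₁, hQ₁⟩ : PrimeSpectrum _)
      have h1 : j Q₁' ⤳ η' := by
        rw [← hQ, j.isEmbedding.specializes_iff]
        exact (PrimeSpectrum.le_iff_specializes Q₁' Q).1 hle
      have h2 : η ⤳ p (j Q₁') := by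
        rw [← Scheme.Hom.comp_apply, Hj.w, Scheme.Hom.comp_apply, ← hbot,
          i.isEmbedding.specializes_iff]
        exact (PrimeSpectrum.le_iff_specializes b _).1 (hb.trans_le bot_le)
      have h3 := h.2 _ h1 h2
      rw [← hQ] at h3
      exact (congrArg PrimeSpectrum.asIdeal (j.isEmbedding.injective h3)).ge
  constructor
  · obtain ⟨A, hA, _, _, j, Q', Q, h1, h2, h3, h4, hQ, hQ', hQm⟩ := key η' specializes_rfl
    rw [← hQ, isClosed_singleton_map_iff_of_isImmersion]
    exact fun hc => (minimalPrimes_tensorProduct h1 h2 Q.asIdeal hQm).1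
      ((PrimeSpectrum.isClosed_singleton_iff_isMaximal Q).1 hc)
  · intro ζ hζ hne
    obtain ⟨A, hA, _, _, j, Q', Q, h1, h2, h3, h4, hQ, hQ', hQm⟩ := key ζ hζ
    rw [← hQ', isClosed_singleton_map_iff_of_isImmersion]
    refine (PrimeSpectrum.isClosed_singleton_iff_isMaximal Q').2
      ((minimalPrimes_tensorProduct h1 h2 Q.asIdeal hQm).2 Q'.asIdeal Q'.isPrime ?_)
    have := h4
    have h5 : Q ⤳ Q' := by rw [← j.isEmbedding.specializes_iff, hQ, hQ']; exact hζ
    refine lt_of_le_of_ne ((PrimeSpectrum.le_iff_specializes Q Q').2 h5) fun he => hne ?_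
    rw [← hQ, ← hQ', PrimeSpectrum.ext he]

end MaximalPoints

open TensorProduct

/-! ### Flat pullback of principal divisors -/

section Flat

/-- A nonzerodivisor on `A ⧸ P` stays one after the flat base change to `B`. -/
lemma mem_map_of_mul_mem_of_flat {A B : Type*} [CommRing A] [CommRing B] [Algebra A B]
    [Module.Flat A B] (P : Ideal A) (a : A) (h : ∀ x, a * x ∈ P → x ∈ P) (x : B)
    (hx : algebraMap A B a * x ∈ P.map (algebraMap A B)) : x ∈ P.map (algebraMap A B) := by
  have h1 : IsSMulRegular (A ⧸ P) a := by
    refine isSMulRegular_iff_right_eq_zero_of_smul.2 fun y hy => ?_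
    obtain ⟨y, rfl⟩ := Ideal.Quotient.mk_surjective y
    exact Ideal.Quotient.eq_zero_iff_mem.2 (h y (Ideal.Quotient.eq_zero_iff_mem.1 hy))
  have h2 : IsSMulRegular (B ⊗[A] (A ⧸ P)) (algebraMap A B a) :=
    h1.of_flat_of_isBaseChange (TensorProduct.isBaseChange A (A ⧸ P) B)
  let e := (Algebra.TensorProduct.quotIdealMapEquivTensorQuot B P).toLinearEquiv
  have h3 := isSMulRegular_iff_right_eq_zero_of_smul.1 h2 (e (Ideal.Quotient.mk _ x)) (by
    rw [← map_smul]
    refine (LinearEquiv.map_eq_zero_iff e).2 (Ideal.Quotient.eq_zero_iff_mem.2 hx))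
  exact Ideal.Quotient.eq_zero_iff_mem.1 ((LinearEquiv.map_eq_zero_iff e).1 h3)

lemma length_quotient_map_of_flat {A B : Type*} [CommRing A] [CommRing B] [IsLocalRing A]
    [IsLocalRing B] [Algebra A B] [IsLocalHom (algebraMap A B)] [Module.Flat A B] (I : Ideal A) :
    Module.length B (B ⧸ I.map (algebraMap A B)) = Module.length A (A ⧸ I) *
      Module.length B (B ⧸ (IsLocalRing.maximalIdeal A).map (algebraMap A B)) := by
  rw [← IsLocalRing.length_baseChange]
  exact (Algebra.TensorProduct.quotIdealMapEquivTensorQuot B I).toLinearEquiv.length_eq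

end Flat

section Stalk

variable {Y' Y : Scheme.{u}} (p : Y' ⟶ Y) {η : Y} {η' y' : Y'}

lemma map_primeAt_le_iff (hη : η ⤳ p y') (Q : Spec (Y'.presheaf.stalk y')) :
    (primeAt hη).map (p.stalkMap y').hom ≤ Q.asIdeal ↔ η ⤳ p (Y'.fromSpecStalk y' Q) := by
  rw [Ideal.map_le_iff_le_comap]
  refine (primeAt_le_iff hη (Spec.map (p.stalkMap y') Q)).trans (iff_of_eq ?_)
  rw [← Scheme.Hom.comp_apply, Scheme.SpecMap_stalkMap_fromSpecStalk, Scheme.Hom.comp_apply]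

lemma evalAt_stalkMap (h : η' ⤳ y') (a : Y.presheaf.stalk (p y')) :
    evalAt h ((p.stalkMap y').hom a) =
      (p.residueFieldMap η').hom (evalAt (h.map p.continuous) a) := by
  have h1 := Scheme.Hom.stalkSpecializes_stalkMap_apply p _ _ h a
  have h2 := congrArg (fun g => g.hom (Y.presheaf.stalkSpecializes (h.map p.continuous) a))
    (Scheme.residue_residueFieldMap p η')
  exact (congrArg (Y'.residue η').hom h1).symm.trans h2.symm

/-- The multiplicity of the fibre through a point of `maximalPoints p η`, in terms of a
specialization. -/
lemma map_map_primeAt (hη : η ⤳ p y') (h : η' ⤳ y') (hpη : p η' = η) :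
    ((primeAt hη).map (p.stalkMap y').hom).map (Y'.presheaf.stalkSpecializes h).hom =
      (IsLocalRing.maximalIdeal (Y.presheaf.stalk (p η'))).map (p.stalkMap η').hom := by
  subst hpη
  let := (Y.presheaf.stalkSpecializes hη).hom.toAlgebra
  have := isLocalization_stalkSpecializes hη
  rw [← IsLocalization.AtPrime.map_eq_maximalIdeal (primeAt hη) (Y.presheaf.stalk (p η')),
    Ideal.map_map, Ideal.map_map, RingHom.algebraMap_toAlgebra, ← CommRingCat.hom_comp,
    ← CommRingCat.hom_comp]
  exact congrArg (fun g => Ideal.map (CommRingCat.Hom.hom g) (primeAt hη))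
    (Scheme.Hom.stalkSpecializes_stalkMap p _ _ h).symm

/-- With `exists_primeAt_eq`, this matches the components of the preimage through `y'` with the
minimal primes over the extended ideal. -/
lemma primeAt_mem_minimalPrimes (hη : η ⤳ p y') (h : η' ⤳ y') (hη' : η' ∈ maximalPoints p η) :
    primeAt h ∈ ((primeAt hη).map (p.stalkMap y').hom).minimalPrimes := by
  refine ⟨⟨inferInstance, (map_primeAt_le_iff p hη ⟨primeAt h, inferInstance⟩).2 ?_⟩, ?_⟩
  · rw [fromSpecStalk_primeAt]; exact hη'.1
  · rintro Q ⟨hQ, hIQ⟩ hle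
    let Q' : ↥(Spec (Y'.presheaf.stalk y')) := (⟨Q, hQ⟩ : PrimeSpectrum _)
    let P' : ↥(Spec (Y'.presheaf.stalk y')) := (⟨primeAt h, inferInstance⟩ : PrimeSpectrum _)
    have h1 : Y'.fromSpecStalk y' Q' ⤳ Y'.fromSpecStalk y' P' :=
      ((PrimeSpectrum.le_iff_specializes Q' P').1 hle).map (Y'.fromSpecStalk y').continuous
    have h2 : Y'.fromSpecStalk y' P' = η' := fromSpecStalk_primeAt h
    rw [h2] at h1
    have h3 := hη'.2 _ h1 ((map_primeAt_le_iff p hη ⟨Q, hQ⟩).1 hIQ)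
    rw [← h2] at h3
    exact (congrArg PrimeSpectrum.asIdeal ((Y'.fromSpecStalk y').isEmbedding.injective h3)).ge

lemma exists_primeAt_eq (hη : η ⤳ p y') (Q : Ideal (Y'.presheaf.stalk y'))
    (hQ : Q ∈ ((primeAt hη).map (p.stalkMap y').hom).minimalPrimes) :
    ∃ (η' : Y') (h : η' ⤳ y'), η' ∈ maximalPoints p η ∧ primeAt h = Q := by
  have hQp := hQ.1.1
  let Q' : ↥(Spec (Y'.presheaf.stalk y')) := (⟨Q, hQp⟩ : PrimeSpectrum _)
  have h := fromSpecStalk_specializes Q'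
  refine ⟨Y'.fromSpecStalk y' Q', h, ⟨(map_primeAt_le_iff p hη Q').1 hQ.1.2, fun ζ hζ hpζ => ?_⟩, ?_⟩
  · have h1 : Y'.fromSpecStalk y' ⟨primeAt (hζ.trans h), inferInstance⟩ = ζ :=
      fromSpecStalk_primeAt _
    have h2 : primeAt (hζ.trans h) ≤ Q := by
      refine (primeAt_le_iff (hζ.trans h) Q').2 hζ
    have h3 := hQ.2 ⟨inferInstance, (map_primeAt_le_iff p hη ⟨primeAt (hζ.trans h), inferInstance⟩).2
      (by rw [h1]; exact hpζ)⟩ h2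
    rw [← h1]
    exact congrArg _ (PrimeSpectrum.ext (le_antisymm h2 h3))
  · exact congrArg PrimeSpectrum.asIdeal ((Y'.fromSpecStalk y').isEmbedding.injective
      (fromSpecStalk_primeAt h))

/-- The point `η'` is minimal over the extended ideal, so the maximal ideal is the only prime of the
quotient, which is Artinian. -/
lemma length_fibre_ne_top [IsLocallyNoetherian Y'] [Flat p] (hη' : η' ∈ maximalPoints p η) :
    Module.length (Y'.presheaf.stalk η') (Y'.presheaf.stalk η' ⧸
      (IsLocalRing.maximalIdeal (Y.presheaf.stalk (p η'))).map (p.stalkMap η').hom) ≠ ⊤ := by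
  have hpη := map_eq_of_mem_maximalPoints hη'
  rw [← map_map_primeAt p (specializes_of_eq hpη.symm) specializes_rfl hpη,
    TopCat.Presheaf.stalkSpecializes_refl, CommRingCat.hom_id, Ideal.map_id]
  set I := (primeAt (specializes_of_eq hpη.symm)).map (p.stalkMap η').hom
  have h1 := primeAt_mem_minimalPrimes p (specializes_of_eq hpη.symm) specializes_rfl hη'
  have h2 : primeAt (specializes_rfl : η' ⤳ η') = IsLocalRing.maximalIdeal _ := by
    rw [primeAt_eq_comap, TopCat.Presheaf.stalkSpecializes_refl, CommRingCat.hom_id]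
    rfl
  rw [h2] at h1
  have : IsArtinianRing (Y'.presheaf.stalk η' ⧸ I) := by
    rw [isArtinianRing_iff_isNoetherianRing_krullDimLE_zero]
    refine ⟨inferInstance, Ring.krullDimLE_zero_iff.2 fun J hJ => ?_⟩
    have h3 : J.comap (Ideal.Quotient.mk I) = IsLocalRing.maximalIdeal _ := by
      refine le_antisymm (IsLocalRing.le_maximalIdeal (Ideal.comap_ne_top _ hJ.ne_top)) ?_
      refine h1.2 ⟨inferInstance, ?_⟩ (IsLocalRing.le_maximalIdeal (Ideal.comap_ne_top _ hJ.ne_top))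
      exact Ideal.mk_ker.symm.trans_le (Ideal.comap_mono bot_le)
    have h4 : (J.comap (Ideal.Quotient.mk I)).IsMaximal := h3 ▸ inferInstance
    rw [← Ideal.map_comap_of_surjective (Ideal.Quotient.mk I) Ideal.Quotient.mk_surjective J]
    exact Ideal.IsMaximal.map_of_surjective_of_ker_le (f := Ideal.Quotient.mk I)
      Ideal.Quotient.mk_surjective
      ((Ideal.mk_ker (I := I)).trans_le (h1.1.2.trans h3.ge))
  rw [Module.length_ne_top_iff, isFiniteLength_iff_isNoetherian_isArtinian]
  exact ⟨inferInstance, isArtinian_of_surjective_algebraMap (M := Y'.presheaf.stalk η' ⧸ I)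
    (Ideal.Quotient.mk_surjective (I := I))⟩

/-- The order of vanishing of a function on the preimage of a curve is the sum over the components
of the multiplicities times the orders of vanishing on them. -/
theorem ordLen_mul_length_fibre [IsLocallyNoetherian Y'] [Flat p] (hη : η ⤳ p y')
    (hcurve : ∀ η' ∈ maximalPoints p η, IsCurvePoint η') (a : Y.presheaf.stalk (p y'))
    (ha : evalAt hη a ≠ 0) [Fintype {η' // η' ∈ maximalPoints p η ∧ η' ⤳ y'}] :
    ordLen hη a * Module.length (Y'.presheaf.stalk y') (Y'.presheaf.stalk y' ⧸
      (IsLocalRing.maximalIdeal (Y.presheaf.stalk (p y'))).map (p.stalkMap y').hom) =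
    ∑ η' : {η' // η' ∈ maximalPoints p η ∧ η' ⤳ y'},
      Module.length (Y'.presheaf.stalk η'.1) (Y'.presheaf.stalk η'.1 ⧸
        (IsLocalRing.maximalIdeal (Y.presheaf.stalk (p η'.1))).map (p.stalkMap η'.1).hom) *
      ordLen η'.2.2 ((p.stalkMap y').hom a) := by
  let := (p.stalkMap y').hom.toAlgebra
  have : Module.Flat (Y.presheaf.stalk (p y')) (Y'.presheaf.stalk y') := Flat.stalkMap p y'
  have : IsLocalHom (algebraMap (Y.presheaf.stalk (p y')) (Y'.presheaf.stalk y')) :=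
    inferInstanceAs (IsLocalHom (p.stalkMap y').hom)
  let (η' : {η' // η' ∈ maximalPoints p η ∧ η' ⤳ y'}) :
    Algebra (Y'.presheaf.stalk y') (Y'.presheaf.stalk η'.1) :=
      (Y'.presheaf.stalkSpecializes η'.2.2).hom.toAlgebra
  have hloc (η' : {η' // η' ∈ maximalPoints p η ∧ η' ⤳ y'}) :
    IsLocalization.AtPrime (Y'.presheaf.stalk η'.1) (primeAt η'.2.2) :=
      isLocalization_stalkSpecializes η'.2.2
  -- The length of the local ring at `y'` modulo the extensions of the prime of `η` and of `a` is
  -- computed twice: by flatness, and by summing over components.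
  have h1 := length_quotient_map_of_flat (B := Y'.presheaf.stalk y') (primeAt hη ⊔ Ideal.span {a})
  have h2 := length_quotient_sup_span ((primeAt hη).map (p.stalkMap y').hom)
    ((p.stalkMap y').hom a) (fun η' : {η' // η' ∈ maximalPoints p η ∧ η' ⤳ y'} => primeAt η'.2.2)
    ?_ ?_ (fun η' => Y'.presheaf.stalk η'.1) ?_ ?_ ?_
  · rw [Ideal.map_sup, Ideal.map_span, Set.image_singleton] at h1
    refine h1.symm.trans (h2.trans (Finset.sum_congr rfl fun η' _ => ?_))
    have h3 := map_map_primeAt p hη η'.2.2 (map_eq_of_mem_maximalPoints η'.2.1)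
    rw [← h3]
    rfl
  · intro η₁ η₂ h12
    apply Subtype.ext
    rw [← fromSpecStalk_primeAt η₁.2.2, ← fromSpecStalk_primeAt η₂.2.2]
    exact congrArg _ (PrimeSpectrum.ext h12)
  · ext Q
    constructor
    · rintro ⟨η', rfl⟩
      exact primeAt_mem_minimalPrimes p hη η'.2.2 η'.2.1
    · intro hQ
      obtain ⟨η', h, hη', rfl⟩ := exists_primeAt_eq p hη Q hQ
      exact ⟨⟨η', hη', h⟩, rfl⟩
  · intro Q hQ hIQ
    obtain ⟨Q₀, hQ₀, hle⟩ := Ideal.exists_minimalPrimes_le hIQ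
    obtain ⟨η', h, hη', rfl⟩ := exists_primeAt_eq p hη Q₀ hQ₀
    refine ((hcurve η' hη').eq_of_le h Q hle).imp (fun h => by rw [h]; exact hQ₀) ?_
    rintro rfl
    infer_instance
  · rintro ⟨η', hη', h⟩ hmem
    have h3 : evalAt h ((p.stalkMap y').hom a) = 0 := hmem
    rw [evalAt_stalkMap, map_eq_zero] at h3
    have := map_eq_of_mem_maximalPoints hη'
    subst this
    exact ha h3
  · exact mem_map_of_mul_mem_of_flat _ a fun x hx =>
      ((inferInstance : (primeAt hη).IsPrime).mem_or_mem hx).resolve_left ha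

end Stalk

section PullbackCycle

variable {Y' Y : Scheme.{u}} {p : Y' ⟶ Y}

lemma IsPullbackCycle.zero : IsPullbackCycle p 0 0 := fun y => by split_ifs <;> simp

lemma IsPullbackCycle.add {z₁ z₂ : ZeroCycle Y} {w₁ w₂ : ZeroCycle Y'}
    (h₁ : IsPullbackCycle p z₁ w₁) (h₂ : IsPullbackCycle p z₂ w₂) :
    IsPullbackCycle p (z₁ + z₂) (w₁ + w₂) := fun y => by
  rw [Finsupp.add_apply, h₁ y, h₂ y]
  split_ifs
  · rw [Finsupp.add_apply, add_mul]
  · rfl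

lemma IsPullbackCycle.neg {z : ZeroCycle Y} {w : ZeroCycle Y'} (h : IsPullbackCycle p z w) :
    IsPullbackCycle p (-z) (-w) := fun y => by
  rw [Finsupp.neg_apply, h y]
  split_ifs
  · rw [Finsupp.neg_apply, neg_mul]
  · rfl

lemma IsPullbackCycle.sub {z₁ z₂ : ZeroCycle Y} {w₁ w₂ : ZeroCycle Y'}
    (h₁ : IsPullbackCycle p z₁ w₁) (h₂ : IsPullbackCycle p z₂ w₂) :
    IsPullbackCycle p (z₁ - z₂) (w₁ - w₂) := by
  simpa only [sub_eq_add_neg] using h₁.add h₂.neg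

lemma IsPullbackCycle.smul {z : ZeroCycle Y} {w : ZeroCycle Y'} (h : IsPullbackCycle p z w)
    (n : ℤ) : IsPullbackCycle p (n • z) (n • w) := fun y => by
  rw [Finsupp.smul_apply, h y]
  split_ifs
  · rw [Finsupp.smul_apply, smul_eq_mul, smul_eq_mul, mul_assoc]
  · simp

lemma IsPullbackCycle.unique {z : ZeroCycle Y} {w₁ w₂ : ZeroCycle Y'}
    (h₁ : IsPullbackCycle p z w₁) (h₂ : IsPullbackCycle p z w₂) : w₁ = w₂ :=
  Finsupp.ext fun y => (h₁ y).trans (h₂ y).symm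

end PullbackCycle

section BaseChange

variable {Y' Y : Scheme.{u}} {p : Y' ⟶ Y} {η : Y}

/-- The pullback of a rational function on the closure of `η` to a component of the preimage. -/
lemma exists_evalAt_stalkMap_eq {f : Y.residueField η} (hf : f ≠ 0) {η' : Y'} (hη' : p η' = η) :
    ∃ f' : Y'.residueField η', f' ≠ 0 ∧ ∀ (y' : Y') (h : η' ⤳ y') (hη : η ⤳ p y')
      (a b : Y.presheaf.stalk (p y')), evalAt hη b ≠ 0 → f * evalAt hη b = evalAt hη a →
        evalAt h ((p.stalkMap y').hom b) ≠ 0 ∧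
        f' * evalAt h ((p.stalkMap y').hom b) = evalAt h ((p.stalkMap y').hom a) := by
  subst hη'
  refine ⟨(p.residueFieldMap η').hom f, (map_ne_zero _).2 hf, fun y' h hη a b hb hab => ?_⟩
  rw [evalAt_stalkMap, evalAt_stalkMap, ← map_mul]
  exact ⟨(map_ne_zero _).2 hb, congrArg _ hab⟩

lemma evalAt_stalkMap_ne_zero {η' y' : Y'} (hη : η ⤳ p y') (h : η' ⤳ y') (hη' : p η' = η)
    {c : Y.presheaf.stalk (p y')} (hc : evalAt hη c ≠ 0) :
    evalAt h ((p.stalkMap y').hom c) ≠ 0 := by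
  subst hη'
  rw [evalAt_stalkMap]
  exact (map_ne_zero _).2 hc

lemma isUnit_of_evalAt_ne_zero {y : Y} (h : η ⤳ y) (hy : y = η) {b : Y.presheaf.stalk y}
    (hb : evalAt h b ≠ 0) : IsUnit b := by
  subst hy
  by_contra hn
  apply hb
  rw [evalAt, TopCat.Presheaf.stalkSpecializes_refl, Category.id_comp]
  exact (IsLocalRing.residue_eq_zero_iff _).2 hn

/-- The pullback of the divisor of `f` is the sum, over the components of the preimage, of their
multiplicities times the divisors of the pulled back functions. At each point this is
`ordLen_mul_length_fibre` for a numerator and a denominator of `f`. -/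
theorem IsDivisorAt.exists_isPullbackCycle [IsNoetherian Y'] [IsLocallyNoetherian Y] [Flat p]
    (hη : IsCurvePoint η) {f : Y.residueField η} {z : ZeroCycle Y} (hz : IsDivisorAt z η f)
    (hcurve : ∀ η' ∈ maximalPoints p η, IsCurvePoint η') :
    ∃ w ∈ ratEquivZero Y', IsPullbackCycle p z w := by
  classical
  have hfin : Finite (maximalPoints p η) := finite_maximalPoints.to_subtype
  let : Fintype (maximalPoints p η) := Fintype.ofFinite _
  choose f' hf' hev using fun η' : maximalPoints p η =>
    exists_evalAt_stalkMap_eq hz.ne_zero (map_eq_of_mem_maximalPoints η'.2)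
  choose w hw using fun η' : maximalPoints p η => exists_isDivisorAt (hcurve η'.1 η'.2) (hf' η')
  have hmem (η' : maximalPoints p η) : w η' ∈ ratEquivZero Y' :=
    AddSubgroup.subset_closure ((hw η').isDivisorOnCurve (hcurve _ η'.2))
  refine ⟨∑ η', (fibreMultiplicity p η'.1 : ℤ) • w η', sum_mem fun η' _ =>
    AddSubgroup.zsmul_mem (ratEquivZero Y') (hmem η') _, ?_⟩
  rintro ⟨y', hy'⟩
  rw [Finsupp.finsetSum_apply]
  simp only [Finsupp.smul_apply, smul_eq_mul]
  by_cases hs : η ⤳ p y'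
  swap
  · rw [Finset.sum_eq_zero, eq_comm]
    · split_ifs with h
      · rw [hz.eq_zero _ h hs, zero_mul]
      · rfl
    · intro η' _
      rw [(hw η').eq_zero, mul_zero]
      intro h
      exact hs (map_eq_of_mem_maximalPoints η'.2 ▸ h.map p.continuous)
  obtain ⟨a, b, hb, hab⟩ := exists_evalAt_mul_eq hs f
  have ha : evalAt hs a ≠ 0 := hab ▸ mul_ne_zero hz.ne_zero hb
  have hwy (η' : maximalPoints p η) (h : η'.1 ⤳ y') : w η' ⟨y', hy'⟩ +
      (ordLen h ((p.stalkMap y').hom b)).toNat = (ordLen h ((p.stalkMap y').hom a)).toNat := by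
    have h1 := hev η' y' h hs a b hb hab
    exact (hw η').add_eq y' hy' h _ _ h1.1 h1.2
  by_cases hcl : IsClosed ({p y'} : Set Y)
  · rw [dif_pos hcl]
    have hzy := hz.add_eq (p y') hcl hs a b hb hab
    let : Fintype {η' // η' ∈ maximalPoints p η ∧ η' ⤳ y'} :=
      Fintype.ofInjective (fun x => (⟨x.1, x.2.1⟩ : maximalPoints p η))
        fun x y h => Subtype.ext congr(($h).1)
    -- The local identity, with the sum over components through `y'` extended by zero to all
    -- components.
    have key (c : Y.presheaf.stalk (p y')) (hc : evalAt hs c ≠ 0) :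
        ((ordLen hs c).toNat : ℤ) * fibreMultiplicity p y' =
          ∑ η' : maximalPoints p η, (fibreMultiplicity p η'.1 : ℤ) *
            if h : η'.1 ⤳ y' then ((ordLen h ((p.stalkMap y').hom c)).toNat : ℤ) else 0 := by
      have h1 := congrArg ENat.toNat (ordLen_mul_length_fibre p hs hcurve c hc)
      have hev' (η' : {η' // η' ∈ maximalPoints p η ∧ η' ⤳ y'}) :
          ordLen η'.2.2 ((p.stalkMap y').hom c) ≠ ⊤ := by
        refine (hcurve _ η'.2.1).ordLen_ne_top _ _ ?_
        exact evalAt_stalkMap_ne_zero hs η'.2.2 (map_eq_of_mem_maximalPoints η'.2.1) hc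
      rw [ENat.toNat_mul, ENat.toNat_sum] at h1
      swap
      · exact fun η' _ => WithTop.mul_ne_top (length_fibre_ne_top p η'.2.1) (hev' η')
      have h2 := congrArg (Nat.cast : ℕ → ℤ) h1
      rw [Nat.cast_mul, Nat.cast_sum] at h2
      refine h2.trans ?_
      refine Finset.sum_of_injOn (fun x => (⟨x.1, x.2.1⟩ : maximalPoints p η))
        (fun x _ y _ h => Subtype.ext congr(($h).1)) (fun _ _ => Finset.mem_univ _)
        (fun η' _ hη' => ?_) (fun η' _ => ?_)
      · rw [dif_neg, mul_zero]
        exact fun h => hη' ⟨⟨η'.1, η'.2, h⟩, Finset.mem_coe.2 (Finset.mem_univ _), rfl⟩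
      · rw [ENat.toNat_mul, Nat.cast_mul, dif_pos η'.2.2]
        rfl
    have h1 := key a ha
    have h2 := key b hb
    rw [← hzy, add_mul, h2, ← eq_sub_iff_add_eq, ← Finset.sum_sub_distrib] at h1
    rw [h1]
    refine Finset.sum_congr rfl fun η' _ => ?_
    rw [← mul_sub]
    congr 1
    split_ifs with h
    · rw [← hwy η' h]; ring
    · rw [(hw η').eq_zero _ _ h, sub_zero]
  · rw [dif_neg hcl]
    refine Finset.sum_eq_zero fun η' _ => ?_
    -- If the image of the closed point `y'` is not closed, it is `η`. Numerator and denominator are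
    -- then units and the order is zero, as the definition of the pullback demands.
    have hpy : p y' = η := by
      by_contra hne
      exact hcl (hη.isClosed_of_specializes _ hs hne)
    by_cases h : η'.1 ⤳ y'
    · have h1 := hwy η' h
      rw [ordLen_of_isUnit h ((isUnit_of_evalAt_ne_zero hs hpy ha).map _),
        ordLen_of_isUnit h ((isUnit_of_evalAt_ne_zero hs hpy hb).map _)] at h1
      simp only [ENat.toNat_zero, Nat.cast_zero, add_zero] at h1
      rw [h1, mul_zero]
    · rw [(hw η').eq_zero _ _ h, mul_zero]

/-- Rational equivalence is preserved by the base change along a morphism from the spectrum of an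
Artinian ring to the spectrum of a field. -/
theorem exists_isPullbackCycle {K : Type u} [Field K] {T : Scheme.{u}} [IsArtinianScheme T]
    [IsAffine T] {t : T ⟶ Spec (.of K)} {π' : Y' ⟶ T} {π : Y ⟶ Spec (.of K)}
    (H : IsPullback p π' π t) [LocallyOfFiniteType π] [QuasiCompact π] {z : ZeroCycle Y}
    (hz : z ∈ ratEquivZero Y) : ∃ w ∈ ratEquivZero Y', IsPullbackCycle p z w := by
  let φ : CommRingCat.of K ⟶ Γ(T, ⊤) := Spec.preimage (T.isoSpec.inv ≫ t)
  have hφ : Spec.map φ = T.isoSpec.inv ≫ t := Spec.map_preimage _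
  have H' : IsPullback p (π' ≫ T.isoSpec.hom) π (Spec.map φ) :=
    H.of_iso (Iso.refl _) (Iso.refl _) T.isoSpec (Iso.refl _) (by simp) (by simp) (by simp)
      (by simp [hφ])
  have hlft : LocallyOfFiniteType π' := MorphismProperty.of_isPullback H inferInstance
  have hqc : QuasiCompact π' := MorphismProperty.of_isPullback H inferInstance
  have h1 : IsLocallyNoetherian Y := LocallyOfFiniteType.isLocallyNoetherian π
  have h2 : IsLocallyNoetherian Y' := LocallyOfFiniteType.isLocallyNoetherian π'
  have h3 : CompactSpace Y' := QuasiCompact.compactSpace_of_compactSpace π'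
  have h4 : IsNoetherian Y' := {}
  have hflat : Flat p := flat_of_isPullback_Spec H'
  refine AddSubgroup.closure_induction (fun z hz => ?_) ⟨0, zero_mem _, .zero⟩ ?_ ?_ hz
  · obtain ⟨η, f, hη, hzf⟩ := IsDivisorOnCurve.exists_isDivisorAt hz
    exact hzf.exists_isPullbackCycle hη fun η' hη' => hη.of_mem_maximalPoints H' hη'
  · rintro x y - - ⟨w₁, h₁, h₁'⟩ ⟨w₂, h₂, h₂'⟩
    exact ⟨_, add_mem h₁ h₂, h₁'.add h₂'⟩
  · rintro x - ⟨w, h, h'⟩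
    exact ⟨_, neg_mem h, h'.neg⟩

end BaseChange

open Module

/-! ### The Hilbert function and the degree of a principal divisor -/

section Filtration

variable {Ω L : Type*} [Field Ω] [CommRing L] [IsDomain L] [Algebra Ω L]

/-- If a filtration `V` of a subalgebra `B` satisfies `V (r + 1) = F V (r + 1 - d) + V r` for large
`r`, then the dimension of `B / F B` is the difference of the dimensions of `V (r + d)` and
`V r`. -/
theorem finrank_quotient_add_finrank (V : ℕ → Submodule Ω L) (hV : Monotone V)
    [∀ r, FiniteDimensional Ω (V r)] (B : Subalgebra Ω L) (hB : ∀ x, x ∈ B ↔ ∃ r, x ∈ V r) (d : ℕ)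
    (F : B) (hF : F ≠ 0) (hFV : ∀ r, ∀ x ∈ V r, F * x ∈ V (r + d)) (r₀ : ℕ)
    (h : ∀ r ≥ r₀, ∀ x ∈ V (r + d + 1), ∃ y ∈ V (r + 1), x - F * y ∈ V (r + d)) :
    FiniteDimensional Ω (B ⧸ Ideal.span {F}) ∧ ∃ r₁, ∀ r ≥ r₁,
      finrank Ω (V (r + d)) = finrank Ω (B ⧸ Ideal.span {F}) + finrank Ω (V r) := by
  have hF0 : (F : L) ≠ 0 := fun h0 => hF (Subtype.ext h0)
  -- Iterating the hypothesis reduces every element of `V (r + d)` modulo `F V r` to the fixed level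
  -- `r₀ + d`.
  have h1 (r : ℕ) (hr : r ≥ r₀) : ∀ x ∈ V (r + d), ∃ y ∈ V r, x - F * y ∈ V (r₀ + d) := by
    induction r, hr using Nat.le_induction with
    | base => exact fun x hx => ⟨0, zero_mem _, by simpa using hx⟩
    | succ r hr ih =>
      intro x hx
      rw [add_right_comm] at hx
      obtain ⟨y, hy, hxy⟩ := h r hr x hx
      obtain ⟨y', hy', hxy'⟩ := ih _ hxy
      refine ⟨y + y', add_mem hy (hV (Nat.le_succ r) hy'), ?_⟩
      rwa [mul_add, ← sub_sub]
  have hle (r : ℕ) : V r ≤ Subalgebra.toSubmodule B := fun x hx => (hB x).2 ⟨r, hx⟩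
  let ψ (r : ℕ) : V r →ₗ[Ω] B ⧸ Ideal.span {F} :=
    (Ideal.Quotient.mkₐ Ω (Ideal.span {F})).toLinearMap ∘ₗ Submodule.inclusion (hle r)
  have hψ (r : ℕ) (x : V r) : ψ r x = 0 ↔ ∃ y ∈ B, (x : L) = F * y := by
    refine (Ideal.Quotient.eq_zero_iff_mem.trans Ideal.mem_span_singleton').trans ?_
    constructor
    · rintro ⟨y, hy⟩
      exact ⟨y, y.2, by rw [mul_comm]; exact congr(($hy : L)).symm⟩
    · rintro ⟨y, hy, hxy⟩
      exact ⟨⟨y, hy⟩, Subtype.ext (by rw [mul_comm]; exact hxy.symm)⟩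
  have hsurj (r : ℕ) (hr : r₀ + d ≤ r) : Function.Surjective (ψ r) := by
    intro b
    obtain ⟨b, rfl⟩ := Ideal.Quotient.mk_surjective b
    obtain ⟨s, hs⟩ := (hB b).1 b.2
    obtain ⟨y, hy, hxy⟩ := h1 (s + r₀) (Nat.le_add_left _ _) b
      (hV (by omega) hs)
    refine ⟨⟨b - F * y, hV hr hxy⟩, ?_⟩
    refine Ideal.Quotient.eq.2 (Ideal.mem_span_singleton'.2 ⟨⟨-y, (hB _).2 ⟨_, neg_mem hy⟩⟩, ?_⟩)
    apply Subtype.ext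
    change -y * (F : L) = ((b : L) - F * y) - b
    ring
  have hfd : FiniteDimensional Ω (B ⧸ Ideal.span {F}) :=
    Module.Finite.of_surjective _ (hsurj _ le_rfl)
  refine ⟨hfd, ?_⟩
  -- The multiples of `F` in the level `r₀ + d`. Their quotients by `F` could lie in higher levels,
  -- but `W` is finite-dimensional, so one level `s₁` contains them all.
  let W : Submodule Ω L := (LinearMap.ker (ψ (r₀ + d))).map (V (r₀ + d)).subtype
  obtain ⟨s₁, hs₁⟩ : ∃ s₁, ∀ x ∈ W, ∃ y ∈ V s₁, x = F * y := by
    obtain ⟨S, hS⟩ : W.FG := Module.Finite.iff_fg.1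
      (inferInstanceAs (Module.Finite Ω ((LinearMap.ker (ψ (r₀ + d))).map (V (r₀ + d)).subtype)))
    have h2 (x : L) (hx : x ∈ W) : ∃ s, ∃ y ∈ V s, x = F * y := by
      obtain ⟨x, hx, rfl⟩ := hx
      obtain ⟨y, hy, hxy⟩ := (hψ _ x).1 hx
      obtain ⟨s, hs⟩ := (hB y).1 hy
      exact ⟨s, y, hs, hxy⟩
    choose! s hs using h2
    refine ⟨S.sup s, ?_⟩
    have h3 : W ≤ (V (S.sup s)).map (LinearMap.mulLeft Ω (F : L)) := by
      rw [← hS, Submodule.span_le]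
      intro x hx
      obtain ⟨y, hy, hxy⟩ := hs x (hS ▸ Submodule.subset_span hx)
      exact ⟨y, hV (Finset.le_sup hx) hy, hxy.symm⟩
    intro x hx
    obtain ⟨y, hy, hxy⟩ := h3 hx
    exact ⟨y, hy, hxy.symm⟩
  refine ⟨max r₀ s₁, fun r hr => ?_⟩
  have hker : LinearMap.ker (ψ (r + d)) =
      LinearMap.range ((LinearMap.mulLeft Ω (F : L)).restrict (p := V r) (q := V (r + d))
        (hFV r)) := by
    ext x
    constructor
    · intro hx
      obtain ⟨b, hb, hxb⟩ := (hψ _ x).1 hx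
      obtain ⟨y, hy, hxy⟩ := h1 r (le_trans (le_max_left _ _) hr) x x.2
      have hw : (x : L) - F * y ∈ W :=
        ⟨⟨_, hxy⟩, (hψ _ _).2 ⟨b - y, sub_mem hb ((hB _).2 ⟨_, hy⟩), by
          rw [mul_sub, ← hxb]⟩, rfl⟩
      obtain ⟨y', hy', hxy'⟩ := hs₁ _ hw
      refine ⟨⟨y + y', add_mem hy (hV (le_trans (le_max_right _ _) hr) hy')⟩, Subtype.ext ?_⟩
      change F * (y + y') = (x : L)
      rw [mul_add, ← hxy']
      ring
    · rintro ⟨y, rfl⟩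
      exact (hψ _ _).2 ⟨y, (hB _).2 ⟨_, y.2⟩, rfl⟩
  have h4 := LinearMap.finrank_range_add_finrank_ker (ψ (r + d))
  rw [LinearMap.range_eq_top.2 (hsurj _ (Nat.add_le_add_right (le_trans (le_max_left _ _) hr) d)),
    finrank_top, hker, LinearMap.finrank_range_of_inj] at h4
  · exact h4.symm
  · intro x y hxy
    exact Subtype.ext (mul_left_cancel₀ hF0 congr(($hxy : L)))

end Filtration

open Module

section Chart

variable {Ω L : Type*} [Field Ω] [Field L] [Algebra Ω L]

/-- The algebra generated by the quotients `m / x` for `m` in a linear system `M`. -/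
def chart (M : Submodule Ω L) (x : L) : Subalgebra Ω L :=
  Algebra.adjoin Ω {a | a * x ∈ M ∧ x ≠ 0}

variable {M : Submodule Ω L} {x x' : L}

lemma mul_pow_mem_pow (hx : x ∈ M) {r s : ℕ} (hrs : r ≤ s) {a : L} (ha : a * x ^ r ∈ M ^ r) :
    a * x ^ s ∈ M ^ s := by
  obtain ⟨s, rfl⟩ := Nat.exists_eq_add_of_le hrs
  rw [pow_add, pow_add, ← mul_assoc]
  exact Submodule.mul_mem_mul ha (Submodule.pow_mem_pow _ hx _)

lemma div_mem_chart (hx0 : x ≠ 0) {m : L} (hm : m ∈ M) : m / x ∈ chart M x :=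
  Algebra.subset_adjoin ⟨by rwa [div_mul_cancel₀ _ hx0], hx0⟩

lemma div_pow_mem_chart (hx0 : x ≠ 0) (r : ℕ) {m : L} (hm : m ∈ M ^ r) :
    m / x ^ r ∈ chart M x := by
  induction r generalizing m with
  | zero =>
    rw [pow_zero, div_one]
    obtain ⟨c, rfl⟩ := Submodule.mem_one.1 hm
    exact Subalgebra.algebraMap_mem _ _
  | succ r ih =>
    rw [pow_succ] at hm
    refine Submodule.mul_induction_on hm (fun a ha b hb => ?_) fun a b ha hb => ?_
    · rw [pow_succ, ← div_mul_div_comm]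
      exact mul_mem (ih ha) (div_mem_chart hx0 hb)
    · rw [add_div]
      exact add_mem ha hb

lemma mem_chart_iff (hx : x ∈ M) (hx0 : x ≠ 0) {a : L} :
    a ∈ chart M x ↔ ∃ r, a * x ^ r ∈ M ^ r := by
  constructor
  · intro ha
    induction ha using Algebra.adjoin_induction with
    | mem a ha => exact ⟨1, by simp [ha.1]⟩
    | algebraMap c => exact ⟨0, by simp⟩
    | add a b _ _ ha hb =>
      obtain ⟨r, hr⟩ := ha
      obtain ⟨s, hs⟩ := hb
      refine ⟨max r s, ?_⟩
      rw [add_mul]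
      exact add_mem (mul_pow_mem_pow hx (le_max_left _ _) hr)
        (mul_pow_mem_pow hx (le_max_right _ _) hs)
    | mul a b _ _ ha hb =>
      obtain ⟨r, hr⟩ := ha
      obtain ⟨s, hs⟩ := hb
      refine ⟨r + s, ?_⟩
      rw [pow_add, pow_add, mul_mul_mul_comm]
      exact Submodule.mul_mem_mul hr hs
  · rintro ⟨r, hr⟩
    have := div_pow_mem_chart hx0 r hr
    rwa [mul_div_cancel_right₀ _ (pow_ne_zero _ hx0)] at this

lemma fg_chart (hM : M.FG) (x : L) : (chart M x).FG := by
  obtain ⟨S, hS⟩ := hM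
  classical
  by_cases hx0 : x = 0
  · simp only [chart, hx0, ne_eq, not_true_eq_false, and_false, Set.ofPred_false,
      Algebra.adjoin_empty]
    exact Subalgebra.fg_bot
  · refine ⟨S.image (· / x), le_antisymm (Algebra.adjoin_le ?_) (Algebra.adjoin_le ?_)⟩
    · intro a ha
      obtain ⟨m, hm, rfl⟩ := Finset.mem_image.1 ha
      exact div_mem_chart hx0 (hS ▸ Submodule.subset_span hm)
    · rintro a ⟨ha, -⟩
      have h1 : M ≤ (Subalgebra.toSubmodule (Algebra.adjoin Ω ((S.image (· / x) : Finset L) :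
          Set L))).comap (LinearMap.mulRight Ω x⁻¹) := by
        rw [← hS, Submodule.span_le]
        intro m hm
        refine Algebra.subset_adjoin (Finset.mem_coe.2 (Finset.mem_image.2 ⟨m, hm, ?_⟩))
        exact div_eq_mul_inv m x
      have h2 : a * x * x⁻¹ ∈ Algebra.adjoin Ω ((S.image (· / x) : Finset L) : Set L) := h1 ha
      rwa [mul_inv_cancel_right₀ hx0] at h2

/-- `O` is obtained from `A` by inverting the elements of `A` that are invertible in `O`. -/
structure IsLocalizationIn (A O : Subalgebra Ω L) : Prop where
  le : A ≤ O
  exists_mul_mem : ∀ r ∈ O, ∃ s ∈ A, s ≠ 0 ∧ s⁻¹ ∈ O ∧ r * s ∈ A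

lemma IsLocalizationIn.le_of_inv_mem {A O O' : Subalgebra Ω L} (h : IsLocalizationIn A O)
    (h' : A ≤ O') (hs : ∀ s ∈ A, s ≠ 0 → s⁻¹ ∈ O → s⁻¹ ∈ O') : O ≤ O' := by
  intro r hr
  obtain ⟨s, hsA, hs0, hsO, hrs⟩ := h.exists_mul_mem r hr
  have := mul_mem (h' hrs) (hs s hsA hs0 hsO)
  rwa [mul_inv_cancel_right₀ hs0] at this

lemma IsLocalizationIn.eq_of_inv_mem_iff {A O O' : Subalgebra Ω L} (h : IsLocalizationIn A O)
    (h' : IsLocalizationIn A O') (hs : ∀ s ∈ A, s ≠ 0 → (s⁻¹ ∈ O ↔ s⁻¹ ∈ O')) : O = O' :=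
  le_antisymm (h.le_of_inv_mem h'.le fun s hA h0 => (hs s hA h0).1)
    (h'.le_of_inv_mem h.le fun s hA h0 => (hs s hA h0).2)

/-- If `x' / x` is a unit at the point of `O`, then the point lies on both charts, and fractions of
equal degree can be rewritten with denominators in `x'`. -/
lemma IsLocalizationIn.of_chart {O : Subalgebra Ω L} (h : IsLocalizationIn (chart M x) O)
    (hx : x ∈ M) (hx0 : x ≠ 0) (hx0' : x' ≠ 0) (h₁ : x' / x ∈ O)
    (h₂ : x / x' ∈ O) : IsLocalizationIn (chart M x') O := by
  refine ⟨Algebra.adjoin_le ?_, fun r hr => ?_⟩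
  · rintro a ⟨ha, -⟩
    have := mul_mem (h.le (div_mem_chart hx0 ha)) h₂
    rwa [div_mul_div_cancel₀ hx0, mul_div_cancel_right₀ _ hx0'] at this
  · obtain ⟨s, hs, hs0, hsO, hrs⟩ := h.exists_mul_mem r hr
    obtain ⟨p, hp⟩ := (mem_chart_iff hx hx0).1 hs
    obtain ⟨q, hq⟩ := (mem_chart_iff hx hx0).1 hrs
    refine ⟨s * x ^ max p q / x' ^ max p q, div_pow_mem_chart hx0' _
      (mul_pow_mem_pow hx (le_max_left _ _) hp), by positivity, ?_, ?_⟩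
    · rw [inv_div, div_mul_eq_div_div_swap, ← div_pow, div_eq_mul_inv]
      exact mul_mem (pow_mem h₁ _) hsO
    · rw [mul_div_assoc', ← mul_assoc]
      exact div_pow_mem_chart hx0' _ (mul_pow_mem_pow hx (le_max_right _ _) hq)

/-- The ideal of the elements of `A` that are not invertible in the local algebra `O`. -/
def centre {A O : Subalgebra Ω L} [IsLocalRing O] (h : A ≤ O) : Ideal A :=
  (IsLocalRing.maximalIdeal O).comap (Subalgebra.inclusion h).toRingHom

instance {A O : Subalgebra Ω L} [IsLocalRing O] (h : A ≤ O) : (centre h).IsPrime :=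
  Ideal.comap_isPrime _ _

lemma isUnit_subalgebra_iff {O : Subalgebra Ω L} {a : O} (ha : a ≠ 0) :
    IsUnit a ↔ (a : L)⁻¹ ∈ O := by
  have ha0 : (a : L) ≠ 0 := fun h => ha (Subtype.ext h)
  constructor
  · rintro ⟨u, rfl⟩
    have h1 : (u : O).1 * (u⁻¹ : Oˣ).1.1 = 1 := congrArg Subtype.val u.mul_inv
    rw [inv_eq_of_mul_eq_one_right h1]
    exact (u⁻¹ : Oˣ).1.2
  · intro h
    exact IsUnit.of_mul_eq_one ⟨_, h⟩ (Subtype.ext (mul_inv_cancel₀ ha0))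

lemma mem_centre_iff {A O : Subalgebra Ω L} [IsLocalRing O] (h : A ≤ O) {a : A} (ha : a ≠ 0) :
    a ∈ centre h ↔ (a : L)⁻¹ ∉ O := by
  have h0 : (Subalgebra.inclusion h).toRingHom a ≠ 0 := fun h0 =>
    ha (Subtype.ext congr(($h0 : L)))
  rw [centre, Ideal.mem_comap, IsLocalRing.mem_maximalIdeal, mem_nonunits_iff,
    isUnit_subalgebra_iff h0]
  rfl

lemma IsLocalizationIn.isLocalization {A O : Subalgebra Ω L} [IsLocalRing O]
    (h : IsLocalizationIn A O) :
    letI := (Subalgebra.inclusion h.le).toRingHom.toAlgebra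
    IsLocalization.AtPrime O (centre h.le) := by
  let := (Subalgebra.inclusion h.le).toRingHom.toAlgebra
  have hinj : Function.Injective (algebraMap A O) := Subalgebra.inclusion_injective h.le
  refine ⟨fun s => ?_, fun z => ?_, fun {a b} hab => ⟨1, by rw [hinj hab]⟩⟩
  · by_contra hs
    exact s.2 hs
  · obtain ⟨s, hs, hs0, hsO, hrs⟩ := h.exists_mul_mem z z.2
    refine ⟨⟨⟨_, hrs⟩, ⟨s, hs⟩, fun hc => ?_⟩, Subtype.ext rfl⟩
    exact (mem_centre_iff h.le (a := ⟨s, hs⟩) fun h => hs0 congr(($h : L))).1 hc hsO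

/-- The Nullstellensatz: the residue field is finite over the algebraically closed field `Ω`. -/
lemma exists_sub_mem_of_isMaximal [IsAlgClosed Ω] {B : Type*} [CommRing B] [Algebra Ω B]
    [Algebra.FiniteType Ω B] (P : Ideal B) [P.IsMaximal] (a : B) :
    ∃ c : Ω, a - algebraMap Ω B c ∈ P := by
  let := Ideal.Quotient.field P
  have : Module.Finite Ω (B ⧸ P) := finite_of_finite_type_of_isJacobsonRing Ω (B ⧸ P)
  obtain ⟨c, hc⟩ := (IsAlgClosed.algebraMap_bijective_of_isIntegral (k := Ω)
    (K := B ⧸ P)).2 (Ideal.Quotient.mk P a)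
  exact ⟨c, Ideal.Quotient.eq.1 hc.symm⟩

lemma list_prod_mem_pow {l : List L} (hl : ∀ a ∈ l, a ∈ M) : l.prod ∈ M ^ l.length := by
  induction l with
  | nil => exact Submodule.one_le.1 (by simp)
  | cons a l ih =>
    rw [List.prod_cons, List.length_cons, pow_succ']
    exact Submodule.mul_mem_mul (hl _ (by simp)) (ih fun b hb => hl _ (by simp [hb]))

lemma finset_prod_mem_pow {α : Type*} (s : Finset α) (g : α → L) (hg : ∀ a ∈ s, g a ∈ M) :
    ∏ a ∈ s, g a ∈ M ^ s.card := by
  have h := list_prod_mem_pow (M := M) (l := s.toList.map g) (by simpa using hg)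
  rwa [List.length_map, Finset.length_toList, Finset.prod_map_toList] at h

/-- If a power of each generator `t i` of `M` lies in `h M ^ (N - 1) + F M ^ (N - d)`, then
`M ^ s = h M ^ (s - 1) + F M ^ (s - d)` for large `s`. -/
lemma exists_add_mem_pow {ι : Type*} [Fintype ι] (t : ι → L)
    (hM : M = Submodule.span Ω (Set.range t)) (h F : L) (d N : ℕ)
    (ht : ∀ i, ∃ a ∈ M ^ (N + d), ∃ b ∈ M ^ (N + 1), t i ^ (N + d + 1) = h * a + F * b)
    (r : ℕ) (hr : Fintype.card ι * (N + d + 1) ≤ r + d + 1) (x : L) (hx : x ∈ M ^ (r + d + 1)) :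
    ∃ a ∈ M ^ (r + d), ∃ b ∈ M ^ (r + 1), x = h * a + F * b := by
  classical
  have hNr (i : ι) : N ≤ r := by
    have : 1 ≤ Fintype.card ι := Fintype.card_pos_iff.2 ⟨i⟩
    nlinarith
  rw [hM, Submodule.span_pow] at hx
  induction hx using Submodule.span_induction with
  | zero => exact ⟨0, zero_mem _, 0, zero_mem _, by simp⟩
  | add x y _ _ hx hy =>
    obtain ⟨a, ha, b, hb, rfl⟩ := hx
    obtain ⟨a', ha', b', hb', rfl⟩ := hy
    exact ⟨a + a', add_mem ha ha', b + b', add_mem hb hb', by ring⟩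
  | smul c x _ hx =>
    obtain ⟨a, ha, b, hb, rfl⟩ := hx
    exact ⟨c • a, Submodule.smul_mem _ _ ha, c • b, Submodule.smul_mem _ _ hb, by
      rw [mul_smul_comm, mul_smul_comm, smul_add]⟩
  | mem x hx =>
    obtain ⟨g, rfl⟩ := Set.mem_pow.1 hx
    rw [List.prod_ofFn]
    choose e he using fun i => (g i).2
    have : Nonempty ι := ⟨e 0⟩
    obtain ⟨i, hi⟩ := Fintype.exists_le_card_fiber_of_mul_le_card e (n := N + d + 1) (by simpa)
    obtain ⟨T, hT, hTc⟩ := Finset.exists_subset_card_eq hi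
    have hgM (j) : (g j : L) ∈ M := by
      rw [← he, hM]
      exact Submodule.subset_span ⟨_, rfl⟩
    have h1 : ∏ j ∈ T, (g j : L) = t i ^ (N + d + 1) := by
      rw [← hTc, Finset.prod_congr rfl fun j hj => ?_, Finset.prod_const]
      rw [← he, (Finset.mem_filter.1 (hT hj)).2]
    have h2 := finset_prod_mem_pow (M := M) Tᶜ (fun j => (g j : L)) fun j _ => hgM j
    rw [Finset.card_compl, Fintype.card_fin, hTc, show r + d + 1 - (N + d + 1) = r - N by omega]
      at h2
    obtain ⟨a, ha, b, hb, hab⟩ := ht i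
    have hN := hNr i
    generalize hP : ∏ j ∈ Tᶜ, (g j : L) = P at h2
    refine ⟨a * P, ?_, b * P, ?_, ?_⟩
    · rw [show r + d = N + d + (r - N) by omega, pow_add]
      exact Submodule.mul_mem_mul ha h2
    · rw [show r + 1 = N + 1 + (r - N) by omega, pow_add]
      exact Submodule.mul_mem_mul hb h2
    · rw [← Finset.prod_mul_prod_compl T, h1, hab, hP]
      ring

end Chart

open Module

section Atlas

variable {Ω L : Type*} [Field Ω] [Field L] [Algebra Ω L]

/-- The local rings of the closed points of a projective curve with function field `L`, where the
`t i` are the homogeneous coordinates of its generic point. -/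
structure IsCurveAtlas {ι 𝒞 : Type*} (t : ι → L) (M : Submodule Ω L) (R : 𝒞 → Subalgebra Ω L)
    [∀ y, IsLocalRing (R y)] : Prop where
  span_eq : M = Submodule.span Ω (Set.range t)
  exists_chart : ∀ y, ∃ i, t i ≠ 0 ∧
    ∃ h : IsLocalizationIn (chart M (t i)) (R y), (centre h.le).IsMaximal
  exists_point : ∀ i, t i ≠ 0 → ∀ P : Ideal (chart M (t i)), P.IsMaximal →
    ∃ y, ∃ h : IsLocalizationIn (chart M (t i)) (R y), centre h.le = P
  injective : Function.Injective R
  isMaximal : ∀ i, t i ≠ 0 → ∀ P : Ideal (chart M (t i)), P.IsPrime → P ≠ ⊥ → P.IsMaximal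
  exists_mul_eq : ∀ i, t i ≠ 0 → ∀ f : L, ∃ a ∈ chart M (t i), ∃ b ∈ chart M (t i), b ≠ 0 ∧
    f * b = a

lemma isMaximal_of_forall_exists_sub_mem {B : Type*} [CommRing B] [Algebra Ω B] (P : Ideal B)
    [hP : P.IsPrime] (h : ∀ a : B, ∃ c : Ω, a - algebraMap Ω B c ∈ P) : P.IsMaximal := by
  refine Ideal.isMaximal_iff.2 ⟨fun h1 => hP.ne_top (P.eq_top_iff_one.2 h1), ?_⟩
  intro J x hPJ hx hxJ
  obtain ⟨c, hc⟩ := h x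
  have hc0 : c ≠ 0 := by
    rintro rfl
    exact hx (by simpa using hc)
  have h1 : algebraMap Ω B c ∈ J := by simpa using J.sub_mem hxJ (hPJ hc)
  rw [J.eq_top_of_isUnit_mem h1 ((isUnit_iff_ne_zero.2 hc0).map (algebraMap Ω B))]
  trivial

lemma IsLocalizationIn.exists_sub_mem [IsAlgClosed Ω] {A O : Subalgebra Ω L} [IsLocalRing O]
    (h : IsLocalizationIn A O) (hA : A.FG) (hP : (centre h.le).IsMaximal) (x : O) :
    ∃ c : Ω, x - algebraMap Ω O c ∈ IsLocalRing.maximalIdeal O := by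
  have := (Subalgebra.fg_iff_finiteType A).1 hA
  obtain ⟨s, hs, hs0, hsO, hrs⟩ := h.exists_mul_mem x x.2
  obtain ⟨c, hc⟩ := exists_sub_mem_of_isMaximal (Ω := Ω) (centre h.le) ⟨s, hs⟩
  obtain ⟨d, hd⟩ := exists_sub_mem_of_isMaximal (Ω := Ω) (centre h.le) ⟨_, hrs⟩
  have hs' : (⟨s, hs⟩ : A) ∉ centre h.le := fun hc =>
    (mem_centre_iff h.le (a := ⟨s, hs⟩) fun h => hs0 congr(($h : L))).1 hc hsO
  have hc0 : c ≠ 0 := by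
    rintro rfl
    exact hs' (by simpa using hc)
  refine ⟨d / c, ?_⟩
  have h1 : (x - algebraMap Ω O (d / c)) * algebraMap Ω O c =
      (x * ⟨s, h.le hs⟩ - algebraMap Ω O d) - x * (⟨s, h.le hs⟩ - algebraMap Ω O c) := by
    rw [sub_mul, ← map_mul, div_mul_cancel₀ _ hc0]
    ring
  have h2 : (x - algebraMap Ω O (d / c)) * algebraMap Ω O c ∈ IsLocalRing.maximalIdeal O :=
    h1 ▸ sub_mem hd (Ideal.mul_mem_left _ _ hc)
  exact (Ideal.mul_unit_mem_iff_mem _ ((isUnit_iff_ne_zero.2 hc0).map (algebraMap Ω O))).1 h2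

lemma IsLocalizationIn.isMaximal_centre {A O : Subalgebra Ω L} [IsLocalRing O]
    (h : IsLocalizationIn A O)
    (hO : ∀ x : O, ∃ c : Ω, x - algebraMap Ω O c ∈ IsLocalRing.maximalIdeal O) :
    (centre h.le).IsMaximal :=
  isMaximal_of_forall_exists_sub_mem (Ω := Ω) _ fun a => hO (Subalgebra.inclusion h.le a)

lemma exists_isLocalizationIn (B : Subalgebra Ω L) (P : Ideal B) [hP : P.IsPrime] :
    ∃ (O : Subalgebra Ω L) (_ : IsLocalRing O) (h : IsLocalizationIn B O), centre h.le = P := by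
  let O : Subalgebra Ω L :=
    { carrier := {x | ∃ s : B, s ∉ P ∧ x * s ∈ B}
      mul_mem' := by
        rintro a b ⟨s, hs, ha⟩ ⟨t, ht, hb⟩
        refine ⟨s * t, fun h => (hP.mem_or_mem h).elim hs ht, ?_⟩
        rw [MulMemClass.coe_mul, mul_mul_mul_comm]
        exact mul_mem ha hb
      add_mem' := by
        rintro a b ⟨s, hs, ha⟩ ⟨t, ht, hb⟩
        refine ⟨s * t, fun h => (hP.mem_or_mem h).elim hs ht, ?_⟩
        rw [MulMemClass.coe_mul, show (a + b) * (s * t : L) = a * s * t + b * t * s by ring]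
        exact add_mem (mul_mem ha t.2) (mul_mem hb s.2)
      algebraMap_mem' := fun c => ⟨1, fun h => hP.ne_top (P.eq_top_iff_one.2 h),
        mul_mem (Subalgebra.algebraMap_mem _ _) (one_mem _)⟩ }
  have h0 (s : B) (hs : s ∉ P) : (s : L) ≠ 0 := fun h => hs (by
    rw [show s = 0 from Subtype.ext h]
    exact P.zero_mem)
  have hinv (s : B) (hs0 : s ≠ 0) : (s : L)⁻¹ ∈ O ↔ s ∉ P := by
    have hs0' : (s : L) ≠ 0 := fun h => hs0 (Subtype.ext h)
    constructor
    · rintro ⟨u, hu, hsu⟩ hs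
      refine hu ?_
      have : u = ⟨_, hsu⟩ * s := Subtype.ext (by
        change (u : L) = (s : L)⁻¹ * u * s
        field_simp)
      rw [this]
      exact P.mul_mem_left _ hs
    · intro hs
      exact ⟨s, hs, by rw [inv_mul_cancel₀ hs0']; exact one_mem _⟩
  have hBO : B ≤ O := fun x hx => ⟨1, fun h => hP.ne_top (P.eq_top_iff_one.2 h), by simpa⟩
  have hunit (x : O) (s : B) (hs : s ∉ P) (hxs : (x : L) * s ∈ B) (hx : ⟨_, hxs⟩ ∉ P) :
      IsUnit x := by
    have hx0 : (x : L) ≠ 0 := fun h => h0 _ hx (by simp [h])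
    refine (isUnit_subalgebra_iff (a := x) fun h => hx0 (congrArg Subtype.val h)).2 ?_
    refine ⟨⟨_, hxs⟩, hx, ?_⟩
    rw [inv_mul_cancel_left₀ hx0]
    exact s.2
  have : IsLocalRing O := by
    refine IsLocalRing.of_isUnit_or_isUnit_one_sub_self fun x => ?_
    obtain ⟨s, hs, hxs⟩ := x.2
    by_cases hx : ⟨_, hxs⟩ ∈ P
    · right
      have h1 : ((1 - x : O) : L) * s = s - x * s := by
        change (1 - (x : L)) * s = _
        ring
      refine hunit (1 - x) s hs (h1 ▸ sub_mem s.2 hxs) fun h2 => hs ?_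
      have : s = ⟨_, h1 ▸ sub_mem s.2 hxs⟩ + ⟨_, hxs⟩ := Subtype.ext (by
        change (s : L) = ((1 - x : O) : L) * s + x * s
        rw [h1]
        ring)
      rw [this]
      exact add_mem h2 hx
    · exact Or.inl (hunit x s hs hxs hx)
  refine ⟨O, this, ⟨hBO, ?_⟩, ?_⟩
  · rintro r ⟨s, hs, hrs⟩
    exact ⟨s, s.2, h0 s hs, (hinv s fun h => h0 s hs congr(($h : L))).2 hs, hrs⟩
  · ext s
    by_cases hs : s = 0
    · simp [hs]
    · rw [mem_centre_iff _ hs, hinv s hs, not_not]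

namespace IsCurveAtlas

variable {ι 𝒞 : Type*} [Finite ι] {t : ι → L} {M : Submodule Ω L} {R : 𝒞 → Subalgebra Ω L}
  [∀ y, IsLocalRing (R y)] (H : IsCurveAtlas t M R)

include H

lemma fg : M.FG := by
  rw [H.span_eq]
  exact Submodule.fg_span (Set.finite_range t)

omit [Finite ι] in
lemma mem (i : ι) : t i ∈ M := by
  rw [H.span_eq]
  exact Submodule.subset_span ⟨i, rfl⟩

omit [Finite ι] H in
lemma eq_of_centre_eq {x : L} {y : 𝒞} {O : Subalgebra Ω L} [IsLocalRing O]
    (h : IsLocalizationIn (chart M x) (R y)) (h' : IsLocalizationIn (chart M x) O)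
    (hc : centre h.le = centre h'.le) : R y = O := by
  refine h.eq_of_inv_mem_iff h' fun s hs hs0 => ?_
  have h0 : (⟨s, hs⟩ : chart M x) ≠ 0 := fun h => hs0 congr(($h : L))
  rw [← not_iff_not, ← mem_centre_iff h.le h0, ← mem_centre_iff h'.le h0, hc]

lemma exists_sub_mem [IsAlgClosed Ω] (y : 𝒞) (x : R y) :
    ∃ c : Ω, x - algebraMap Ω (R y) c ∈ IsLocalRing.maximalIdeal (R y) := by
  obtain ⟨i, hi, h, hP⟩ := H.exists_chart y
  exact h.exists_sub_mem (fg_chart H.fg _) hP x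

lemma finite_setOf (i : ι) (hi : t i ≠ 0) {a : L} (ha : a ∈ chart M (t i)) (ha0 : a ≠ 0) :
    {y | IsLocalizationIn (chart M (t i)) (R y) ∧ a⁻¹ ∉ R y}.Finite := by
  have hfg := fg_chart H.fg (t i)
  have := (Subalgebra.fg_iff_finiteType _).1 hfg
  have : IsNoetherianRing (chart M (t i)) := Algebra.FiniteType.isNoetherianRing Ω _
  have ha0' : (⟨a, ha⟩ : chart M (t i)) ≠ 0 := fun h => ha0 congr(($h : L))
  have hfin := Ideal.finite_minimalPrimes_of_isNoetherianRing _
    (Ideal.span {(⟨a, ha⟩ : chart M (t i))})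
  refine Set.Finite.of_finite_image (f := fun y => {s : chart M (t i) | s ≠ 0 → (s : L)⁻¹ ∉ R y})
    ((hfin.image fun P : Ideal (chart M (t i)) => (P : Set (chart M (t i)))).subset ?_) ?_
  · rintro _ ⟨y, ⟨h, hy⟩, rfl⟩
    have hmem : (⟨a, ha⟩ : chart M (t i)) ∈ centre h.le := (mem_centre_iff _ ha0').2 hy
    refine ⟨centre h.le, ⟨⟨inferInstance, by rwa [Ideal.span_singleton_le_iff_mem]⟩, ?_⟩, ?_⟩
    · rintro Q ⟨hQ, haQ⟩ hle
      rw [Ideal.span_singleton_le_iff_mem] at haQ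
      have hQ' := H.isMaximal i hi Q hQ fun hQ0 => ha0' (by rwa [hQ0] at haQ)
      exact (hQ'.eq_of_le (Ideal.IsPrime.ne_top inferInstance) hle).ge
    · ext s
      by_cases hs : s = 0
      · simp [hs]
      · simp [mem_centre_iff h.le hs, hs]
  · rintro y ⟨h, -⟩ y' ⟨h', -⟩ hyy'
    refine H.injective (h.eq_of_inv_mem_iff h' fun s hs hs0 => ?_)
    have h0 : (⟨s, hs⟩ : chart M (t i)) ≠ 0 := fun h => hs0 congr(($h : L))
    have := Set.ext_iff.1 hyy' ⟨s, hs⟩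
    simpa [h0, not_iff_not] using this

lemma exists_isLocalizationIn_chart [IsAlgClosed Ω] {h : L} (hh : h ∈ M) (hh0 : h ≠ 0)
    (P : Ideal (chart M h)) [hP : P.IsMaximal] :
    ∃ y, ∃ h : IsLocalizationIn (chart M h) (R y), centre h.le = P := by
  obtain ⟨O, hO, hl, hc⟩ := exists_isLocalizationIn (chart M h) P
  obtain ⟨i, hi⟩ : ∃ i, (⟨t i / h, div_mem_chart hh0 (H.mem i)⟩ : chart M h) ∉ P := by
    by_contra! hcon
    have h1 : M ≤ ((P.restrictScalars Ω).map (chart M h).val.toLinearMap).comap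
        (LinearMap.mulRight Ω h⁻¹) := by
      conv_lhs => rw [H.span_eq]
      rw [Submodule.span_le]
      rintro _ ⟨i, rfl⟩
      exact ⟨_, hcon i, div_eq_mul_inv _ _⟩
    obtain ⟨a, ha, ha'⟩ := h1 hh
    have h2 : (a : L) = 1 := ha'.trans (mul_inv_cancel₀ hh0)
    refine hP.ne_top (P.eq_top_iff_one.2 ?_)
    rw [show (1 : chart M h) = a from Subtype.ext h2.symm]
    exact ha
  have hti : t i ≠ 0 := fun h0 => hi (by simp only [h0, zero_div]; exact P.zero_mem)
  have h0 : (⟨t i / h, div_mem_chart hh0 (H.mem i)⟩ : chart M h) ≠ 0 := fun h => by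
    rw [h] at hi
    exact hi P.zero_mem
  have hinv : h / t i ∈ O := by
    rw [← inv_div]
    by_contra hcon
    exact hi (hc ▸ (mem_centre_iff hl.le h0).2 hcon)
  have hl' := hl.of_chart hh hh0 hti (hl.le (div_mem_chart hh0 (H.mem i))) hinv
  obtain ⟨y, hy, hyc⟩ := H.exists_point i hti _ (hl'.isMaximal_centre
    (hl.exists_sub_mem (fg_chart H.fg _) (hc ▸ hP)))
  obtain rfl := eq_of_centre_eq hy hl' hyc
  exact ⟨y, hl, hc⟩

end IsCurveAtlas

end Atlas

open Module

section Degree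

variable {Ω L : Type*} [Field Ω] [Field L] [Algebra Ω L]

open Classical in
/-- The length of `O / x` for `x ∈ O`. -/
noncomputable def lengthMod (O : Subalgebra Ω L) (x : L) : ℕ :=
  if h : x ∈ O then (Ring.ord O ⟨x, h⟩).toNat else 0

lemma lengthMod_of_mem {O : Subalgebra Ω L} {x : L} (h : x ∈ O) :
    lengthMod O x = (Ring.ord O ⟨x, h⟩).toNat :=
  dif_pos h

lemma lengthMod_eq_zero {O : Subalgebra Ω L} {x : L} (h : x ∈ O) (hx : x ≠ 0) (h' : x⁻¹ ∈ O) :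
    lengthMod O x = 0 := by
  have h1 : IsUnit (⟨x, h⟩ : O) := (isUnit_subalgebra_iff (a := ⟨x, h⟩)
    fun h0 => hx (congrArg Subtype.val h0)).2 h'
  rw [lengthMod_of_mem h, Ring.ord_of_isUnit h1]
  rfl

lemma length_residueField_eq_one {O : Type*} [CommRing O] [IsLocalRing O] [Algebra Ω O]
    [IsLocalHom (algebraMap Ω O)]
    (h : ∀ x : O, ∃ c : Ω, x - algebraMap Ω O c ∈ IsLocalRing.maximalIdeal O) :
    length (IsLocalRing.ResidueField Ω) (IsLocalRing.ResidueField O) = 1 := by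
  let e : IsLocalRing.ResidueField Ω →ₗ[IsLocalRing.ResidueField Ω] IsLocalRing.ResidueField O :=
    Algebra.linearMap _ _
  have he : Function.Bijective e := by
    refine ⟨(algebraMap (IsLocalRing.ResidueField Ω) (IsLocalRing.ResidueField O)).injective,
      fun x => ?_⟩
    obtain ⟨x, rfl⟩ := IsLocalRing.residue_surjective x
    obtain ⟨c, hc⟩ := h x
    exact ⟨IsLocalRing.residue _ c, (Ideal.Quotient.eq.2 hc).symm⟩
  rw [← (LinearEquiv.ofBijective e he).length_eq]
  exact length_eq_one_iff.2 inferInstance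

lemma length_quotient_map_span {B O : Type*} [CommRing B] [CommRing O] [Algebra B O] (b : B) :
    length O (O ⧸ (Ideal.span {b}).map (algebraMap B O)) = Ring.ord O (algebraMap B O b) := by
  rw [Ideal.map_span, Set.image_singleton]
  rfl

namespace IsCurveAtlas

variable {ι 𝒞 : Type*} [Finite ι] {t : ι → L} {M : Submodule Ω L} {R : 𝒞 → Subalgebra Ω L}
  [∀ y, IsLocalRing (R y)] (H : IsCurveAtlas t M R)

include H

lemma finrank_quotient_eq_sum [IsAlgClosed Ω] {h : L} (hh : h ∈ M) (hh0 : h ≠ 0) (F : chart M h)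
    (hF : F ≠ 0)
    [Module.Finite Ω (chart M h ⧸ Ideal.span {F})] (Z : Finset 𝒞)
    (hZ : ∀ y ∈ Z, IsLocalizationIn (chart M h) (R y))
    (hZF : ∀ y, IsLocalizationIn (chart M h) (R y) → (F : L)⁻¹ ∉ R y → y ∈ Z) :
    finrank Ω (chart M h ⧸ Ideal.span {F}) = ∑ y ∈ Z, lengthMod (R y) F := by
  have hmax (y : 𝒞) (hy : IsLocalizationIn (chart M h) (R y)) : (centre hy.le).IsMaximal :=
    hy.isMaximal_centre (H.exists_sub_mem y)
  have : IsArtinianRing (chart M h ⧸ Ideal.span {F}) :=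
    isArtinian_of_tower Ω (inferInstance : IsArtinian Ω (chart M h ⧸ Ideal.span {F}))
  let (y : Z) : Algebra (chart M h) (R y) :=
    (Subalgebra.inclusion (hZ y y.2).le).toRingHom.toAlgebra
  have (y : Z) : IsScalarTower Ω (chart M h) (R y) := IsScalarTower.of_algebraMap_eq fun _ => rfl
  have h1 (y : Z) := (hZ y y.2).isLocalization
  have (y : Z) : IsLocalHom (algebraMap Ω (R y)) := inferInstance
  have (y : Z) : (centre (hZ y y.2).le).IsMaximal := hmax y (hZ y y.2)
  have hl := length_quotient_eq_sum_localization (A := Ω) (R := chart M h) (Ideal.span {F})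
    (ι := Z) (fun y => centre (hZ y y.2).le) ?_ ?_ (fun y => R y)
  · rw [length_eq_finrank] at hl
    replace hl := hl.trans (Finset.sum_congr rfl fun y _ =>
      (congrArg₂ (· * ·) (length_quotient_map_span F)
        (length_residueField_eq_one (H.exists_sub_mem y))).trans (mul_one _))
    have h3 : ∀ y : Z, Ring.ord (R y) (algebraMap (chart M h) (R y) F) ≠ ⊤ := by
      intro y hy
      have h4 : (finrank Ω (chart M h ⧸ Ideal.span {F}) : ℕ∞) = ⊤ := by
        rw [hl]
        exact WithTop.sum_eq_top.2 ⟨y, Finset.mem_univ _, hy⟩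
      exact ENat.natCast_ne_top _ h4
    rw [← ENat.toNat_natCast (finrank Ω (chart M h ⧸ Ideal.span {F})), hl,
      ENat.toNat_sum fun y _ => h3 y, ← Finset.sum_coe_sort Z]
    exact Finset.sum_congr rfl fun y _ => (lengthMod_of_mem ((hZ y y.2).le F.2)).symm
  · intro P hP hFP
    obtain ⟨y, hy, hyP⟩ := H.exists_isLocalizationIn_chart hh hh0 P
    refine ⟨⟨y, hZF y hy ?_⟩, hyP.symm⟩
    rw [← mem_centre_iff hy.le hF, hyP]
    exact hFP (Ideal.mem_span_singleton_self F)
  · intro y y' hyy'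
    exact Subtype.ext (H.injective (eq_of_centre_eq (hZ y y.2) (hZ y' y'.2) hyy'))

lemma exists_add_mul_mem_pow {h F : L} (hh : h ∈ M) (hh0 : h ≠ 0) (hF0 : F ≠ 0) (d : ℕ)
    (hF : F ∈ M ^ d)
    (hhF : ∀ y i, t i ≠ 0 → IsLocalizationIn (chart M (t i)) (R y) → (F / t i ^ d)⁻¹ ∉ R y →
      (h / t i)⁻¹ ∈ R y) :
    ∃ r₀, ∀ r ≥ r₀, ∀ x ∈ M ^ (r + d + 1), ∃ a ∈ M ^ (r + d), ∃ b ∈ M ^ (r + 1),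
      x = h * a + F * b := by
  have h1 (i : ι) : ∃ p, ∀ N ≥ p, ∃ a ∈ M ^ (N + d), ∃ b ∈ M ^ (N + 1),
      t i ^ (N + d + 1) = h * a + F * b := by
    by_cases hi : t i = 0
    · exact ⟨0, fun N _ => ⟨0, zero_mem _, 0, zero_mem _, by simp [hi]⟩⟩
    let h' : chart M (t i) := ⟨h / t i, div_mem_chart hi hh⟩
    let F' : chart M (t i) := ⟨F / t i ^ d, div_pow_mem_chart hi d hF⟩
    have hh' : h' ≠ 0 := fun h => (div_ne_zero hh0 hi) congr(($h : L))
    have hF' : F' ≠ 0 := fun h => (div_ne_zero hF0 (pow_ne_zero d hi)) congr(($h : L))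
    have htop : Ideal.span {h', F'} = ⊤ := by
      by_contra hne
      obtain ⟨P, hP, hle⟩ := Ideal.exists_le_maximal _ hne
      obtain ⟨y, hy, rfl⟩ := H.exists_point i hi P hP
      rw [Ideal.span_le] at hle
      exact (mem_centre_iff hy.le hh').1 (hle (by simp))
        (hhF y i hi hy ((mem_centre_iff hy.le hF').1 (hle (by simp))))
    obtain ⟨α, β, hαβ⟩ := Ideal.mem_span_pair.1 ((Ideal.eq_top_iff_one _).1 htop)
    obtain ⟨p, hp⟩ := (mem_chart_iff (H.mem i) hi).1 α.2
    obtain ⟨q, hq⟩ := (mem_chart_iff (H.mem i) hi).1 β.2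
    have h2 : (α : L) * (h / t i) + β * (F / t i ^ d) = 1 := congr(($hαβ : L))
    refine ⟨max p q, fun N hN => ⟨α * t i ^ (N + d),
      mul_pow_mem_pow (H.mem i) (by have := le_max_left p q; omega) hp, β * t i ^ (N + 1),
      mul_pow_mem_pow (H.mem i) (by have := le_max_right p q; omega) hq, ?_⟩⟩
    rw [← mul_one (t i ^ _), ← h2]
    field_simp
    ring
  choose p hp using h1
  have := Fintype.ofFinite ι
  let N := Finset.univ.sup p
  refine ⟨Fintype.card ι * (N + d + 1), fun r hr x hx => ?_⟩
  exact exists_add_mem_pow t H.span_eq h F d N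
    (fun i => hp i N (Finset.le_sup (Finset.mem_univ i))) r (by omega) x hx

lemma exists_finrank_add [IsAlgClosed Ω] {h F : L} (hh : h ∈ M) (hh0 : h ≠ 0) (hF0 : F ≠ 0) (d : ℕ)
    (hF : F ∈ M ^ d)
    (hhF : ∀ y i, t i ≠ 0 → IsLocalizationIn (chart M (t i)) (R y) → (F / t i ^ d)⁻¹ ∉ R y →
      (h / t i)⁻¹ ∈ R y) (Z : Finset 𝒞)
    (hZ : ∀ y ∈ Z, IsLocalizationIn (chart M h) (R y))
    (hZF : ∀ y, IsLocalizationIn (chart M h) (R y) → (F / h ^ d)⁻¹ ∉ R y → y ∈ Z) :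
    ∃ r₁, ∀ r ≥ r₁, finrank Ω (M ^ (r + d) : Submodule Ω L) =
      ∑ y ∈ Z, lengthMod (R y) (F / h ^ d) + finrank Ω (M ^ r : Submodule Ω L) := by
  obtain ⟨r₀, hr₀⟩ := H.exists_add_mul_mem_pow hh hh0 hF0 d hF hhF
  have hpow (r : ℕ) : h ^ r ≠ 0 := pow_ne_zero r hh0
  let V (r : ℕ) : Submodule Ω L := (M ^ r).map (LinearMap.mulRight Ω (h ^ r)⁻¹)
  have hV (r : ℕ) (x : L) : x ∈ V r ↔ x * h ^ r ∈ M ^ r := by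
    constructor
    · rintro ⟨m, hm, rfl⟩
      change m * (h ^ r)⁻¹ * h ^ r ∈ M ^ r
      rwa [inv_mul_cancel_right₀ (hpow r)]
    · exact fun hx => ⟨_, hx, mul_inv_cancel_right₀ (hpow r) x⟩
  have hfin (r : ℕ) : FiniteDimensional Ω (M ^ r : Submodule Ω L) :=
    Module.Finite.iff_fg.2 (H.fg.pow r)
  have hrank (r : ℕ) : finrank Ω (V r) = finrank Ω (M ^ r : Submodule Ω L) :=
    LinearEquiv.finrank_eq (Submodule.equivMapOfInjective _
      (mul_left_injective₀ (inv_ne_zero (hpow r))) _).symm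
  let F' : chart M h := ⟨F / h ^ d, div_pow_mem_chart hh0 d hF⟩
  have hF' : F' ≠ 0 := fun h0 => (div_ne_zero hF0 (hpow d)) congr(($h0 : L))
  obtain ⟨h1, r₁, h2⟩ := finrank_quotient_add_finrank V
    (monotone_nat_of_le_succ fun r x hx => (hV _ _).2
      (mul_pow_mem_pow hh r.le_succ ((hV _ _).1 hx)))
    (chart M h) (fun x => (mem_chart_iff hh hh0).trans (exists_congr fun r => (hV r x).symm)) d F'
    hF' (fun r x hx => by
      rw [hV] at hx ⊢
      have h3 : (F' : L) * x * h ^ (r + d) = x * h ^ r * F := by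
        change F / h ^ d * x * h ^ (r + d) = _
        field_simp
        ring
      rw [h3, pow_add]
      exact Submodule.mul_mem_mul hx hF) r₀ (fun r hr x hx => by
      rw [hV] at hx
      obtain ⟨a, ha, b, hb, hab⟩ := hr₀ r hr _ hx
      refine ⟨b / h ^ (r + 1), (hV _ _).2 (by rwa [div_mul_cancel₀ _ (hpow _)]), (hV _ _).2 ?_⟩
      have h3 : (x - F' * (b / h ^ (r + 1))) * h ^ (r + d) = a := by
        refine mul_left_cancel₀ hh0 ?_
        rw [← sub_eq_iff_eq_add.2 hab]
        change h * ((x - F / h ^ d * (b / h ^ (r + 1))) * h ^ (r + d)) = _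
        field_simp
        ring
      rwa [h3])
  refine ⟨r₁, fun r hr => ?_⟩
  rw [← hrank, ← hrank, h2 r hr, H.finrank_quotient_eq_sum hh hh0 F' hF' Z hZ hZF]

omit [Finite ι] [∀ y, IsLocalRing (R y)] H in
lemma inv_div_mem {h : L} (hh : h ∈ M) (hh0 : h ≠ 0) {y : 𝒞} {i : ι} (hi : t i ≠ 0)
    (hy : IsLocalizationIn (chart M (t i)) (R y)) (d : ℕ) {F : L} (hF : (F / t i ^ d)⁻¹ ∈ R y) : (F / h ^ d)⁻¹ ∈ R y := by
  have h1 := mul_mem hF (pow_mem (hy.le (div_mem_chart hi hh)) d)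
  convert h1 using 1
  rw [div_pow, inv_div, inv_div]
  field_simp

/-- A linear form that does not vanish at finitely many given points. -/
lemma exists_avoiding [Infinite Ω] (i₀ : ι) (hi₀ : t i₀ ≠ 0) {Z : Set 𝒞} (hZ : Z.Finite) :
    ∃ h ∈ M, h ≠ 0 ∧ ∀ y ∈ Z, ∀ i, t i ≠ 0 → IsLocalizationIn (chart M (t i)) (R y) →
      (h / t i)⁻¹ ∈ R y := by
  classical
  have := Fintype.ofFinite ι
  let W (y : 𝒞) (i : ι) : Submodule Ω M :=
    if hi : t i ≠ 0 ∧ IsLocalizationIn (chart M (t i)) (R y) then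
      ((centre hi.2.le).restrictScalars Ω).comap
        (LinearMap.codRestrict (Subalgebra.toSubmodule (chart M (t i)))
          ((LinearMap.mulRight Ω (t i)⁻¹).comp M.subtype) fun m => by
            have := div_mem_chart hi.1 m.2
            rwa [div_eq_mul_inv] at this)
    else ⊥
  have hW (y : 𝒞) (i : ι) (hi : t i ≠ 0) (hy : IsLocalizationIn (chart M (t i)) (R y)) (m : M) :
      m ∈ W y i ↔ (⟨m / t i, div_mem_chart hi m.2⟩ : chart M (t i)) ∈ centre hy.le := by
    simp only [W, dif_pos (⟨hi, hy⟩ : t i ≠ 0 ∧ IsLocalizationIn (chart M (t i)) (R y))]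
    simp only [div_eq_mul_inv]
    rfl
  have hbot : (⊥ : Submodule Ω M) ≠ ⊤ := fun h => hi₀ (by
    have h1 : (⟨t i₀, H.mem i₀⟩ : M) ∈ (⊥ : Submodule Ω M) := h ▸ trivial
    exact congrArg Subtype.val ((Submodule.mem_bot Ω).1 h1))
  have htop (y : 𝒞) (i : ι) : W y i ≠ ⊤ := by
    by_cases hi : t i ≠ 0 ∧ IsLocalizationIn (chart M (t i)) (R y)
    · intro h
      have h1 := (hW y i hi.1 hi.2 ⟨t i, H.mem i⟩).1 (h ▸ trivial)
      refine (inferInstance : (centre hi.2.le).IsPrime).ne_top ((Ideal.eq_top_iff_one _).2 ?_)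
      have h2 : (⟨t i / t i, div_mem_chart hi.1 (H.mem i)⟩ : chart M (t i)) = 1 :=
        Subtype.ext (div_self hi.1)
      rw [← h2]
      exact h1
    · simp only [W, dif_neg hi]
      exact hbot
  let S : Finset (Subspace Ω M) :=
    insert ⊥ ((hZ.toFinset ×ˢ Finset.univ).image fun p : 𝒞 × ι => W p.1 p.2)
  have hS : ⊤ ∉ S := by
    intro h
    rcases Finset.mem_insert.1 h with h | h
    · exact hbot h.symm
    · obtain ⟨p, -, hp⟩ := Finset.mem_image.1 h
      exact htop _ _ hp
  obtain ⟨h, hh⟩ := (Set.ne_univ_iff_exists_notMem _).1 (Subspace.biUnion_ne_univ_of_top_notMem hS)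
  have hh' : ∀ p ∈ S, h ∉ p := fun p hp hhp => hh (Set.mem_biUnion hp hhp)
  have hh0 : (h : L) ≠ 0 := fun h0 =>
    hh' ⊥ (Finset.mem_insert_self _ _) ((Submodule.mem_bot Ω).2 (Subtype.ext h0))
  refine ⟨h, h.2, hh0, fun y hy i hi hl => ?_⟩
  have h1 := hh' (W y i) (Finset.mem_insert_of_mem (Finset.mem_image.2
    ⟨(y, i), by simpa using hy, rfl⟩))
  rw [hW y i hi hl, mem_centre_iff, not_not] at h1
  · exact h1
  · exact fun h0 => (div_ne_zero hh0 hi) congr(($h0 : L))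

/-- The degree of a principal divisor on a projective curve is zero. -/
theorem sum_eq_zero [IsAlgClosed Ω] {f : L} (hf : f ≠ 0) (g : 𝒞 →₀ ℤ)
    (hg : ∀ y, ∀ a ∈ R y, ∀ b ∈ R y, b ≠ 0 → f * b = a →
      g y + lengthMod (R y) b = lengthMod (R y) a) : ∑ y ∈ g.support, g y = 0 := by
  classical
  rcases isEmpty_or_nonempty 𝒞 with _ | ⟨⟨y₀⟩⟩
  · rw [Finset.eq_empty_of_isEmpty g.support, Finset.sum_empty]
  obtain ⟨i₀, hi₀, -⟩ := H.exists_chart y₀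
  obtain ⟨a, ha, b, hb, hb0, hab⟩ := H.exists_mul_eq i₀ hi₀ f
  have ha0 : a ≠ 0 := hab ▸ mul_ne_zero hf hb0
  obtain ⟨p, hp⟩ := (mem_chart_iff (H.mem i₀) hi₀).1 ha
  obtain ⟨q, hq⟩ := (mem_chart_iff (H.mem i₀) hi₀).1 hb
  obtain ⟨d, F, G, hF, hG, hF0, hG0, hFG⟩ : ∃ d, ∃ F G : L, F ∈ M ^ d ∧ G ∈ M ^ d ∧ F ≠ 0 ∧
      G ≠ 0 ∧ f * G = F :=
    ⟨max p q, a * t i₀ ^ max p q, b * t i₀ ^ max p q,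
      mul_pow_mem_pow (H.mem i₀) (le_max_left _ _) hp,
      mul_pow_mem_pow (H.mem i₀) (le_max_right _ _) hq, mul_ne_zero ha0 (pow_ne_zero _ hi₀),
      mul_ne_zero hb0 (pow_ne_zero _ hi₀), by rw [← mul_assoc, hab]⟩
  have hfin (x : L) (hx : x ∈ M ^ d) (hx0 : x ≠ 0) : {y | ∃ i, t i ≠ 0 ∧
      IsLocalizationIn (chart M (t i)) (R y) ∧ (x / t i ^ d)⁻¹ ∉ R y}.Finite := by
    refine (Set.finite_iUnion (f := fun i => {y | t i ≠ 0 ∧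
      IsLocalizationIn (chart M (t i)) (R y) ∧ (x / t i ^ d)⁻¹ ∉ R y}) fun i => ?_).subset
      fun y ⟨i, hi⟩ => Set.mem_iUnion.2 ⟨i, hi⟩
    by_cases hi : t i = 0
    · simp [hi]
    · exact (H.finite_setOf i hi (div_pow_mem_chart hi d hx)
        (div_ne_zero hx0 (pow_ne_zero d hi))).subset fun y hy => hy.2
  have hZ := (hfin F hF hF0).union (hfin G hG hG0)
  have : Infinite Ω := IsAlgClosed.instInfinite
  obtain ⟨h, hh, hh0, hZh⟩ := H.exists_avoiding i₀ hi₀ hZ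
  let Z : Finset 𝒞 := hZ.toFinset.filter fun y => IsLocalizationIn (chart M h) (R y)
  have hZl : ∀ y ∈ Z, IsLocalizationIn (chart M h) (R y) := fun y hy => (Finset.mem_filter.1 hy).2
  have hmemZ (x : L) (hx : x = F ∨ x = G) (y : 𝒞) (hy : IsLocalizationIn (chart M h) (R y))
      (hxy : (x / h ^ d)⁻¹ ∉ R y) : y ∈ Z := by
    obtain ⟨i, hi, hl, -⟩ := H.exists_chart y
    have h1 : (x / t i ^ d)⁻¹ ∉ R y := fun hx' => hxy (inv_div_mem hh hh0 hi hl d hx')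
    refine Finset.mem_filter.2 ⟨hZ.mem_toFinset.2 ?_, hy⟩
    rcases hx with rfl | rfl
    · exact Or.inl ⟨i, hi, hl, h1⟩
    · exact Or.inr ⟨i, hi, hl, h1⟩
  obtain ⟨r₁, h₁⟩ := H.exists_finrank_add hh hh0 hF0 d hF
    (fun y i hi hl hy => hZh y (Or.inl ⟨i, hi, hl, hy⟩) i hi hl) Z hZl (hmemZ F (Or.inl rfl))
  obtain ⟨r₂, h₂⟩ := H.exists_finrank_add hh hh0 hG0 d hG
    (fun y i hi hl hy => hZh y (Or.inr ⟨i, hi, hl, hy⟩) i hi hl) Z hZl (hmemZ G (Or.inr rfl))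
  have hsum := (h₁ _ (le_max_left r₁ r₂)).symm.trans (h₂ _ (le_max_right r₁ r₂))
  have hpow (x : L) (hx0 : x ≠ 0) : x ^ d ≠ 0 := pow_ne_zero d hx0
  have hmem (x : L) (hx : x ∈ M ^ d) (y : 𝒞) (x' : L) (hx' : x' ≠ 0)
      (hy : IsLocalizationIn (chart M x') (R y)) : x / x' ^ d ∈ R y :=
    hy.le (div_pow_mem_chart hx' d hx)
  have hval (y : 𝒞) (x : L) (hx0 : x ≠ 0) (hy : IsLocalizationIn (chart M x) (R y)) :
      g y + lengthMod (R y) (G / x ^ d) = lengthMod (R y) (F / x ^ d) :=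
    hg y _ (hmem F hF y x hx0 hy) _ (hmem G hG y x hx0 hy) (div_ne_zero hG0 (hpow x hx0))
      (by rw [mul_div_assoc', hFG])
  have hsupp : g.support ⊆ Z := by
    intro y hy
    by_contra hyZ
    refine Finsupp.mem_support_iff.1 hy ?_
    obtain ⟨i, hi, hl, -⟩ := H.exists_chart y
    have hzero (x : L) (hx : x = F ∨ x = G) : (x / t i ^ d)⁻¹ ∈ R y := by
      by_contra hxy
      have hyZ' : y ∈ hZ.toFinset := by
        rw [hZ.mem_toFinset]
        rcases hx with rfl | rfl
        · exact Or.inl ⟨i, hi, hl, hxy⟩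
        · exact Or.inr ⟨i, hi, hl, hxy⟩
      have h3 := hZh y (hZ.mem_toFinset.1 hyZ') i hi hl
      rw [inv_div] at h3
      exact hyZ (Finset.mem_filter.2 ⟨hyZ', hl.of_chart (H.mem i) hi hh0
        (hl.le (div_mem_chart hi hh)) h3⟩)
    have h4 := hval y (t i) hi hl
    rw [lengthMod_eq_zero (hmem F hF y _ hi hl) (div_ne_zero hF0 (hpow _ hi)) (hzero F (Or.inl rfl)),
      lengthMod_eq_zero (hmem G hG y _ hi hl) (div_ne_zero hG0 (hpow _ hi))
        (hzero G (Or.inr rfl))] at h4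
    simpa using h4
  rw [Finset.sum_subset hsupp fun y _ hy => Finsupp.notMem_support_iff.1 hy]
  have h5 : ∑ y ∈ Z, g y + ∑ y ∈ Z, (lengthMod (R y) (G / h ^ d) : ℤ) =
      ∑ y ∈ Z, (lengthMod (R y) (F / h ^ d) : ℤ) := by
    rw [← Finset.sum_add_distrib]
    exact Finset.sum_congr rfl fun y hy => hval y h hh0 (hZl y hy)
  have h6 : ∑ y ∈ Z, (lengthMod (R y) (F / h ^ d) : ℤ) =
      ∑ y ∈ Z, (lengthMod (R y) (G / h ^ d) : ℤ) := by
    exact_mod_cast Nat.add_right_cancel hsum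
  omega

end IsCurveAtlas

end Degree

section Coordinates

/-- Homogeneous coordinates on a scheme `Y` over a field: affine opens `U i` that cover `Y`, and
functions `u i j` on `U i` (the quotients of the coordinates) that generate the algebra of
functions on `U i`. -/
structure Coordinates {K : Type u} [Field K] {Y : Scheme.{u}} (π : Y ⟶ Spec (.of K))
    (ι : Type) where
  /-- the affine charts -/
  U : ι → Y.Opens
  /-- the quotients of the coordinates -/
  u (i j : ι) : Γ(Y, U i)
  isAffineOpen (i) : IsAffineOpen (U i)
  exists_mem (x : Y) : ∃ i, x ∈ U i
  mem_iff (i j : ι) (x : Y) (hx : x ∈ U i) : IsUnit (Y.presheaf.germ (U i) x hx (u i j)) ↔ x ∈ U j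
  germ_eq (i j m : ι) (x : Y) (hi : x ∈ U i) (hj : x ∈ U j) : Y.presheaf.germ (U i) x hi (u i m) =
    Y.presheaf.germ (U i) x hi (u i j) * Y.presheaf.germ (U j) x hj (u j m)
  closure_eq_top (i) : Subring.closure
    (Set.range (π.appLE ⊤ (U i) le_top).hom ∪ Set.range (u i)) = ⊤

variable {K : Type u} [Field K] {Y : Scheme.{u}} {π : Y ⟶ Spec (.of K)} {ι : Type}

/-- The pullback of homogeneous coordinates along an affine morphism. -/
noncomputable def Coordinates.comap (c : Coordinates π ι) {K' : Type u} [Field K'] {Y' : Scheme.{u}}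
    (π' : Y' ⟶ Spec (.of K')) (r : Y' ⟶ Y) [IsAffineHom r]
    (h : ∀ i, Subring.closure (Set.range (π'.appLE ⊤ (r ⁻¹ᵁ c.U i) le_top).hom ∪
      Set.range fun j => (r.app (c.U i)).hom (c.u i j)) = ⊤) : Coordinates π' ι where
  U i := r ⁻¹ᵁ c.U i
  u i j := (r.app (c.U i)).hom (c.u i j)
  isAffineOpen i := (c.isAffineOpen i).preimage r
  exists_mem x := c.exists_mem (r x)
  mem_iff i j x hx := by
    rw [← Scheme.Hom.germ_stalkMap_apply r (c.U i) x hx, isUnit_map_iff]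
    exact c.mem_iff i j (r x) hx
  germ_eq i j m x hi hj := by
    rw [← Scheme.Hom.germ_stalkMap_apply r (c.U i) x hi, ← Scheme.Hom.germ_stalkMap_apply r _ x hi,
      ← Scheme.Hom.germ_stalkMap_apply r _ x hj, ← map_mul]
    exact congrArg (r.stalkMap x).hom (c.germ_eq i j m (r x) hi hj)
  closure_eq_top := h

lemma closure_union_range_eq_top_of_isPushout {A B C D : CommRingCat.{u}} {f : A ⟶ B} {g : A ⟶ C}
    {f' : B ⟶ D} {g' : C ⟶ D} (h : IsPushout f g f' g') :
    Subring.closure (Set.range f'.hom ∪ Set.range g'.hom) = ⊤ := by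
  set S := Subring.closure (Set.range f'.hom ∪ Set.range g'.hom)
  let a : B ⟶ .of S := CommRingCat.ofHom (f'.hom.codRestrict S fun x =>
    Subring.subset_closure (Or.inl ⟨x, rfl⟩))
  let b : C ⟶ .of S := CommRingCat.ofHom (g'.hom.codRestrict S fun x =>
    Subring.subset_closure (Or.inr ⟨x, rfl⟩))
  have hab : f ≫ a = g ≫ b := by
    ext x
    exact congrArg (fun φ : A ⟶ D => φ.hom x) h.w
  have hid : h.desc a b hab ≫ CommRingCat.ofHom S.subtype = 𝟙 D := by
    refine h.hom_ext ?_ ?_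
    · rw [h.inl_desc_assoc, Category.comp_id]
      rfl
    · rw [h.inr_desc_assoc, Category.comp_id]
      rfl
  refine top_le_iff.1 fun x _ => ?_
  have h1 : ((h.desc a b hab).hom x : D) = x := congrArg (fun φ : D ⟶ D => φ.hom x) hid
  rw [← h1]
  exact ((h.desc a b hab).hom x).2

lemma map_closure_range_union {A B C D : Type*} [CommRing A] [CommRing B] [CommRing C]
    [CommRing D] (f : A →+* B) (g : B →+* D) {ι : Type*} (u : ι → B) (h : C →+* D)
    (hu : Subring.closure (Set.range f ∪ Set.range u) = ⊤)
    (hD : Subring.closure (Set.range g ∪ Set.range h) = ⊤) (hfg : ∀ a, ∃ c, g (f a) = h c) :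
    Subring.closure (Set.range h ∪ Set.range fun j => g (u j)) = ⊤ := by
  rw [← top_le_iff, ← hD, Subring.closure_le]
  rintro x (⟨b, rfl⟩ | ⟨c, rfl⟩)
  · have hb : b ∈ Subring.closure (Set.range f ∪ Set.range u) := hu ▸ trivial
    induction hb using Subring.closure_induction with
    | mem b hb =>
      rcases hb with ⟨a, rfl⟩ | ⟨j, rfl⟩
      · obtain ⟨c, hc⟩ := hfg a
        exact hc ▸ Subring.subset_closure (Or.inl ⟨c, rfl⟩)
      · exact Subring.subset_closure (Or.inr ⟨j, rfl⟩)
    | zero => simp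
    | one => simp
    | add x y _ _ hx hy => rw [map_add]; exact add_mem hx hy
    | mul x y _ _ hx hy => rw [map_mul]; exact mul_mem hx hy
    | neg x _ hx => rw [map_neg]; exact neg_mem hx
  · exact Subring.subset_closure (Or.inl ⟨c, rfl⟩)

lemma appLE_top_eq {A : CommRingCat.{u}} {Y : Scheme.{u}} (π : Y ⟶ Spec A) {U : Y.Opens}
    (hU : IsAffineOpen U) (χ : A ⟶ Γ(Y, U)) (h : U.ι ≫ π = U.toSpecΓ ≫ Spec.map χ) :
    π.appLE ⊤ U le_top = (Scheme.ΓSpecIso A).hom ≫ χ := by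
  have h2 : IsIso U.toSpecΓ := by
    rw [← hU.isoSpec_hom]
    infer_instance
  have h3 := Scheme.Opens.toSpecΓ_SpecMap_presheaf_map_top (⊤ : (Spec A).Opens)
  have h4 : (homOfLE (le_top : (⊤ : (Spec A).Opens) ≤ ⊤)).op = 𝟙 _ := rfl
  rw [h4, (Spec A).presheaf.map_id, Spec.map_id, Category.comp_id] at h3
  have hle : U ≤ π ⁻¹ᵁ ⊤ := le_top
  change π.appLE ⊤ U hle = _
  apply Spec.map_injective
  rw [← cancel_epi U.toSpecΓ, Scheme.Opens.toSpecΓ_SpecMap_appLE, h3, Scheme.Hom.resLE_comp_ι_assoc, Spec.map_comp, ← Category.assoc, ← Category.assoc, h, SpecMap_ΓSpecIso_hom]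

lemma Coordinates.nonempty_of_isClosedImmersion (c : Coordinates π ι) {Y' : Scheme.{u}}
    (r : Y' ⟶ Y) [IsClosedImmersion r] : Nonempty (Coordinates (r ≫ π) ι) := by
  refine ⟨c.comap _ r fun i => ?_⟩
  refine map_closure_range_union (π.appLE ⊤ (c.U i) le_top).hom _ _ _ (c.closure_eq_top i) ?_
    fun a => ⟨a, ?_⟩
  · rw [← top_le_iff]
    intro x _
    obtain ⟨y, rfl⟩ := r.app_surjective _ (c.isAffineOpen i) x
    exact Subring.subset_closure (Or.inl ⟨y, rfl⟩)
  · rw [← Scheme.Hom.appLE_comp_appLE r π ⊤ (c.U i) (r ⁻¹ᵁ c.U i) le_top le_rfl,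
      Scheme.Hom.app_eq_appLE]
    rfl

lemma Coordinates.nonempty_of_isPullback (c : Coordinates π ι) {Y' : Scheme.{u}} {K' : Type u}
    [Field K'] {p : Y' ⟶ Y} {π' : Y' ⟶ Spec (.of K')} {φ : Spec (.of K') ⟶ Spec (.of K)}
    (H : IsPullback p π' π φ) : Nonempty (Coordinates π' ι) := by
  have : IsAffineHom p := MorphismProperty.of_isPullback (P := @IsAffineHom) H.flip inferInstance
  refine ⟨c.comap _ p fun i => ?_⟩
  have h1 := isIso_pushoutSection_of_isAffineOpen H (US := ⊤) (UT := ⊤) (UX := c.U i)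
    (UY := p ⁻¹ᵁ c.U i) le_top le_top (by simp) (isAffineOpen_top _) (isAffineOpen_top _)
    (c.isAffineOpen i)
  replace h1 := (isIso_pushoutSection_iff H le_top (by simp) (by simp)).1 h1
  refine map_closure_range_union (π.appLE ⊤ (c.U i) le_top).hom _ _ _ (c.closure_eq_top i) ?_
    fun a => ⟨(φ.appLE ⊤ ⊤ le_top).hom a, ?_⟩
  · rw [Scheme.Hom.app_eq_appLE]
    exact closure_union_range_eq_top_of_isPushout h1
  · rw [Scheme.Hom.app_eq_appLE]
    exact congr($(h1.w).hom a)

end Coordinates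

section Proj

attribute [local instance] MvPolynomial.gradedAlgebra

/-- The grading of the polynomial ring in `N + 1` variables by degree. -/
abbrev homogeneousParts (k : Type u) [Field k] (N : ℕ) :
    ℕ → Submodule k (MvPolynomial (Fin (N + 1)) k) :=
  MvPolynomial.homogeneousSubmodule (Fin (N + 1)) k

variable (k : Type u) [Field k] (N : ℕ)

open HomogeneousLocalization

lemma X_mem_homogeneousSubmodule (i : Fin (N + 1)) : MvPolynomial.X i ∈ (homogeneousParts k N) 1 :=
  MvPolynomial.isHomogeneous_X k i

/-- The quotient of two coordinates on projective space. -/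
noncomputable def coordinateQuotient (i j : Fin (N + 1)) :
    Away (homogeneousParts k N) (MvPolynomial.X i : MvPolynomial (Fin (N + 1)) k) :=
  Away.mk (homogeneousParts k N) (X_mem_homogeneousSubmodule k N i) 1 (MvPolynomial.X j)
    (by simpa using X_mem_homogeneousSubmodule k N j)

lemma exists_stalk_ringHom (x : ProjectiveSpectrum (homogeneousParts k N)) :
    ∃ v : (projectiveSpace k N).presheaf.stalk x →+*
        Localization x.asHomogeneousIdeal.toIdeal.primeCompl,
      Function.Injective v ∧ (∀ s, IsUnit (v s) → IsUnit s) ∧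
      ∀ (i j : Fin (N + 1)) (hx : x ∈ Proj.basicOpen (homogeneousParts k N) (MvPolynomial.X i)),
        v ((projectiveSpace k N).presheaf.germ _ x hx
          ((Proj.awayToSection (homogeneousParts k N) (MvPolynomial.X i)).hom (coordinateQuotient k N i j))) =
          Localization.mk (MvPolynomial.X j) ⟨MvPolynomial.X i, hx⟩ := by
  let w : AtPrime (homogeneousParts k N) x.asHomogeneousIdeal.toIdeal →+* Localization x.asHomogeneousIdeal.toIdeal.primeCompl :=
    algebraMap _ _
  refine ⟨w.comp (Proj.stalkIso' (homogeneousParts k N) x).toRingHom, ?_, ?_, ?_⟩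
  · exact (val_injective _).comp (Proj.stalkIso' (homogeneousParts k N) x).injective
  · intro s hs
    have h1 : IsUnit (Proj.stalkIso' (homogeneousParts k N) x s) := (isUnit_iff_isUnit_val _ _ _).1 hs
    exact (MulEquiv.isUnit_map (Proj.stalkIso' (homogeneousParts k N) x)).1 h1
  · intro i j hx
    have h1 := Proj.stalkIso'_germ (homogeneousParts k N) _ x hx
      ((Proj.awayToSection (homogeneousParts k N) (MvPolynomial.X i)).hom (coordinateQuotient k N i j))
    refine (congrArg w h1).trans ?_
    refine (ProjectiveSpectrum.Proj.awayToSection_apply (homogeneousParts k N) _ (coordinateQuotient k N i j)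
      ⟨x, hx⟩).trans ?_
    rw [coordinateQuotient, Away.val_mk, Localization.mk_eq_mk', IsLocalization.map_mk',
      Localization.mk_eq_mk']
    simp

lemma isUnit_germ_coordinateQuotient_iff (x : ProjectiveSpectrum (homogeneousParts k N)) (i j : Fin (N + 1))
    (hx : x ∈ Proj.basicOpen (homogeneousParts k N) (MvPolynomial.X i)) :
    IsUnit ((projectiveSpace k N).presheaf.germ _ x hx
      ((Proj.awayToSection (homogeneousParts k N) (MvPolynomial.X i)).hom (coordinateQuotient k N i j))) ↔
      x ∈ Proj.basicOpen (homogeneousParts k N) (MvPolynomial.X j) := by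
  obtain ⟨v, -, hv, h⟩ := exists_stalk_ringHom k N x
  have h1 : IsUnit (Localization.mk (MvPolynomial.X j) ⟨MvPolynomial.X i, hx⟩ :
      Localization x.asHomogeneousIdeal.toIdeal.primeCompl) ↔
      x ∈ Proj.basicOpen (homogeneousParts k N) (MvPolynomial.X j) := by
    rw [Localization.mk_eq_mk']
    exact IsLocalization.AtPrime.isUnit_mk'_iff _ x.asHomogeneousIdeal.toIdeal _ _
  refine Iff.trans ⟨fun h => h.map v, hv _⟩ ?_
  rw [h i j hx]
  exact h1

lemma germ_coordinateQuotient_eq (x : ProjectiveSpectrum (homogeneousParts k N)) (i j m : Fin (N + 1))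
    (hi : x ∈ Proj.basicOpen (homogeneousParts k N) (MvPolynomial.X i)) (hj : x ∈ Proj.basicOpen (homogeneousParts k N) (MvPolynomial.X j)) :
    (projectiveSpace k N).presheaf.germ _ x hi
      ((Proj.awayToSection (homogeneousParts k N) (MvPolynomial.X i)).hom (coordinateQuotient k N i m)) =
    (projectiveSpace k N).presheaf.germ _ x hi
      ((Proj.awayToSection (homogeneousParts k N) (MvPolynomial.X i)).hom (coordinateQuotient k N i j)) *
    (projectiveSpace k N).presheaf.germ _ x hj
      ((Proj.awayToSection (homogeneousParts k N) (MvPolynomial.X j)).hom (coordinateQuotient k N j m)) := by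
  obtain ⟨v, hv, -, h⟩ := exists_stalk_ringHom k N x
  apply hv
  refine Eq.trans ?_ (map_mul v _ _).symm
  rw [h i m hi, h i j hi, h j m hj, Localization.mk_mul, Localization.mk_eq_mk_iff,
    Localization.r_iff_exists]
  refine ⟨1, ?_⟩
  simp only [OneMemClass.coe_one, one_mul, Submonoid.coe_mul]
  ring

lemma algebraMap_zero_surjective : Function.Surjective (algebraMap k ((homogeneousParts k N) 0)) := by
  rintro ⟨r, hr⟩
  rw [homogeneousParts, MvPolynomial.homogeneousSubmodule_zero] at hr
  obtain ⟨c, rfl⟩ := Submodule.mem_one.1 hr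
  exact ⟨c, Subtype.ext rfl⟩

lemma adjoin_X_eq_top : Algebra.adjoin ((homogeneousParts k N) 0)
    (Set.range fun i => (MvPolynomial.X i : MvPolynomial (Fin (N + 1)) k)) = ⊤ := by
  refine top_le_iff.1 fun p _ => ?_
  induction p using MvPolynomial.induction_on with
  | C c => exact Subalgebra.algebraMap_mem _ (algebraMap k ((homogeneousParts k N) 0) c)
  | add p q hp hq => exact add_mem (hp trivial) (hq trivial)
  | mul_X p i hp => exact mul_mem (hp trivial) (Algebra.subset_adjoin ⟨i, rfl⟩)

lemma closure_coordinateQuotient (i : Fin (N + 1)) :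
    Subring.closure (Set.range ((fromZeroRingHom (homogeneousParts k N)
        (.powers (MvPolynomial.X i : MvPolynomial (Fin (N + 1)) k))).comp (algebraMap k ((homogeneousParts k N) 0))) ∪
      Set.range (coordinateQuotient k N i)) = ⊤ := by
  have h1 := Away.span_mk_prod_pow_eq_top (X_mem_homogeneousSubmodule k N i)
    (fun j => MvPolynomial.X j) (adjoin_X_eq_top k N) (fun _ => 1)
    (X_mem_homogeneousSubmodule k N)
  refine top_le_iff.1 fun x _ => ?_
  have hx : x ∈ (⊤ : Submodule ((homogeneousParts k N) 0) (Away (homogeneousParts k N) (MvPolynomial.X i :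
    MvPolynomial (Fin (N + 1)) k))) := trivial
  rw [← h1] at hx
  induction hx using Submodule.span_induction with
  | zero => exact zero_mem _
  | add x y _ _ hx hy => exact add_mem (hx trivial) (hy trivial)
  | smul r x _ hx =>
    obtain ⟨c, rfl⟩ := algebraMap_zero_surjective k N r
    rw [Algebra.smul_def]
    exact mul_mem (Subring.subset_closure (Or.inl ⟨c, rfl⟩)) (hx trivial)
  | mem x hx =>
    obtain ⟨a, e, he, rfl⟩ := hx
    have h2 : Away.mk (homogeneousParts k N) (X_mem_homogeneousSubmodule k N i) a (∏ j, MvPolynomial.X j ^ e j)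
        (he ▸ SetLike.prod_pow_mem_graded _ _ _ _ fun j _ => X_mem_homogeneousSubmodule k N j) =
        ∏ j, coordinateQuotient k N i j ^ e j := by
      have he' : ∑ j, e j = a := by simpa using he
      apply val_injective
      rw [← HomogeneousLocalization.algebraMap_apply,
        ← HomogeneousLocalization.algebraMap_apply, map_prod]
      simp only [map_pow, HomogeneousLocalization.algebraMap_apply, coordinateQuotient, Away.val_mk, Localization.mk_pow]
      rw [Localization.mk_prod]
      congr 1
      apply Subtype.ext
      simp [Finset.prod_pow_eq_pow_sum, he']
    rw [h2]
    refine prod_mem fun j _ => ?_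
    refine pow_mem ?_ _
    exact Subring.subset_closure (Or.inr ⟨j, rfl⟩)

theorem nonempty_coordinates_projectiveSpace :
    Nonempty (Coordinates (projectiveSpaceStructure k N) (Fin (N + 1))) := by
  have hX := X_mem_homogeneousSubmodule k N
  refine ⟨⟨fun i => Proj.basicOpen (homogeneousParts k N) (MvPolynomial.X i),
    fun i j => (Proj.awayToSection (homogeneousParts k N) (MvPolynomial.X i)).hom (coordinateQuotient k N i j),
    fun i => Proj.isAffineOpen_basicOpen (homogeneousParts k N) _ (hX i) one_pos, ?_, ?_, ?_, ?_⟩⟩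
  · intro x
    have := Proj.iSup_basicOpen_eq_top' (homogeneousParts k N) (fun i : Fin (N + 1) => MvPolynomial.X i)
      (fun i => ⟨1, hX i⟩) (adjoin_X_eq_top k N)
    have hx : x ∈ (⊤ : (Proj (homogeneousParts k N)).Opens) := trivial
    rw [← this] at hx
    simpa using hx
  · exact fun i j x hx => isUnit_germ_coordinateQuotient_iff k N x i j hx
  · exact fun i j m x hi hj => germ_coordinateQuotient_eq k N x i j m hi hj
  · intro i
    have h1 : (projectiveSpaceStructure k N).appLE ⊤ (Proj.basicOpen (homogeneousParts k N) (MvPolynomial.X i)) le_top =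
        (Scheme.ΓSpecIso _).hom ≫ CommRingCat.ofHom ((fromZeroRingHom (homogeneousParts k N)
        (.powers (MvPolynomial.X i : MvPolynomial (Fin (N + 1)) k))).comp (algebraMap k ((homogeneousParts k N) 0))) ≫
        Proj.awayToSection (homogeneousParts k N) (MvPolynomial.X i) := by
      have h3 : (Proj.basicOpen (homogeneousParts k N) (MvPolynomial.X i)).ι ≫ Proj.toSpecZero (homogeneousParts k N) =
          Proj.basicOpenToSpec (homogeneousParts k N) (MvPolynomial.X i) ≫
            Spec.map (CommRingCat.ofHom (fromZeroRingHom (homogeneousParts k N) _)) := by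
        rw [← Proj.awayι_toSpecZero (homogeneousParts k N) _ (hX i) one_pos, ← Proj.basicOpenIsoSpec_inv_ι,
          ← Proj.basicOpenIsoSpec_hom (homogeneousParts k N) _ (hX i) one_pos, Category.assoc, Iso.hom_inv_id_assoc]
      refine appLE_top_eq _ (Proj.isAffineOpen_basicOpen (homogeneousParts k N) _ (hX i) one_pos) _ ?_
      rw [← Category.assoc, h3, Category.assoc, ← Spec.map_comp, Proj.basicOpenToSpec,
        Category.assoc, ← Spec.map_comp, Category.assoc]
      rfl
    have h2 : Function.Surjective (Proj.awayToSection (homogeneousParts k N)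
        (MvPolynomial.X i : MvPolynomial (Fin (N + 1)) k)).hom := by
      have := (Proj.basicOpenIsoAway (homogeneousParts k N) _ (hX i) one_pos).isIso_hom
      rw [Proj.basicOpenIsoAway_hom] at this
      exact (ConcreteCategory.bijective_of_isIso _).2
    have h3 := congrArg (Subring.map (Proj.awayToSection (homogeneousParts k N)
        (MvPolynomial.X i : MvPolynomial (Fin (N + 1)) k)).hom) (closure_coordinateQuotient k N i)
    rw [RingHom.map_closure, ← RingHom.range_eq_map, RingHom.range_eq_top.2 h2, Set.image_union,
      ← Set.range_comp, ← Set.range_comp] at h3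
    rw [← h3, h1]
    congr 2
    exact (ConcreteCategory.bijective_of_isIso
      (Scheme.ΓSpecIso (.of k)).hom).2.range_comp
      (⇑(Proj.awayToSection (homogeneousParts k N) (MvPolynomial.X i)).hom ∘ ⇑((fromZeroRingHom (homogeneousParts k N)
        (.powers (MvPolynomial.X i : MvPolynomial (Fin (N + 1)) k))).comp (algebraMap k ((homogeneousParts k N) 0))))

end Proj

section Ranges

variable {Ω L A : Type*} [Field Ω] [Field L] [Algebra Ω L] [CommRing A]

/-- The range of a ring homomorphism to `L` whose image contains `Ω`, as a subalgebra. -/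
def rangeSubalgebra (φ : A →+* L) (h : ∀ c, algebraMap Ω L c ∈ φ.range) : Subalgebra Ω L :=
  { φ.range with algebraMap_mem' := h }

/-- The surjection onto the range. -/
def toRangeSubalgebra (φ : A →+* L) (h : ∀ c, algebraMap Ω L c ∈ φ.range) :
    A →+* rangeSubalgebra φ h :=
  φ.codRestrict (rangeSubalgebra φ h) fun a => ⟨a, rfl⟩

lemma toRangeSubalgebra_surjective (φ : A →+* L) (h : ∀ c, algebraMap Ω L c ∈ φ.range) :
    Function.Surjective (toRangeSubalgebra φ h) := by
  rintro ⟨_, a, rfl⟩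
  exact ⟨a, rfl⟩

lemma ker_toRangeSubalgebra (φ : A →+* L) (h : ∀ c, algebraMap Ω L c ∈ φ.range) :
    RingHom.ker (toRangeSubalgebra φ h) = RingHom.ker φ := by
  ext a
  rw [RingHom.mem_ker, RingHom.mem_ker]
  exact Subtype.ext_iff

instance [IsLocalRing A] (φ : A →+* L) (h : ∀ c, algebraMap Ω L c ∈ φ.range) :
    IsLocalRing (rangeSubalgebra φ h) :=
  IsLocalRing.of_surjective' _ (toRangeSubalgebra_surjective φ h)

lemma inv_mem_rangeSubalgebra_iff [IsLocalRing A] {φ : A →+* L}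
    {h : ∀ c, algebraMap Ω L c ∈ φ.range} {a : A} (ha : φ a ≠ 0) :
    (φ a)⁻¹ ∈ rangeSubalgebra φ h ↔ IsUnit a := by
  constructor
  · rintro ⟨b, hb⟩
    have h1 : φ (1 - a * b) = 0 := by
      rw [map_sub, map_one, map_mul, hb, mul_inv_cancel₀ ha, sub_self]
    rcases IsLocalRing.isUnit_or_isUnit_one_sub_self (a * b) with h2 | h2
    · exact isUnit_of_mul_isUnit_left h2
    · exact absurd h1 (h2.map φ).ne_zero
  · rintro ⟨u, rfl⟩
    refine ⟨(u⁻¹ : Aˣ), ?_⟩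
    exact eq_inv_of_mul_eq_one_left (by rw [← map_mul, u.inv_mul, map_one])

end Ranges

section Evaluation

variable {Y : Scheme.{u}}

lemma evalAt_germ {η y : Y} (h : η ⤳ y) {U : Y.Opens} (hη : η ∈ U) (hy : y ∈ U) (s : Γ(Y, U)) :
    evalAt h (Y.presheaf.germ U y hy s) = (Y.evaluation U η hη).hom s :=
  congrArg (Y.residue η).hom (Y.presheaf.germ_stalkSpecializes_apply hy h s)

lemma mem_primeIdealOf_iff {U : Y.Opens} (hU : IsAffineOpen U) {y : Y} (hy : y ∈ U)
    (s : Γ(Y, U)) :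
    s ∈ (hU.primeIdealOf ⟨y, hy⟩).asIdeal ↔ ¬ IsUnit (Y.presheaf.germ U y hy s) := by
  let : Algebra Γ(Y, U) (Y.presheaf.stalk y) := (Y.presheaf.germ U y hy).hom.toAlgebra
  have : IsLocalization.AtPrime (Y.presheaf.stalk y) (hU.primeIdealOf ⟨y, hy⟩).asIdeal :=
    hU.isLocalization_stalk ⟨y, hy⟩
  exact iff_not_comm.1 (IsLocalization.AtPrime.isUnit_to_map_iff (Y.presheaf.stalk y)
    (hU.primeIdealOf ⟨y, hy⟩).asIdeal s)

lemma exists_mul_germ_eq {U : Y.Opens} (hU : IsAffineOpen U) {y : Y} (hy : y ∈ U)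
    (a : Y.presheaf.stalk y) : ∃ s b : Γ(Y, U), IsUnit (Y.presheaf.germ U y hy s) ∧
      a * Y.presheaf.germ U y hy s = Y.presheaf.germ U y hy b := by
  let : Algebra Γ(Y, U) (Y.presheaf.stalk y) := (Y.presheaf.germ U y hy).hom.toAlgebra
  have : IsLocalization.AtPrime (Y.presheaf.stalk y) (hU.primeIdealOf ⟨y, hy⟩).asIdeal :=
    hU.isLocalization_stalk ⟨y, hy⟩
  obtain ⟨⟨b, s⟩, h⟩ := IsLocalization.surj (hU.primeIdealOf ⟨y, hy⟩).asIdeal.primeCompl a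
  exact ⟨s, b, IsLocalization.map_units (Y.presheaf.stalk y) s, h⟩

lemma primeIdealOf_eq_ker {U : Y.Opens} (hU : IsAffineOpen U) {η : Y} (hη : η ∈ U) :
    (hU.primeIdealOf ⟨η, hη⟩).asIdeal = RingHom.ker (Y.evaluation U η hη).hom := by
  ext s
  rw [mem_primeIdealOf_iff, RingHom.mem_ker, ← mem_nonunits_iff, ← IsLocalRing.mem_maximalIdeal,
    ← IsLocalRing.residue_eq_zero_iff]
  rfl

lemma primeIdealOf_fromSpec {U : Y.Opens} (hU : IsAffineOpen U) (Q : ↥(Spec Γ(Y, U)))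
    (h : hU.fromSpec Q ∈ U) : hU.primeIdealOf ⟨hU.fromSpec Q, h⟩ = Q :=
  hU.fromSpec.isEmbedding.injective (hU.fromSpec_primeIdealOf _)

lemma fromSpec_mem {U : Y.Opens} (hU : IsAffineOpen U) (Q : ↥(Spec Γ(Y, U))) :
    hU.fromSpec Q ∈ U := by
  have : hU.fromSpec Q ∈ Set.range hU.fromSpec := ⟨Q, rfl⟩
  rwa [hU.range_fromSpec] at this

lemma isMaximal_primeIdealOf {U : Y.Opens} (hU : IsAffineOpen U) {y : Y} (hy : y ∈ U)
    (h : IsClosed ({y} : Set Y)) : (hU.primeIdealOf ⟨y, hy⟩).asIdeal.IsMaximal := by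
  rw [← PrimeSpectrum.isClosed_singleton_iff_isMaximal]
  have h1 : hU.fromSpec ⁻¹' {y} = {hU.primeIdealOf ⟨y, hy⟩} := by
    ext Q
    have h2 := hU.fromSpec_primeIdealOf ⟨y, hy⟩
    constructor
    · exact fun hQ => hU.fromSpec.isEmbedding.injective (hQ.trans h2.symm)
    · rintro rfl
      exact h2
  exact h1 ▸ h.preimage hU.fromSpec.continuous

lemma specializes_fromSpec {U : Y.Opens} (hU : IsAffineOpen U) {η : Y} (hη : η ∈ U)
    (Q : ↥(Spec Γ(Y, U))) (h : RingHom.ker (Y.evaluation U η hη).hom ≤ Q.asIdeal) :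
    η ⤳ hU.fromSpec Q := by
  have h1 := hU.fromSpec_primeIdealOf ⟨η, hη⟩
  have h2 : hU.primeIdealOf ⟨η, hη⟩ ⤳ Q :=
    (PrimeSpectrum.le_iff_specializes _ _).1 ((primeIdealOf_eq_ker hU hη).trans_le h)
  have h3 := h2.map hU.fromSpec.continuous
  rwa [h1] at h3

end Evaluation

open Module

lemma isMaximal_of_isMaximal_comap {A B : Type*} [CommRing A] [CommRing B] {f : A →+* B}
    (hf : Function.Surjective f) {P : Ideal B} (h : (P.comap f).IsMaximal) : P.IsMaximal := by
  rw [← Ideal.map_comap_of_surjective f hf P]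
  exact Ideal.IsMaximal.map_of_surjective_of_ker_le hf fun x hx =>
    Ideal.mem_comap.2 ((RingHom.mem_ker.1 hx).symm ▸ P.zero_mem)

section Degree

variable {Ω : Type u} [Field Ω] {Y : Scheme.{u}} (π : Y ⟶ Spec (.of Ω)) (η : Y)

/-- The field `Ω` acts on the residue fields of an `Ω`-scheme. -/
noncomputable def residueFieldHom : Ω →+* Y.residueField η :=
  (((Scheme.ΓSpecIso (.of Ω)).inv ≫ π.appTop ≫ Y.evaluation ⊤ η trivial).hom :)

variable {π η}

lemma evaluation_appLE {U : Y.Opens} (hη : η ∈ U) (c : Γ(Spec (.of Ω), ⊤)) :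
    (Y.evaluation U η hη).hom ((π.appLE ⊤ U le_top).hom c) =
      residueFieldHom π η ((Scheme.ΓSpecIso (.of Ω)).hom.hom c) := by
  have h1 : (Scheme.ΓSpecIso (.of Ω)).inv.hom ((Scheme.ΓSpecIso (.of Ω)).hom.hom c) = c :=
    congrArg (fun φ : Γ(Spec (.of Ω), ⊤) ⟶ Γ(Spec (.of Ω), ⊤) => φ.hom c)
      (Scheme.ΓSpecIso (.of Ω)).hom_inv_id
  have h2 : residueFieldHom π η ((Scheme.ΓSpecIso (.of Ω)).hom.hom c) =
      (Y.evaluation ⊤ η trivial).hom (π.appTop.hom c) :=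
    congrArg (fun c => (Y.evaluation ⊤ η trivial).hom (π.appTop.hom c)) h1
  rw [h2]
  exact congrArg (Y.residue η).hom (Y.presheaf.germ_res_apply (homOfLE le_top) η hη _)

variable [Algebra Ω (Y.residueField η)] (halg : algebraMap Ω (Y.residueField η) = residueFieldHom π η)

include halg

lemma algebraMap_mem_range_evaluation {U : Y.Opens} (hη : η ∈ U) (c : Ω) :
    algebraMap Ω (Y.residueField η) c ∈ (Y.evaluation U η hη).hom.range := by
  refine ⟨(π.appLE ⊤ U le_top).hom ((Scheme.ΓSpecIso (.of Ω)).inv.hom c), ?_⟩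
  rw [evaluation_appLE, halg]
  exact congrArg (fun φ : CommRingCat.of Ω ⟶ .of Ω => residueFieldHom π η (φ.hom c))
    (Scheme.ΓSpecIso (.of Ω)).inv_hom_id

lemma algebraMap_mem_range_evalAt {y : Y} (h : η ⤳ y) (c : Ω) :
    algebraMap Ω (Y.residueField η) c ∈ (evalAt h).range := by
  obtain ⟨s, hs⟩ := algebraMap_mem_range_evaluation halg (U := ⊤) trivial c
  exact ⟨_, (evalAt_germ (U := ⊤) h trivial trivial s).trans hs⟩

/-- The local ring at `y` of the closure of `η`, as a subalgebra of the residue field of `η`. -/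
noncomputable def localSubalgebra {y : Y} (h : η ⤳ y) : Subalgebra Ω (Y.residueField η) :=
  rangeSubalgebra (evalAt h) (algebraMap_mem_range_evalAt halg h)

instance {y : Y} (h : η ⤳ y) : IsLocalRing (localSubalgebra halg h) :=
  inferInstanceAs (IsLocalRing (rangeSubalgebra _ _))

lemma inv_mem_localSubalgebra_iff {y : Y} (h : η ⤳ y) {a : Y.presheaf.stalk y}
    (ha : evalAt h a ≠ 0) : (evalAt h a)⁻¹ ∈ localSubalgebra halg h ↔ IsUnit a :=
  inv_mem_rangeSubalgebra_iff ha

lemma lengthMod_localSubalgebra {y : Y} (h : η ⤳ y) (a : Y.presheaf.stalk y) :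
    lengthMod (localSubalgebra halg h) (evalAt h a) = (ordLen h a).toNat := by
  rw [lengthMod_of_mem (show evalAt h a ∈ localSubalgebra halg h from ⟨a, rfl⟩), ordLen, primeAt,
    ← ker_toRangeSubalgebra _ (algebraMap_mem_range_evalAt halg h), length_quotient_ker_sup _
    (toRangeSubalgebra_surjective _ (algebraMap_mem_range_evalAt halg h))]
  rfl

lemma mem_primeIdealOf_iff_inv_notMem {y : Y} (h : η ⤳ y) {U : Y.Opens} (hU : IsAffineOpen U)
    (hη : η ∈ U) (hy : y ∈ U) (s : Γ(Y, U)) : s ∈ (hU.primeIdealOf ⟨y, hy⟩).asIdeal ↔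
      (Y.evaluation U η hη).hom s ≠ 0 → ((Y.evaluation U η hη).hom s)⁻¹ ∉ localSubalgebra halg h := by
  rw [mem_primeIdealOf_iff, ← evalAt_germ h hη hy]
  by_cases h0 : evalAt h (Y.presheaf.germ U y hy s) = 0
  · simp only [h0, ne_eq, not_true_eq_false, false_imp_iff, iff_true]
    exact fun hu => (hu.map (evalAt h)).ne_zero h0
  · rw [inv_mem_localSubalgebra_iff halg h h0]
    simp [h0]

variable {ι : Type} (c : Coordinates π ι)

omit [Algebra Ω (Y.residueField η)] halg in
lemma exists_homogeneousCoordinates : ∃ t : ι → Y.residueField η,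
    (∀ i, t i ≠ 0 ↔ η ∈ c.U i) ∧
      ∀ i (hi : η ∈ c.U i) j, (Y.evaluation (c.U i) η hi).hom (c.u i j) = t j / t i := by
  obtain ⟨i₀, hi₀⟩ := c.exists_mem η
  have h1 (j : ι) : (Y.evaluation (c.U i₀) η hi₀).hom (c.u i₀ j) ≠ 0 ↔ η ∈ c.U j := by
    rw [← c.mem_iff i₀ j η hi₀]
    exact IsLocalRing.residue_ne_zero_iff_isUnit _
  refine ⟨fun j => (Y.evaluation (c.U i₀) η hi₀).hom (c.u i₀ j), h1, fun i hi j => ?_⟩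
  rw [eq_div_iff ((h1 i).2 hi), mul_comm]
  have h2 := congrArg (Y.residue η).hom (c.germ_eq i₀ i j η hi₀ hi)
  rw [map_mul] at h2
  exact h2.symm

variable {t : ι → Y.residueField η} (ht : ∀ i, t i ≠ 0 ↔ η ∈ c.U i)
  (htu : ∀ i (hi : η ∈ c.U i) j, (Y.evaluation (c.U i) η hi).hom (c.u i j) = t j / t i)

include ht htu

lemma rangeSubalgebra_evaluation_eq (i : ι) (hi : η ∈ c.U i) :
    rangeSubalgebra (Y.evaluation (c.U i) η hi).hom (algebraMap_mem_range_evaluation halg hi) =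
      chart (Submodule.span Ω (Set.range t)) (t i) := by
  have hti := (ht i).2 hi
  refine le_antisymm ?_ (Algebra.adjoin_le ?_)
  · rintro _ ⟨a, rfl⟩
    have ha : a ∈ Subring.closure
      (Set.range (π.appLE ⊤ (c.U i) le_top).hom ∪ Set.range (c.u i)) := c.closure_eq_top i ▸ trivial
    change (Y.evaluation (c.U i) η hi).hom a ∈ _
    induction ha using Subring.closure_induction with
    | mem a ha =>
      rcases ha with ⟨b, rfl⟩ | ⟨j, rfl⟩
      · rw [evaluation_appLE, ← halg]
        exact Subalgebra.algebraMap_mem _ _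
      · rw [htu]
        exact div_mem_chart hti (Submodule.subset_span ⟨j, rfl⟩)
    | zero => simp
    | one => simp
    | add x y _ _ hx hy => rw [map_add]; exact add_mem hx hy
    | mul x y _ _ hx hy => rw [map_mul]; exact mul_mem hx hy
    | neg x _ hx => rw [map_neg]; exact neg_mem hx
  · rintro a ⟨ha, -⟩
    have h1 : Submodule.span Ω (Set.range t) ≤ (Subalgebra.toSubmodule
        (rangeSubalgebra (Y.evaluation (c.U i) η hi).hom
          (algebraMap_mem_range_evaluation halg hi))).comap (LinearMap.mulRight Ω (t i)⁻¹) := by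
      rw [Submodule.span_le]
      rintro _ ⟨j, rfl⟩
      exact ⟨c.u i j, (htu i hi j).trans (div_eq_mul_inv _ _)⟩
    have h2 : a * t i * (t i)⁻¹ ∈ rangeSubalgebra (Y.evaluation (c.U i) η hi).hom
      (algebraMap_mem_range_evaluation halg hi) := h1 ha
    rwa [mul_inv_cancel_right₀ hti] at h2

/-- The surjection from the functions on a chart of `Y` to a chart of the closure of `η`. -/
noncomputable def toChart (i : ι) (hi : η ∈ c.U i) :
    Γ(Y, c.U i) →+* chart (Submodule.span Ω (Set.range t)) (t i) :=
  (Y.evaluation (c.U i) η hi).hom.codRestrict (chart (Submodule.span Ω (Set.range t)) (t i))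
    fun a => rangeSubalgebra_evaluation_eq halg c ht htu i hi ▸ ⟨a, rfl⟩

lemma toChart_surjective (i : ι) (hi : η ∈ c.U i) :
    Function.Surjective (toChart halg c ht htu i hi) := by
  rintro ⟨x, hx⟩
  have hx' := hx
  rw [← rangeSubalgebra_evaluation_eq halg c ht htu i hi] at hx'
  obtain ⟨a, rfl⟩ := hx'
  exact ⟨a, rfl⟩

lemma isLocalizationIn_localSubalgebra (i : ι) {y : Y} (h : η ⤳ y) (hy : y ∈ c.U i) :
    IsLocalizationIn (chart (Submodule.span Ω (Set.range t)) (t i)) (localSubalgebra halg h) := by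
  have hi : η ∈ c.U i := h.mem_open (c.U i).2 hy
  refine ⟨?_, ?_⟩
  · rw [← rangeSubalgebra_evaluation_eq halg c ht htu i hi]
    rintro _ ⟨a, rfl⟩
    exact ⟨_, evalAt_germ h hi hy a⟩
  · rintro _ ⟨r, rfl⟩
    obtain ⟨s, b, hs, hrs⟩ := exists_mul_germ_eq (c.isAffineOpen i) hy r
    have hs0 := (hs.map (evalAt h)).ne_zero
    refine ⟨_, (toChart halg c ht htu i hi s).2, ?_, ?_, ?_⟩
    · change (Y.evaluation (c.U i) η hi).hom s ≠ 0
      rwa [← evalAt_germ h hi hy]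
    · change ((Y.evaluation (c.U i) η hi).hom s)⁻¹ ∈ _
      rw [← evalAt_germ h hi hy]
      exact (inv_mem_localSubalgebra_iff halg h hs0).2 hs
    · change evalAt h r * (Y.evaluation (c.U i) η hi).hom s ∈ _
      rw [← evalAt_germ h hi hy, ← map_mul, hrs, evalAt_germ h hi hy]
      exact (toChart halg c ht htu i hi b).2

lemma comap_centre_eq (i : ι) {y : Y} (h : η ⤳ y) (hy : y ∈ c.U i) (hi : η ∈ c.U i) :
    (centre (isLocalizationIn_localSubalgebra halg c ht htu i h hy).le).comap
      (toChart halg c ht htu i hi) = ((c.isAffineOpen i).primeIdealOf ⟨y, hy⟩).asIdeal := by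
  ext s
  rw [mem_primeIdealOf_iff_inv_notMem halg h (c.isAffineOpen i) hi hy, Ideal.mem_comap]
  by_cases hs : toChart halg c ht htu i hi s = 0
  · have hs' : (Y.evaluation (c.U i) η hi).hom s = 0 := congrArg Subtype.val hs
    simp [hs, hs']
  · have hs' : (Y.evaluation (c.U i) η hi).hom s ≠ 0 := fun h => hs (Subtype.ext h)
    rw [mem_centre_iff _ hs]
    simp only [ne_eq, hs', not_false_eq_true, true_imp_iff]
    rfl

theorem isCurveAtlas_localSubalgebra [JacobsonSpace Y] (hη : IsCurvePoint η) :
    IsCurveAtlas t (Submodule.span Ω (Set.range t))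
      fun y : {y : {y : Y // IsClosed ({y} : Set Y)} // η ⤳ y.1} => localSubalgebra halg y.2 := by
  have key (i : ι) (hi : η ∈ c.U i) (P : Ideal (chart (Submodule.span Ω (Set.range t)) (t i)))
      (hP : P.IsPrime) : ∃ y, ∃ hy : y ∈ c.U i, ((c.isAffineOpen i).primeIdealOf ⟨y, hy⟩).asIdeal =
        P.comap (toChart halg c ht htu i hi) ∧ η ⤳ y := by
    let Q : ↥(Spec Γ(Y, c.U i)) :=
      (⟨P.comap (toChart halg c ht htu i hi), inferInstance⟩ : PrimeSpectrum _)
    refine ⟨(c.isAffineOpen i).fromSpec Q, fromSpec_mem _ Q, ?_, specializes_fromSpec _ hi Q ?_⟩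
    · rw [primeIdealOf_fromSpec]
    · intro s hs
      have : toChart halg c ht htu i hi s = 0 := Subtype.ext hs
      exact Ideal.mem_comap.2 (this ▸ P.zero_mem)
  refine ⟨rfl, ?_, ?_, ?_, ?_, ?_⟩
  · rintro ⟨⟨y, hyc⟩, h⟩
    obtain ⟨i, hi⟩ := c.exists_mem y
    have hηi : η ∈ c.U i := h.mem_open (c.U i).2 hi
    refine ⟨i, (ht i).2 hηi, isLocalizationIn_localSubalgebra halg c ht htu i h hi, ?_⟩
    have h1 := isMaximal_primeIdealOf (c.isAffineOpen i) hi hyc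
    rw [← comap_centre_eq halg c ht htu i h hi hηi] at h1
    exact isMaximal_of_isMaximal_comap (toChart_surjective halg c ht htu i hηi) h1
  · intro i hi P hP
    have hηi := (ht i).1 hi
    obtain ⟨y, hy, hyP, h⟩ := key i hηi P hP.isPrime
    have h1 : ((c.isAffineOpen i).primeIdealOf ⟨y, hy⟩).asIdeal.IsMaximal :=
      hyP ▸ Ideal.comap_isMaximal_of_surjective _ (toChart_surjective halg c ht htu i hηi)
    have hyc : IsClosed ({y} : Set Y) := by
      have h2 := (c.isAffineOpen i).fromSpec_primeIdealOf ⟨y, hy⟩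
      have h3 := (isClosed_singleton_map_iff_of_isImmersion (c.isAffineOpen i).fromSpec
        ((c.isAffineOpen i).primeIdealOf ⟨y, hy⟩)).2
        ((PrimeSpectrum.isClosed_singleton_iff_isMaximal _).2 h1)
      rwa [h2] at h3
    refine ⟨⟨⟨y, hyc⟩, h⟩, isLocalizationIn_localSubalgebra halg c ht htu i h hy, ?_⟩
    apply Ideal.comap_injective_of_surjective _ (toChart_surjective halg c ht htu i hηi)
    rw [comap_centre_eq halg c ht htu i h hy hηi, hyP]
  · rintro ⟨⟨y, hyc⟩, h⟩ ⟨⟨y', hyc'⟩, h'⟩ heq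
    obtain ⟨i, hi⟩ := c.exists_mem y
    obtain ⟨j, hj⟩ := c.exists_mem y'
    have hηi : η ∈ c.U i := h.mem_open (c.U i).2 hi
    have hηj : η ∈ c.U j := h'.mem_open (c.U j).2 hj
    replace heq : localSubalgebra halg h = localSubalgebra halg h' := heq
    have hyj : y ∈ c.U j := by
      rw [← c.mem_iff i j y hi]
      have h1 : evalAt h (Y.presheaf.germ (c.U i) y hi (c.u i j)) = t j / t i := by
        rw [evalAt_germ h hηi hi, htu]
      rw [← inv_mem_localSubalgebra_iff halg h (by
        rw [h1]
        exact div_ne_zero ((ht j).2 hηj) ((ht i).2 hηi)), h1, heq, inv_div, ← htu j hηj,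
        ← evalAt_germ h' hηj hj]
      exact ⟨_, rfl⟩
    have h2 : (c.isAffineOpen j).primeIdealOf ⟨y, hyj⟩ =
        (c.isAffineOpen j).primeIdealOf ⟨y', hj⟩ := by
      apply PrimeSpectrum.ext
      ext s
      rw [mem_primeIdealOf_iff_inv_notMem halg h _ hηj hyj,
        mem_primeIdealOf_iff_inv_notMem halg h' _ hηj hj, heq]
    have h3 := (c.isAffineOpen j).fromSpec_primeIdealOf ⟨y, hyj⟩
    rw [h2, (c.isAffineOpen j).fromSpec_primeIdealOf] at h3
    exact Subtype.ext (Subtype.ext h3.symm)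
  · intro i hi P hP hP0
    have hηi := (ht i).1 hi
    obtain ⟨y, hy, hyP, h⟩ := key i hηi P hP
    have hne : y ≠ η := by
      rintro rfl
      rw [primeIdealOf_eq_ker] at hyP
      refine hP0 (eq_bot_iff.2 fun x hx => ?_)
      obtain ⟨s, rfl⟩ := toChart_surjective halg c ht htu i hηi x
      have hs : s ∈ P.comap (toChart halg c ht htu i hηi) := hx
      rw [← hyP] at hs
      exact (Submodule.mem_bot _).2 (Subtype.ext hs)
    have h1 := isMaximal_primeIdealOf (c.isAffineOpen i) hy (hη.isClosed_of_specializes y h hne)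
    rw [hyP] at h1
    exact isMaximal_of_isMaximal_comap (toChart_surjective halg c ht htu i hηi) h1
  · intro i hi f
    have hηi := (ht i).1 hi
    obtain ⟨f, rfl⟩ := Y.residue_surjective η f
    obtain ⟨s, b, hs, hrs⟩ := exists_mul_germ_eq (c.isAffineOpen i) hηi f
    refine ⟨_, (toChart halg c ht htu i hηi b).2, _, (toChart halg c ht htu i hηi s).2,
      (hs.map (Y.residue η).hom).ne_zero, ?_⟩
    have h2 := congrArg (Y.residue η).hom hrs
    rw [map_mul] at h2
    exact h2

end Degree

section

variable {Ω : Type u} [Field Ω] [IsAlgClosed Ω] {Y : Scheme.{u}} {π : Y ⟶ Spec (.of Ω)} {ι : Type}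
  [Finite ι]

/-- The degree of a principal divisor on a projective curve is zero. -/
theorem IsDivisorAt.sum_eq_zero [JacobsonSpace Y] (c : Coordinates π ι) {η : Y}
    (hη : IsCurvePoint η) {z : ZeroCycle Y} {f : Y.residueField η} (h : IsDivisorAt z η f) :
    z.sum (fun _ m => m) = 0 := by
  classical
  let : Algebra Ω (Y.residueField η) := (residueFieldHom π η).toAlgebra
  have halg : algebraMap Ω (Y.residueField η) = residueFieldHom π η := rfl
  obtain ⟨t, ht, htu⟩ := exists_homogeneousCoordinates (η := η) c
  have H := isCurveAtlas_localSubalgebra halg c ht htu hη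
  have h1 := H.sum_eq_zero h.ne_zero (z.subtypeDomain fun y => η ⤳ y.1) ?_
  · have h2 : ∀ y ∈ z.support, η ⤳ y.1 := fun y hy => by
      by_contra hn
      exact Finsupp.mem_support_iff.1 hy (h.eq_zero y.1 y.2 hn)
    exact (Finsupp.sum_subtypeDomain_index (h := fun _ m => m) h2).symm.trans h1
  · rintro ⟨y, hy⟩ _ ⟨a, rfl⟩ _ ⟨b, rfl⟩ hb hab
    change z y + (lengthMod (localSubalgebra halg hy) (evalAt hy b) : ℤ) =
      lengthMod (localSubalgebra halg hy) (evalAt hy a)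
    rw [lengthMod_localSubalgebra, lengthMod_localSubalgebra]
    exact h.add_eq y.1 y.2 hy a b hb hab

/-- The degree over a clopen subset of a zero-cycle that is rationally equivalent to zero on a
projective scheme is zero. -/
theorem sum_filter_eq_zero [JacobsonSpace Y] (c : Coordinates π ι)
    {z : ZeroCycle Y} (hz : z ∈ ratEquivZero Y) (V : Set Y) (hV : IsClopen V) [DecidablePred (· ∈ V)] :
    (z.filter fun y => y.1 ∈ V).sum (fun _ m => m) = 0 := by
  induction hz using AddSubgroup.closure_induction with
  | mem z hz =>
    obtain ⟨η, f, hη, h⟩ := hz.exists_isDivisorAt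
    by_cases hηV : η ∈ V
    · have h1 : z.filter (fun y => y.1 ∈ V) = z := by
        rw [Finsupp.filter_eq_self_iff]
        intro y hy
        by_contra hyV
        refine hy (h.eq_zero y.1 y.2 fun hs => hyV ?_)
        exact hs.mem_closed hV.isClosed hηV
      rw [h1]
      exact h.sum_eq_zero c hη
    · have h1 : z.filter (fun y => y.1 ∈ V) = 0 := by
        rw [Finsupp.filter_eq_zero_iff]
        intro y hy
        refine h.eq_zero y.1 y.2 fun hs => hηV ?_
        exact hs.mem_open hV.isOpen hy
      rw [h1, Finsupp.sum_zero_index]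
  | zero => rw [Finsupp.filter_zero, Finsupp.sum_zero_index]
  | add z w _ _ hz hw =>
    rw [Finsupp.filter_add, Finsupp.sum_add_index' (fun _ => rfl) fun _ _ _ => rfl, hz, hw, add_zero]
  | neg z _ hz =>
    rw [Finsupp.filter_neg, Finsupp.sum_neg_index fun _ => rfl]
    simpa [Finsupp.sum] using hz

end

open TensorProduct

lemma exists_idempotent_of_isReduced_of_isArtinianRing {E : Type*} [CommRing E] [IsReduced E]
    [IsArtinianRing E] (a : E) : ∃ c, (a * c) * (a * c) = a * c ∧ a * (a * c) = a := by
  obtain ⟨n, hn⟩ := IsArtinian.monotone_stabilizes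
    (⟨fun n => OrderDual.toDual (Ideal.span {a ^ n}), fun m n h => by
      exact Ideal.span_singleton_le_span_singleton.2 (pow_dvd_pow a h)⟩ :
      ℕ →o (Ideal E)ᵒᵈ)
  have h1 : Ideal.span {a ^ n} = Ideal.span {a ^ (n + 1)} := hn (n + 1) (by omega)
  obtain ⟨c, hc⟩ := Ideal.mem_span_singleton.1 (h1 ▸ Ideal.mem_span_singleton_self (a ^ n))
  have h2 : a * (a * c) = a := by
    have : IsNilpotent (a * (a * c) - a) := ⟨n + 1, by
      have : (a * (a * c) - a) ^ (n + 1) =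
        (a ^ (n + 1) * c - a ^ n) * (a * (a * c - 1) ^ n) := by
        have e : a * (a * c) - a = a * (a * c - 1) := by ring
        rw [e, mul_pow, pow_succ, pow_succ]; ring
      rw [this, ← hc]; ring⟩
    exact sub_eq_zero.1 this.eq_zero
  exact ⟨c, by linear_combination c * h2, h2⟩

lemma exists_idempotent_of_etale (R S : Type u) [CommRing R] [IsDomain R]
    [IsIntegrallyClosed R] [CommRing S] [Algebra R S] [Algebra.Etale R S] (a : S) :
    ∃ e : S, e * e = e ∧ a * e = a ∧ ∀ b, a * b = 0 → e * b = 0 := by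
  let K := FractionRing R
  let E := S ⊗[R] K
  have : Module.Finite K (K ⊗[R] S) := Algebra.FormallyUnramified.finite_of_free K _
  have : IsReduced (K ⊗[R] S) := Algebra.FormallyUnramified.isReduced_of_field K _
  have : IsArtinianRing (K ⊗[R] S) := IsArtinianRing.of_finite K _
  let φ := (Algebra.TensorProduct.comm R S K).toRingEquiv
  have : IsReduced E := isReduced_of_injective φ φ.injective
  have : IsArtinianRing E := φ.symm.surjective.isArtinianRing
  obtain ⟨c, hc, hac⟩ := exists_idempotent_of_isReduced_of_isArtinianRing (algebraMap S E a)
  have hint : IsIntegral S (algebraMap S E a * c) :=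
    ⟨Polynomial.X * (Polynomial.X - 1), by
      exact (Polynomial.monic_X).mul (by simpa using Polynomial.monic_X_sub_C (1 : S)), by
      simp [mul_sub, hc]⟩
  obtain ⟨t, ht⟩ := (TensorProduct.toIntegralClosure_bijective_of_smooth (R := R) (S := S)
    (B := K)).2 ⟨_, hint⟩
  have hinj : Function.Injective (algebraMap S E) :=
    Algebra.TensorProduct.includeLeft_injective (S := S) (R := R) (A := S) (B := K)
      (IsFractionRing.injective R K)
  have key : ∃ e : S, algebraMap S E e = algebraMap S E a * c := by
    replace ht := congrArg Subtype.val ht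
    change _ = algebraMap S E a * c at ht
    rw [← ht]
    clear ht
    induction t with
    | zero => exact ⟨0, by simp⟩
    | add x y hx hy =>
      obtain ⟨e, he⟩ := hx
      obtain ⟨e', he'⟩ := hy
      exact ⟨e + e', by simp [he, he']⟩
    | tmul x y =>
      obtain ⟨r, hr⟩ := IsIntegrallyClosed.isIntegral_iff.1 y.2
      refine ⟨r • x, ?_⟩
      change (r • x) ⊗ₜ[R] (1 : K) = x ⊗ₜ[R] (y : K)
      rw [← hr, TensorProduct.smul_tmul, Algebra.smul_def, mul_one]
  obtain ⟨e, he⟩ := key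
  refine ⟨e, hinj (by simp [he, hc]), hinj (by simp [he, hac]), fun b hb => hinj ?_⟩
  have := congrArg (algebraMap S E) hb
  simp only [map_mul, map_zero, he] at this ⊢
  linear_combination c * this

lemma isDomain_localization_atPrime_of_idempotent {S : Type u} [CommRing S]
    (H : ∀ a : S, ∃ e : S, e * e = e ∧ a * e = a ∧ ∀ b, a * b = 0 → e * b = 0)
    (p : Ideal S) [p.IsPrime] (L : Type*) [CommRing L] [Algebra S L] [IsLocalization.AtPrime L p] :
    IsDomain L := by
  have : Nontrivial L := (IsLocalization.AtPrime.isLocalRing L p).toNontrivial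
  have : NoZeroDivisors L := ⟨fun {x y} hxy => by
    obtain ⟨a, s, rfl⟩ := IsLocalization.exists_mk'_eq p.primeCompl x
    obtain ⟨b, t, rfl⟩ := IsLocalization.exists_mk'_eq p.primeCompl y
    rw [← IsLocalization.mk'_mul, IsLocalization.mk'_eq_zero_iff] at hxy
    obtain ⟨u, hu⟩ := hxy
    obtain ⟨e, he, hae, heb⟩ := H (u * a)
    have h2 := heb b (by rw [mul_assoc]; exact hu)
    by_cases hep : e ∈ p
    · refine Or.inl ?_
      rw [IsLocalization.mk'_eq_zero_iff]
      refine ⟨⟨(1 - e) * u, p.primeCompl.mul_mem (fun h => ?_) u.2⟩, ?_⟩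
      · exact (Ideal.ne_top_iff_one p).1 ‹p.IsPrime›.ne_top (by simpa using p.add_mem h hep)
      · change (1 - e) * u * a = 0
        linear_combination -hae
    · refine Or.inr ?_
      rw [IsLocalization.mk'_eq_zero_iff]
      exact ⟨⟨e, hep⟩, h2⟩⟩
  exact NoZeroDivisors.to_isDomain L

lemma isDomain_localization_atPrime_of_smooth (F A : Type u) [Field F] [CommRing A]
    [Algebra F A] [Algebra.Smooth F A] (p : Ideal A) [p.IsPrime] (L : Type u) [CommRing L]
    [Algebra A L] [IsLocalization.AtPrime L p] : IsDomain L := by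
  obtain ⟨f, hf, n, alg, _, _⟩ := Algebra.IsSmoothAt.exists_isStandardEtale_mvPolynomial
    (R := F) (p := p)
  have : (Ideal.map (algebraMap A (Localization.Away f)) p).IsPrime :=
    IsLocalization.isPrime_of_isPrime_disjoint (.powers f) _ _ ‹_›
      ((Ideal.disjoint_powers_iff_notMem_of_isPrime _).mpr hf)
  have hA : Algebra.Etale (MvPolynomial (Fin n) F) (Localization.Away f) := inferInstance
  let P := Ideal.map (algebraMap A (Localization.Away f)) p
  have h3 := IsLocalization.isLocalization_isLocalization_atPrime_isLocalization
    (.powers f) (Localization.AtPrime P) P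
  have h4 : P.comap (algebraMap A (Localization.Away f)) = p :=
    IsLocalization.under_map_of_isPrime_disjoint (.powers f) _ ‹_›
      ((Ideal.disjoint_powers_iff_notMem_of_isPrime _).mpr hf)
  have h5 : IsLocalization.AtPrime (Localization.AtPrime P) p := by
    convert h3 using 1
    simp_rw [h4]
  have := isDomain_localization_atPrime_of_idempotent
    (exists_idempotent_of_etale (MvPolynomial (Fin n) F) (Localization.Away f)) P
    (Localization.AtPrime P)
  exact MulEquiv.isDomain (Localization.AtPrime P)
    (IsLocalization.algEquiv p.primeCompl L (Localization.AtPrime P)).toMulEquiv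

lemma isDomain_stalk_of_smooth {F : Type u} [Field F] {Y : Scheme.{u}}
    (π : Y ⟶ Spec (.of F)) [Smooth π] (y : Y) : IsDomain (Y.presheaf.stalk y) := by
  obtain ⟨_, ⟨U, hU, rfl⟩, hy, -⟩ := Y.isBasis_affineOpens.exists_subset_of_mem_open
    (Set.mem_univ y) isOpen_univ
  obtain ⟨φ, hφ⟩ := Spec.map_surjective (hU.fromSpec ≫ π)
  have h1 : Smooth (Spec.map φ) := by
    have : IsOpenImmersion hU.fromSpec := hU.isOpenImmersion_fromSpec
    have : Smooth hU.fromSpec := HasRingHomProperty.of_isOpenImmersion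
      (P := @Smooth) RingHom.Smooth.holdsForLocalizationAway.containsIdentities
    rw [hφ]; exact smooth_comp _ _
  have h2 : φ.hom.Smooth := (HasRingHomProperty.Spec_iff (P := @Smooth)).1 h1
  let : Algebra F Γ(Y, U) := φ.hom.toAlgebra
  have : Algebra.Smooth F Γ(Y, U) := h2
  let : Algebra Γ(Y, U) (Y.presheaf.stalk y) := (Y.presheaf.germ U y hy).hom.toAlgebra
  have : IsLocalization.AtPrime (Y.presheaf.stalk y) (hU.primeIdealOf ⟨y, hy⟩).asIdeal :=
    hU.isLocalization_stalk ⟨y, hy⟩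
  exact isDomain_localization_atPrime_of_smooth F Γ(Y, U) (hU.primeIdealOf ⟨y, hy⟩).asIdeal _

lemma isIntegral_of_isDomain_stalk (Y : Scheme.{u}) [IsNoetherian Y] [Nonempty Y]
    (hdom : ∀ y : Y, IsDomain (Y.presheaf.stalk y))
    (hconn : ∀ V : Set Y, IsClopen V → V.Nonempty → V = Set.univ) : IsIntegral Y := by
  have hred : IsReduced Y := by
    have (y : Y) : _root_.IsReduced (Y.presheaf.stalk y) := by
      have := hdom y
      infer_instance
    exact isReduced_of_isReduced_stalk Y
  have key : ∀ y : Y, ∃ η : Y, ∀ ξ, ξ ⤳ y → η ⤳ ξ := by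
    intro y
    have := hdom y
    let b : ↥(Spec (Y.presheaf.stalk y)) :=
      (⟨⊥, Ideal.isPrime_bot⟩ : PrimeSpectrum (Y.presheaf.stalk y))
    refine ⟨Y.fromSpecStalk y b, fun ξ hξ => ?_⟩
    obtain ⟨q, rfl⟩ : ξ ∈ Set.range (Y.fromSpecStalk y) := by
      rw [Scheme.range_fromSpecStalk]; exact hξ
    have : b ⤳ q := (PrimeSpectrum.le_iff_specializes _ _).1 (bot_le (a := q.asIdeal))
    exact this.map (Y.fromSpecStalk y).continuous
  have hdisj : ∀ Z ∈ irreducibleComponents Y, ∀ Z' ∈ irreducibleComponents Y, ∀ y ∈ Z,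
      y ∈ Z' → Z = Z' := by
    intro Z hZ Z' hZ' y hy hy'
    obtain ⟨η, hη⟩ := key y
    have main : ∀ Z ∈ irreducibleComponents Y, y ∈ Z → Z = closure {η} := by
      intro Z hZ hy
      obtain ⟨ξ, hξ⟩ := QuasiSober.sober hZ.1 (isClosed_of_mem_irreducibleComponents Z hZ)
      have h1 : ξ ⤳ y := by rw [specializes_iff_mem_closure, hξ.def]; exact hy
      have h2 : Z ⊆ closure {η} := by
        rw [← hξ.def]
        exact closure_minimal (by simpa using (hη ξ h1).mem_closure) isClosed_closure
      exact h2.antisymm (hZ.2 isIrreducible_singleton.closure h2)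
    rw [main Z hZ hy, main Z' hZ' hy']
  obtain ⟨y0⟩ := ‹Nonempty Y›
  have hZ := irreducibleComponent_mem_irreducibleComponents y0
  set Z := irreducibleComponent y0
  have hfin := TopologicalSpace.NoetherianSpace.finite_irreducibleComponents (α := Y)
  have hcompl : Zᶜ = ⋃₀ (irreducibleComponents Y \ {Z}) := by
    ext y
    refine ⟨fun h => ⟨irreducibleComponent y, ⟨irreducibleComponent_mem_irreducibleComponents y,
      fun e => h ?_⟩, mem_irreducibleComponent⟩, ?_⟩
    · rw [← Set.mem_singleton_iff.1 e]; exact mem_irreducibleComponent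
    · rintro ⟨W, ⟨hW, hWZ⟩, hy⟩ hy'
      exact hWZ (hdisj W hW Z hZ y hy hy')
  have hclopen : IsClopen Z := by
    refine ⟨isClosed_of_mem_irreducibleComponents Z hZ, ?_⟩
    rw [← isClosed_compl_iff, hcompl]
    rw [Set.sUnion_eq_biUnion]
    exact (hfin.subset Set.sdiff_subset).isClosed_biUnion
      fun W hW => isClosed_of_mem_irreducibleComponents W hW.1
  have huniv := hconn Z hclopen ⟨y0, mem_irreducibleComponent⟩
  have : IrreducibleSpace Y := by
    rw [irreducibleSpace_def, Set.top_eq_univ, ← huniv]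
    exact hZ.1
  exact isIntegral_of_irreducibleSpace_of_isReduced Y

lemma length_eq_one_of_isField {R : Type*} [CommRing R] (h : IsField R) :
    Module.length R R = 1 := by
  let := h.toField
  have : IsSimpleModule R R := by
    infer_instance
  exact Module.length_eq_one R R

lemma residueDegree_eq_one {T Y : Scheme.{u}} (h : T ⟶ Y) [IsClosedImmersion h] (t : T) :
    h.residueDegree t = 1 := by
  have hs : Function.Surjective (h.residueFieldMap t).hom := by
    have h1 := h.stalkMap_surjective t
    have h2 : Function.Surjective (T.residue t).hom := IsLocalRing.residue_surjective
    intro x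
    obtain ⟨x, rfl⟩ := h2 x
    obtain ⟨x, rfl⟩ := h1 x
    refine ⟨(Y.residue (h t)).hom x, ?_⟩
    exact congrArg (fun φ => φ.hom x) (Scheme.residue_residueFieldMap h t)
  let := (h.residueFieldMap t).hom.toAlgebra
  exact finrank_eq_one 1 one_ne_zero fun w => (hs w).imp fun c hc => by
    rw [Algebra.smul_def, mul_one]; exact hc

lemma finiteCycle_of_isClosedImmersion {T Y : Scheme.{u}} [IsArtinianScheme T] [IsIntegral T]
    [Subsingleton T] (h : T ⟶ Y) [IsClosedImmersion h] (t : T) {y : Y}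
    (hy : IsClosed ({y} : Set Y)) (hxy : h t = y) :
    finiteCycle h = Finsupp.single ⟨y, hy⟩ 1 := by
  subst hxy
  have hc : IsClosed ({t} : Set T) := (isClosed_singleton_map_iff h _).1 hy
  have : fundamentalCycle T = Finsupp.single ⟨t, hc⟩ 1 := by
    ext ⟨t', ht'⟩
    obtain rfl : t' = t := Subsingleton.elim _ _
    have := isArtinianRing_stalk t'
    rw [fundamentalCycle_apply, length_eq_one_of_isField (IsArtinianRing.isField_of_isDomain _)]
    simp
  rw [finiteCycle, this, pushCycle_single, residueDegree_eq_one]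
  simp

/-- Zero-cycles are combinations of cycles of Artinian schemes that are finite over the base. -/
lemma zeroCycle_induction {k : Type u} [Field k] {X : Scheme.{u}} (π : X ⟶ Spec (.of k))
    [LocallyOfFiniteType π] {C : ZeroCycle X → Prop} (zero : C 0)
    (add : ∀ z₁ z₂, C z₁ → C z₂ → C (z₁ + z₂)) (smul : ∀ (n : ℤ) z, C z → C (n • z))
    (finite : ∀ (V : Scheme.{u}) (v : V ⟶ X) [IsArtinianScheme V] [IsFinite v]
      [IsFinite (v ≫ π)], C (finiteCycle v)) (z : ZeroCycle X) : C z := by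
  induction z using Finsupp.induction_linear with
  | zero => exact zero
  | add z₁ z₂ h₁ h₂ => exact add _ _ h₁ h₂
  | single x n =>
    obtain ⟨x, hx⟩ := x
    let h := X.fromSpecResidueField x
    have : JacobsonSpace X := LocallyOfFiniteType.jacobsonSpace π
    have : IsClosedImmersion h := isClosed_singleton_iff_isClosedImmersion.1 hx
    have : IsFinite (h ≫ π) := isFinite_iff_locallyOfFiniteType_of_jacobsonSpace.2 inferInstance
    have e : (Finsupp.single ⟨x, hx⟩ n : ZeroCycle X) = n • finiteCycle h := by
      rw [finiteCycle_of_isClosedImmersion h (IsLocalRing.closedPoint _) hx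
        (Scheme.fromSpecResidueField_apply _ _)]
      simp
    rw [e]
    exact smul n _ (finite _ h)

/-- Pullbacks of zero-cycles along successive base changes of the ground field exist and
compose. -/
lemma exists_isPullbackCycle_comp {k : Type u} [Field k] {X X' X'' B B' : Scheme.{u}}
    {π : X ⟶ Spec (.of k)} [LocallyOfFiniteType π] {p : X' ⟶ X} {π' : X' ⟶ B}
    {b : B ⟶ Spec (.of k)} {p' : X'' ⟶ X'} {π'' : X'' ⟶ B'} {b' : B' ⟶ B}
    (H : IsPullback p π' π b) (H' : IsPullback p' π'' π' b') [IsArtinianScheme B]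
    [IsArtinianScheme B'] [Flat b'] (z : ZeroCycle X) :
    ∃ w w', IsPullbackCycle p z w ∧ IsPullbackCycle p' w w' ∧ IsPullbackCycle (p' ≫ p) z w' := by
  have : Flat b := inferInstance
  have : Flat p := MorphismProperty.of_isPullback H.flip ‹Flat b›
  have : Flat p' := MorphismProperty.of_isPullback H'.flip ‹Flat b'›
  have : LocallyOfFiniteType π' := MorphismProperty.of_isPullback H ‹_›
  have : LocallyOfFiniteType π'' := MorphismProperty.of_isPullback H' ‹_›
  have : IsLocallyNoetherian X := LocallyOfFiniteType.isLocallyNoetherian π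
  have : IsLocallyNoetherian X' := LocallyOfFiniteType.isLocallyNoetherian π'
  have : IsLocallyNoetherian X'' := LocallyOfFiniteType.isLocallyNoetherian π''
  refine zeroCycle_induction π (C := fun z => ∃ w w', IsPullbackCycle p z w ∧
    IsPullbackCycle p' w w' ∧ IsPullbackCycle (p' ≫ p) z w') ⟨0, 0, .zero, .zero, .zero⟩ ?_ ?_ (fun V v _ _ _ => ?_) z
  · rintro z₁ z₂ ⟨w₁, w₁', a₁, b₁, c₁⟩ ⟨w₂, w₂', a₂, b₂, c₂⟩
    exact ⟨_, _, a₁.add a₂, b₁.add b₂, c₁.add c₂⟩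
  · rintro n z ⟨w, w', a, b, c⟩
    exact ⟨_, _, a.smul n, b.smul n, c.smul n⟩
  let P := pullback v p
  have HP : IsPullback (pullback.fst v p) (pullback.snd v p) v p := .of_hasPullback _ _
  let P' := pullback (pullback.snd v p) p'
  have HP' : IsPullback (pullback.fst (pullback.snd v p) p') (pullback.snd (pullback.snd v p) p')
    (pullback.snd v p) p' := .of_hasPullback _ _
  have : IsFinite (pullback.snd v p ≫ π') :=
    MorphismProperty.of_isPullback (P := @IsFinite) (HP.paste_vert H) ‹IsFinite (v ≫ π)›
  have : IsFinite (pullback.snd (pullback.snd v p) p' ≫ π'') :=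
    MorphismProperty.of_isPullback (P := @IsFinite) (HP'.paste_vert H') this
  have : IsArtinianScheme P := isArtinianScheme_of_isFinite (pullback.snd v p ≫ π')
  have : IsArtinianScheme P' :=
    isArtinianScheme_of_isFinite (pullback.snd (pullback.snd v p) p' ≫ π'')
  exact ⟨_, _, isPullbackCycle_finiteCycle HP, isPullbackCycle_finiteCycle HP',
    isPullbackCycle_finiteCycle (HP'.paste_horiz HP)⟩

section Diagonal

variable {k : Type u} [Field k] {X : Scheme.{u}} (f : X ⟶ Spec (.of k)) [IsIntegral X]
  [IsSeparated f]

instance isClosedImmersion_diagonalSection : IsClosedImmersion (diagonalSection f) := by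
  have h1 : IsClosedImmersion
      (diagonalSection f ≫ pullback.snd f (genericInclusion X ≫ f)) := by
    rw [diagonalSection, pullback.lift_snd]; infer_instance
  exact IsClosedImmersion.of_comp _ (pullback.snd f (genericInclusion X ≫ f))

lemma diagonalCycle_eq_finiteCycle : diagonalCycle f = finiteCycle (diagonalSection f) :=
  have : Subsingleton (Spec X.functionField) :=
    inferInstanceAs (Subsingleton (PrimeSpectrum X.functionField))
  (finiteCycle_of_isClosedImmersion _ _ _ rfl).symm

variable {f}

lemma diagonalMultipleDescends_iff {m : ℕ} : DiagonalMultipleDescends f m ↔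
    ∃ z w, IsPullbackCycle (overFunctionFieldProj f) z w ∧
      m • diagonalCycle f - w ∈ ratEquivZero (overFunctionField f) := by
  refine exists_congr fun z => exists_congr fun w => and_congr_right fun _ => ?_
  rw [← neg_mem_iff, neg_sub, sub_eq_neg_add]
  exact (QuotientAddGroup.eq (s := ratEquivZero (overFunctionField f))
    (a := m • diagonalCycle f) (b := w))

/-- If `m · δ_X` is equivalent to the pullback of `z`, then so is `m` times any section of
`X_B`, for an Artinian scheme `B` over the generic point of `X`. -/
lemma DiagonalMultipleDescends.exists_isPullbackCycle [LocallyOfFiniteType f] [QuasiCompact f]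
    {m : ℕ} (hm : DiagonalMultipleDescends f m) : ∃ z : ZeroCycle X,
    ∀ {B Y : Scheme.{u}} [IsArtinianScheme B] [IsAffine B] {p : Y ⟶ X} {π : Y ⟶ B}
      {b : B ⟶ Spec (.of k)} (_ : IsPullback p π f b) (s : B ⟶ Y) [IsFinite s] (_ : s ≫ π = 𝟙 B)
      (a : B ⟶ Spec X.functionField) (_ : a ≫ genericInclusion X = s ≫ p),
      ∃ w, IsPullbackCycle p z w ∧ m • finiteCycle s - w ∈ ratEquivZero Y := by
  obtain ⟨z, w, hw, hδ⟩ := diagonalMultipleDescends_iff.1 hm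
  refine ⟨z, ?_⟩
  intro B Y _ _ p π b H s _ hs a ha
  have hb : a ≫ genericInclusion X ≫ f = b := by
    rw [reassoc_of% ha, H.w, reassoc_of% hs]
  let r : Y ⟶ overFunctionField f := pullback.lift p (π ≫ a) (by rw [Category.assoc, hb, H.w])
  have hr₁ : r ≫ overFunctionFieldProj f = p := pullback.lift_fst _ _ _
  have hr₂ : r ≫ pullback.snd f (genericInclusion X ≫ f) = π ≫ a := pullback.lift_snd _ _ _
  have Hδ : IsPullback (overFunctionFieldProj f) (pullback.snd f (genericInclusion X ≫ f)) f
    (genericInclusion X ≫ f) := .of_hasPullback _ _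
  have Hr : IsPullback r π (pullback.snd f (genericInclusion X ≫ f)) a := by
    refine IsPullback.of_right ?_ hr₂ Hδ
    rw [hr₁, hb]; exact H
  have hd₁ : diagonalSection f ≫ overFunctionFieldProj f = genericInclusion X :=
    pullback.lift_fst _ _ _
  have hd₂ : diagonalSection f ≫ pullback.snd f (genericInclusion X ≫ f) = 𝟙 _ :=
    pullback.lift_snd _ _ _
  have Hs : IsPullback a s (diagonalSection f) r := by
    refine IsPullback.of_bot ?_ ?_ Hr
    · rw [hs, hd₂]; exact IsPullback.of_vert_isIso ⟨by simp⟩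
    · refine pullback.hom_ext ?_ ?_
      · rw [Category.assoc, Category.assoc, hr₁]; erw [hd₁]; exact ha
      · rw [Category.assoc, Category.assoc, hr₂, hd₂, reassoc_of% hs, Category.comp_id]
  have : LocallyOfFiniteType π := MorphismProperty.of_isPullback H ‹_›
  have : IsLocallyNoetherian Y := LocallyOfFiniteType.isLocallyNoetherian π
  have : IsLocallyNoetherian (overFunctionField f) :=
    LocallyOfFiniteType.isLocallyNoetherian (pullback.snd f (genericInclusion X ≫ f))
  have : Flat a := inferInstanceAs (Flat (Y := Spec (.of X.functionField)) a)
  have : Flat r := MorphismProperty.of_isPullback Hr.flip this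
  obtain ⟨w₀, hw₀, hw₀'⟩ := TorsionOrder.exists_isPullbackCycle (K := X.functionField) Hr hδ
  obtain ⟨w₁, w', h₁, h₂, h₃⟩ := exists_isPullbackCycle_comp Hδ Hr z
  obtain rfl := h₁.unique hw
  rw [hr₁] at h₃
  refine ⟨w', h₃, ?_⟩
  have h₄ := (((isPullbackCycle_finiteCycle Hs).smul m).sub h₂).unique (w₂ := w₀) (by
    rw [← diagonalCycle_eq_finiteCycle]; simpa using hw₀')
  rw [natCast_zsmul] at h₄
  rwa [h₄]

end Diagonal

lemma exists_comp_fromSpecStalk_eq {Ω : Type u} [Field Ω] {X : Scheme.{u}}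
    (g : Spec (.of Ω) ⟶ X) (t : Spec (.of Ω)) {x : X} (hx : g t = x) :
    ∃ a, a ≫ X.fromSpecStalk x = g := by
  subst hx
  obtain rfl : t = IsLocalRing.closedPoint Ω := Subsingleton.elim (α := PrimeSpectrum Ω) _ _
  exact ⟨_, Scheme.Spec_stalkClosedPointTo_fromSpecStalk g⟩

/-- A fibre product of two schemes over a field has a geometric point over any two points. -/
lemma exists_geometric_points {F : Type u} [Field F] {Y : Scheme.{u}} (π : Y ⟶ Spec (.of F))
    (y₁ y₂ : Y) : ∃ (Ω : Type u) (_ : Field Ω) (_ : IsAlgClosed Ω) (g₁ g₂ : Spec (.of Ω) ⟶ Y),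
      g₁ ≫ π = g₂ ≫ π ∧ ∀ t, g₁ t = y₁ ∧ g₂ t = y₂ := by
  obtain ⟨x, h₁, h₂⟩ := Scheme.Pullback.exists_preimage_pullback (f := π) (g := π) y₁ y₂
    (Subsingleton.elim (α := PrimeSpectrum F) _ _)
  let κ := (pullback π π).residueField x
  let Ω := AlgebraicClosure κ
  let g : Spec (.of Ω) ⟶ pullback π π :=
    Spec.map (CommRingCat.ofHom (algebraMap κ Ω)) ≫ (pullback π π).fromSpecResidueField x
  have hg (t : Spec (.of Ω)) : g t = x := by
    rw [Scheme.Hom.comp_apply]; exact Scheme.fromSpecResidueField_apply _ _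
  refine ⟨Ω, inferInstance, inferInstance, g ≫ pullback.fst π π, g ≫ pullback.snd π π, ?_, fun t => ⟨?_, ?_⟩⟩
  · simp only [Category.assoc, pullback.condition]
  · rw [Scheme.Hom.comp_apply, hg, h₁]
  · rw [Scheme.Hom.comp_apply, hg, h₂]

section Geometric

variable {k : Type u} [Field k] {X : Scheme.{u}} {f : X ⟶ Spec (.of k)} [IsIntegral X]
  [IsSeparated f] [LocallyOfFiniteType f] [QuasiCompact f] {ι : Type} [Finite ι]

/-- If a positive multiple of the diagonal descends, the base changes of `X` are connected. -/
theorem DiagonalMultipleDescends.eq_univ_of_isClopen {m : ℕ} (hm : DiagonalMultipleDescends f m)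
    (hpos : m ≠ 0) (c : Coordinates f ι) {F : Type u} [Field F] {X' : Scheme.{u}} {p : X' ⟶ X}
    {π : X' ⟶ Spec (.of F)} {φ : Spec (.of F) ⟶ Spec (.of k)} (H : IsPullback p π f φ)
    {V : Set X'} (hV : IsClopen V) (hne : V.Nonempty) : V = Set.univ := by
  classical
  by_contra hne'
  have hne'' : Vᶜ.Nonempty := Set.nonempty_compl.2 hne'
  have : Flat p := MorphismProperty.of_isPullback H.flip (inferInstance : Flat φ)
  have hgen : ∀ W : Set X', IsOpen W → W.Nonempty → ∃ ξ ∈ W, p ξ = genericPoint X := by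
    rintro W hW ⟨y, hy⟩
    obtain ⟨ξ, hξ, hξ'⟩ := Flat.generalizingMap p (genericPoint_specializes (p y))
    exact ⟨ξ, hξ.mem_open hW hy, hξ'⟩
  obtain ⟨ξ₁, hξ₁, h₁⟩ := hgen V hV.isOpen hne
  obtain ⟨ξ₂, hξ₂, h₂⟩ := hgen Vᶜ hV.compl.isOpen hne''
  obtain ⟨Ω, _, _, g₁, g₂, hg, hg₁₂⟩ := exists_geometric_points π ξ₁ ξ₂
  let t : Spec (.of Ω) := IsLocalRing.closedPoint Ω
  obtain ⟨hg₁, hg₂⟩ := hg₁₂ t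
  let Y := pullback π (g₁ ≫ π)
  let ρ : Y ⟶ X' := pullback.fst π (g₁ ≫ π)
  let τ : Y ⟶ Spec (.of Ω) := pullback.snd π (g₁ ≫ π)
  have HY : IsPullback (ρ ≫ p) τ f ((g₁ ≫ π) ≫ φ) :=
    (IsPullback.of_hasPullback π (g₁ ≫ π)).paste_horiz H
  obtain ⟨z, hz⟩ := hm.exists_isPullbackCycle
  have main : ∀ g : Spec (.of Ω) ⟶ X', g₁ ≫ π = g ≫ π →
      p (g t) = genericPoint X → ∃ (y : Y) (hy : IsClosed ({y} : Set Y)),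
        ρ y = g t ∧ ∃ w, IsPullbackCycle (ρ ≫ p) z w ∧
          m • Finsupp.single ⟨y, hy⟩ 1 - w ∈ ratEquivZero Y := by
    intro g hg hgp
    let s : Spec (.of Ω) ⟶ Y := pullback.lift g (𝟙 _) (by rw [Category.id_comp, hg])
    have hs₁ : s ≫ ρ = g := pullback.lift_fst _ _ _
    have hs₂ : s ≫ τ = 𝟙 _ := pullback.lift_snd _ _ _
    have : IsClosedImmersion s := by
      have : IsClosedImmersion (s ≫ τ) := by rw [hs₂]; infer_instance
      have : IsSeparated τ := MorphismProperty.of_isPullback HY ‹_›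
      exact IsClosedImmersion.of_comp s τ
    obtain ⟨a, ha⟩ := exists_comp_fromSpecStalk_eq (g ≫ p) t (x := genericPoint X)
      (by rw [Scheme.Hom.comp_apply, hgp])
    obtain ⟨w, hw, hw'⟩ := hz HY s hs₂ a (by rw [reassoc_of% hs₁]; exact ha)
    have : Subsingleton (Spec (.of Ω)) := inferInstanceAs (Subsingleton (PrimeSpectrum Ω))
    have hy : IsClosed {s t} :=
      (isClosed_singleton_map_iff s _).2 (by
        exact (Set.Subsingleton.isClosed (X := PrimeSpectrum Ω)) Set.subsingleton_singleton)
    rw [finiteCycle_of_isClosedImmersion s t hy rfl] at hw'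
    exact ⟨_, hy, by rw [← Scheme.Hom.comp_apply, hs₁], w, hw, hw'⟩
  obtain ⟨y₁, hy₁, e₁, w₁, hw₁, hr₁⟩ := main g₁ rfl (by rw [hg₁, h₁])
  obtain ⟨y₂, hy₂, e₂, w₂, hw₂, hr₂⟩ := main g₂ hg (by rw [hg₂, h₂])
  obtain rfl := hw₁.unique hw₂
  have hr := sub_mem hr₁ hr₂
  rw [sub_sub_sub_cancel_right] at hr
  obtain ⟨c'⟩ := c.nonempty_of_isPullback HY
  have : LocallyOfFiniteType τ := MorphismProperty.of_isPullback HY ‹_›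
  have : JacobsonSpace Y := LocallyOfFiniteType.jacobsonSpace τ
  have h0 := sum_filter_eq_zero c' hr (ρ ⁻¹' V) (hV.preimage ρ.continuous)
  have n₂ : ¬ (y₂ ∈ ρ ⁻¹' V) := by rw [Set.mem_preimage, e₂, hg₂]; exact hξ₂
  have n₁ : y₁ ∈ ρ ⁻¹' V := by rw [Set.mem_preimage, e₁, hg₁]; exact hξ₁
  rw [Finsupp.filter_sub, Finsupp.smul_single, Finsupp.smul_single,
    Finsupp.filter_single_of_pos (p := fun y : {y : Y // IsClosed ({y} : Set Y)} =>
      y.1 ∈ ρ ⁻¹' V) (a := ⟨y₁, hy₁⟩) n₁,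
    Finsupp.filter_single_of_neg (p := fun y : {y : Y // IsClosed ({y} : Set Y)} =>
      y.1 ∈ ρ ⁻¹' V) (a := ⟨y₂, hy₂⟩) n₂, sub_zero,
    Finsupp.sum_single_index rfl] at h0
  exact hpos (by simpa using h0)

/-- If a positive multiple of the diagonal of a smooth projective variety descends, the variety is
geometrically integral. -/
theorem DiagonalMultipleDescends.geometricallyIntegral [Smooth f] {m : ℕ}
    (hm : DiagonalMultipleDescends f m) (hpos : m ≠ 0) (c : Coordinates f ι) :
    GeometricallyIntegral f := by
  refine ⟨fun F _ φ X' p π H => ?_⟩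
  have : Smooth π := MorphismProperty.of_isPullback H ‹_›
  have : QuasiCompact π := MorphismProperty.of_isPullback H ‹_›
  have : IsLocallyNoetherian X' := LocallyOfFiniteType.isLocallyNoetherian π
  have : CompactSpace X' := QuasiCompact.compactSpace_of_compactSpace π
  have : IsNoetherian X' := {}
  have : Nonempty X' := by
    obtain ⟨x, -⟩ := Scheme.exists_preimage_of_isPullback H (genericPoint X)
      (IsLocalRing.closedPoint F) (Subsingleton.elim (α := PrimeSpectrum k) _ _)
    exact ⟨x⟩
  exact isIntegral_of_isDomain_stalk X' (isDomain_stalk_of_smooth π)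
    fun V hV hne => hm.eq_univ_of_isClopen hpos c H hV hne

end Geometric

/-- The degree of the fraction field of `B` over that of the ring of invariants divides the order
of the group. -/
lemma finrank_dvd_card_of_isInvariant (G A B K L : Type*) [Group G] [Finite G] [CommRing A]
    [CommRing B] [Algebra A B] [Field K] [Field L] [Algebra K L] [Algebra A K] [Algebra B L]
    [Algebra A L] [IsFractionRing A K] [IsFractionRing B L] [IsScalarTower A K L]
    [IsScalarTower A B L] [MulSemiringAction G B] [Algebra.IsInvariant A B G]
    [SMulCommClass G A B] :
    FiniteDimensional K L ∧ Module.finrank K L ∣ Nat.card G := by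
  let := IsFractionRing.mulSemiringAction G B L
  have : SMulDistribClass G B L := inferInstance
  have hinv := IsFractionRing.isInvariant G A B K L
  have hcomm (g : G) (x : K) : g • algebraMap K L x = algebraMap K L x := by
    obtain ⟨a, b, hb, rfl⟩ := IsFractionRing.div_surjective A x
    have h (a : A) : g • algebraMap K L (algebraMap A K a) = algebraMap K L (algebraMap A K a) := by
      rw [← IsScalarTower.algebraMap_apply, IsScalarTower.algebraMap_apply A B L,
        ← algebraMap.coe_smul' , smul_algebraMap]
    rw [map_div₀, smul_div₀', h, h]
  let E := FixedPoints.subfield G L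
  let φ : K →+* E := (algebraMap K L).codRestrict E fun x g => hcomm g x
  have hφ : Function.Bijective φ := ⟨φ.injective, fun ⟨y, hy⟩ => by
    obtain ⟨x, hx⟩ := hinv.isInvariant y hy
    exact ⟨x, Subtype.ext hx⟩⟩
  have e := Algebra.finrank_eq_of_equiv_equiv (RingEquiv.ofBijective φ hφ) (RingEquiv.refl L)
    (by ext; rfl)
  have hcard : Nat.card (L ≃ₐ[E] L) = Module.finrank E L := IsGalois.card_aut_eq_finrank E L
  have hpos : 0 < Module.finrank K L := by rw [e]; exact Module.finrank_pos
  refine ⟨FiniteDimensional.of_finrank_pos hpos, ?_⟩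
  rw [e, ← hcard]
  exact Subgroup.card_dvd_of_surjective _ (FixedPoints.toAlgAut_surjective G L)

section SymmetricProduct

variable {k : Type u} [Field k] {X : Scheme.{u}} {f : X ⟶ Spec (.of k)} {n : ℕ}

lemma permute_π (σ : Equiv.Perm (Fin n)) (i : Fin n) : permute f n σ ≫
    WidePullback.π (fun _ : Fin n => f) i = WidePullback.π (fun _ : Fin n => f) (σ i) :=
  WidePullback.lift_π _ _ _ _ _

lemma permute_base (σ : Equiv.Perm (Fin n)) :
    permute f n σ ≫ powerStructure f n = powerStructure f n :=
  WidePullback.lift_base _ _ _ _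

lemma permute_one : permute f n 1 = 𝟙 _ :=
  WidePullback.hom_ext (fun _ => f) _ _ (fun i => by rw [permute_π, Category.id_comp]; rfl)
    (by rw [permute_base, Category.id_comp])

lemma permute_mul (σ τ : Equiv.Perm (Fin n)) :
    permute f n (σ * τ) = permute f n σ ≫ permute f n τ :=
  WidePullback.hom_ext (fun _ => f) _ _
    (fun i => by rw [permute_π, Category.assoc, permute_π, permute_π]; rfl)
    (by rw [permute_base, Category.assoc, permute_base, permute_base])

variable {S : Scheme.{u}} {q : power f n ⟶ S} (hq : IsSymmetricProduct f n q) (U : S.Opens)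

include hq

lemma IsSymmetricProduct.le_preimage (σ : Equiv.Perm (Fin n)) :
    q ⁻¹ᵁ U ≤ permute f n σ ⁻¹ᵁ q ⁻¹ᵁ U := by
  rw [← Scheme.Hom.comp_preimage, hq.invariant σ]

/-- The action of the symmetric group on the functions on an invariant open subset of `X^n`. -/
@[reducible]
noncomputable def IsSymmetricProduct.mulSemiringAction :
    MulSemiringAction (Equiv.Perm (Fin n)) Γ(power f n, q ⁻¹ᵁ U) where
  smul σ s := ((permute f n σ).appLE _ _ (hq.le_preimage U σ)).hom s
  one_smul s := by
    change ((permute f n 1).appLE _ _ (hq.le_preimage U 1)).hom s = s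
    have h : (permute f n 1).appLE _ _ (hq.le_preimage U 1) = 𝟙 _ := by
      have (g : power f n ⟶ power f n) (hg : g = 𝟙 _) (h) :
        g.appLE (q ⁻¹ᵁ U) (q ⁻¹ᵁ U) h = 𝟙 _ := by subst hg; exact (Scheme.Hom.appLE_eq_app _).trans (Scheme.Hom.id_app _)
      exact this _ permute_one _
    rw [h]; rfl
  mul_smul σ τ s := by
    change ((permute f n (σ * τ)).appLE _ _ (hq.le_preimage U _)).hom s =
      ((permute f n σ).appLE _ _ (hq.le_preimage U σ)).hom
        (((permute f n τ).appLE _ _ (hq.le_preimage U τ)).hom s)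
    have (g : power f n ⟶ power f n) (hg : g = permute f n σ ≫ permute f n τ) (h) :
        g.appLE (q ⁻¹ᵁ U) (q ⁻¹ᵁ U) h = (permute f n τ).appLE _ _ (hq.le_preimage U τ) ≫
          (permute f n σ).appLE _ _ (hq.le_preimage U σ) := by
      subst hg; rw [Scheme.Hom.appLE_comp_appLE]
    rw [this _ (permute_mul σ τ)]; rfl
  smul_zero σ := map_zero _
  smul_add σ := map_add _
  smul_one σ := map_one _
  smul_mul σ := map_mul _

lemma IsSymmetricProduct.isInvariant :
    letI := (q.app U).hom.toAlgebra
    letI := hq.mulSemiringAction U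
    Algebra.IsInvariant Γ(S, U) Γ(power f n, q ⁻¹ᵁ U) (Equiv.Perm (Fin n)) ∧
      SMulCommClass (Equiv.Perm (Fin n)) Γ(S, U) Γ(power f n, q ⁻¹ᵁ U) := by
  let := (q.app U).hom.toAlgebra
  let := hq.mulSemiringAction U
  refine ⟨⟨fun s hs => hq.exists_of_invariant U s fun σ _ => hs σ⟩, ⟨fun σ b s => ?_⟩⟩
  have h : (q.app U) ≫ (permute f n σ).appLE _ _ (hq.le_preimage U σ) = q.app U := by
    have (g : power f n ⟶ S) (hg : permute f n σ ≫ q = g) (h) :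
        (q.app U) ≫ (permute f n σ).appLE _ _ (hq.le_preimage U σ) = g.appLE U (q ⁻¹ᵁ U) h := by
      subst hg; rw [Scheme.Hom.comp_appLE]
    rw [this _ (hq.invariant σ) le_rfl, Scheme.Hom.appLE_eq_app]
  rw [Algebra.smul_def, Algebra.smul_def, smul_mul']
  exact congrArg (· * σ • s) (congrArg (fun φ => φ.hom b) h)

lemma IsSymmetricProduct.isIntegralHom : IsIntegralHom q where
  toIsAffineHom := hq.isAffineHom
  isIntegral_app U _ := by
    let := (q.app U).hom.toAlgebra
    let := hq.mulSemiringAction U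
    obtain ⟨_, _⟩ := hq.isInvariant U
    have := Algebra.IsInvariant.isIntegral Γ(S, U) Γ(power f n, q ⁻¹ᵁ U) (Equiv.Perm (Fin n))
    exact this.isIntegral

lemma IsSymmetricProduct.surjective : Surjective q := by
  have := hq.isIntegralHom
  refine ⟨fun y => ?_⟩
  by_contra hy
  let V : S.Opens := ⟨(Set.range q)ᶜ, q.isClosedMap.isClosed_range.isOpen_compl⟩
  have hV : q ⁻¹ᵁ V = ⊥ := by
    ext x
    simp [V]
  have : Subsingleton Γ(power f n, q ⁻¹ᵁ V) := by
    rw [hV]; infer_instance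
  have h1 : (1 : Γ(S, V)) = 0 := hq.injective V (Subsingleton.elim _ _)
  have h2 := congrArg (S.presheaf.germ V y hy).hom h1
  rw [map_one, map_zero] at h2
  exact one_ne_zero h2

lemma IsSymmetricProduct.isIntegral [IsIntegral (power f n)] : IsIntegral S := by
  have := hq.surjective
  have hne : Nonempty S := (Nonempty.map q inferInstance)
  refine ⟨hne, fun U hU => ?_⟩
  have : Nonempty (q ⁻¹ᵁ U) := by
    obtain ⟨x, hx⟩ := hU
    obtain ⟨y, rfl⟩ := q.surjective x
    exact ⟨⟨y, hx⟩⟩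
  exact (hq.injective U).isDomain (q.app U).hom

end SymmetricProduct

section Power

variable {k : Type u} [Field k] {X : Scheme.{u}} (f : X ⟶ Spec (.of k)) (n : ℕ)

/-- The morphism to `X^n` with given components. -/
noncomputable def powerLift {f : X ⟶ Spec (.of k)} {n : ℕ} {T : Scheme.{u}}
    (t : T ⟶ Spec (.of k)) (g : Fin n → (T ⟶ X)) (hg : ∀ i, g i ≫ f = t) : T ⟶ power f n :=
  WidePullback.lift t g hg

/-- The projections of `X^n`. -/
noncomputable abbrev powerπ {f : X ⟶ Spec (.of k)} {n : ℕ} (i : Fin n) : power f n ⟶ X :=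
  WidePullback.π (fun _ : Fin n => f) i

variable {f n}

lemma powerπ_comp (i : Fin n) : powerπ i ≫ f = powerStructure f n := WidePullback.π_arrow _ i

lemma powerLift_π {T : Scheme.{u}} (t : T ⟶ Spec (.of k)) (g : Fin n → (T ⟶ X))
    (hg : ∀ i, g i ≫ f = t) (i : Fin n) : powerLift t g hg ≫ powerπ i = g i :=
  WidePullback.lift_π _ _ _ _ _

lemma powerLift_base {T : Scheme.{u}} (t : T ⟶ Spec (.of k)) (g : Fin n → (T ⟶ X))
    (hg : ∀ i, g i ≫ f = t) : powerLift t g hg ≫ powerStructure f n = t :=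
  WidePullback.lift_base _ _ _ _

lemma power_hom_ext {T : Scheme.{u}} {a b : T ⟶ power f n}
    (h : ∀ i, a ≫ powerπ i = b ≫ powerπ i) (h' : a ≫ powerStructure f n = b ≫ powerStructure f n) :
    a = b :=
  WidePullback.hom_ext (fun _ => f) _ _ h h'

variable (f n)

/-- `X^{n+1}` is the fibre product of `X^n` and `X`. -/
lemma isPullback_power_succ : ∃ τ : power f (n + 1) ⟶ power f n,
    IsPullback (powerπ 0) τ f (powerStructure f n) := by
  let τ : power f (n + 1) ⟶ power f n :=
    powerLift (powerStructure f (n + 1)) (fun i => powerπ i.succ) fun i => powerπ_comp _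
  have hτ (i) : τ ≫ powerπ i = powerπ i.succ := powerLift_π _ _ _ i
  have hτ' : τ ≫ powerStructure f n = powerStructure f (n + 1) := powerLift_base _ _ _
  refine ⟨τ, ⟨⟨by rw [powerπ_comp, hτ']⟩, ⟨PullbackCone.IsLimit.mk _
    (fun s => powerLift (s.fst ≫ f) (Fin.cons s.fst fun i => s.snd ≫ powerπ i) ?_)
    (fun s => ?_) (fun s => ?_) (fun s m h₁ h₂ => ?_)⟩⟩⟩
  · intro i
    induction i using Fin.cases with
    | zero => rfl
    | succ i => rw [Fin.cons_succ, Category.assoc, powerπ_comp, s.condition]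
  · exact powerLift_π _ _ _ 0
  · refine power_hom_ext (fun i => ?_) ?_
    · rw [Category.assoc, hτ, powerLift_π, Fin.cons_succ]
    · rw [Category.assoc, hτ', powerLift_base, s.condition]
  · refine power_hom_ext (fun i => ?_) ?_
    · rw [powerLift_π]
      induction i using Fin.cases with
      | zero => exact h₁
      | succ i => rw [Fin.cons_succ, ← h₂, Category.assoc, hτ]
    · rw [powerLift_base, ← h₁, Category.assoc, powerπ_comp]

instance isIso_powerStructure_zero : IsIso (powerStructure f 0) :=
  ⟨powerLift (𝟙 _) Fin.elim0 (fun i => i.elim0),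
    power_hom_ext (fun i => i.elim0) (by rw [Category.assoc, powerLift_base]; simp),
    powerLift_base _ _ _⟩

lemma powerStructure_of_property (P : MorphismProperty Scheme.{u}) [P.IsMultiplicative]
    [P.IsStableUnderBaseChange] (hf : P f) : P (powerStructure f n) := by
  induction n with
  | zero => exact P.of_isIso _
  | succ n ih =>
    obtain ⟨τ, hτ⟩ := isPullback_power_succ f n
    rw [← powerπ_comp 0, hτ.w]
    exact P.comp_mem _ _ (P.of_isPullback hτ hf) ih

lemma isIntegral_power [GeometricallyIntegral f] [Flat f] [UniversallyOpen f]
    [LocallyOfFiniteType f] : IsIntegral (power f n) := by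
  induction n with
  | zero =>
    have : Nonempty (power f 0) := Nonempty.map (inv (powerStructure f 0)) inferInstance
    exact isIntegral_of_isOpenImmersion (powerStructure f 0)
  | succ n ih =>
    obtain ⟨τ, hτ⟩ := isPullback_power_succ f n
    have : LocallyOfFiniteType (powerStructure f n) :=
      powerStructure_of_property f n @LocallyOfFiniteType ‹_›
    have : IsLocallyNoetherian (power f n) :=
      LocallyOfFiniteType.isLocallyNoetherian (powerStructure f n)
    have : GeometricallyIntegral τ := MorphismProperty.of_isPullback hτ ‹_›
    have : Flat τ := MorphismProperty.of_isPullback hτ ‹_›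
    have : UniversallyOpen τ := MorphismProperty.of_isPullback hτ ‹_›
    exact GeometricallyIntegral.isIntegral_of_isLocallyNoetherian τ

end Power

/-- A scheme with a finite surjective morphism from a proper scheme is proper if its functions
inject. -/
lemma isProper_of_isIntegralHom {k : Type u} [Field k] {P S : Scheme.{u}} {q : P ⟶ S}
    {s : S ⟶ Spec (.of k)} [IsProper (q ≫ s)] [IsIntegralHom q] [Surjective q]
    (hq : ∀ U, Function.Injective (q.app U).hom) : IsProper s ∧ IsFinite q := by
  have : LocallyOfFiniteType q := locallyOfFiniteType_of_comp q s
  have hfin : IsFinite q := (IsFinite.iff_isIntegralHom_and_locallyOfFiniteType q).2 ⟨‹_›, ‹_›⟩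
  have : UniversallyClosed s := .of_comp_surjective q s
  have : LocallyOfFiniteType s := by
    rw [HasRingHomProperty.iff_appLE (P := @LocallyOfFiniteType)]
    intro U V e
    have e' : q ⁻¹ᵁ V.1 ≤ (q ≫ s) ⁻¹ᵁ U.1 := fun x hx => e hx
    have hV : IsAffineOpen (q ⁻¹ᵁ V.1) := V.2.preimage q
    have h₁ : ((q ≫ s).appLE U.1 (q ⁻¹ᵁ V.1) e').hom.FiniteType :=
      (HasRingHomProperty.iff_appLE (P := @LocallyOfFiniteType)).1 inferInstance U ⟨_, hV⟩ e'
    have h₂ : (q.app V.1).hom.Finite := IsFinite.finite_app q V.1 V.2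
    have h₃ : s.appLE U.1 V.1 e ≫ q.app V.1 = (q ≫ s).appLE U.1 (q ⁻¹ᵁ V.1) e' := by
      rw [Scheme.Hom.app_eq_appLE, Scheme.Hom.appLE_comp_appLE]
    let := (s.appLE U.1 V.1 e).hom.toAlgebra
    let := (q.app V.1).hom.toAlgebra
    let := ((q ≫ s).appLE U.1 (q ⁻¹ᵁ V.1) e').hom.toAlgebra
    have : IsScalarTower Γ(Spec (.of k), U.1) Γ(S, V.1) Γ(P, q ⁻¹ᵁ V.1) :=
      .of_algebraMap_eq fun x => (congrArg (fun φ => φ.hom x) h₃).symm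
    have : IsNoetherianRing Γ(Spec (.of k), U.1) :=
      IsLocallyNoetherian.component_noetherian U
    exact ⟨fg_of_fg_of_fg Γ(Spec (.of k), U.1) Γ(S, V.1) Γ(P, q ⁻¹ᵁ V.1) h₁.1 h₂.1 (hq V.1)⟩
  have : IsSeparated s := by
    refine ⟨IsClosedImmersion.of_isPreimmersion _ ?_⟩
    have h : Set.range (pullback.diagonal s) =
        Set.range (pullback.diagonal (q ≫ s) ≫ pullback.map (q ≫ s) (q ≫ s) s s q q (𝟙 _) (by simp)
          (by simp)) := by
      have : pullback.diagonal (q ≫ s) ≫ pullback.map (q ≫ s) (q ≫ s) s s q q (𝟙 _) (by simp)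
          (by simp) = q ≫ pullback.diagonal s := by
        refine pullback.hom_ext ?_ ?_
        · rw [Category.assoc, pullback.map, pullback.lift_fst]; simp
        · rw [Category.assoc, pullback.map, pullback.lift_snd]; simp
      rw [this, Scheme.Hom.comp_base]
      exact (q.surjective.range_comp _).symm
    rw [h]
    have : UniversallyClosed (pullback.map (q ≫ s) (q ≫ s) s s q q (𝟙 _) (by simp) (by simp)) :=
      MorphismProperty.pullbackMap (P := @UniversallyClosed) inferInstance inferInstance rfl rfl
    exact (Scheme.Hom.isClosedMap _).isClosed_range
  exact ⟨{}, hfin⟩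

section Degree

variable {k : Type u} [Field k] {X : Scheme.{u}} {f : X ⟶ Spec (.of k)} {n : ℕ}
  [IsIntegral (power f n)] {S : Scheme.{u}} [IsIntegral S] {q : power f n ⟶ S}

/-- The function field of `X^n` is a finite extension of that of the symmetric product, of degree
dividing `n!`. -/
lemma IsSymmetricProduct.exists_map_functionField (hq : IsSymmetricProduct f n q) :
    ∃ (φ : S.functionField ⟶ (power f n).functionField) (d : ℕ),
      Spec.map φ ≫ genericInclusion S = genericInclusion (power f n) ≫ q ∧ d ∣ n.factorial ∧
      letI := φ.hom.toAlgebra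
      FiniteDimensional S.functionField (power f n).functionField ∧
      Module.finrank S.functionField (power f n).functionField = d := by
  have := hq.surjective
  have hgen : q (genericPoint (power f n)) ⤳ genericPoint S := by
    obtain ⟨y, hy⟩ := q.surjective (genericPoint S)
    rw [← hy]
    exact (genericPoint_specializes y).map q.continuous
  let φ := S.presheaf.stalkSpecializes hgen ≫ q.stalkMap (genericPoint (power f n))
  suffices main : letI := φ.hom.toAlgebra
      FiniteDimensional S.functionField (power f n).functionField ∧
      Module.finrank S.functionField (power f n).functionField ∣ n.factorial by
    refine ⟨φ, _, ?_, main.2, main.1, rfl⟩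
    rw [Spec.map_comp, Category.assoc, Scheme.SpecMap_stalkSpecializes_fromSpecStalk,
      Scheme.SpecMap_stalkMap_fromSpecStalk]
  obtain ⟨_, ⟨U, hU, rfl⟩, hxU, -⟩ := S.isBasis_affineOpens.exists_subset_of_mem_open
    (Set.mem_univ (genericPoint S)) isOpen_univ
  have hxU' : genericPoint (power f n) ∈ q ⁻¹ᵁ U := hgen.mem_open U.2 hxU
  have : Nonempty U := ⟨⟨_, hxU⟩⟩
  have : Nonempty ↑(q ⁻¹ᵁ U) := ⟨⟨_, hxU'⟩⟩
  have := hq.isAffineHom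
  have h₁ : S.presheaf.germ U _ hxU ≫ φ = q.app U ≫ (power f n).presheaf.germ _ _ hxU' := by
    rw [TopCat.Presheaf.germ_stalkSpecializes_assoc, Scheme.Hom.germ_stalkMap]
  let := φ.hom.toAlgebra
  let := (q.app U).hom.toAlgebra
  let := ((power f n).presheaf.germ _ _ hxU').hom.toAlgebra
  let := (S.presheaf.germ _ _ hxU).hom.toAlgebra
  let := (S.presheaf.germ U _ hxU ≫ φ).hom.toAlgebra
  have : IsFractionRing Γ(S, U) S.functionField :=
    functionField_isFractionRing_of_isAffineOpen S U hU
  have : IsFractionRing Γ(power f n, q ⁻¹ᵁ U) (power f n).functionField :=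
    functionField_isFractionRing_of_isAffineOpen _ _ (hU.preimage q)
  have : IsScalarTower Γ(S, U) S.functionField (power f n).functionField :=
    .of_algebraMap_eq fun x => rfl
  have : IsScalarTower Γ(S, U) Γ(power f n, q ⁻¹ᵁ U) (power f n).functionField :=
    .of_algebraMap_eq fun x => congrArg (fun φ => φ.hom x) h₁
  let := hq.mulSemiringAction U
  obtain ⟨_, _⟩ := hq.isInvariant U
  have main := finrank_dvd_card_of_isInvariant (Equiv.Perm (Fin n)) Γ(S, U)
    Γ(power f n, q ⁻¹ᵁ U) S.functionField (power f n).functionField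
  rw [Nat.card_perm, Nat.card_fin] at main
  exact main

end Degree

section Product

variable {k : Type u} [Field k] {X Y W : Scheme.{u}} {f₁ : X ⟶ Spec (.of k)}
  {f₂ : Y ⟶ Spec (.of k)} {p₁ : W ⟶ X} {p₂ : W ⟶ Y} [IsIntegral X] [IsIntegral Y]
  [IsIntegral W] [IsSeparated f₁] [IsSeparated f₂] [LocallyOfFiniteType f₁]
  [LocallyOfFiniteType f₂] [QuasiCompact f₁] [QuasiCompact f₂]

lemma exists_comp_genericInclusion_eq (p : W ⟶ X) [Surjective p] :
    ∃ a : Spec W.functionField ⟶ Spec X.functionField,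
      a ≫ genericInclusion X = genericInclusion W ≫ p := by
  have hgen : p (genericPoint W) = genericPoint X := by
    obtain ⟨y, hy⟩ := p.surjective (genericPoint X)
    refine ((?_ : p (genericPoint W) ⤳ genericPoint X).antisymm (genericPoint_specializes _)).eq
    rw [← hy]
    exact (genericPoint_specializes y).map p.continuous
  refine exists_comp_fromSpecStalk_eq (Ω := W.functionField) _
    (IsLocalRing.closedPoint W.functionField) ?_
  exact (congrArg p Scheme.fromSpecStalk_closedPoint).trans hgen

/-- If multiples of the diagonals of `X` and `Y` descend, then their product descends for
`X × Y`. -/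
theorem DiagonalMultipleDescends.prod (H : IsPullback p₁ p₂ f₁ f₂) [IsSeparated (p₁ ≫ f₁)]
    {m₁ m₂ : ℕ} (h₁ : DiagonalMultipleDescends f₁ m₁) (h₂ : DiagonalMultipleDescends f₂ m₂) :
    DiagonalMultipleDescends (p₁ ≫ f₁) (m₁ * m₂) := by
  have : Surjective f₁ := ⟨fun y => ⟨genericPoint X, Subsingleton.elim (α := PrimeSpectrum k) _ _⟩⟩
  have : Surjective f₂ := ⟨fun y => ⟨genericPoint Y, Subsingleton.elim (α := PrimeSpectrum k) _ _⟩⟩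
  have : Surjective p₁ := MorphismProperty.of_isPullback H.flip ‹Surjective f₂›
  have : Surjective p₂ := MorphismProperty.of_isPullback H ‹Surjective f₁›
  have : LocallyOfFiniteType p₁ := MorphismProperty.of_isPullback H.flip ‹LocallyOfFiniteType f₂›
  have : IsLocallyNoetherian W := LocallyOfFiniteType.isLocallyNoetherian (p₁ ≫ f₁)
  have : IsLocallyNoetherian Y := LocallyOfFiniteType.isLocallyNoetherian f₂
  obtain ⟨a₁, ha₁⟩ := exists_comp_genericInclusion_eq p₁
  obtain ⟨a₂, ha₂⟩ := exists_comp_genericInclusion_eq p₂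
  obtain ⟨z₁, hz₁⟩ := h₁.exists_isPullbackCycle
  obtain ⟨z₂, hz₂⟩ := h₂.exists_isPullbackCycle
  let γ := genericInclusion W
  let b := γ ≫ p₁ ≫ f₁
  let M := overFunctionField (p₁ ≫ f₁)
  let μ : M ⟶ W := overFunctionFieldProj (p₁ ≫ f₁)
  let ν : M ⟶ Spec W.functionField := pullback.snd (p₁ ≫ f₁) b
  have HM : IsPullback μ ν (p₁ ≫ f₁) b := .of_hasPullback _ _
  have : IsLocallyNoetherian M := LocallyOfFiniteType.isLocallyNoetherian ν
  have : Flat μ := MorphismProperty.of_isPullback HM.flip (inferInstance : Flat b)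
  let N := pullback f₂ b
  let μ' : N ⟶ Y := pullback.fst f₂ b
  let ν' : N ⟶ Spec W.functionField := pullback.snd f₂ b
  have HN : IsPullback μ' ν' f₂ b := .of_hasPullback _ _
  have : IsLocallyNoetherian N := LocallyOfFiniteType.isLocallyNoetherian ν'
  have : Flat μ' := MorphismProperty.of_isPullback HN.flip (inferInstance : Flat b)
  let s₂ : Spec W.functionField ⟶ N := pullback.lift (γ ≫ p₂) (𝟙 _)
    (by rw [Category.id_comp, Category.assoc, ← H.w])
  have hs₂ : s₂ ≫ μ' = γ ≫ p₂ := pullback.lift_fst _ _ _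
  have hs₂' : s₂ ≫ ν' = 𝟙 _ := pullback.lift_snd _ _ _
  let j : N ⟶ W := H.lift (ν' ≫ γ ≫ p₁) μ' (by rw [HN.w, Category.assoc, Category.assoc])
  have hj₁ : j ≫ p₁ = ν' ≫ γ ≫ p₁ := H.lift_fst _ _ _
  have hj₂ : j ≫ p₂ = μ' := H.lift_snd _ _ _
  let g₂ : N ⟶ M := pullback.lift j ν' (by rw [reassoc_of% hj₁])
  have hg₂ : g₂ ≫ μ = j := pullback.lift_fst _ _ _
  have hg₂' : g₂ ≫ ν = ν' := pullback.lift_snd _ _ _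
  have : IsFinite s₂ := by
    have : IsFinite (s₂ ≫ ν') := by rw [hs₂']; infer_instance
    exact IsFinite.of_comp s₂ ν'
  have : IsFinite g₂ := by
    let t : M ⟶ N := pullback.lift (μ ≫ p₂) ν (by rw [Category.assoc, ← H.w, HM.w])
    have ht : g₂ ≫ t = 𝟙 N := by
      refine pullback.hom_ext ?_ ?_
      · rw [Category.assoc, pullback.lift_fst, reassoc_of% hg₂, hj₂, Category.id_comp]
      · rw [Category.assoc, pullback.lift_snd, hg₂', Category.id_comp]
    have : IsSeparated t := by
      have : IsSeparated (t ≫ ν') := by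
        rw [pullback.lift_snd]; exact MorphismProperty.of_isPullback HM ‹IsSeparated (p₁ ≫ f₁)›
      exact IsSeparated.of_comp t ν'
    have : IsFinite (g₂ ≫ t) := by rw [ht]; infer_instance
    exact IsFinite.of_comp g₂ t
  have hd : s₂ ≫ g₂ = diagonalSection (p₁ ≫ f₁) := by
    refine pullback.hom_ext ?_ ?_
    · rw [diagonalSection, pullback.lift_fst, Category.assoc, hg₂]
      refine H.hom_ext ?_ ?_
      · rw [Category.assoc, hj₁, reassoc_of% hs₂']
      · rw [Category.assoc, hj₂, hs₂]
    · rw [diagonalSection, pullback.lift_snd, Category.assoc, hg₂', hs₂']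
  obtain ⟨w₂, hw₂, hr₂⟩ := hz₂ HN s₂ hs₂' a₂ (ha₂.trans hs₂.symm)
  have hr₂' := pushCycle_mem_ratEquivZero g₂ hr₂
  rw [map_sub, map_nsmul, pushCycle_finiteCycle] at hr₂'
  suffices h : ∀ z : ZeroCycle Y, ∃ w ζ ω, IsPullbackCycle μ' z w ∧ IsPullbackCycle μ ζ ω ∧
      m₁ • pushCycle g₂ w - ω ∈ ratEquivZero M by
    obtain ⟨w, ζ, ω, hw, hζ, hω⟩ := h z₂
    obtain rfl := hw.unique hw₂
    refine diagonalMultipleDescends_iff.2 ⟨ζ, ω, hζ, ?_⟩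
    have := add_mem (nsmul_mem hr₂' m₁) hω
    rw [smul_sub, sub_add_sub_cancel, smul_smul] at this
    simp only [hd] at this
    rwa [diagonalCycle_eq_finiteCycle]
  intro z
  refine zeroCycle_induction f₂ (C := fun z => ∃ w ζ ω, IsPullbackCycle μ' z w ∧
    IsPullbackCycle μ ζ ω ∧ m₁ • pushCycle g₂ w - ω ∈ ratEquivZero M)
    ⟨0, 0, 0, .zero, .zero, by simp⟩ ?_ ?_ (fun V v _ _ _ => ?_) z
  · rintro z z' ⟨w, ζ, ω, hw, hζ, hω⟩ ⟨w', ζ', ω', hw', hζ', hω'⟩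
    refine ⟨_, _, _, hw.add hw', hζ.add hζ', ?_⟩
    rw [map_add, smul_add, add_sub_add_comm]
    exact add_mem hω hω'
  · rintro n z ⟨w, ζ, ω, hw, hζ, hω⟩
    refine ⟨_, _, _, hw.smul n, hζ.smul n, ?_⟩
    rw [map_zsmul, smul_comm, ← smul_sub]
    exact zsmul_mem hω n
  let B := pullback (v ≫ f₂) b
  let β : B ⟶ V := pullback.fst (v ≫ f₂) b
  let φ : B ⟶ Spec W.functionField := pullback.snd (v ≫ f₂) b
  have HB : IsPullback β φ (v ≫ f₂) b := .of_hasPullback _ _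
  have : IsFinite φ := MorphismProperty.of_isPullback HB ‹_›
  have : IsArtinianScheme B := isArtinianScheme_of_isFinite φ
  have : IsAffine B := isAffine_of_isAffineHom φ
  let vN : B ⟶ N := pullback.lift (β ≫ v) φ (by rw [Category.assoc, HB.w])
  have hvN : vN ≫ μ' = β ≫ v := pullback.lift_fst _ _ _
  have hvN' : vN ≫ ν' = φ := pullback.lift_snd _ _ _
  have HvN : IsPullback β vN v μ' := .of_bot (by rw [hvN']; exact HB) hvN.symm HN
  have : IsFinite vN := MorphismProperty.of_isPullback HvN ‹_›
  let R := pullback f₁ (v ≫ f₂)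
  let ρ₁ : R ⟶ X := pullback.fst f₁ (v ≫ f₂)
  let ρ₂ : R ⟶ V := pullback.snd f₁ (v ≫ f₂)
  have HR : IsPullback ρ₁ ρ₂ f₁ (v ≫ f₂) := .of_hasPullback _ _
  let e : R ⟶ W := H.lift ρ₁ (ρ₂ ≫ v) (by rw [HR.w, Category.assoc])
  have he₁ : e ≫ p₁ = ρ₁ := H.lift_fst _ _ _
  have he₂ : e ≫ p₂ = ρ₂ ≫ v := H.lift_snd _ _ _
  have He : IsPullback e ρ₂ p₂ v := .of_right (by rw [he₁]; exact HR) he₂ H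
  have : IsFinite e := MorphismProperty.of_isPullback He.flip ‹IsFinite v›
  let Q := pullback e μ
  let σ : Q ⟶ R := pullback.fst e μ
  let g₁ : Q ⟶ M := pullback.snd e μ
  have HQ : IsPullback σ g₁ e μ := .of_hasPullback _ _
  have : IsFinite g₁ := MorphismProperty.of_isPullback HQ ‹_›
  let π : Q ⟶ B := pullback.lift (σ ≫ ρ₂) (g₁ ≫ ν)
    (by rw [Category.assoc, Category.assoc, ← HR.w, ← HM.w, ← reassoc_of% HQ.w, reassoc_of% he₁])
  have hπ₁ : π ≫ β = σ ≫ ρ₂ := pullback.lift_fst _ _ _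
  have hπ₂ : π ≫ φ = g₁ ≫ ν := pullback.lift_snd _ _ _
  have HQB : IsPullback σ π ρ₂ β := by
    refine .of_bot ?_ hπ₁.symm HB
    rw [hπ₂, ← HR.w, ← he₁, Category.assoc]
    exact HQ.paste_vert HM
  have HQX : IsPullback (σ ≫ ρ₁) π f₁ (β ≫ v ≫ f₂) := HQB.paste_horiz HR
  let s : B ⟶ Q := HQX.lift (φ ≫ γ ≫ p₁) (𝟙 B)
    (by rw [Category.id_comp, HB.w, Category.assoc, Category.assoc])
  have hs₁ : s ≫ σ ≫ ρ₁ = φ ≫ γ ≫ p₁ := HQX.lift_fst _ _ _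
  have hs : s ≫ π = 𝟙 B := HQX.lift_snd _ _ _
  have : IsSeparated π := MorphismProperty.of_isPullback HQX ‹IsSeparated f₁›
  have : IsFinite s := by
    have : IsFinite (s ≫ π) := by rw [hs]; infer_instance
    exact IsFinite.of_comp s π
  obtain ⟨w₁, hw₁, hr₁⟩ := hz₁ HQX s hs (φ ≫ a₁) (by rw [Category.assoc, ha₁, hs₁])
  have hr₁' := pushCycle_mem_ratEquivZero g₁ hr₁
  have hsg : s ≫ g₁ = vN ≫ g₂ := by
    refine pullback.hom_ext ?_ ?_
    · change (s ≫ g₁) ≫ μ = (vN ≫ g₂) ≫ μ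
      rw [Category.assoc, Category.assoc, hg₂, ← HQ.w]
      refine H.hom_ext ?_ ?_
      · rw [Category.assoc, Category.assoc, Category.assoc, he₁, hj₁, hs₁, reassoc_of% hvN']
      · rw [Category.assoc, Category.assoc, Category.assoc, he₂, hj₂, ← reassoc_of% hπ₁,
          reassoc_of% hs, hvN]
    · change (s ≫ g₁) ≫ ν = (vN ≫ g₂) ≫ ν
      rw [Category.assoc, Category.assoc, hg₂', hvN', ← hπ₂, reassoc_of% hs]
  rw [map_sub, map_nsmul, pushCycle_finiteCycle] at hr₁'
  simp only [hsg] at hr₁'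
  rw [← pushCycle_finiteCycle] at hr₁'
  suffices h : ∀ z : ZeroCycle X, ∃ w ζ, IsPullbackCycle (σ ≫ ρ₁) z w ∧
      IsPullbackCycle μ ζ (pushCycle g₁ w) by
    obtain ⟨w, ζ, hw, hζ⟩ := h z₁
    obtain rfl := hw.unique hw₁
    exact ⟨_, ζ, _, isPullbackCycle_finiteCycle HvN, hζ, hr₁'⟩
  have : LocallyOfFiniteType π := MorphismProperty.of_isPullback HQX ‹LocallyOfFiniteType f₁›
  have : IsLocallyNoetherian Q := LocallyOfFiniteType.isLocallyNoetherian π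
  have : IsLocallyNoetherian X := LocallyOfFiniteType.isLocallyNoetherian f₁
  have : Flat (σ ≫ ρ₁) :=
    MorphismProperty.of_isPullback HQX.flip (inferInstance : Flat (β ≫ v ≫ f₂))
  intro z
  refine zeroCycle_induction f₁ (C := fun z => ∃ w ζ, IsPullbackCycle (σ ≫ ρ₁) z w ∧
    IsPullbackCycle μ ζ (pushCycle g₁ w)) ⟨0, 0, .zero, by rw [map_zero]; exact .zero⟩ ?_ ?_
    (fun U u _ _ _ => ?_) z
  · rintro z z' ⟨w, ζ, hw, hζ⟩ ⟨w', ζ', hw', hζ'⟩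
    exact ⟨_, _, hw.add hw', by rw [map_add]; exact hζ.add hζ'⟩
  · rintro n z ⟨w, ζ, hw, hζ⟩
    exact ⟨_, _, hw.smul n, by rw [map_zsmul]; exact hζ.smul n⟩
  let U₁ := pullback u ρ₁
  have HU₁ : IsPullback (pullback.fst u ρ₁) (pullback.snd u ρ₁) u ρ₁ := .of_hasPullback _ _
  let U₂ := pullback (pullback.snd u ρ₁) σ
  have HU₂ : IsPullback (pullback.fst (pullback.snd u ρ₁) σ) (pullback.snd (pullback.snd u ρ₁) σ)
    (pullback.snd u ρ₁) σ := .of_hasPullback _ _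
  have : IsFinite (pullback.snd u ρ₁ ≫ ρ₂) :=
    MorphismProperty.of_isPullback (P := @IsFinite) (HU₁.paste_vert HR) ‹IsFinite (u ≫ f₁)›
  have : IsFinite (pullback.snd (pullback.snd u ρ₁) σ ≫ π) :=
    MorphismProperty.of_isPullback (P := @IsFinite) (HU₂.paste_vert HQB) this
  have : IsArtinianScheme U₁ := isArtinianScheme_of_isFinite (pullback.snd u ρ₁ ≫ ρ₂)
  have : IsArtinianScheme U₂ :=
    isArtinianScheme_of_isFinite (pullback.snd (pullback.snd u ρ₁) σ ≫ π)
  refine ⟨_, finiteCycle (pullback.snd u ρ₁ ≫ e),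
    isPullbackCycle_finiteCycle (HU₂.paste_horiz HU₁), ?_⟩
  rw [pushCycle_finiteCycle]
  exact isPullbackCycle_finiteCycle (HU₂.paste_vert HQ)

end Product

lemma diagonalMultipleDescends_one {k : Type u} [Field k] {W : Scheme.{u}}
    (h : W ⟶ Spec (.of k)) [IsIntegral W] [IsIso h] : DiagonalMultipleDescends h 1 := by
  have : IsArtinianScheme W := isArtinianScheme_of_isFinite h
  have : IsLocallyNoetherian (overFunctionField h) :=
    LocallyOfFiniteType.isLocallyNoetherian (pullback.snd h (genericInclusion W ≫ h))
  have : Flat (overFunctionFieldProj h) := 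
    MorphismProperty.of_isPullback (IsPullback.of_hasPullback h (genericInclusion W ≫ h)).flip
      (inferInstance : Flat (genericInclusion W ≫ h))
  have hd : diagonalSection h ≫ pullback.snd h (genericInclusion W ≫ h) = 𝟙 _ :=
    pullback.lift_snd _ _ _
  have : IsIso (diagonalSection h) := by
    rw [← IsIso.eq_comp_inv] at hd
    rw [hd]; infer_instance
  have H : IsPullback (genericInclusion W) (diagonalSection h) (𝟙 W) (overFunctionFieldProj h) :=
    IsPullback.of_vert_isIso ⟨by rw [Category.comp_id]; exact (pullback.lift_fst _ _ _).symm⟩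
  refine diagonalMultipleDescends_iff.2 ⟨_, _, isPullbackCycle_finiteCycle H, ?_⟩
  rw [one_smul, diagonalCycle_eq_finiteCycle, sub_self]
  exact zero_mem _

/-- Descent of multiples of the diagonal to powers. -/
lemma DiagonalMultipleDescends.pow {k : Type u} [Field k] {X : Scheme.{u}}
    {f : X ⟶ Spec (.of k)} [IsIntegral X] [IsSeparated f] [LocallyOfFiniteType f] [QuasiCompact f]
    [GeometricallyIntegral f] [Flat f] [UniversallyOpen f] {m : ℕ}
    (hm : DiagonalMultipleDescends f m) :
    ∀ (n : ℕ) [IsIntegral (power f n)] [IsSeparated (powerStructure f n)],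
      DiagonalMultipleDescends (powerStructure f n) (m ^ n) := by
  intro n
  induction n with
  | zero => intro _ _; exact diagonalMultipleDescends_one _
  | succ n ih =>
    intro _ _
    have : IsIntegral (power f n) := isIntegral_power f n
    have : IsSeparated (powerStructure f n) := powerStructure_of_property f n @IsSeparated ‹_›
    have : LocallyOfFiniteType (powerStructure f n) :=
      powerStructure_of_property f n @LocallyOfFiniteType ‹_›
    have : QuasiCompact (powerStructure f n) := powerStructure_of_property f n @QuasiCompact ‹_›
    obtain ⟨τ, H⟩ := isPullback_power_succ f n
    have key : ∀ g, powerπ (f := f) (n := n + 1) 0 ≫ f = g → ∀ [IsSeparated g],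
        DiagonalMultipleDescends g (m * m ^ n) := by
      rintro _ rfl _
      exact hm.prod H ih
    rw [pow_succ']
    exact key _ (powerπ_comp 0)

section Descent

variable {k : Type u} [Field k] {P S : Scheme.{u}} [IsIntegral P] [IsIntegral S] {q : P ⟶ S}
  [IsFinite q] {s : S ⟶ Spec (.of k)} [IsSeparated s] [LocallyOfFiniteType s]
  [IsSeparated (q ≫ s)] {φ : S.functionField ⟶ P.functionField}

/-- Descent of multiples of the diagonal along a finite morphism. -/
theorem DiagonalMultipleDescends.of_isFinite
    (hφ : Spec.map φ ≫ genericInclusion S = genericInclusion P ≫ q) {d : ℕ}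
    (hd : letI := φ.hom.toAlgebra; FiniteDimensional S.functionField P.functionField ∧
      Module.finrank S.functionField P.functionField = d) {m : ℕ}
    (hm : DiagonalMultipleDescends (q ≫ s) m) : DiagonalMultipleDescends s (d * m) := by
  let := φ.hom.toAlgebra
  obtain ⟨_, hd⟩ := hd
  have : IsFinite (Spec.map φ) := by
    rw [IsFinite.SpecMap_iff]
    exact (RingHom.finite_algebraMap (A := S.functionField) (B := P.functionField)).2 inferInstance
  have hdeg : ∀ {T' T : Scheme.{u}} {p' : T' ⟶ Spec P.functionField} {π : T' ⟶ T}
      {c : T ⟶ Spec S.functionField} (_ : IsPullback p' π (Spec.map φ) c) [IsFinite π]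
      [IsArtinianScheme T'] [IsArtinianScheme T],
      finiteCycle π = d • fundamentalCycle T := fun H => by
    rw [← hd]
    exact pushCycle_fundamentalCycle (K := S.functionField) (F := P.functionField) H
  let b := genericInclusion S ≫ s
  let M := overFunctionField (q ≫ s)
  let N := overFunctionField s
  let μ : M ⟶ P := overFunctionFieldProj (q ≫ s)
  let ν : M ⟶ Spec P.functionField := pullback.snd (q ≫ s) (genericInclusion P ≫ q ≫ s)
  let μ' : N ⟶ S := overFunctionFieldProj s
  let ν' : N ⟶ Spec S.functionField := pullback.snd s b
  have hb : Spec.map φ ≫ b = genericInclusion P ≫ q ≫ s := by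
    rw [← Category.assoc, hφ, Category.assoc]
  have HM : IsPullback μ ν (q ≫ s) (Spec.map φ ≫ b) := by
    rw [hb]; exact .of_hasPullback _ _
  have HN : IsPullback μ' ν' s b := .of_hasPullback _ _
  let r : M ⟶ N := pullback.map (q ≫ s) (genericInclusion P ≫ q ≫ s) s b q (Spec.map φ) (𝟙 _)
    (by rw [Category.comp_id]) (by rw [Category.comp_id, hb])
  have hr : r ≫ μ' = μ ≫ q := pullback.lift_fst _ _ _
  have hr' : r ≫ ν' = ν ≫ Spec.map φ := pullback.lift_snd _ _ _
  have : IsFinite r :=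
    MorphismProperty.pullbackMap (P := @IsFinite) ‹IsFinite q› ‹IsFinite (Spec.map φ)› rfl hb.symm
  have hdiag : diagonalSection (q ≫ s) ≫ r = Spec.map φ ≫ diagonalSection s := by
    refine pullback.hom_ext ?_ ?_
    · change (_ ≫ r) ≫ μ' = (_ ≫ _) ≫ μ'
      rw [Category.assoc, Category.assoc, hr]
      erw [pullback.lift_fst_assoc, pullback.lift_fst]
      exact hφ.symm
    · change (_ ≫ r) ≫ ν' = (_ ≫ _) ≫ ν'
      rw [Category.assoc, Category.assoc, hr']
      erw [pullback.lift_snd_assoc, pullback.lift_snd]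
      rw [Category.id_comp, Category.comp_id]
  have hδ : pushCycle r (diagonalCycle (q ≫ s)) = d • diagonalCycle s := by
    rw [diagonalCycle_eq_finiteCycle, diagonalCycle_eq_finiteCycle, pushCycle_finiteCycle]
    simp only [hdiag]
    rw [← pushCycle_finiteCycle, hdeg (c := 𝟙 _) (p' := 𝟙 _)
      (IsPullback.of_horiz_isIso ⟨by simp⟩), map_nsmul]
    rfl
  obtain ⟨z, w, hw, hrat⟩ := diagonalMultipleDescends_iff.1 hm
  have hrat' := pushCycle_mem_ratEquivZero r hrat
  rw [map_sub, map_nsmul, hδ] at hrat'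
  suffices h : ∀ z : ZeroCycle P, ∃ w ζ ω, IsPullbackCycle μ z w ∧ IsPullbackCycle μ' ζ ω ∧
      pushCycle r w = d • ω by
    obtain ⟨w', ζ, ω, hw', hζ, hω⟩ := h z
    obtain rfl := hw.unique hw'
    refine diagonalMultipleDescends_iff.2 ⟨(d : ℤ) • ζ, (d : ℤ) • ω, hζ.smul d, ?_⟩
    rwa [natCast_zsmul, ← hω, mul_comm, mul_smul]
  have : LocallyOfFiniteType ν := MorphismProperty.of_isPullback HM inferInstance
  have : LocallyOfFiniteType ν' := MorphismProperty.of_isPullback HN inferInstance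
  have : IsLocallyNoetherian M := LocallyOfFiniteType.isLocallyNoetherian ν
  have : IsLocallyNoetherian N := LocallyOfFiniteType.isLocallyNoetherian ν'
  have : IsLocallyNoetherian P := LocallyOfFiniteType.isLocallyNoetherian (q ≫ s)
  have : IsLocallyNoetherian S := LocallyOfFiniteType.isLocallyNoetherian s
  have : Flat μ :=
    MorphismProperty.of_isPullback HM.flip (inferInstance : Flat (Spec.map φ ≫ b))
  have : Flat μ' := MorphismProperty.of_isPullback HN.flip (inferInstance : Flat b)
  intro z
  refine zeroCycle_induction (q ≫ s) (C := fun z => ∃ w ζ ω, IsPullbackCycle μ z w ∧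
    IsPullbackCycle μ' ζ ω ∧ pushCycle r w = d • ω) ⟨0, 0, 0, .zero, .zero, by simp⟩ ?_ ?_
    (fun V v _ _ _ => ?_) z
  · rintro z z' ⟨w, ζ, ω, hw, hζ, hω⟩ ⟨w', ζ', ω', hw', hζ', hω'⟩
    exact ⟨_, _, _, hw.add hw', hζ.add hζ', by rw [map_add, hω, hω', smul_add]⟩
  · rintro n z ⟨w, ζ, ω, hw, hζ, hω⟩
    exact ⟨_, _, _, hw.smul n, hζ.smul n, by rw [map_zsmul, hω, smul_comm]⟩
  let V₁ := pullback v μ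
  have HV₁ : IsPullback (pullback.fst v μ) (pullback.snd v μ) v μ := .of_hasPullback _ _
  let V₂ := pullback (v ≫ q) μ'
  have HV₂ : IsPullback (pullback.fst (v ≫ q) μ') (pullback.snd (v ≫ q) μ') (v ≫ q) μ' :=
    .of_hasPullback _ _
  have H₁ := HV₁.paste_vert HM
  have H₂ := HV₂.paste_vert HN
  rw [Category.assoc] at H₂
  have : IsFinite (pullback.snd v μ ≫ ν) := MorphismProperty.of_isPullback H₁ ‹_›
  have : IsFinite (pullback.snd (v ≫ q) μ' ≫ ν') := MorphismProperty.of_isPullback H₂ ‹_›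
  have : IsArtinianScheme V₁ := isArtinianScheme_of_isFinite (pullback.snd v μ ≫ ν)
  have : IsArtinianScheme V₂ := isArtinianScheme_of_isFinite (pullback.snd (v ≫ q) μ' ≫ ν')
  let t : V₁ ⟶ V₂ := pullback.lift (pullback.fst v μ) (pullback.snd v μ ≫ r)
    (by rw [Category.assoc, hr, pullback.condition_assoc])
  have ht : t ≫ pullback.fst (v ≫ q) μ' = pullback.fst v μ := pullback.lift_fst _ _ _
  have ht' : t ≫ pullback.snd (v ≫ q) μ' = pullback.snd v μ ≫ r := pullback.lift_snd _ _ _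
  have Ht : IsPullback t (pullback.snd v μ ≫ ν) (pullback.snd (v ≫ q) μ' ≫ ν') (Spec.map φ) := by
    refine .of_right ?_ (by rw [reassoc_of% ht', hr', Category.assoc]) H₂
    rw [ht]; exact H₁
  have : IsFinite t := MorphismProperty.of_isPullback Ht.flip ‹IsFinite (Spec.map φ)›
  refine ⟨_, _, _, isPullbackCycle_finiteCycle HV₁, isPullbackCycle_finiteCycle HV₂, ?_⟩
  rw [pushCycle_finiteCycle]
  simp only [← ht']
  rw [← pushCycle_finiteCycle, hdeg Ht.flip, map_nsmul]
  rfl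

end Descent

section OrderDivides

variable {k : Type u} [Field k] {X : Scheme.{u}} {f : X ⟶ Spec (.of k)} [IsIntegral X]
  [IsSeparated f]

lemma exists_diagonalMultipleDescends_of_ne_top (h : torsionOrder f ≠ ⊤) :
    ∃ m : ℕ, 0 < m ∧ DiagonalMultipleDescends f m ∧ torsionOrder f = m := by
  have hne : {e : ℕ∞ | ∃ m : ℕ, 0 < m ∧ DiagonalMultipleDescends f m ∧ e = m}.Nonempty := by
    by_contra hne
    rw [Set.not_nonempty_iff_eq_empty] at hne
    exact h (by rw [torsionOrder, hne, sInf_empty])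
  exact csInf_mem hne

/-- The torsion order divides every multiple of the diagonal that descends. -/
lemma DiagonalMultipleDescends.torsionOrder_dvd {a : ℕ} (ha : DiagonalMultipleDescends f a)
    (hpos : 0 < a) : torsionOrder f ≠ ⊤ ∧ (torsionOrder f).toNat ∣ a := by
  have hle : ∀ a : ℕ, 0 < a → DiagonalMultipleDescends f a → torsionOrder f ≤ a :=
    fun a h₁ h₂ => sInf_le ⟨a, h₁, h₂, rfl⟩
  have hne : torsionOrder f ≠ ⊤ := ne_top_of_le_ne_top (ENat.natCast_ne_top a) (hle a hpos ha)
  refine ⟨hne, ?_⟩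
  obtain ⟨t, ht, hdt, e⟩ := exists_diagonalMultipleDescends_of_ne_top hne
  rw [e, ENat.toNat_natCast]
  by_contra hndvd
  obtain ⟨z, w, hw, hr⟩ := diagonalMultipleDescends_iff.1 ha
  obtain ⟨z', w', hw', hr'⟩ := diagonalMultipleDescends_iff.1 hdt
  have hmod : DiagonalMultipleDescends f (a % t) := by
    refine diagonalMultipleDescends_iff.2
      ⟨_, _, hw.sub (hw'.smul (a / t : ℕ)), ?_⟩
    have h := sub_mem hr (nsmul_mem hr' (a / t))
    have e : a • diagonalCycle f =
        (a % t) • diagonalCycle f + (a / t) • t • diagonalCycle f := by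
      rw [smul_smul, ← add_smul, mul_comm, Nat.mod_add_div]
    rw [e, smul_sub] at h
    rw [natCast_zsmul]
    convert h using 1
    abel
  have := hle _ (Nat.pos_of_ne_zero fun h => hndvd (Nat.dvd_of_mod_eq_zero h)) hmod
  rw [e, Nat.cast_le] at this
  exact absurd (Nat.mod_lt a ht) (by omega)

end OrderDivides

section

attribute [local instance] MvPolynomial.gradedAlgebra

lemma isProper_projectiveSpaceStructure (k : Type u) [Field k] (N : ℕ) :
    IsProper (projectiveSpaceStructure k N) := by
  classical
  have hb : Function.Bijective
      (algebraMap k (MvPolynomial.homogeneousSubmodule (Fin (N + 1)) k 0)) := by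
    refine ⟨.of_comp (f := Subtype.val) (algebraMap k (MvPolynomial (Fin (N + 1)) k)).injective, fun ⟨x, hx⟩ => ?_⟩
    rw [MvPolynomial.homogeneousSubmodule_zero] at hx
    obtain ⟨r, hr⟩ := Submodule.mem_one.1 hx
    exact ⟨r, Subtype.ext hr⟩
  have h₁ : IsIso (CommRingCat.ofHom
      (algebraMap k (MvPolynomial.homogeneousSubmodule (Fin (N + 1)) k 0))) :=
    (ConcreteCategory.isIso_iff_bijective _).2 hb
  have : Algebra.FiniteType (MvPolynomial.homogeneousSubmodule (Fin (N + 1)) k 0)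
      (MvPolynomial (Fin (N + 1)) k) :=
    ⟨⟨Finset.univ.image MvPolynomial.X, by simpa using adjoin_X_eq_top k N⟩⟩
  exact inferInstance

end

end TorsionOrder

theorem mainTheorem11 {k : Type u} [Field k] {X : Scheme.{u}} (f : X ⟶ Spec (.of k))
    [IsIntegral X] [IsSeparated f] [Smooth f] (hproj : TorsionOrder.IsProjectiveOver f)
    (hfin : TorsionOrder.torsionOrder f ≠ ⊤) (n : ℕ) (hn : 0 < n)
    {S : Scheme.{u}} (s : S ⟶ Spec (.of k)) (q : TorsionOrder.power f n ⟶ S)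
    (hq : TorsionOrder.IsSymmetricProduct f n q)
    (hs : q ≫ s = TorsionOrder.powerStructure f n) :
    ∃ (_ : IsIntegral S) (_ : IsProper s),
      TorsionOrder.torsionOrder s ≠ ⊤ ∧
      (TorsionOrder.torsionOrder s).toNat ∣
        n.factorial * (TorsionOrder.torsionOrder f).toNat ^ n := by
  obtain ⟨m, hpos, hm, htor⟩ := TorsionOrder.exists_diagonalMultipleDescends_of_ne_top hfin
  rw [htor, ENat.toNat_natCast]
  obtain ⟨N, i, _, hi⟩ := hproj
  have : IsProper (TorsionOrder.projectiveSpaceStructure k N) :=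
    TorsionOrder.isProper_projectiveSpaceStructure k N
  obtain ⟨c₀⟩ := TorsionOrder.nonempty_coordinates_projectiveSpace k N
  obtain ⟨c⟩ : Nonempty (TorsionOrder.Coordinates f (Fin (N + 1))) :=
    hi ▸ c₀.nonempty_of_isClosedImmersion i
  have : IsProper f := hi ▸ inferInstance
  have : GeometricallyIntegral f := hm.geometricallyIntegral hpos.ne' c
  have : UniversallyOpen f := inferInstance
  have : IsIntegral (TorsionOrder.power f n) := TorsionOrder.isIntegral_power f n
  have hprop : IsProper (TorsionOrder.powerStructure f n) :=
    TorsionOrder.powerStructure_of_property f n @IsProper inferInstance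
  have := hq.isIntegralHom
  have := hq.surjective
  have : IsIntegral S := hq.isIntegral
  have hdesc := hm.pow n
  obtain ⟨φ, d, hφ, hdvd, hd⟩ := hq.exists_map_functionField
  have key : ∀ g, q ≫ s = g → ∀ [IsProper g], TorsionOrder.DiagonalMultipleDescends g (m ^ n) →
      ∃ (_ : IsProper s), TorsionOrder.DiagonalMultipleDescends s (d * m ^ n) := by
    rintro _ rfl _ h
    obtain ⟨hs, _⟩ := TorsionOrder.isProper_of_isIntegralHom (q := q) (s := s) hq.injective
    exact ⟨hs, h.of_isFinite hφ hd⟩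
  obtain ⟨hps, hd'⟩ := key _ hs hdesc
  obtain ⟨h₁, h₂⟩ := hd'.torsionOrder_dvd
    (Nat.mul_pos (Nat.pos_of_dvd_of_pos hdvd n.factorial_pos) (pow_pos hpos n))
  exact ⟨inferInstance, hps, h₁, h₂.trans (Nat.mul_dvd_mul_right hdvd _)⟩
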